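/- Let $G=(V,E)$ be a finite simple undirected graph with $n=|V|\ge 1$ vertices and $m=|E|$ edges, where $n\le 2m$ (this holds in particular when $G$ has no isolated vertices). Let $k\ge 2$, and let $\delta$ be the degeneracy of $G$, i.e. the least $d$ such that every nonempty $S\subseteq V$ contains a vertex with at most $d$ neighbours in $S$. The motif is the $k$-clique: a motif instance is a set of $k$ pairwise adjacent vertices. For $u\in V$ and $S\subseteq V$ let $\mathbb M(u)$ be the number of instances containing $u$, let $\mathbb M_j^S(u)$ be the number of instances containing $u$ that have exactly $j$ vertices in $S$, and let the motif resident of $u$ be $$Mr_S(u)=\frac{\mathbb M(u)+\mathbb M_k^S(u)-\mathbb M_1^S(u)}{\mathbb M(u)}$$ (read as $0$ if $\mathbb M(u)=0$). Let $\mathrm{vol}(S)=\sum_{u\in S}\mathbb M(u)$, let $\mathrm{cut}(S)$ be the number of instances meeting both $S$ and $V\setminus S$, and let $\phi(S)=\mathrm{cut}(S)/\min\{\mathrm{vol}(S),\mathrm{vol}(V\setminus S)\}$ (read as $0$ if the denominator is $0$). Algorithm PSMC lists all motif instances and computes all motif degrees $\mathbb M(u)$; then, starting from $S_1=V$, it sets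 $S_{i+1}=S_i\setminus\{u_i\}$, where $u_i$ is a vertex of $S_i$ with the smallest value $Mr_{S_i}(u_i)$ (ties broken in any way), until no vertex is left; finally it returns a set $\hat S$ with the smallest $\phi$ among those of $S_1,\dots,S_n$ that satisfy $\mathrm{vol}(S)\le \mathrm{vol}(V\setminus S)$. Theorem. The worst-case running time of PSMC is $$O\!\left(k\left(\tfrac{\delta}{2}\right)^{k-2} m\right).$$ Precisely: there are one random access machine program and constants $c$, $C$ and $D_k$ (where $c$ and $C$ are absolute and $D_k$ depends only on $k$) such that for all $G$ and $k$ as above, given $n$, $m$, $k$ and the list of edges of $G$ in any order, the program halts having recorded a complete run of PSMC (the list of motif instances, the motif degrees, the deletion order $u_1,\dots,u_n$, and $\hat S$), it uses only natural numbers smaller than $(n+k+\#\{\text{motif instances}\})^c$, and the number $T$ of its elementary steps satisfies $$T\le C\,k\left(\tfrac{\delta}{2}\right)^{k-2} m \quad\text{if } k=2 \text{ or } \delta\ge 2,\qquad\text{and}\qquad T\le D_k\,k\left(\tfrac{\delta}{2}\right)^{k-2} m\quad\text{in all cases.}$$ -/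

import Mathlib

namespace PSMC

/-! ### Graph notions.  The motif is the `k`-clique; its instances in `G` are `G.cliqueFinset k`. -/

section Graph

variable {n : ℕ} (G : SimpleGraph (Fin n)) [DecidableRel G.Adj] (k : ℕ)

/-- The degeneracy of `G`: the least `d` such that every nonempty vertex set `S` contains a vertex
with at most `d` neighbours in `S`. -/
noncomputable def degeneracy : ℕ :=
  sInf {d : ℕ | ∀ S : Finset (Fin n), S.Nonempty → ∃ v ∈ S, (G.neighborFinset v ∩ S).card ≤ d}

/-- The motif degree `𝕄(u)`: the number of motif instances that contain `u`. -/
def motifDegree (u : Fin n) : ℕ :=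
  ((G.cliqueFinset k).filter (fun S => u ∈ S)).card

/-- `𝕄_j^C(u)`: the number of motif instances that contain `u` and have exactly `j` vertices
in `C`. -/
def motifDegreeIn (C : Finset (Fin n)) (j : ℕ) (u : Fin n) : ℕ :=
  ((G.cliqueFinset k).filter (fun S => u ∈ S ∧ (C ∩ S).card = j)).card

/-- The motif resident `Mr_C(u) = (𝕄(u) + 𝕄_k^C(u) - 𝕄_1^C(u)) / 𝕄(u)`.  For a vertex that lies in
no motif instance the quotient is read as `0`, so that such vertices are deleted first. -/
def motifResident (C : Finset (Fin n)) (u : Fin n) : ℚ :=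
  ((motifDegree G k u : ℚ) + motifDegreeIn G k C k u - motifDegreeIn G k C 1 u) /
    motifDegree G k u

/-- The number of motif instances that meet both `C` and its complement. -/
def motifCut (C : Finset (Fin n)) : ℕ :=
  ((G.cliqueFinset k).filter (fun S => (S ∩ C).Nonempty ∧ (S ∩ Cᶜ).Nonempty)).card

/-- The motif volume of `C`. -/
def motifVol (C : Finset (Fin n)) : ℕ :=
  ∑ u ∈ C, motifDegree G k u

/-- The motif conductance of `C`. -/
def motifConductance (C : Finset (Fin n)) : ℚ :=
  (motifCut G k C : ℚ) / (min (motifVol G k C) (motifVol G k Cᶜ) : ℕ)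

/-- The vertices that are still present when the vertices `σ 0, …, σ (i - 1)` have been deleted. -/
def remaining (σ : Equiv.Perm (Fin n)) (i : Fin n) : Finset (Fin n) :=
  Finset.univ.filter (fun v => i ≤ σ.symm v)

/-- `σ` and `cluster` are the deletion order and the result of a run of the algorithm PSMC on `G`:
in every round a vertex of smallest motif resident with respect to the remaining vertex set is
deleted, and the result has the smallest motif conductance among those vertex sets of the rounds
whose motif volume is at most that of their complement.  Ties may be broken in any way. -/
structure IsRun (σ : Equiv.Perm (Fin n)) (cluster : Finset (Fin n)) : Prop where
  greedy : ∀ i : Fin n, ∀ v ∈ remaining σ i,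
    motifResident G k (remaining σ i) (σ i) ≤ motifResident G k (remaining σ i) v
  mem : ∃ i : Fin n, cluster = remaining σ i
  vol_le : motifVol G k cluster ≤ motifVol G k clusterᶜ
  best : ∀ i : Fin n, motifVol G k (remaining σ i) ≤ motifVol G k (remaining σ i)ᶜ →
    motifConductance G k cluster ≤ motifConductance G k (remaining σ i)

end Graph

/-! ### A random access machine, programmed in a structured language.

A program has finitely many scalar variables and finitely many arrays, all holding natural numbers
below the word bound `W`.  Every elementary operation costs one step. -/

/-- Binary machine operations. -/
inductive Op where
  | add | sub | mul | div | mod | lt | eq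

/-- The effect of a machine operation; `sub` is truncated, comparisons return `1` or `0`. -/
def Op.apply : Op → ℕ → ℕ → ℕ
  | .add, a, b => a + b
  | .sub, a, b => a - b
  | .mul, a, b => a * b
  | .div, a, b => a / b
  | .mod, a, b => a % b
  | .lt, a, b => if a < b then 1 else 0
  | .eq, a, b => if a = b then 1 else 0

/-- Memory contents: the value of each scalar variable, and of each cell of each array. -/
structure Store where
  var : ℕ → ℕ
  arr : ℕ → ℕ → ℕ

/-- Expressions: literals, scalar variables, array cells, binary operations. -/
inductive Expr where
  | lit (c : ℕ)
  | var (x : ℕ)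
  | get (a : ℕ) (i : Expr)
  | bin (o : Op) (e₁ e₂ : Expr)

/-- The value of an expression. -/
def Expr.eval (s : Store) : Expr → ℕ
  | .lit c => c
  | .var x => s.var x
  | .get a i => s.arr a (i.eval s)
  | .bin o e₁ e₂ => o.apply (e₁.eval s) (e₂.eval s)

/-- The number of steps needed to evaluate an expression. -/
def Expr.cost : Expr → ℕ
  | .lit _ => 1
  | .var _ => 1
  | .get _ i => i.cost + 1
  | .bin _ e₁ e₂ => e₁.cost + e₂.cost + 1

/-- All values (and array indices) that occur in the evaluation of an expression are below `W`. -/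
def Expr.Fits (W : ℕ) (s : Store) : Expr → Prop
  | .lit c => c < W
  | .var x => s.var x < W
  | .get a i => i.Fits W s ∧ s.arr a (i.eval s) < W
  | .bin o e₁ e₂ => e₁.Fits W s ∧ e₂.Fits W s ∧ o.apply (e₁.eval s) (e₂.eval s) < W

/-- Commands: assignment to a variable, assignment `a[i] := e` to an array cell, sequential
composition, conditional, and while loop (a condition holds if its value is not `0`). -/
inductive Cmd where
  | skip
  | assign (x : ℕ) (e : Expr)
  | store (a : ℕ) (i e : Expr)
  | seq (c₁ c₂ : Cmd)
  | ite (e : Expr) (c₁ c₂ : Cmd)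
  | loop (e : Expr) (c : Cmd)

/-- Overwrite a scalar variable. -/
def Store.setVar (s : Store) (x v : ℕ) : Store :=
  ⟨Function.update s.var x v, s.arr⟩

/-- Overwrite an array cell. -/
def Store.setArr (s : Store) (a i v : ℕ) : Store :=
  ⟨s.var, Function.update s.arr a (Function.update (s.arr a) i v)⟩

/-- `Exec W c s t s'`: with word bound `W`, the command `c` started in the memory `s` halts after
exactly `t` steps in the memory `s'`, and no value of `W` or more occurs on the way. -/
inductive Exec (W : ℕ) : Cmd → Store → ℕ → Store → Prop where
  | skip (s : Store) : Exec W .skip s 1 s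
  | assign (s : Store) (x : ℕ) (e : Expr) (h : e.Fits W s) :
      Exec W (.assign x e) s (e.cost + 1) (s.setVar x (e.eval s))
  | store (s : Store) (a : ℕ) (i e : Expr) (hi : i.Fits W s) (he : e.Fits W s) :
      Exec W (.store a i e) s (i.cost + e.cost + 1) (s.setArr a (i.eval s) (e.eval s))
  | seq {c₁ c₂ : Cmd} {s s' s'' : Store} {t₁ t₂ : ℕ}
      (h₁ : Exec W c₁ s t₁ s') (h₂ : Exec W c₂ s' t₂ s'') :
      Exec W (.seq c₁ c₂) s (t₁ + t₂) s''
  | iteTrue {e : Expr} {c₁ c₂ : Cmd} {s s' : Store} {t : ℕ} (h : e.Fits W s)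
      (he : e.eval s ≠ 0) (h₁ : Exec W c₁ s t s') :
      Exec W (.ite e c₁ c₂) s (e.cost + 1 + t) s'
  | iteFalse {e : Expr} {c₁ c₂ : Cmd} {s s' : Store} {t : ℕ} (h : e.Fits W s)
      (he : e.eval s = 0) (h₂ : Exec W c₂ s t s') :
      Exec W (.ite e c₁ c₂) s (e.cost + 1 + t) s'
  | loopTrue {e : Expr} {c : Cmd} {s s' s'' : Store} {t₁ t₂ : ℕ} (h : e.Fits W s)
      (he : e.eval s ≠ 0) (h₁ : Exec W c s t₁ s') (h₂ : Exec W (.loop e c) s' t₂ s'') :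
      Exec W (.loop e c) s (e.cost + 1 + t₁ + t₂) s''
  | loopFalse {e : Expr} {c : Cmd} {s : Store} (h : e.Fits W s) (he : e.eval s = 0) :
      Exec W (.loop e c) s (e.cost + 1) s

/-! ### Input and output -/

/-- `L` lists every edge of `G` exactly once, in any order and orientation. -/
def IsEdgeList {n : ℕ} (G : SimpleGraph (Fin n)) (L : List (Fin n × Fin n)) : Prop :=
  (L.map (fun p => s(p.1, p.2))).Nodup ∧
    ∀ e : Sym2 (Fin n), e ∈ L.map (fun p => s(p.1, p.2)) ↔ e ∈ G.edgeSet

/-- The initial memory: variables `0`, `1`, `2` hold the number of vertices, the number of edges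
and `k`; arrays `0` and `1` hold the first and the second endpoints of the edges; everything else
is `0`. -/
def input {n : ℕ} (k : ℕ) (L : List (Fin n × Fin n)) : Store where
  var x := if x = 0 then n else if x = 1 then L.length else if x = 2 then k else 0
  arr a i :=
    if a = 0 then (L.map (fun p => (p.1 : ℕ))).getD i 0
    else if a = 1 then (L.map (fun p => (p.2 : ℕ))).getD i 0
    else 0

/-- The final memory `s` records a complete run of PSMC on `G` with the `k`-clique as motif:
the consecutive blocks of length `k` in array `2`, whose number is in variable `3`, list every motif
instance exactly once; array `3` holds the motif degrees; array `4` holds the vertices in the order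
of their deletion; array `5` is the indicator function of the returned cluster. -/
structure RecordsRun {n : ℕ} (G : SimpleGraph (Fin n)) [DecidableRel G.Adj] (k : ℕ)
    (s : Store) : Prop where
  instances : Set.BijOn (fun j => (Finset.range k).image (fun i => s.arr 2 (k * j + i)))
    (Set.Iio (s.var 3)) {T | ∃ S ∈ G.cliqueFinset k, T = S.map Fin.valEmbedding}
  degrees : ∀ v : Fin n, s.arr 3 v = motifDegree G k v
  run : ∃ (σ : Equiv.Perm (Fin n)) (cluster : Finset (Fin n)), IsRun G k σ cluster ∧
    (∀ i : Fin n, s.arr 4 i = σ i) ∧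
    ∀ v : Fin n, s.arr 5 v = if v ∈ cluster then 1 else 0

end PSMC

/-!
A program is exhibited and verified.  Three ideas make it run in time `O(k (δ / 2) ^ (k - 2) m)`.

*Listing the cliques.*  Repeatedly removing a vertex of small remaining degree orders the vertices so
that each has at most `δ` later neighbours (`buildOrd_spec`).  A depth-first search through common
later neighbours finds each clique once, as its list in this order (`listCliques_spec`,
`mem_allCliques`).  A vertex with `d` later neighbours is the first one of at most `d choose (j + 1)`
cliques with `j + 2` vertices, and `2 ^ j * (d choose (j + 1)) ≤ d * δ ^ j`, because
`2 ^ j ≤ (j + 1)!`.  Summation over the vertices gives the bound (`extCost_le_real`): the numbers of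
smaller cliques are bounded by smaller powers of `max 1 (δ / 2)`, and the sum over their at most `k`
sizes is absorbed by the factor `k`.  For `k = 2` any order of the vertices will do.

*The greedy deletion.*  As `k * N` for the number `N` of cliques is within the time bound, it remains
to delete all vertices in time `O(k N + n)`.  For a vertex `u` with `𝕄(u) > 0` the motif resident is
`3 - cur u / 𝕄(u)`, where `cur u` is a sum over the instances that contain `u`, each contributing
`1`, plus `1` if a vertex of the instance is deleted, plus `1` if `u` is its only remaining vertex
(`Enumerates.motifResident_eq`).  Thus `cur` only grows, and an instance changes the contributions
of its vertices at most twice: when its first vertex is deleted, and when only one vertex remains.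
There are at most `2 k N` such changes.

*A priority queue.*  It has to return the vertex with the largest quotient `cur u / den u`, where
`den u = max 𝕄(u) 1`.  A comparison-based heap would cost a logarithmic factor.  Instead, vertices
are grouped by their denominator `b`; in a group, those with numerator `a` form a stack, for
`b ≤ a ≤ 3 b`, and the largest numerator is maintained (`Buckets`).  Groups whose denominators have
the same binary logarithm form a class, represented by its best group, the champion (`Champion`).
Among the classes, a machine word holds the staircase of the classes whose champions exceed all
champions of higher classes; its lowest bit belongs to the overall maximum (`Stair`).  Raising a
numerator takes constant amortized time (`touch_spec`): stale stack entries and steps of the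
staircase are paid for when they are created.  Extraction of `u` repairs one group, one class and the
lower part of the staircase in time `O(den u)` (`extractMax_spec`), and the denominators sum up to at
most `k N + n`.

The verification uses a weakest-precondition calculus with time credits (`WP`, `WP.sound`).  Memory
is not restricted, apart from the size of the words, so that each two-dimensional table is an array
with a generous stride, and tables need no initialization since all memory is `0` at the start.
The scalars `0` to `3` hold `n`, `m`, `k` and `N` throughout.  The arrays are used as follows.

* `0`, `1`: input; `2` to `5`: output
* `6`, `7`: adjacency lists and their lengths; `8`: remaining degrees in the removal process
* `9`, `10`: positions in the vertex order, counted from `1`, and the order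
* `11`, `12`: lists of later neighbours and their lengths; `13`: matrix of later neighbours
* `14`, `15`: lists of candidates of the search and their lengths; `16`, `17`: index of the next
  candidate and chosen vertex at each level
* `18`: lists of the instances that contain a vertex; their lengths are the motif degrees
* `19`, `20`, `21`: denominators, numerators, and flags of the deleted vertices
* `22`: number of remaining vertices of each instance
* `23`, `24`: stacks of the priority queue and their heights; `25`: largest numerators of the groups;
  `26`: champions of the classes
* `27`, `28`, `29`: tables of powers of two, of highest bits, and of lowest bits
-/

namespace PSMC

/-! ### A weakest-precondition calculus for the machine -/

/-- Every scalar and every array cell of the store is below `K`. -/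
def Store.Bdd (K : ℕ) (s : Store) : Prop := (∀ x, s.var x < K) ∧ ∀ a i, s.arr a i < K

/-- If all atoms of `e` are below `K`, then the value of `e` is below `K ^ e.deg`. -/
def Expr.deg : Expr → ℕ
  | .lit _ => 1
  | .var _ => 1
  | .get _ _ => 1
  | .bin _ e₁ e₂ => e₁.deg + e₂.deg

/-- Syntactic smallness: literals are below `4` and all subexpressions have degree at most `16`. -/
def Expr.ok : Expr → Bool
  | .lit c => decide (c < 4)
  | .var _ => true
  | .get _ i => i.ok
  | .bin _ e₁ e₂ => e₁.ok && e₂.ok && decide (e₁.deg + e₂.deg ≤ 16)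

/-- All expressions in the command are syntactically small. -/
def Cmd.ok : Cmd → Bool
  | .skip => true
  | .assign _ e => e.ok
  | .store _ i e => i.ok && e.ok
  | .seq c₁ c₂ => c₁.ok && c₂.ok
  | .ite e c₁ c₂ => e.ok && c₁.ok && c₂.ok
  | .loop e c => e.ok && c.ok

/-- The scalar variables that a command may write. -/
def Cmd.wv : Cmd → List ℕ
  | .skip => []
  | .assign x _ => [x]
  | .store _ _ _ => []
  | .seq c₁ c₂ => c₁.wv ++ c₂.wv
  | .ite _ c₁ c₂ => c₁.wv ++ c₂.wv
  | .loop _ c => c.wv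

/-- The arrays that a command may write. -/
def Cmd.wa : Cmd → List ℕ
  | .skip => []
  | .assign _ _ => []
  | .store a _ _ => [a]
  | .seq c₁ c₂ => c₁.wa ++ c₂.wa
  | .ite _ c₁ c₂ => c₁.wa ++ c₂.wa
  | .loop _ c => c.wa

/-- What has to be shown before the value of `e` is stored: it is below `K`.  For an atom or a
comparison this is automatic. -/
def Expr.Small (K : ℕ) (s : Store) : Expr → Prop
  | .lit _ => True
  | .var _ => True
  | .get _ _ => True
  | .bin .lt _ _ => True
  | .bin .eq _ _ => True
  | .bin .add a b => a.eval s + b.eval s < K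
  | .bin .sub a b => a.eval s - b.eval s < K
  | .bin .mul a b => a.eval s * b.eval s < K
  | .bin .div a b => a.eval s / b.eval s < K
  | .bin .mod a b => a.eval s % b.eval s < K

theorem pow_add_pow_le {K p q : ℕ} (hK : 4 ≤ K) (hp : 1 ≤ p) (hq : 1 ≤ q) :
    K ^ p + K ^ q ≤ K ^ (p + q) := by
  have h1 : 4 ≤ K ^ p := hK.trans (Nat.le_self_pow (by omega) K)
  have h2 : 4 ≤ K ^ q := hK.trans (Nat.le_self_pow (by omega) K)
  rw [pow_add]; nlinarith

theorem Expr.one_le_deg (e : Expr) : 1 ≤ e.deg := by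
  induction e <;> simp [Expr.deg]; omega

theorem Expr.eval_lt {K : ℕ} (hK : 4 ≤ K) {s : Store} (hs : s.Bdd K) :
    ∀ e : Expr, e.ok = true → e.eval s < K ^ e.deg
  | .lit c, h => by simp [Expr.ok] at h; simp [Expr.eval, Expr.deg]; omega
  | .var x, _ => by simpa [Expr.eval, Expr.deg] using hs.1 x
  | .get a i, _ => by simpa [Expr.eval, Expr.deg] using hs.2 a _
  | .bin o e₁ e₂, h => by
    simp only [Expr.ok, Bool.and_eq_true, decide_eq_true_eq] at h
    have h1 := Expr.eval_lt hK hs e₁ h.1.1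
    have h2 := Expr.eval_lt hK hs e₂ h.1.2
    have h3 := pow_add_pow_le hK e₁.one_le_deg e₂.one_le_deg
    have h4 : 1 ≤ K ^ (e₁.deg + e₂.deg) := Nat.one_le_pow _ _ (by omega)
    have h5 : K ^ (e₁.deg + e₂.deg) ≥ 4 := hK.trans (Nat.le_self_pow (by
      have := e₁.one_le_deg; omega) K)
    simp only [Expr.eval, Expr.deg]
    cases o <;> simp only [Op.apply]
    · omega
    · omega
    · rw [pow_add]
      exact Nat.mul_lt_mul'' h1 h2
    · have := Nat.div_le_self (e₁.eval s) (e₂.eval s); omega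
    · have := Nat.mod_le (e₁.eval s) (e₂.eval s); omega
    · split <;> omega
    · split <;> omega

theorem Expr.ok_deg {e : Expr} (h : e.ok = true) : e.deg ≤ 16 := by
  cases e <;> simp_all [Expr.ok, Expr.deg]

theorem Expr.fits_of_ok {K : ℕ} (hK : 4 ≤ K) {s : Store} (hs : s.Bdd K) :
    ∀ e : Expr, e.ok = true → e.Fits (K ^ 16) s := by
  have key : ∀ e : Expr, e.ok = true → e.eval s < K ^ 16 := fun e h =>
    (Expr.eval_lt hK hs e h).trans_le (Nat.pow_le_pow_right (by omega) (Expr.ok_deg h))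
  intro e
  induction e with
  | lit c => exact key _
  | var x => exact key _
  | get a i ih => exact fun h => ⟨ih h, key (.get a i) h⟩
  | bin o e₁ e₂ ih₁ ih₂ =>
    intro h
    have h' := h
    simp only [Expr.ok, Bool.and_eq_true, decide_eq_true_eq] at h'
    exact ⟨ih₁ h'.1.1, ih₂ h'.1.2, key (.bin o e₁ e₂) h⟩

theorem Expr.Small.lt {K : ℕ} (hK : 4 ≤ K) {s : Store} (hs : s.Bdd K) {e : Expr}
    (h : e.ok = true) (hS : e.Small K s) : e.eval s < K := by
  match e, hS with
  | .lit c, _ => simp [Expr.ok] at h; simp [Expr.eval]; omega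
  | .var x, _ => exact hs.1 x
  | .get a i, _ => exact hs.2 a _
  | .bin .lt a b, _ => simp only [Expr.eval, Op.apply]; split <;> omega
  | .bin .eq a b, _ => simp only [Expr.eval, Op.apply]; split <;> omega
  | .bin .add a b, hS => exact hS
  | .bin .sub a b, hS => exact hS
  | .bin .mul a b, hS => exact hS
  | .bin .div a b, hS => exact hS
  | .bin .mod a b, hS => exact hS

/-- `WP K c s r Q`: started in `s` with `r` time credits, the command `c` halts, stores only values
below `K`, and ends in a store and with a number of credits that satisfy `Q`.  Credits may become
negative in between, but not at the test of a loop; as each test consumes credits, they are at the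
same time the termination measure of all loops. -/
def WP (K : ℕ) : Cmd → Store → ℤ → (Store → ℤ → Prop) → Prop
  | .skip, s, r, Q => Q s (r - 1)
  | .assign x e, s, r, Q => e.Small K s ∧ Q (s.setVar x (e.eval s)) (r - (e.cost + 1 : ℕ))
  | .store a i e, s, r, Q =>
      e.Small K s ∧ Q (s.setArr a (i.eval s) (e.eval s)) (r - (i.cost + e.cost + 1 : ℕ))
  | .seq c₁ c₂, s, r, Q => WP K c₁ s r (fun s' r' => WP K c₂ s' r' Q)
  | .ite e c₁ c₂, s, r, Q =>
      (e.eval s ≠ 0 → WP K c₁ s (r - (e.cost + 1 : ℕ)) Q) ∧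
      (e.eval s = 0 → WP K c₂ s (r - (e.cost + 1 : ℕ)) Q)
  | .loop e c, s, r, Q => ∃ I : Store → ℤ → Prop, I s r ∧ ∀ s' r', I s' r' →
      0 ≤ r' ∧ (e.eval s' = 0 → Q s' (r' - (e.cost + 1 : ℕ))) ∧
      (e.eval s' ≠ 0 → WP K c s' (r' - (e.cost + 1 : ℕ)) I)

theorem Store.Bdd.setVar {K : ℕ} {s : Store} (hs : s.Bdd K) {x v : ℕ} (hv : v < K) :
    (s.setVar x v).Bdd K := by
  refine ⟨fun y => ?_, hs.2⟩
  simp only [Store.setVar, Function.update_apply]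
  split
  · exact hv
  · exact hs.1 y

theorem Store.Bdd.setArr {K : ℕ} {s : Store} (hs : s.Bdd K) {a i v : ℕ} (hv : v < K) :
    (s.setArr a i v).Bdd K := by
  refine ⟨hs.1, fun b j => ?_⟩
  simp only [Store.setArr, Function.update_apply]
  split
  · simp only [Function.update_apply]
    split
    · exact hv
    · exact hs.2 a j
  · exact hs.2 b j

theorem Exec.loop_of_inv {K : ℕ} (hK : 4 ≤ K) {e : Expr} {c : Cmd} (he : e.ok = true)
    {I Q : Store → ℤ → Prop}
    (hI : ∀ s' r', I s' r' → 0 ≤ r' ∧ (e.eval s' = 0 → Q s' (r' - (e.cost + 1 : ℕ))) ∧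
      (e.eval s' ≠ 0 → WP K c s' (r' - (e.cost + 1 : ℕ)) I))
    (hc : ∀ s r Q, s.Bdd K → WP K c s r Q →
      ∃ t s', Exec (K ^ 16) c s t s' ∧ s'.Bdd K ∧ Q s' (r - (t : ℤ))) :
    ∀ (m : ℕ) (s : Store) (r : ℤ), r < m → s.Bdd K → I s r →
      ∃ t s', Exec (K ^ 16) (.loop e c) s t s' ∧ s'.Bdd K ∧ Q s' (r - (t : ℤ)) := by
  intro m
  induction m with
  | zero => intro s r hr _ hIs; have := (hI s r hIs).1; omega
  | succ m ih =>
    intro s r hr hs hIs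
    obtain ⟨h0, hz, hnz⟩ := hI s r hIs
    by_cases h : e.eval s = 0
    · exact ⟨_, s, .loopFalse (Expr.fits_of_ok hK hs e he) h, hs, hz h⟩
    · obtain ⟨t₁, s₁, hx, hb, hI'⟩ := hc _ _ _ hs (hnz h)
      obtain ⟨t₂, s₂, hx₂, hb₂, hQ⟩ := ih s₁ _ (by push_cast; omega) hb hI'
      refine ⟨_, s₂, .loopTrue (Expr.fits_of_ok hK hs e he) h hx hx₂, hb₂, ?_⟩
      convert hQ using 1; push_cast; ring

/-- Soundness of the calculus. -/
theorem WP.sound {K : ℕ} (hK : 4 ≤ K) : ∀ (c : Cmd), c.ok = true → ∀ (s : Store) (r : ℤ)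
    (Q : Store → ℤ → Prop), s.Bdd K → WP K c s r Q →
    ∃ t s', Exec (K ^ 16) c s t s' ∧ s'.Bdd K ∧ Q s' (r - (t : ℤ)) := by
  intro c
  induction c with
  | skip => exact fun _ s r Q hs h => ⟨1, s, .skip s, hs, h⟩
  | assign x e =>
    exact fun hok s r Q hs h => ⟨_, _, .assign s x e (Expr.fits_of_ok hK hs e hok),
      hs.setVar (h.1.lt hK hs hok), h.2⟩
  | store a i e =>
    intro hok s r Q hs h
    simp only [Cmd.ok, Bool.and_eq_true] at hok
    exact ⟨_, _, .store s a i e (Expr.fits_of_ok hK hs i hok.1) (Expr.fits_of_ok hK hs e hok.2),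
      hs.setArr (h.1.lt hK hs hok.2), h.2⟩
  | seq c₁ c₂ ih₁ ih₂ =>
    intro hok s r Q hs h
    simp only [Cmd.ok, Bool.and_eq_true] at hok
    obtain ⟨t₁, s₁, hx, hb, h'⟩ := ih₁ hok.1 s r _ hs h
    obtain ⟨t₂, s₂, hx₂, hb₂, hQ⟩ := ih₂ hok.2 s₁ _ _ hb h'
    refine ⟨_, s₂, .seq hx hx₂, hb₂, ?_⟩
    convert hQ using 1; push_cast; ring
  | ite e c₁ c₂ ih₁ ih₂ =>
    intro hok s r Q hs h
    simp only [Cmd.ok, Bool.and_eq_true] at hok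
    by_cases he : e.eval s = 0
    · obtain ⟨t, s', hx, hb, hQ⟩ := ih₂ hok.2 s _ _ hs (h.2 he)
      refine ⟨_, s', .iteFalse (Expr.fits_of_ok hK hs e hok.1.1) he hx, hb, ?_⟩
      convert hQ using 1; push_cast; ring
    · obtain ⟨t, s', hx, hb, hQ⟩ := ih₁ hok.1.2 s _ _ hs (h.1 he)
      refine ⟨_, s', .iteTrue (Expr.fits_of_ok hK hs e hok.1.1) he hx, hb, ?_⟩
      convert hQ using 1; push_cast; ring
  | loop e c ih =>
    intro hok s r Q hs h
    simp only [Cmd.ok, Bool.and_eq_true] at hok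
    obtain ⟨I, h0, hI⟩ := h
    have hr := (hI s r h0).1
    exact Exec.loop_of_inv hK hok.1 hI (ih hok.2) (r.toNat + 1) s r (by omega) hs h0

theorem WP.mono {K : ℕ} : ∀ {c : Cmd} {s : Store} {r : ℤ} {Q Q' : Store → ℤ → Prop},
    WP K c s r Q → (∀ s' r', Q s' r' → Q' s' r') → WP K c s r Q' := by
  intro c
  induction c with
  | skip => exact fun h hQ => hQ _ _ h
  | assign x e => exact fun h hQ => ⟨h.1, hQ _ _ h.2⟩
  | store a i e => exact fun h hQ => ⟨h.1, hQ _ _ h.2⟩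
  | seq c₁ c₂ ih₁ ih₂ => exact fun h hQ => ih₁ h fun s' r' h' => ih₂ h' hQ
  | ite e c₁ c₂ ih₁ ih₂ =>
    exact fun h hQ => ⟨fun he => ih₁ (h.1 he) hQ, fun he => ih₂ (h.2 he) hQ⟩
  | loop e c ih =>
    rintro s r Q Q' ⟨I, h0, hI⟩ hQ
    exact ⟨I, h0, fun s' r' h => ⟨(hI s' r' h).1, fun he => hQ _ _ ((hI s' r' h).2.1 he),
      (hI s' r' h).2.2⟩⟩

/-- The stores `s` and `s'` agree outside the scalars `xs` and the arrays `as`. -/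
def Same (xs as : List ℕ) (s s' : Store) : Prop :=
  (∀ x, x ∉ xs → s'.var x = s.var x) ∧ ∀ a, a ∉ as → s'.arr a = s.arr a

theorem Same.refl (xs as : List ℕ) (s : Store) : Same xs as s s := ⟨fun _ _ => rfl, fun _ _ => rfl⟩

theorem Same.trans {xs as : List ℕ} {s s' s'' : Store} (h : Same xs as s s')
    (h' : Same xs as s' s'') : Same xs as s s'' :=
  ⟨fun x hx => (h'.1 x hx).trans (h.1 x hx), fun a ha => (h'.2 a ha).trans (h.2 a ha)⟩

theorem Same.mono {xs as xs' as' : List ℕ} {s s' : Store} (h : Same xs as s s')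
    (hx : xs ⊆ xs') (ha : as ⊆ as') : Same xs' as' s s' :=
  ⟨fun x h' => h.1 x fun h'' => h' (hx h''), fun a h' => h.2 a fun h'' => h' (ha h'')⟩

/-- A command changes only what it writes. -/
theorem WP.frame {K : ℕ} : ∀ {c : Cmd} {s : Store} {r : ℤ} {Q : Store → ℤ → Prop},
    WP K c s r Q → WP K c s r (fun s' r' => Q s' r' ∧ Same c.wv c.wa s s') := by
  intro c
  induction c with
  | skip => exact fun h => ⟨h, Same.refl _ _ _⟩
  | assign x e =>
    refine fun {s r Q} h => ⟨h.1, h.2, fun y hy => ?_, fun _ _ => rfl⟩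
    simp only [Cmd.wv, List.mem_singleton] at hy
    simp [Store.setVar, Function.update_of_ne hy]
  | store a i e =>
    refine fun {s r Q} h => ⟨h.1, h.2, fun _ _ => rfl, fun y hy => ?_⟩
    simp only [Cmd.wa, List.mem_singleton] at hy
    simp [Store.setArr, Function.update_of_ne hy]
  | seq c₁ c₂ ih₁ ih₂ =>
    refine fun h => (ih₁ h).mono fun s' r' h' => (ih₂ h'.1).mono fun s'' r'' h'' => ⟨h''.1, ?_⟩
    exact (h'.2.mono (by simp [Cmd.wv]) (by simp [Cmd.wa])).trans
      (h''.2.mono (by simp [Cmd.wv]) (by simp [Cmd.wa]))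
  | ite e c₁ c₂ ih₁ ih₂ =>
    exact fun h => ⟨fun he => (ih₁ (h.1 he)).mono fun s' r' h' =>
        ⟨h'.1, h'.2.mono (by simp [Cmd.wv]) (by simp [Cmd.wa])⟩,
      fun he => (ih₂ (h.2 he)).mono fun s' r' h' =>
        ⟨h'.1, h'.2.mono (by simp [Cmd.wv]) (by simp [Cmd.wa])⟩⟩
  | loop e c ih =>
    rintro s r Q ⟨I, h0, hI⟩
    refine ⟨fun s' r' => I s' r' ∧ Same c.wv c.wa s s', ⟨h0, Same.refl _ _ _⟩, ?_⟩
    intro s' r' h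
    exact ⟨(hI s' r' h.1).1, fun he => ⟨(hI s' r' h.1).2.1 he, h.2⟩,
      fun he => (ih ((hI s' r' h.1).2.2 he)).mono fun s'' r'' h' => ⟨h'.1, h.2.trans h'.2⟩⟩

/-- The rule of consequence, together with the frame property. -/
theorem WP.conseq {K : ℕ} {c : Cmd} {s : Store} {r : ℤ} {Q Q' : Store → ℤ → Prop}
    (h : WP K c s r Q) (hQ : ∀ s' r', Q s' r' → Same c.wv c.wa s s' → Q' s' r') :
    WP K c s r Q' :=
  h.frame.mono fun s' r' h' => hQ s' r' h'.1 h'.2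

/-- The loop rule.  The invariant may use that everything the body does not write is unchanged. -/
theorem WP.loop {K : ℕ} {e : Expr} {c : Cmd} {s : Store} {r : ℤ} {Q : Store → ℤ → Prop}
    (I : Store → ℤ → Prop) (h0 : I s r)
    (hI : ∀ s' r', Same c.wv c.wa s s' → I s' r' → 0 ≤ r' ∧
      (e.eval s' = 0 → Q s' (r' - (e.cost + 1 : ℕ))) ∧
      (e.eval s' ≠ 0 → WP K c s' (r' - (e.cost + 1 : ℕ)) I)) : WP K (.loop e c) s r Q := by
  refine ⟨fun s' r' => I s' r' ∧ Same c.wv c.wa s s', ⟨h0, Same.refl _ _ _⟩, ?_⟩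
  intro s' r' h
  obtain ⟨h1, h2, h3⟩ := hI s' r' h.2 h.1
  exact ⟨h1, h2, fun he => (h3 he).conseq fun s'' r'' h' hs => ⟨h', h.2.trans hs⟩⟩

section StoreLemmas

variable (s : Store) (a b i x y v : ℕ)

theorem Store.var_setVar : (s.setVar x v).var y = if y = x then v else s.var y := by
  simp [Store.setVar, Function.update_apply]

theorem Store.arr_setVar : (s.setVar x v).arr = s.arr := rfl

theorem Store.var_setArr : (s.setArr a i v).var = s.var := rfl

theorem Store.arr_setArr : (s.setArr a i v).arr b =
    if b = a then Function.update (s.arr a) i v else s.arr b := by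
  simp only [Store.setArr, Function.update_apply]

end StoreLemmas

theorem ite_one_zero_ne {p : Prop} [Decidable p] : (if p then 1 else 0 : ℕ) ≠ 0 ↔ p := by
  split <;> simp_all

theorem ite_one_zero_eq {p : Prop} [Decidable p] : (if p then 1 else 0 : ℕ) = 0 ↔ ¬ p := by
  split <;> simp_all

/-- `for x from its current value to the value of y (exclusive) do c`. -/
def forUp (x y : ℕ) (c : Cmd) : Cmd :=
  .loop (.bin .lt (.var x) (.var y)) (.seq c (.assign x (.bin .add (.var x) (.lit 1))))

/-- The rule for counting loops, with an amortized cost of the body. -/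
theorem WP.forUp {K x y : ℕ} {c : Cmd} {s : Store} {r : ℤ} {Q : Store → ℤ → Prop}
    (N i0 : ℕ) (I : ℕ → Store → ℤ → Prop) (hNK : N < K) (hi0 : i0 ≤ N)
    (hx : s.var x = i0) (hy : s.var y = N)
    (hxc : x ∉ c.wv) (hyc : y ∉ c.wv) (hxy : x ≠ y)
    (h0 : I i0 s r) (hpos : ∀ i s r, i ≤ N → I i s r → 0 ≤ r)
    (hstep : ∀ i s' r', i0 ≤ i → i < N → s'.var x = i → Same (x :: c.wv) c.wa s s' →
      I i s' r' → WP K c s' (r' - 4) (fun s'' r'' => I (i + 1) (s''.setVar x (i + 1)) (r'' - 4)))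
    (hend : ∀ s' r', s'.var x = N → Same (x :: c.wv) c.wa s s' → I N s' r' → Q s' (r' - 4)) :
    WP K (forUp x y c) s r Q := by
  refine WP.loop (fun s' r' => ∃ i, i0 ≤ i ∧ i ≤ N ∧ s'.var x = i ∧ I i s' r')
    ⟨i0, le_rfl, hi0, hx, h0⟩ ?_
  rintro s' r' hs ⟨i, h1, h2, h3, h4⟩
  have hs' : Same (x :: c.wv) c.wa s s' := hs.mono (by simp [Cmd.wv]) (by simp [Cmd.wa])
  have hy' : s'.var y = N := by rw [hs'.1 y (by simp [hyc, hxy.symm]), hy]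
  refine ⟨hpos i s' r' h2 h4, ?_, ?_⟩
  · intro he
    simp only [Expr.eval, Op.apply, ite_one_zero_eq, h3, hy'] at he
    obtain rfl : i = N := by omega
    exact hend s' r' h3 hs' h4
  · intro he
    simp only [Expr.eval, Op.apply, ite_one_zero_ne, h3, hy'] at he
    simp only [WP]
    refine (hstep i s' r' h1 he h3 hs' h4).conseq fun s'' r'' h hs'' => ?_
    have hx'' : s''.var x = i := by rw [hs''.1 x hxc, h3]
    refine ⟨?_, i + 1, by omega, by omega, by simp [Store.var_setVar, Expr.eval, Op.apply, hx''], ?_⟩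
    · simp only [Expr.Small, Expr.eval, hx'']; omega
    · simpa [Expr.eval, Op.apply, hx'', Expr.cost] using h

/-- The rule for counting loops whose `i`-th round costs at most `f i`. -/
theorem WP.forUp_sum {K x y : ℕ} {c : Cmd} {s : Store} {r : ℤ} {Q : Store → ℤ → Prop}
    (N i0 : ℕ) (I : ℕ → Store → Prop) (f : ℕ → ℕ) (hNK : N < K) (hi0 : i0 ≤ N)
    (hx : s.var x = i0) (hy : s.var y = N)
    (hxc : x ∉ c.wv) (hyc : y ∉ c.wv) (hxy : x ≠ y)
    (h0 : I i0 s) (hr : (∑ i ∈ Finset.Ico i0 N, ((f i : ℤ) + 8)) + 4 ≤ r)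
    (hstep : ∀ (i : ℕ) (s' : Store) (r' : ℤ), i0 ≤ i → i < N → s'.var x = i →
      Same (x :: c.wv) c.wa s s' → I i s' → f i ≤ r' → WP K c s' r' (fun s'' r'' => r' - f i ≤ r'' ∧ I (i + 1) (s''.setVar x (i + 1))))
    (hend : ∀ (s' : Store) (r' : ℤ), r - ((∑ i ∈ Finset.Ico i0 N, ((f i : ℤ) + 8)) + 4) ≤ r' →
      s'.var x = N → Same (x :: c.wv) c.wa s s' → I N s' → Q s' r') :
    WP K (PSMC.forUp x y c) s r Q := by
  refine WP.forUp N i0 (fun i s' r' => i0 ≤ i ∧ I i s' ∧ r -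
      (∑ i ∈ Finset.Ico i0 N, ((f i : ℤ) + 8)) + (∑ j ∈ Finset.Ico i N, ((f j : ℤ) + 8)) ≤ r')
    hNK hi0 hx hy hxc hyc hxy ⟨le_rfl, h0, by simp⟩ ?_ ?_ ?_
  · rintro i s r' hi ⟨_, _, h⟩
    have : 0 ≤ ∑ j ∈ Finset.Ico i N, ((f j : ℤ) + 8) := Finset.sum_nonneg fun _ _ => by positivity
    omega
  · rintro i s' r' h1 h2 h3 hS ⟨_, hI, h⟩
    have h5 := Finset.sum_eq_sum_Ico_succ_bot h2 (fun j => ((f j : ℤ) + 8))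
    have h6 : 0 ≤ ∑ j ∈ Finset.Ico (i + 1) N, ((f j : ℤ) + 8) :=
      Finset.sum_nonneg fun _ _ => by positivity
    refine (hstep i s' (r' - 4) h1 h2 h3 hS hI (by omega)).mono ?_
    rintro s'' r'' ⟨h7, h8⟩
    exact ⟨by omega, h8, by omega⟩
  · rintro s' r' h1 hS ⟨_, hI, h⟩
    simp only [Finset.Ico_self, Finset.sum_empty] at h
    exact hend s' _ (by omega) h1 hS hI


/-! ### Stacks stored in one array -/

-- Concrete syntax for machine programs.
infixl:65 " +ₑ " => Expr.bin Op.add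
infixl:65 " -ₑ " => Expr.bin Op.sub
infixl:70 " *ₑ " => Expr.bin Op.mul
infixl:70 " /ₑ " => Expr.bin Op.div
infixl:70 " %ₑ " => Expr.bin Op.mod
infix:50 " <ₑ " => Expr.bin Op.lt
infix:50 " =ₑ " => Expr.bin Op.eq
infixr:20 " ;; " => Cmd.seq
infix:30 " ≔ " => Cmd.assign

/-- The contents, from bottom to top, of the `i`-th stack, where stack `i` occupies the `st` cells
of `D` from `i * st` on, and `H i` is its height. -/
def rd (D H : ℕ → ℕ) (st i : ℕ) : List ℕ := (List.range (H i)).map fun j => D (i * st + j)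

section Rd

variable {D H : ℕ → ℕ} {st i i' v : ℕ}

@[simp] theorem length_rd : (rd D H st i).length = H i := by simp [rd]

theorem getElem_rd {j : ℕ} (h : j < (rd D H st i).length) : (rd D H st i)[j] = D (i * st + j) := by
  simp [rd]

theorem cell_ne {j j' : ℕ} (hi : i' ≠ i) (hj : j < st) (hj' : j' < st) :
    i' * st + j' ≠ i * st + j := by
  intro h
  have h1 : (i' * st + j') / st = (i * st + j) / st := by rw [h]
  rw [mul_comm i', mul_comm i, Nat.mul_add_div (by omega), Nat.mul_add_div (by omega),
    Nat.div_eq_of_lt hj, Nat.div_eq_of_lt hj'] at h1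
  omega

theorem rd_push (hi : H i < st) (hi' : H i' ≤ st) :
    rd (Function.update D (i * st + H i) v) (Function.update H i (H i + 1)) st i' =
      if i' = i then rd D H st i ++ [v] else rd D H st i' := by
  split
  · subst i'
    simp only [rd, Function.update_self, List.range_succ, List.map_append, List.map_cons,
      List.map_nil]
    congr 1
    refine List.map_congr_left fun j hj => ?_
    rw [List.mem_range] at hj
    rw [Function.update_of_ne (by omega)]
  · rename_i h
    simp only [rd, Function.update_of_ne h]
    refine List.map_congr_left fun j hj => ?_
    rw [List.mem_range] at hj
    rw [Function.update_of_ne (cell_ne h hi (by omega))]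

theorem rd_pop : rd D (Function.update H i (H i - 1)) st i' =
      if i' = i then (rd D H st i).dropLast else rd D H st i' := by
  split
  · subst i'
    simp [rd, List.dropLast_eq_take, ← List.map_take, List.take_range]
  · rename_i h
    simp only [rd, Function.update_of_ne h]

theorem rd_top (h : 0 < H i) : (rd D H st i).getLast? = some (D (i * st + (H i - 1))) := by
  rw [List.getLast?_eq_getElem?, List.getElem?_eq_getElem (by simp; omega), getElem_rd]
  simp

end Rd

/-- Push the value of `v` onto the `i`-th stack in the arrays `D` (contents) and `H` (heights). -/
def push (D H : ℕ) (st i v : Expr) : Cmd :=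
  .store D (i *ₑ st +ₑ .get H i) v ;; .store H i (.get H i +ₑ .lit 1)

/-! ### Adjacency lists -/

/-- The neighbours of `u` in the order in which the edges of the list `L` mention them. -/
def adjOf (L : List (ℕ × ℕ)) (u : ℕ) : List ℕ :=
  L.flatMap fun p => (if u = p.1 then [p.2] else []) ++ (if u = p.2 then [p.1] else [])

/-- Array `6`, with heights in array `7` and stride `n`, becomes the adjacency lists; array `8` is a
copy of the degrees. -/
def buildAdj : Cmd :=
  4 ≔ .lit 0 ;;
  forUp 4 1 (
    5 ≔ .get 0 (.var 4) ;; 6 ≔ .get 1 (.var 4) ;;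
    push 6 7 (.var 0) (.var 5) (.var 6) ;; push 6 7 (.var 0) (.var 6) (.var 5) ;;
    .store 8 (.var 5) (.get 7 (.var 5)) ;; .store 8 (.var 6) (.get 7 (.var 6)))

theorem adjOf_append (L L' : List (ℕ × ℕ)) (u : ℕ) : adjOf (L ++ L') u = adjOf L u ++ adjOf L' u := by
  simp [adjOf]

theorem adjOf_take_succ {L : List (ℕ × ℕ)} {e : ℕ} (he : e < L.length) (u : ℕ) :
    adjOf (L.take (e + 1)) u = adjOf (L.take e) u ++
      ((if u = L[e].1 then [L[e].2] else []) ++ (if u = L[e].2 then [L[e].1] else [])) := by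
  rw [List.take_succ_eq_append_getElem he, adjOf_append]; simp [adjOf]

theorem length_adjOf_take_le (L : List (ℕ × ℕ)) (e u : ℕ) :
    (adjOf (L.take e) u).length ≤ (adjOf L u).length := by
  conv_rhs => rw [← List.take_append_drop e L, adjOf_append]
  simp

theorem buildAdj_spec {K n m : ℕ} {L : List (ℕ × ℕ)} (hm : L.length = m) (hmK : m < K)
    (hnK : n < K)
    (hL : ∀ p ∈ L, p.1 < n ∧ p.2 < n ∧ p.1 ≠ p.2) (hadj : ∀ u < n, (adjOf L u).length ≤ n)
    {s : Store} (h0 : s.var 0 = n) (h1 : s.var 1 = m)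
    (ha0 : ∀ e (he : e < L.length), s.arr 0 e = L[e].1)
    (ha1 : ∀ e (he : e < L.length), s.arr 1 e = L[e].2)
    (h7 : ∀ u, s.arr 7 u = 0) (h8 : ∀ u, s.arr 8 u = 0) {r : ℤ} (hr : 68 * (m : ℤ) + 6 ≤ r) :
    WP K buildAdj s r fun s' r' => r - (68 * (m : ℤ) + 6) ≤ r' ∧
      ∀ u < n, rd (s'.arr 6) (s'.arr 7) n u = adjOf L u ∧ s'.arr 8 u = s'.arr 7 u := by
  simp only [buildAdj, WP, Expr.Small, Expr.eval, Expr.cost, true_and]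
  refine WP.forUp_sum m 0 (fun e s' =>
    ∀ u < n, rd (s'.arr 6) (s'.arr 7) n u = adjOf (L.take e) u ∧ s'.arr 8 u = s'.arr 7 u)
    (fun _ => 60) hmK (Nat.zero_le _) ?_ ?_ ?_ ?_ ?_ ?_ ?_ ?_ ?_
  · simp [Store.var_setVar]
  · simp [Store.var_setVar, h1]
  · decide
  · decide
  · decide
  · intro u hu
    simp [Store.arr_setVar, rd, h7, h8, adjOf]
  · simp; omega
  · intro e s' r' _ he hx hS hI hr'
    have he' : e < L.length := hm ▸ he
    have e0 : s'.arr 0 = s.arr 0 := (hS.2 0 (by decide)).trans (by simp [Store.arr_setVar])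
    have e1 : s'.arr 1 = s.arr 1 := (hS.2 1 (by decide)).trans (by simp [Store.arr_setVar])
    have v0 : s'.var 0 = n := (hS.1 0 (by decide)).trans (by simp [Store.var_setVar, h0])
    obtain ⟨hp1, hp2, hp3⟩ := hL L[e] (List.getElem_mem _)
    have hlen : ∀ u < n, s'.arr 7 u ≤ n ∧ (u = L[e].1 ∨ u = L[e].2 → s'.arr 7 u < n) := by
      intro u hu
      have h1 := congrArg List.length (hI u hu).1
      have h2 := length_adjOf_take_le L (e + 1) u
      rw [adjOf_take_succ he'] at h2
      have h3 := hadj u hu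
      simp only [length_rd, List.length_append] at h1 h2
      refine ⟨by omega, ?_⟩
      rintro (h | h)
      · rw [if_pos h] at h2; simp at h2; omega
      · rw [if_pos h] at h2; simp at h2; omega
    simp only [push, WP, Expr.Small, Expr.eval, Expr.cost, Op.apply, Store.var_setVar,
      Store.arr_setVar, Store.var_setArr, Store.arr_setArr, hx, e0, e1, v0, ha0 e he', ha1 e he',
      Nat.reduceEqDiff, if_true, if_false, true_and, Function.update_self,
      Function.update_of_ne hp3, Function.update_of_ne hp3.symm]
    refine ⟨by have := (hlen _ hp1).2 (.inl rfl); omega,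
      by have := (hlen _ hp2).2 (.inr rfl); omega, by push_cast; omega, ?_⟩
    intro u hu
    have A : ∀ w < n, Function.update (s'.arr 7) L[e].1 (s'.arr 7 L[e].1 + 1) w ≤ n := by
      intro w hw
      rw [Function.update_apply]
      split
      · subst w; exact (hlen _ hp1).2 (.inl rfl)
      · exact (hlen w hw).1
    have B : Function.update (s'.arr 7) L[e].1 (s'.arr 7 L[e].1 + 1) L[e].2 = s'.arr 7 L[e].2 :=
      Function.update_of_ne hp3.symm ..
    have C := (hlen _ hp2).2 (.inr rfl)
    constructor
    · have P := rd_push (D := Function.update (s'.arr 6) (L[e].1 * n + s'.arr 7 L[e].1) L[e].2)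
        (i' := u) (v := L[e].1) (B ▸ C) (A u hu)
      have P' := rd_push (D := s'.arr 6) (i' := u) (v := L[e].2) ((hlen _ hp1).2 (.inl rfl))
        (hlen u hu).1
      have P'' := rd_push (D := s'.arr 6) (i' := L[e].2) (v := L[e].2)
        ((hlen _ hp1).2 (.inl rfl)) (hlen _ hp2).1
      rw [B] at P
      rw [P, adjOf_take_succ he', P', P'', if_neg hp3.symm, (hI _ hp1).1, (hI _ hp2).1, (hI _ hu).1]
      by_cases hu1 : u = L[e].1
      · rw [if_pos hu1, if_pos hu1, if_neg (hu1 ▸ hp3), if_neg (hu1 ▸ hp3), hu1]; simp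
      · by_cases hu2 : u = L[e].2
        · rw [if_pos hu2, if_neg hu1, if_pos hu2, hu2]; simp
        · rw [if_neg hu1, if_neg hu2, if_neg hu1, if_neg hu2]; simp
    · have := (hI u hu).2
      simp only [Function.update_apply]
      split_ifs <;> simp_all
  · intro s' r' h hx hS hI
    simp only [Finset.sum_const, Nat.card_Ico, nsmul_eq_mul] at h
    refine ⟨by push_cast at h; omega, fun u hu => ?_⟩
    have := hI u hu
    rwa [List.take_of_length_le (by omega)] at this


/-! ### Degeneracy order -/

/-- `A` describes a simple graph on the vertices below `n` by adjacency lists. -/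
structure AdjLists (n : ℕ) (A : ℕ → List ℕ) : Prop where
  nodup : ∀ u < n, (A u).Nodup
  lt : ∀ u < n, ∀ v ∈ A u, v < n
  symm : ∀ u < n, ∀ v ∈ A u, u ∈ A v

theorem AdjLists.mem_comm {n : ℕ} {A : ℕ → List ℕ} (hA : AdjLists n A) {u v : ℕ} (hu : u < n)
    (hv : v < n) : u ∈ A v ↔ v ∈ A u := ⟨hA.symm v hv u, hA.symm u hu v⟩

theorem length_le_of_nodup_lt {n : ℕ} {l : List ℕ} (h : l.Nodup) (h' : ∀ x ∈ l, x < n) :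
    l.length ≤ n := by
  rw [← List.toFinset_card_of_nodup h, ← Finset.card_range n]
  exact Finset.card_le_card fun x hx => by simpa using h' x (by simpa using hx)

theorem AdjLists.length_le {n : ℕ} {A : ℕ → List ℕ} (hA : AdjLists n A) {u : ℕ} (hu : u < n) :
    (A u).length ≤ n := length_le_of_nodup_lt (hA.nodup u hu) (hA.lt u hu)

/-- `ord 0, …, ord (tl - 1)` are distinct vertices, `pos` is one plus the inverse of `ord` and `0`
elsewhere, and each of these vertices has at most `D` neighbours that come later or do not occur. -/
structure PartialOrd (n : ℕ) (A : ℕ → List ℕ) (D : ℕ) (ord pos : ℕ → ℕ) (tl : ℕ) : Prop where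
  pos_ord : ∀ i < tl, ord i < n ∧ pos (ord i) = i + 1
  ord_pos : ∀ v < n, pos v ≠ 0 → pos v ≤ tl ∧ ord (pos v - 1) = v
  deg : ∀ v < n, pos v ≠ 0 → (A v).countP (fun w => pos w = 0 ∨ pos v < pos w) ≤ D

theorem PartialOrd.le {n : ℕ} {A : ℕ → List ℕ} {D : ℕ} {ord pos : ℕ → ℕ} {tl : ℕ}
    (h : PartialOrd n A D ord pos tl) : tl ≤ n := by
  have := Finset.card_le_card_of_injOn (s := Finset.range tl) (t := Finset.range n) ord
    (fun i hi => by simpa using (h.pos_ord i (by simpa using hi)).1)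
    (fun i hi j hj hij => by
      have h1 := (h.pos_ord i (by simpa using hi)).2
      have h2 := (h.pos_ord j (by simpa using hj)).2
      rw [hij] at h1; omega)
  simpa using this

theorem PartialOrd.append {n : ℕ} {A : ℕ → List ℕ} {D : ℕ} {ord pos : ℕ → ℕ} {tl v : ℕ}
    (h : PartialOrd n A D ord pos tl) (hA : ∀ u < n, ∀ v ∈ A u, v < n) (hv : v < n)
    (hp : pos v = 0)
    (hD : (A v).countP (fun w => pos w = 0) ≤ D) :
    PartialOrd n A D (Function.update ord tl v) (Function.update pos v (tl + 1)) (tl + 1) := by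
  refine ⟨fun i hi => ?_, fun u hu hpu => ?_, fun u hu hpu => ?_⟩
  · by_cases hi' : i = tl
    · subst hi'; simp [hv]
    · have h1 := h.pos_ord i (by omega)
      have h2 : ord i ≠ v := by rintro rfl; omega
      rw [Function.update_of_ne hi', Function.update_of_ne h2]; exact h1
  · by_cases huv : u = v
    · subst huv; simp
    · rw [Function.update_of_ne huv] at hpu ⊢
      obtain ⟨h1, h2⟩ := h.ord_pos u hu hpu
      exact ⟨by omega, by rw [Function.update_of_ne (by omega)]; exact h2⟩
  · by_cases huv : u = v
    · subst huv
      refine le_trans (List.countP_mono_left fun w hw => ?_) hD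
      simp only [Function.update_self, decide_eq_true_eq, Function.update_apply]
      split
      · omega
      · rintro (h1 | h1)
        · exact h1
        · by_contra h2
          have := (h.ord_pos w (hA u hu w hw) h2).1
          omega
    · rw [Function.update_of_ne huv] at hpu ⊢
      refine le_trans (List.countP_mono_left fun w hw => ?_) (h.deg u hu hpu)
      simp only [decide_eq_true_eq, Function.update_apply]
      split
      · rename_i hwv; subst hwv; exact fun _ => .inl hp
      · exact id

/-- The vertex `w` is not among the first `h` vertices of the order. -/
def Unproc (pos : ℕ → ℕ) (h w : ℕ) : Prop := pos w = 0 ∨ h < pos w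

instance (pos : ℕ → ℕ) (h w : ℕ) : Decidable (Unproc pos h w) :=
  inferInstanceAs (Decidable (_ ∨ _))

theorem unproc_append {pos : ℕ → ℕ} {h tl v : ℕ} (hp : pos v = 0) (hh : h ≤ tl) (w : ℕ) :
    Unproc (Function.update pos v (tl + 1)) h w ↔ Unproc pos h w := by
  simp only [Unproc, Function.update_apply]
  split
  · subst w; omega
  · rfl

/-- Append the vertex in the scalar `v` to the order in array `10`, with positions in array `9` and
length in the scalar `5`. -/
def appendOrd (v : ℕ) : Cmd :=
  .store 10 (.var 5) (.var v) ;; .store 9 (.var v) (.var 5 +ₑ .lit 1) ;; 5 ≔ .var 5 +ₑ .lit 1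

/-- Append the vertex in the scalar `v` if it is new and its current degree is at most the
threshold in the scalar `4`. -/
def tryAppend (v : ℕ) : Cmd :=
  .ite ((.get 9 (.var v) =ₑ .lit 0) *ₑ (.get 8 (.var v) <ₑ .var 4 +ₑ .lit 1)) (appendOrd v) .skip

/-- Append all new vertices whose current degree is at most the threshold. -/
def scanOrd : Cmd := 7 ≔ .lit 0 ;; forUp 7 0 (tryAppend 7)

/-- Remove the vertices of the queue between the scalars `6` and `5` from the graph. -/
def drainOrd : Cmd :=
  .loop (.var 6 <ₑ .var 5) (
    8 ≔ .get 10 (.var 6) ;; 6 ≔ .var 6 +ₑ .lit 1 ;; 9 ≔ .lit 0 ;; 10 ≔ .get 7 (.var 8) ;;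
    forUp 9 10 (
      11 ≔ .get 6 (.var 8 *ₑ .var 0 +ₑ .var 9) ;;
      .store 8 (.var 11) (.get 8 (.var 11) -ₑ .lit 1) ;;
      tryAppend 11))

/-- Remove vertices until none is left, raising the threshold in the scalar `4` when necessary. -/
def peelOrd : Cmd :=
  .loop (.var 5 <ₑ .var 0) (scanOrd ;; drainOrd ;; 4 ≔ .var 4 +ₑ .lit 1)

/-- Array `10` becomes an order of the vertices by repeated removal of vertices of current degree
at most a threshold, which is raised when no such vertex is left.  For `k = 2` any order will do,
and the threshold starts at `n`. -/
def buildOrd : Cmd :=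
  .ite (.var 2 <ₑ .lit 3) (4 ≔ .var 0) (4 ≔ .lit 0) ;; 5 ≔ .lit 0 ;; 6 ≔ .lit 0 ;; peelOrd

theorem PartialOrd.lt_of_new {n : ℕ} {A : ℕ → List ℕ} {D : ℕ} {ord pos : ℕ → ℕ} {tl v : ℕ}
    (h : PartialOrd n A D ord pos tl) (hv : v < n) (hp : pos v = 0) : tl < n := by
  have h2 : ∀ u < n, ∀ w ∈ (fun _ : ℕ => ([] : List ℕ)) u, w < n := by simp
  have h3 : PartialOrd n (fun _ => []) 0 ord pos tl := ⟨h.pos_ord, h.ord_pos, by simp⟩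
  exact (h3.append h2 hv hp (by simp)).le

/-- A vertex whose current degree is at most `d ≤ D` may be appended: all its neighbours that are not
yet in the order are counted in its current degree. -/
theorem tryAppend_spec {K n D d tl h v x : ℕ} {A : ℕ → List ℕ} (hA : AdjLists n A) (hnK : n + 1 < K)
    {s : Store} (hO : PartialOrd n A D (s.arr 10) (s.arr 9) tl) (h4 : s.var 4 = d) (h5 : s.var 5 = tl)
    (hx : s.var x = v) (hv : v < n) (hh : h ≤ tl) (hdD : d ≤ D)
    (h8 : s.arr 9 v = 0 → (A v).countP (fun w => Unproc (s.arr 9) h w) ≤ s.arr 8 v) (r : ℤ) :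
    WP K (tryAppend x) s r fun s' r' => r - 30 ≤ r' ∧
      (∃ tl', s'.var 5 = tl' ∧ tl ≤ tl' ∧ PartialOrd n A D (s'.arr 10) (s'.arr 9) tl') ∧
      (∀ w, Unproc (s'.arr 9) h w ↔ Unproc (s.arr 9) h w) ∧
      (∀ w, s'.arr 9 w = 0 → s.arr 9 w = 0) ∧ (∀ i < tl, s'.arr 10 i = s.arr 10 i) ∧
      (s'.arr 9 v = 0 → d < s.arr 8 v) := by
  simp only [tryAppend, appendOrd, WP, Expr.Small, Expr.eval, Expr.cost, Op.apply, true_and,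
    mul_ne_zero_iff, mul_eq_zero, ite_one_zero_ne, ite_one_zero_eq, Store.var_setVar,
    Store.arr_setVar, Store.var_setArr, Store.arr_setArr, hx, h4, h5, Nat.reduceEqDiff, if_true,
    if_false]
  constructor
  · rintro ⟨h1, h2⟩
    have hD : (A v).countP (fun w => s.arr 9 w = 0) ≤ D := by
      refine le_trans (List.countP_mono_left fun w hw => ?_) ((h8 h1).trans (by omega))
      simp only [decide_eq_true_eq]
      exact .inl
    have hlt := hO.lt_of_new hv h1
    refine ⟨by omega, by omega, by push_cast; omega, ⟨tl + 1, rfl, by omega, hO.append hA.lt hv h1 hD⟩,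
      unproc_append h1 hh, fun w => ?_, fun i hi => ?_, ?_⟩
    · rw [Function.update_apply]; split <;> simp
    · rw [Function.update_of_ne (by omega)]
    · simp
  · intro h1
    refine ⟨by push_cast; omega, ⟨tl, rfl, le_rfl, hO⟩, fun w => trivial, fun w => id, fun _ _ => trivial, fun hp => ?_⟩
    omega

/-- The time that the removal of the vertices that are not yet processed will take. -/
def drainCost (n : ℕ) (A : ℕ → List ℕ) (pos : ℕ → ℕ) (h : ℕ) : ℕ :=
  ∑ v ∈ Finset.range n, if Unproc pos h v then 70 * (A v).length + 50 else 0

theorem scanOrd_spec {K n D d tl h : ℕ} {A : ℕ → List ℕ} (hA : AdjLists n A) (hnK : n + 1 < K)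
    {s : Store} (hO : PartialOrd n A D (s.arr 10) (s.arr 9) tl) (h0 : s.var 0 = n)
    (h4 : s.var 4 = d) (h5 : s.var 5 = tl) (hh : h ≤ tl) (hdD : d ≤ D)
    (h8 : ∀ v < n, s.arr 8 v = (A v).countP (fun w => Unproc (s.arr 9) h w)) {r : ℤ}
    (hr : 38 * (n : ℤ) + 6 ≤ r) :
    WP K scanOrd s r fun s' r' => r - (38 * n + 6) ≤ r' ∧
      (∃ tl', s'.var 5 = tl' ∧ tl ≤ tl' ∧ PartialOrd n A D (s'.arr 10) (s'.arr 9) tl') ∧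
      (∀ w, Unproc (s'.arr 9) h w ↔ Unproc (s.arr 9) h w) ∧
      ∀ v < n, s'.arr 9 v = 0 → d < s.arr 8 v := by
  simp only [scanOrd, WP, Expr.Small, Expr.eval, Expr.cost, true_and]
  refine WP.forUp_sum n 0 (fun i s' =>
      (∃ tl', s'.var 5 = tl' ∧ tl ≤ tl' ∧ PartialOrd n A D (s'.arr 10) (s'.arr 9) tl') ∧
      (∀ w, Unproc (s'.arr 9) h w ↔ Unproc (s.arr 9) h w) ∧
      ∀ v < i, s'.arr 9 v = 0 → d < s.arr 8 v)
    (fun _ => 30) (by omega) (Nat.zero_le _) ?_ ?_ (by decide) (by decide) (by decide) ?_ ?_ ?_ ?_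
  · simp [Store.var_setVar]
  · simp [Store.var_setVar, h0]
  · exact ⟨⟨tl, by simp [Store.var_setVar, h5], le_rfl, hO⟩, fun w => Iff.rfl, by omega⟩
  · simp; omega
  · rintro i s' r' _ hi hx hS ⟨⟨tl', h5', htl, hO'⟩, hU, hd⟩ hr'
    have e8 : s'.arr 8 = s.arr 8 := (hS.2 8 (by decide)).trans (by simp [Store.arr_setVar])
    have v4 : s'.var 4 = d := (hS.1 4 (by decide)).trans (by simp [Store.var_setVar, h4])
    refine (tryAppend_spec (x := 7) hA hnK hO' v4 h5' hx hi (hh.trans htl) hdD ?_ r').mono ?_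
    · rw [e8, h8 i hi]
      simp only [hU, le_refl, implies_true]
    · rintro s'' r'' ⟨h1, ⟨tl'', h2, h3, h4'⟩, h5'', h6, _, h7⟩
      refine ⟨by push_cast; omega, ⟨tl'', by simp [Store.var_setVar, h2], htl.trans h3, h4'⟩,
        fun w => (h5'' w).trans (hU w), fun v hv => ?_⟩
      rw [Store.arr_setVar]
      intro hp
      rcases Nat.lt_succ_iff_lt_or_eq.1 hv with hv | rfl
      · exact hd v hv (h6 v hp)
      · exact e8 ▸ h7 hp
  · rintro s' r' h hx hS ⟨h1, h2, h3⟩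
    simp only [Finset.sum_const, Nat.card_Ico, nsmul_eq_mul] at h
    exact ⟨by push_cast at h; omega, h1, h2, h3⟩

/-- Removal of the next vertex of the queue lowers the current degrees of its neighbours by one. -/
theorem countP_unproc_succ {n : ℕ} {A : ℕ → List ℕ} (hA : AdjLists n A) {ord pos : ℕ → ℕ}
    {D tl h : ℕ} (hO : PartialOrd n A D ord pos tl) (hh : h < tl) {v : ℕ} (hv : v < n) :
    (A v).countP (fun w => Unproc pos h w) = (A v).countP (fun w => Unproc pos (h + 1) w) +
      if v ∈ A (ord h) then 1 else 0 := by
  obtain ⟨h1, h2⟩ := hO.pos_ord h hh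
  have h3 : ∀ w ∈ A v, Unproc pos h w ↔ (Unproc pos (h + 1) w ∨ w = ord h) := by
    intro w hw
    have hw' := hA.lt v hv w hw
    constructor
    · rintro (h4 | h4)
      · exact .inl (.inl h4)
      · by_cases h5 : pos w = h + 1
        · right
          have := (hO.ord_pos w hw' (by omega)).2
          rw [← this, h5]; rfl
        · exact .inl (.inr (by omega))
    · rintro ((h4 | h4) | rfl)
      · exact .inl h4
      · exact .inr (by omega)
      · exact .inr (by omega)
  have h4 : (A v).countP (fun w => Unproc pos h w) =
      (A v).countP (fun w => decide (Unproc pos (h + 1) w) || decide (w = ord h)) :=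
    List.countP_congr fun w hw => by simpa using h3 w hw
  have h5 : ¬ Unproc pos (h + 1) (ord h) := by simp [Unproc, h2]
  have h6 : ∀ l : List ℕ, l.countP (fun w => decide (Unproc pos (h + 1) w) || decide (w = ord h)) =
      l.countP (fun w => Unproc pos (h + 1) w) + l.count (ord h) := by
    intro l
    induction l with
    | nil => simp
    | cons a l ih =>
      simp only [List.countP_cons, List.count_cons, ih]
      by_cases ha : a = ord h
      · subst ha; simp [h5]; omega
      · simp [ha]; split <;> omega
  rw [h4, h6]
  congr 1
  split
  · rename_i hm
    exact List.count_eq_one_of_mem (hA.nodup v hv) ((hA.mem_comm h1 hv).2 hm)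
  · rename_i hm
    exact List.count_eq_zero_of_not_mem fun h => hm ((hA.mem_comm h1 hv).1 h)

theorem drainCost_succ {n : ℕ} {A : ℕ → List ℕ} {ord pos : ℕ → ℕ}
    {D tl h : ℕ} (hO : PartialOrd n A D ord pos tl) (hh : h < tl) :
    drainCost n A pos h = drainCost n A pos (h + 1) + (70 * (A (ord h)).length + 50) := by
  obtain ⟨h1, h2⟩ := hO.pos_ord h hh
  have : ∀ v ∈ Finset.range n, (if Unproc pos h v then 70 * (A v).length + 50 else 0) =
      (if Unproc pos (h + 1) v then 70 * (A v).length + 50 else 0) +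
      if v = ord h then 70 * (A (ord h)).length + 50 else 0 := by
    intro v hv
    by_cases hvo : v = ord h
    · subst hvo; simp [Unproc, h2]
    · have : Unproc pos h v ↔ Unproc pos (h + 1) v := by
        simp only [Unproc]
        constructor
        · rintro (h4 | h4)
          · exact .inl h4
          · refine .inr (Nat.lt_of_le_of_ne h4 fun h5 => hvo ?_)
            have := (hO.ord_pos v (by simpa using hv) (by omega)).2
            rw [← this, ← h5]; rfl
        · omega
      simp [this, hvo]
  rw [drainCost, Finset.sum_congr rfl this, Finset.sum_add_distrib, Finset.sum_ite_eq']
  simp [h1, drainCost]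

theorem drainCost_congr {n : ℕ} {A : ℕ → List ℕ} {pos pos' : ℕ → ℕ} {h : ℕ}
    (hU : ∀ w, Unproc pos' h w ↔ Unproc pos h w) : drainCost n A pos' h = drainCost n A pos h := by
  simp only [drainCost, hU]

/-- When the queue is empty, the current degree of each vertex outside the order exceeds the
threshold.  The cost is paid by the decrease of `drainCost`. -/
theorem drainOrd_spec {K n D d tl h : ℕ} {A : ℕ → List ℕ} (hA : AdjLists n A) (hnK : n + 1 < K)
    {s : Store} (hO : PartialOrd n A D (s.arr 10) (s.arr 9) tl) (h0 : s.var 0 = n)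
    (h4 : s.var 4 = d) (h5 : s.var 5 = tl) (h6 : s.var 6 = h) (hh : h ≤ tl) (hdD : d ≤ D)
    (hrd : ∀ u < n, rd (s.arr 6) (s.arr 7) n u = A u)
    (h8 : ∀ v < n, s.arr 8 v = (A v).countP (fun w => Unproc (s.arr 9) h w))
    (hbig : ∀ v < n, s.arr 9 v = 0 → d < s.arr 8 v) {r : ℤ}
    (hr : (drainCost n A (s.arr 9) h : ℤ) + 4 ≤ r) :
    WP K drainOrd s r fun s' r' =>
      r - drainCost n A (s.arr 9) h - 4 ≤ r' - drainCost n A (s'.arr 9) (s'.var 6) ∧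
      (∃ tl', s'.var 5 = tl' ∧ s'.var 6 = tl' ∧ PartialOrd n A D (s'.arr 10) (s'.arr 9) tl' ∧
        (∀ v < n, s'.arr 8 v = (A v).countP (fun w => Unproc (s'.arr 9) tl' w)) ∧
        (∀ v < n, s'.arr 9 v = 0 → d < s'.arr 8 v)) := by
  refine WP.loop (fun s' r' => ∃ tl' h', s'.var 5 = tl' ∧ s'.var 6 = h' ∧ h' ≤ tl' ∧
      PartialOrd n A D (s'.arr 10) (s'.arr 9) tl' ∧
      r - drainCost n A (s.arr 9) h ≤ r' - drainCost n A (s'.arr 9) h' ∧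
      (∀ v < n, s'.arr 8 v = (A v).countP (fun w => Unproc (s'.arr 9) h' w)) ∧
        (∀ v < n, s'.arr 9 v = 0 → d < s'.arr 8 v))
    ⟨tl, h, h5, h6, hh, hO, le_rfl, h8, hbig⟩ ?_
  rintro s' r' hS ⟨tl', h', h5', h6', hh', hO', hr', h8', hbig'⟩
  have v0 : s'.var 0 = n := (hS.1 0 (by decide)).trans h0
  have v4 : s'.var 4 = d := (hS.1 4 (by decide)).trans h4
  have e6 : s'.arr 6 = s.arr 6 := hS.2 6 (by decide)
  have e7 : s'.arr 7 = s.arr 7 := hS.2 7 (by decide)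
  refine ⟨by omega, ?_, ?_⟩
  · intro he
    simp only [Expr.eval, Op.apply, ite_one_zero_eq, h5', h6'] at he
    obtain rfl : h' = tl' := by omega
    rw [h6']
    exact ⟨by simp only [Expr.cost]; push_cast; omega, h', h5', rfl, hO', h8', hbig'⟩
  · intro he
    simp only [Expr.eval, Op.apply, ite_one_zero_ne, h5', h6'] at he
    obtain ⟨hxn, hxp⟩ := hO'.pos_ord h' he
    have hle := hO'.le
    have hdc := drainCost_succ hO' he
    set x := s'.arr 10 h' with hxdef
    have hlenx : s.arr 7 x = (A x).length := by rw [← hrd x hxn]; simp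
    have hlenn := hA.length_le hxn
    simp only [WP, Expr.Small, Expr.eval, Expr.cost, Op.apply, true_and, Store.var_setVar,
      Store.arr_setVar, h6', Nat.reduceEqDiff, if_true, if_false, e7, ← hxdef]
    refine ⟨by omega, ?_⟩
    refine WP.forUp_sum (A x).length 0 (fun j s'' => ∃ tl'', s''.var 5 = tl'' ∧ h' + 1 ≤ tl'' ∧
        s''.var 6 = h' + 1 ∧
        PartialOrd n A D (s''.arr 10) (s''.arr 9) tl'' ∧
        (∀ w, Unproc (s''.arr 9) (h' + 1) w ↔ Unproc (s'.arr 9) (h' + 1) w) ∧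
        (∀ v < n, s''.arr 8 v = (A v).countP (fun w => Unproc (s'.arr 9) (h' + 1) w) +
          if v ∈ (A x).drop j then 1 else 0) ∧
        (∀ v < n, s''.arr 9 v = 0 → d < s''.arr 8 v))
      (fun _ => 50) (by omega) (Nat.zero_le _) ?_ ?_ (by decide) (by decide) (by decide) ?_ ?_ ?_ ?_
    · simp [Store.var_setVar]
    · simp [Store.var_setVar, hlenx]
    · refine ⟨tl', by simp [Store.var_setVar, h5'], by omega, by simp [Store.var_setVar], hO', fun w => Iff.rfl,
        fun v hv => ?_, hbig'⟩
      rw [List.drop_zero, ← countP_unproc_succ hA hO' he hv]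
      exact h8' v hv
    · simp; omega
    · rintro j s'' r'' _ hj hx9 hS'' ⟨tl'', h5'', htl'', h6'', hO'', hU'', h8'', hbig''⟩ hr''
      have w0 : s''.var 0 = n := (hS''.1 0 (by decide)).trans (by simp [Store.var_setVar, v0])
      have w4 : s''.var 4 = d := (hS''.1 4 (by decide)).trans (by simp [Store.var_setVar, v4])
      have w8 : s''.var 8 = x := (hS''.1 8 (by decide)).trans (by simp [Store.var_setVar])
      have f6 : s''.arr 6 = s.arr 6 :=
        (hS''.2 6 (by decide)).trans (by simp [Store.arr_setVar, e6])
      have hy : s.arr 6 (x * n + j) = (A x)[j] := by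
        simp only [← hrd x hxn]
        rw [getElem_rd]
      set y := (A x)[j] with hydef
      have hyA : y ∈ A x := List.getElem_mem _
      have hyn : y < n := hA.lt x hxn y hyA
      have hdrop : (A x).drop j = y :: (A x).drop (j + 1) := List.drop_eq_getElem_cons hj
      have hnd : y ∉ (A x).drop (j + 1) := by
        have := (hA.nodup x hxn).sublist (List.drop_sublist j (A x))
        rw [hdrop, List.nodup_cons] at this
        exact this.1
      have hy8 : s''.arr 8 y = (A y).countP (fun w => Unproc (s'.arr 9) (h' + 1) w) + 1 := by
        rw [h8'' y hyn, hdrop]; simp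
      have hy8n : s''.arr 8 y ≤ n + 1 := by
        rw [hy8]
        have h1 := hA.length_le hyn
        have h2 := List.countP_le_length (p := fun w => decide (Unproc (s'.arr 9) (h' + 1) w)) (l := A y)
        omega
      simp only [WP, Expr.Small, Expr.eval, Expr.cost, Op.apply, true_and, Store.var_setVar,
        Store.arr_setVar, Nat.reduceEqDiff, if_true, if_false, f6, w8, w0, hx9, hy]
      refine ⟨by omega, ?_⟩
      refine (tryAppend_spec (x := 11) (v := y) (tl := tl'') (d := d) (h := h' + 1) (D := D) hA hnK
        (by simpa [Store.arr_setArr, Store.arr_setVar] using hO'')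
        (by simp [Store.var_setArr, Store.var_setVar, w4])
        (by simp [Store.var_setArr, Store.var_setVar, h5''])
        (by simp [Store.var_setArr, Store.var_setVar]) hyn htl'' hdD ?_ _).conseq ?_
      · intro _
        simp only [Store.arr_setArr, Store.arr_setVar, Nat.reduceEqDiff, if_true, if_false,
          Function.update_self, hy8, hU'']
        omega
      · rintro s3 r3 ⟨g1, ⟨tl3, g2, g3, g4⟩, g5, g6, g7, g8⟩ hS3
        have k8 := hS3.2 8 (by decide)
        have k6 := hS3.1 6 (by decide)
        simp only [Store.arr_setArr, Store.arr_setVar, Store.var_setArr, Store.var_setVar,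
          Nat.reduceEqDiff, if_true, if_false, Function.update_self] at g5 g6 g8 k8 k6
        refine ⟨by push_cast at g1 ⊢; omega, tl3, by simp [g2], by omega,
          by simp [k6, h6''], g4, fun w => (g5 w).trans (hU'' w), ?_, ?_⟩
        · intro v hv
          rw [k8, Function.update_apply]
          split
          · subst v
            rw [hy8, if_neg hnd]; omega
          · rename_i hvy
            rw [h8'' v hv, hdrop]
            simp [hvy]
        · intro v hv
          rw [k8, Function.update_apply]
          split
          · subst v; exact g8
          · exact fun hp => hbig'' v hv (g6 v hp)
    · rintro s'' r'' hrr hx9 hS'' ⟨tl'', h5'', htl'', h6'', hO'', hU'', h8'', hbig''⟩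
      simp only [Finset.sum_const, Nat.card_Ico, nsmul_eq_mul] at hrr
      refine ⟨tl'', h' + 1, h5'', h6'', htl'', hO'', ?_, ?_, hbig''⟩
      · rw [drainCost_congr hU'']
        push_cast at hrr hdc ⊢
        omega
      · intro v hv
        rw [h8'' v hv]
        simp [hU'']

theorem countP_mem_eq {n : ℕ} {A : ℕ → List ℕ} (hA : AdjLists n A) {pos : ℕ → ℕ} {tl : ℕ}
    (hpos : ∀ v < n, pos v ≤ tl) {v : ℕ} (hv : v < n) :
    (A v).countP (fun w => Unproc pos tl w) =
      (A v).countP (fun w => w ∈ (Finset.range n).filter fun w => pos w = 0) := by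
  refine List.countP_congr fun w hw => ?_
  have h1 := hA.lt v hv w hw
  have h2 := hpos w h1
  rw [decide_eq_true_iff, decide_eq_true_iff, Finset.mem_filter, Finset.mem_range]
  simp only [Unproc]; omega

/-- The hypothesis `hdeg` says that a set of vertices in which all degrees exceed `d` exists only for
`d < D`; as the vertices that are left after a phase form such a set, the threshold never has to be
raised beyond `D`.  Each of the phases scans all vertices once, and in total each vertex is removed
once. -/
theorem buildOrd_spec {K n k D : ℕ} {A : ℕ → List ℕ} (hA : AdjLists n A) (hnK : n + 1 < K)
    (hD0 : (if k < 3 then n else 0) ≤ D) (hDn : D ≤ n)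
    (hdeg : ∀ d, (if k < 3 then n else 0) ≤ d → ∀ U ⊆ Finset.range n, U.Nonempty →
      (∀ v ∈ U, d < (A v).countP (fun w => w ∈ U)) → d < D)
    {s : Store} (h0 : s.var 0 = n) (h2 : s.var 2 = k)
    (hrd : ∀ u < n, rd (s.arr 6) (s.arr 7) n u = A u)
    (h8 : ∀ v < n, s.arr 8 v = (A v).length) (h9 : ∀ v, s.arr 9 v = 0) {r : ℤ}
    (hr : (((D - (if k < 3 then n else 0) + 1) * (38 * n + 40) +
      ∑ v ∈ Finset.range n, (70 * (A v).length + 50) + 30 : ℕ) : ℤ) ≤ r) :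
    WP K buildOrd s r fun s' r' =>
      r - (((D - (if k < 3 then n else 0) + 1) * (38 * n + 40) +
        ∑ v ∈ Finset.range n, (70 * (A v).length + 50) + 30 : ℕ) : ℤ) ≤ r' ∧
      PartialOrd n A D (s'.arr 10) (s'.arr 9) n := by
  set d0 := if k < 3 then n else 0 with hd0
  have hdc : drainCost n A (s.arr 9) 0 = ∑ v ∈ Finset.range n, (70 * (A v).length + 50) :=
    Finset.sum_congr rfl fun v _ => by simp [Unproc, h9]
  set F := ∑ v ∈ Finset.range n, (70 * (A v).length + 50) with hF
  have main : ∀ s1 : Store, s1.arr = s.arr → s1.var 0 = n → s1.var 4 = d0 → s1.var 5 = 0 →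
      s1.var 6 = 0 → ∀ r1 : ℤ, r - 20 ≤ r1 →
      WP K peelOrd s1 r1
        fun s' r' => r - (((D - d0 + 1) * (38 * n + 40) + F + 30 : ℕ) : ℤ) ≤ r' ∧
          PartialOrd n A D (s'.arr 10) (s'.arr 9) n := by
    intro s1 e1 v0 v4 v5 v6 r1 hr1
    -- In the invariant, `D + 1 - d` phases are left, and the queue has been emptied.
    refine WP.loop (fun s' r' => ∃ d tl, s'.var 4 = d ∧ s'.var 5 = tl ∧ s'.var 6 = tl ∧ d0 ≤ d ∧
      (tl < n → d ≤ D) ∧ PartialOrd n A D (s'.arr 10) (s'.arr 9) tl ∧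
      (∀ v < n, s'.arr 8 v = (A v).countP (fun w => Unproc (s'.arr 9) tl w)) ∧
      r - (((D - d0 + 1) * (38 * n + 40) + F + 30 : ℕ) : ℤ) +
        (((D + 1 - d) * (38 * n + 40) + drainCost n A (s'.arr 9) tl + 10 : ℕ) : ℤ) ≤ r')
      ⟨d0, 0, v4, v5, v6, le_rfl, fun _ => hD0, ?_, ?_, ?_⟩ ?_
    · rw [e1]
      exact ⟨by omega, fun v _ h => absurd (h9 v) h, fun v _ h => absurd (h9 v) h⟩
    · intro v hv
      rw [e1, h8 v hv, eq_comm, List.countP_eq_length]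
      simp [Unproc, h9]
    · rw [e1, hdc, show D + 1 - d0 = D - d0 + 1 by omega]
      push_cast; omega
    · rintro s' r' hS ⟨d, tl, w4, w5, w6, hd, hdD, hO, hdg, hr'⟩
      have w0 : s'.var 0 = n := (hS.1 0 (by decide)).trans v0
      have hcst : (0 : ℤ) ≤ (((D + 1 - d) * (38 * n + 40) + drainCost n A (s'.arr 9) tl + 10 : ℕ) : ℤ) :=
        by positivity
      refine ⟨by omega, ?_, ?_⟩
      · intro he
        simp only [Expr.eval, Op.apply, ite_one_zero_eq, w5, w0] at he
        obtain rfl : tl = n := le_antisymm hO.le (by omega)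
        generalize (D + 1 - d) * (38 * tl + 40) = X at hr'
        exact ⟨by simp only [Expr.cost]; omega, hO⟩
      · intro he
        simp only [Expr.eval, Op.apply, ite_one_zero_ne, w5, w0] at he
        specialize hdD he
        obtain ⟨q, hq⟩ : ∃ q, D + 1 - d = q + 1 := ⟨D - d, by omega⟩
        have hq' : D + 1 - (d + 1) = q := by omega
        rw [hq] at hr' hcst
        have hnn : (0 : ℤ) ≤ (q * (38 * n + 40) + drainCost n A (s'.arr 9) tl : ℕ) := by positivity
        have hrT := hr
        have hqn : (0 : ℤ) ≤ (q : ℤ) * (38 * n + 40) := by positivity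
        push_cast at hr' hnn hrT
        simp only [WP, Expr.cost]
        refine (scanOrd_spec hA hnK hO w0 w4 w5 le_rfl hdD hdg (by push_cast; linarith)).conseq ?_
        rintro s2 r2 ⟨hr2, ⟨tl2, x5, htl2, hO2⟩, hU2, hbig⟩ hS2
        have x8 : s2.arr 8 = s'.arr 8 := hS2.2 8 (by decide)
        have hS2' := hS.trans (hS2.mono (by decide) (by decide))
        have x6 : s2.arr 6 = s.arr 6 := (hS2'.2 6 (by decide)).trans (by rw [e1])
        have x7 : s2.arr 7 = s.arr 7 := (hS2'.2 7 (by decide)).trans (by rw [e1])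
        have hdc2 := drainCost_congr (n := n) (A := A) hU2
        refine (drainOrd_spec (d := d) (h := tl) hA hnK hO2 ((hS2'.1 0 (by decide)).trans v0)
          ((hS2.1 4 (by decide)).trans w4) x5 ((hS2.1 6 (by decide)).trans w6) htl2 hdD
          (by rw [x6, x7]; exact hrd) (fun v hv => by rw [x8, hdg v hv]; simp only [hU2])
          (fun v hv => by rw [x8]; exact hbig v hv) ?_).conseq ?_
        · rw [hdc2]; push_cast at hr2; linarith
        · rintro s3 r3 ⟨hr3, tl3, y5, y6, hO3, hdg3, hbig3⟩ hS3
          have y4 : s3.var 4 = d := (hS3.1 4 (by decide)).trans ((hS2.1 4 (by decide)).trans w4)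
          simp only [Expr.eval, Expr.Small, Op.apply, y4, Store.var_setVar, Store.arr_setVar]
          refine ⟨by omega, d + 1, tl3, rfl, y5, y6, by omega, fun htl3 => ?_, hO3, hdg3, ?_⟩
          · obtain ⟨v, hv, hvp⟩ : ∃ v < n, s3.arr 9 v = 0 := by
              by_contra! hcon
              have h1 := Finset.card_le_card_of_injOn (s := Finset.range n)
                (t := Finset.range tl3) (fun v => s3.arr 9 v - 1)
                (fun v hv => by
                  have hv : v < n := by simpa using hv
                  have h2 := (hO3.ord_pos v hv (hcon v hv)).1
                  have h3 := hcon v hv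
                  simp; omega)
                (fun v hv w hw hvw => by
                  have hv : v < n := by simpa using hv
                  have hw : w < n := by simpa using hw
                  rw [← (hO3.ord_pos v hv (hcon v hv)).2, ← (hO3.ord_pos w hw (hcon w hw)).2]
                  exact congrArg _ hvw)
              simp only [Finset.card_range] at h1
              omega
            refine hdeg d hd ((Finset.range n).filter fun w => s3.arr 9 w = 0)
              (Finset.filter_subset _ _) ⟨v, by simp [hv, hvp]⟩ fun w hw => ?_
            simp only [Finset.mem_filter, Finset.mem_range] at hw
            rw [← countP_mem_eq hA (tl := tl3) ?_ hw.1, ← hdg3 w hw.1]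
            · exact hbig3 w hw.1 hw.2
            · intro u hu
              by_cases hu0 : s3.arr 9 u = 0
              · omega
              · exact (hO3.ord_pos u hu hu0).1
          · rw [hq', ← y6]
            rw [hdc2] at hr3
            push_cast at hr2 ⊢
            linarith
  simp only [buildOrd, WP, Expr.Small, Expr.eval, Expr.cost, Op.apply, true_and, ite_one_zero_ne,
    ite_one_zero_eq, h2]
  constructor
  · intro hk
    refine main _ ?_ ?_ ?_ ?_ ?_ _ ?_ <;>
      simp [Store.var_setVar, Store.arr_setVar, h0, hd0, hk]
    omega
  · intro hk
    refine main _ ?_ ?_ ?_ ?_ ?_ _ ?_ <;>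
      simp [Store.var_setVar, Store.arr_setVar, h0, hd0, hk]
    omega


/-! ### Later neighbours -/

/-- The later neighbours of `u` among the first `i` vertices of the order, in this order. -/
def outL (A : ℕ → List ℕ) (ord pos : ℕ → ℕ) (i u : ℕ) : List ℕ :=
  ((List.range i).map ord).filter fun x => u ∈ A x ∧ pos u < pos x

/-- The loop body of `buildOut` for the scalar `5`: append this vertex to the lists of its earlier
neighbours. -/
def addOut : Cmd :=
  forUp 6 7 (
    8 ≔ .get 6 (.var 5 *ₑ .var 0 +ₑ .var 6) ;;
    .ite (.get 9 (.var 8) <ₑ .get 9 (.var 5))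
      (push 11 12 (.var 0) (.var 8) (.var 5) ;; .store 13 (.var 8 *ₑ .var 0 +ₑ .var 5) (.lit 1))
      .skip)

/-- Array `11`, with heights in array `12` and stride `n`, becomes the lists of later neighbours,
and array `13` the corresponding adjacency matrix. -/
def buildOut : Cmd :=
  4 ≔ .lit 0 ;;
  forUp 4 0 (5 ≔ .get 10 (.var 4) ;; 6 ≔ .lit 0 ;; 7 ≔ .get 7 (.var 5) ;; addOut)

theorem outL_succ {A : ℕ → List ℕ} {ord pos : ℕ → ℕ} {i u : ℕ} :
    outL A ord pos (i + 1) u = outL A ord pos i u ++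
      if u ∈ A (ord i) ∧ pos u < pos (ord i) then [ord i] else [] := by
  simp only [outL, List.range_succ, List.map_append, List.filter_append, List.map_cons,
    List.map_nil, List.filter_cons, List.filter_nil, decide_eq_true_eq]

theorem length_outL_le {A : ℕ → List ℕ} {ord pos : ℕ → ℕ} {i u : ℕ} :
    (outL A ord pos i u).length ≤ i :=
  (List.length_filter_le _ _).trans (by simp)

theorem cell_inj {n u u' x x' : ℕ} (hx : x < n) (hx' : x' < n) :
    u * n + x = u' * n + x' ↔ u = u' ∧ x = x' := by
  constructor
  · intro h
    have h1 : u = u' := by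
      by_contra hne
      exact cell_ne hne hx' hx h
    subst h1
    exact ⟨rfl, by omega⟩
  · rintro ⟨rfl, rfl⟩; rfl

theorem addOut_spec {K n i : ℕ} {A : ℕ → List ℕ} (hA : AdjLists n A) (hnK : n + 1 < K)
    {ord pos : ℕ → ℕ} {x : ℕ} (hi : i < n) (hxn : x < n) (hxi : ord i = x) (hxp : pos x = i + 1)
    {s : Store} (h9 : s.arr 9 = pos) (h5 : s.var 5 = x) (h0 : s.var 0 = n) (h6 : s.var 6 = 0)
    (h7 : s.var 7 = (A x).length)
    (hrd : ∀ u < n, rd (s.arr 6) (s.arr 7) n u = A u)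
    (hout : ∀ u < n, rd (s.arr 11) (s.arr 12) n u = outL A ord pos i u)
    (hmat : ∀ u < n, ∀ y < n, s.arr 13 (u * n + y) ≠ 0 ↔ u ∈ A y ∧ pos u < pos y ∧ pos y ≤ i)
    {r : ℤ} (hr : 60 * ((A x).length : ℤ) + 4 ≤ r) :
    WP K addOut s r fun s' r' => r - (60 * ((A x).length : ℤ) + 4) ≤ r' ∧
      (∀ u < n, rd (s'.arr 11) (s'.arr 12) n u = outL A ord pos (i + 1) u) ∧
      (∀ u < n, ∀ y < n, s'.arr 13 (u * n + y) ≠ 0 ↔ u ∈ A y ∧ pos u < pos y ∧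
        (pos y ≤ i ∨ y = x)) := by
  have hlenn := hA.length_le hxn
  refine WP.forUp_sum (A x).length 0 (fun j s' =>
      (∀ u < n, rd (s'.arr 11) (s'.arr 12) n u = outL A ord pos i u ++
        if u ∈ (A x).take j ∧ pos u < pos x then [x] else []) ∧
      (∀ u < n, ∀ y < n, s'.arr 13 (u * n + y) ≠ 0 ↔
        (u ∈ A y ∧ pos u < pos y ∧ pos y ≤ i) ∨ (y = x ∧ u ∈ (A x).take j ∧ pos u < pos x)))
      (fun _ => 50) (by omega) (Nat.zero_le _) h6 h7 (by decide) (by decide) (by decide) ?_ ?_ ?_ ?_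
  · simpa using ⟨hout, hmat⟩
  · simp; omega
  · rintro j s' r' _ hj hx6 hS ⟨ho, hm⟩ hr'
    have e6 : s'.arr 6 = s.arr 6 := hS.2 6 (by decide)
    have e9 : s'.arr 9 = pos := (hS.2 9 (by decide)).trans h9
    have v0 : s'.var 0 = n := (hS.1 0 (by decide)).trans h0
    have v5 : s'.var 5 = x := (hS.1 5 (by decide)).trans h5
    have hy : s.arr 6 (x * n + j) = (A x)[j] := by
      simp only [← hrd x hxn]
      rw [getElem_rd]
    set y := (A x)[j] with hydef
    have hyA : y ∈ A x := List.getElem_mem _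
    have hyn : y < n := hA.lt x hxn y hyA
    have htake : (A x).take (j + 1) = (A x).take j ++ [y] := List.take_succ_eq_append_getElem hj
    have hnd : y ∉ (A x).take j := by
      have := (hA.nodup x hxn).sublist (List.take_sublist (j + 1) (A x))
      rw [htake, List.nodup_append] at this
      intro h
      exact this.2.2 y h y (by simp) rfl
    have hlen : ∀ u < n, s'.arr 12 u ≤ n := fun u hu => by
      have h1 := congrArg List.length (ho u hu)
      have h2 := @length_outL_le A ord pos i u
      simp only [length_rd, List.length_append] at h1
      split at h1 <;> simp at h1 <;> omega
    have hleny : s'.arr 12 y < n := by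
      have h1 := congrArg List.length (ho y hyn)
      have h2 := @length_outL_le A ord pos i y
      simp [hnd] at h1
      omega
    simp only [push, WP, Expr.Small, Expr.eval, Expr.cost, Op.apply, true_and, Store.var_setVar,
      Store.arr_setVar, Store.var_setArr, Store.arr_setArr, Nat.reduceEqDiff, if_true, if_false,
      e6, e9, v5, v0, hx6, hy, ite_one_zero_ne, ite_one_zero_eq]
    constructor
    · intro hlt
      refine ⟨by omega, by push_cast; omega, fun u hu => ?_, fun u hu z hz => ?_⟩
      · rw [rd_push hleny (hlen u hu), htake]
        by_cases huy : u = y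
        · subst huy
          rw [if_pos rfl, ho _ hu, if_neg (fun h => hnd h.1), if_pos ⟨by simp, hlt⟩]; simp
        · rw [if_neg huy, ho u hu]
          simp [huy]
      · rw [Function.update_apply]
        split
        · rename_i heq
          obtain ⟨rfl, rfl⟩ := (cell_inj hz hxn).1 heq
          simp [htake, hlt]
        · rename_i hne
          rw [hm u hu z hz, htake]
          have : ¬ (u = y ∧ z = x) := fun h => hne (by rw [h.1, h.2])
          simp only [List.mem_append, List.mem_singleton]
          tauto
    · intro hlt
      refine ⟨by push_cast; omega, fun u hu => ?_, fun u hu z hz => ?_⟩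
      · rw [ho u hu, htake]
        congr 1
        by_cases huy : u = y
        · subst huy; simp [hlt]
        · simp [huy]
      · rw [hm u hu z hz, htake]
        by_cases huy : u = y
        · subst huy; simp [hlt]
        · simp [huy]
  · rintro s' r' hrr _ _ ⟨ho, hm⟩
    simp only [Finset.sum_const, Nat.card_Ico, nsmul_eq_mul] at hrr
    refine ⟨by push_cast at hrr; omega, fun u hu => ?_, fun u hu y hy => ?_⟩
    · rw [ho u hu, outL_succ, hxi, List.take_length]
    · rw [hm u hu y hy, List.take_length]
      constructor
      · rintro (h | ⟨rfl, h⟩)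
        · exact ⟨h.1, h.2.1, .inl h.2.2⟩
        · exact ⟨h.1, h.2, .inr rfl⟩
      · rintro ⟨h1, h2, h3 | rfl⟩
        · exact .inl ⟨h1, h2, h3⟩
        · exact .inr ⟨rfl, h1, h2⟩

theorem PartialOrd.sum_ord {n : ℕ} {A : ℕ → List ℕ} {D : ℕ} {ord pos : ℕ → ℕ}
    (h : PartialOrd n A D ord pos n) {M : Type*} [AddCommMonoid M] (f : ℕ → M) :
    ∑ i ∈ Finset.range n, f (ord i) = ∑ v ∈ Finset.range n, f v := by
  have hinj : Set.InjOn ord (Finset.range n) := fun i hi j hj hij => by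
    have h1 := (h.pos_ord i (by simpa using hi)).2
    have h2 := (h.pos_ord j (by simpa using hj)).2
    rw [hij] at h1; omega
  have himg : (Finset.range n).image ord = Finset.range n := by
    refine Finset.eq_of_subset_of_card_le (fun x hx => ?_) ?_
    · obtain ⟨i, hi, rfl⟩ := Finset.mem_image.1 hx
      simpa using (h.pos_ord i (by simpa using hi)).1
    · rw [Finset.card_image_of_injOn hinj]
  conv_rhs => rw [← himg]
  rw [Finset.sum_image hinj]

theorem PartialOrd.pos_ne_zero {n : ℕ} {A : ℕ → List ℕ} {D : ℕ} {ord pos : ℕ → ℕ}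
    (h : PartialOrd n A D ord pos n) {v : ℕ} (hv : v < n) : pos v ≠ 0 :=
  fun hp => lt_irrefl n (h.lt_of_new hv hp)

theorem buildOut_spec {K n D : ℕ} {A : ℕ → List ℕ} (hA : AdjLists n A) (hnK : n + 1 < K)
    {ord pos : ℕ → ℕ} (hO : PartialOrd n A D ord pos n)
    {s : Store} (h9 : s.arr 9 = pos) (h10 : s.arr 10 = ord) (h0 : s.var 0 = n)
    (hrd : ∀ u < n, rd (s.arr 6) (s.arr 7) n u = A u)
    (h12 : ∀ u, s.arr 12 u = 0) (h13 : ∀ u, s.arr 13 u = 0)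
    {r : ℤ} (hr : ((∑ v ∈ Finset.range n, (60 * (A v).length + 30) + 6 : ℕ) : ℤ) ≤ r) :
    WP K buildOut s r fun s' r' =>
      r - ((∑ v ∈ Finset.range n, (60 * (A v).length + 30) + 6 : ℕ) : ℤ) ≤ r' ∧
      (∀ u < n, rd (s'.arr 11) (s'.arr 12) n u = outL A ord pos n u) ∧
      (∀ u < n, ∀ y < n, s'.arr 13 (u * n + y) ≠ 0 ↔ u ∈ A y ∧ pos u < pos y) := by
  have hsum : ((∑ v ∈ Finset.range n, (60 * (A v).length + 30) : ℕ) : ℤ) =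
      ∑ i ∈ Finset.Ico 0 n, (((60 * (A (ord i)).length + 22 : ℕ) : ℤ) + 8) := by
    rw [Nat.Ico_zero_eq_range, ← hO.sum_ord]
    push_cast
    exact Finset.sum_congr rfl fun _ _ => by ring
  push_cast [-Nat.cast_sum] at hr ⊢
  rw [hsum] at hr ⊢
  simp only [buildOut, WP, Expr.Small, Expr.eval, Expr.cost, true_and]
  refine WP.forUp_sum n 0 (fun i s' =>
      (∀ u < n, rd (s'.arr 11) (s'.arr 12) n u = outL A ord pos i u) ∧
      (∀ u < n, ∀ y < n, s'.arr 13 (u * n + y) ≠ 0 ↔ u ∈ A y ∧ pos u < pos y ∧ pos y ≤ i))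
      (fun i => 60 * (A (ord i)).length + 22) (by omega) (Nat.zero_le _) (by simp [Store.var_setVar])
      (by simp [Store.var_setVar, h0]) (by decide) (by decide) (by decide) ?_ ?_ ?_ ?_
  · refine ⟨fun u hu => by simp [Store.arr_setVar, rd, h12, outL], fun u hu y hy => ?_⟩
    have := hO.pos_ne_zero hy
    simp [Store.arr_setVar, h13]; omega
  · push_cast at hr ⊢; omega
  · rintro i s' r' _ hi hx4 hS ⟨ho, hm⟩ hr'
    obtain ⟨h1, h2⟩ := hO.pos_ord i hi
    have e6 : s'.arr 6 = s.arr 6 := (hS.2 6 (by decide))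
    have e7 : s'.arr 7 = s.arr 7 := (hS.2 7 (by decide))
    have e9 : s'.arr 9 = pos := (hS.2 9 (by decide)).trans h9
    have e10 : s'.arr 10 = ord := (hS.2 10 (by decide)).trans h10
    have v0 : s'.var 0 = n := (hS.1 0 (by decide)).trans (by simp [Store.var_setVar, h0])
    have hlenx : s.arr 7 (ord i) = (A (ord i)).length := by rw [← hrd _ h1]; simp
    simp only [WP, Expr.Small, Expr.eval, Expr.cost, true_and, Store.var_setVar, Store.arr_setVar,
      Nat.reduceEqDiff, if_true, if_false, e7, e10, hx4, hlenx]
    refine (addOut_spec (i := i) hA hnK hi h1 rfl h2 (by simp [Store.arr_setVar, e9])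
      (by simp [Store.var_setVar]) (by simp [Store.var_setVar, v0]) (by simp [Store.var_setVar])
      (by simp [Store.var_setVar]) (by simpa [Store.arr_setVar, e6, e7] using hrd)
      (by simpa [Store.arr_setVar] using ho) (by simpa [Store.arr_setVar] using hm)
      (by push_cast at hr' ⊢; omega)).mono ?_
    rintro s'' r'' ⟨g1, g2, g3⟩
    refine ⟨by push_cast at g1 ⊢; omega, g2, fun u hu y hy => (g3 u hu y hy).trans ?_⟩
    refine and_congr_right fun _ => and_congr_right fun _ => ?_
    constructor
    · rintro (h | rfl)
      · omega
      · omega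
    · intro h
      by_cases hp : pos y ≤ i
      · exact .inl hp
      · right
        rw [← (hO.ord_pos y hy (hO.pos_ne_zero hy)).2]
        congr 1; omega
  · rintro s' r' hrr _ _ ⟨ho, hm⟩
    refine ⟨by push_cast at hrr ⊢; omega, ho, fun u hu y hy => (hm u hu y hy).trans ?_⟩
    have := (hO.ord_pos y hy (hO.pos_ne_zero hy)).1
    tauto


/-! ### Listing the cliques by depth-first search -/

/-- All extensions of the list `pre` by `f` elements of `C`, each of which is related by `T` to all
those that follow it. -/
def ext (T : ℕ → ℕ → Bool) : ℕ → List ℕ → List ℕ → List (List ℕ)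
  | 0, pre, _ => [pre]
  | f + 1, pre, C => C.flatMap fun w => ext T f (pre ++ [w]) (C.filter (T w))

/-- The first `l` entries of `cho`. -/
def chosen (cho : ℕ → ℕ) (l : ℕ) : List ℕ := (List.range l).map cho

/-- The cliques that a depth-first search still has to list at levels `1, …, l`, where level `l` has
the candidates `C l`, of which the first `idx l` are done. -/
def rest (T : ℕ → ℕ → Bool) (k : ℕ) (C : ℕ → List ℕ) (idx cho : ℕ → ℕ) : ℕ → List (List ℕ)
  | 0 => []
  | l + 1 => ((C (l + 1)).drop (idx (l + 1))).flatMap (fun w =>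
      ext T (k - 1 - (l + 1)) (chosen cho (l + 1) ++ [w]) ((C (l + 1)).filter (T w))) ++
      rest T k C idx cho l

/-- A bound for the time to list all extensions by `f` elements. -/
def extCost (T : ℕ → ℕ → Bool) (k : ℕ) : ℕ → List ℕ → ℕ
  | 0, _ => 30 * k + 70
  | f + 1, C => (C.map fun w => (if f = 0 then 0 else 50 * C.length + 80) +
      extCost T k f (C.filter (T w))).sum + 20

/-- A bound for the time that is needed for `rest`. -/
def restCost (T : ℕ → ℕ → Bool) (k : ℕ) (C : ℕ → List ℕ) (idx : ℕ → ℕ) : ℕ → ℕ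
  | 0 => 0
  | l + 1 => (((C (l + 1)).drop (idx (l + 1))).map fun w =>
      (if k - 1 - (l + 1) = 0 then 0 else 50 * (C (l + 1)).length + 80) +
      extCost T k (k - 1 - (l + 1)) ((C (l + 1)).filter (T w))).sum + 20 + restCost T k C idx l

/-- The first `N` blocks of length `k` of an array. -/
def blocks (a : ℕ → ℕ) (k N : ℕ) : List (List ℕ) :=
  (List.range N).map fun j => (List.range k).map fun i => a (k * j + i)

section

variable {T : ℕ → ℕ → Bool} {k : ℕ} {C C' : ℕ → List ℕ} {idx idx' cho cho' : ℕ → ℕ}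

theorem chosen_congr {l : ℕ} (h : ∀ i < l, cho' i = cho i) : chosen cho' l = chosen cho l :=
  List.map_congr_left fun i hi => h i (List.mem_range.1 hi)

theorem chosen_succ {l : ℕ} : chosen cho (l + 1) = chosen cho l ++ [cho l] := by
  simp [chosen, List.range_succ]

theorem rest_congr {l : ℕ} (hC : ∀ j, 1 ≤ j → j ≤ l → C' j = C j) (hi : ∀ j, j ≤ l → idx' j = idx j)
    (hc : ∀ i < l, cho' i = cho i) : rest T k C' idx' cho' l = rest T k C idx cho l := by
  induction l with
  | zero => rfl
  | succ l ih =>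
    simp only [rest]
    rw [ih (fun j h0 hj => hC j h0 (by omega)) (fun j hj => hi j (by omega)) (fun i h => hc i (by omega)),
      hC _ (by omega) le_rfl, hi _ le_rfl, chosen_congr hc]

theorem restCost_congr {l : ℕ} (hC : ∀ j, 1 ≤ j → j ≤ l → C' j = C j) (hi : ∀ j, j ≤ l → idx' j = idx j) :
    restCost T k C' idx' l = restCost T k C idx l := by
  induction l with
  | zero => rfl
  | succ l ih =>
    simp only [restCost]
    rw [ih (fun j h0 hj => hC j h0 (by omega)) (fun j hj => hi j (by omega)), hC _ (by omega) le_rfl, hi _ le_rfl]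

/-- Dropping a finished level. -/
theorem rest_pop {l : ℕ} (h : (C (l + 1)).length ≤ idx (l + 1)) :
    rest T k C idx cho (l + 1) = rest T k C idx cho l := by
  simp [rest, List.drop_of_length_le h]

theorem restCost_pop {l : ℕ} (h : (C (l + 1)).length ≤ idx (l + 1)) :
    restCost T k C idx (l + 1) = 20 + restCost T k C idx l := by
  simp [restCost, List.drop_of_length_le h]

/-- Splitting off the next candidate of the current level. -/
theorem rest_next {l w : ℕ} (h : idx (l + 1) < (C (l + 1)).length)
    (hw : (C (l + 1))[idx (l + 1)] = w) :
    rest T k C idx cho (l + 1) =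
      ext T (k - 1 - (l + 1)) (chosen cho (l + 1) ++ [w]) ((C (l + 1)).filter (T w)) ++
      rest T k C (Function.update idx (l + 1) (idx (l + 1) + 1)) cho (l + 1) := by
  conv_lhs => rw [rest, List.drop_eq_getElem_cons h, hw]
  rw [List.flatMap_cons, rest, Function.update_self, List.append_assoc,
    rest_congr (C' := C) (idx' := Function.update idx (l + 1) (idx (l + 1) + 1)) (cho' := cho)
      (fun _ _ _ => rfl) (fun j hj => Function.update_of_ne (by omega) ..) (fun _ _ => rfl)]

theorem restCost_next {l w : ℕ} (h : idx (l + 1) < (C (l + 1)).length)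
    (hw : (C (l + 1))[idx (l + 1)] = w) :
    restCost T k C idx (l + 1) =
      (if k - 1 - (l + 1) = 0 then 0 else 50 * (C (l + 1)).length + 80) +
      extCost T k (k - 1 - (l + 1)) ((C (l + 1)).filter (T w)) +
      restCost T k C (Function.update idx (l + 1) (idx (l + 1) + 1)) (l + 1) := by
  conv_lhs => rw [restCost, List.drop_eq_getElem_cons h, hw]
  rw [List.map_cons, List.sum_cons, restCost, Function.update_self,
    restCost_congr (C' := C) (idx' := Function.update idx (l + 1) (idx (l + 1) + 1))
      (fun _ _ _ => rfl) (fun j hj => Function.update_of_ne (by omega) ..)]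
  ring

/-- Opening a new level. -/
theorem rest_open {l w : ℕ} (hl : l + 1 ≤ k - 1) (hcho : cho l = w) (hidx : idx (l + 1) = 0) :
    rest T k C idx cho (l + 1) =
      ext T (k - 1 - l) (chosen cho l ++ [w]) (C (l + 1)) ++ rest T k C idx cho l := by
  obtain ⟨f, hf⟩ : ∃ f, k - 1 - l = f + 1 := ⟨k - 1 - l - 1, by omega⟩
  rw [rest, hf, ext, hidx, List.drop_zero, show k - 1 - (l + 1) = f by omega, chosen_succ, hcho]

end

theorem blocks_succ {a : ℕ → ℕ} {k N : ℕ} :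
    blocks a k (N + 1) = blocks a k N ++ [(List.range k).map fun i => a (k * N + i)] := by
  simp [blocks, List.range_succ]

theorem blocks_congr {a a' : ℕ → ℕ} {k N : ℕ} (h : ∀ p < k * N, a' p = a p) :
    blocks a' k N = blocks a k N := by
  refine List.map_congr_left fun j hj => List.map_congr_left fun i hi => h _ ?_
  rw [List.mem_range] at hi hj
  calc k * j + i < k * j + k := by omega
    _ = k * (j + 1) := by ring
    _ ≤ k * N := Nat.mul_le_mul_left k hj

@[simp] theorem length_blocks {a : ℕ → ℕ} {k N : ℕ} : (blocks a k N).length = N := by simp [blocks]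

/-- Output the chosen vertices as a new block of array `2`. -/
def outBlock : Cmd :=
  8 ≔ .lit 0 ;; forUp 8 2 (.store 2 (.var 4) (.get 17 (.var 8)) ;; 4 ≔ .var 4 +ₑ .lit 1) ;;
  3 ≔ .var 3 +ₑ .lit 1

/-- The candidates of the next level are those of this level that are later neighbours of the vertex
in the scalar `7`. -/
def filterCand : Cmd :=
  .store 15 (.var 6 +ₑ .lit 1) (.lit 0) ;; 8 ≔ .lit 0 ;; 9 ≔ .get 15 (.var 6) ;;
  forUp 8 9 (
    10 ≔ .get 14 (.var 6 *ₑ .var 0 +ₑ .var 8) ;;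
    .ite (.get 13 (.var 7 *ₑ .var 0 +ₑ .var 10))
      (push 14 15 (.var 0) (.var 6 +ₑ .lit 1) (.var 10)) .skip)

/-- The depth-first search; the scalar `6` is the current level, array `14` contains the candidates
of each level, array `16` how many of them are done, array `17` the chosen vertices. -/
def dfsLoop : Cmd :=
  .loop (.var 6) (
    .ite (.get 16 (.var 6) <ₑ .get 15 (.var 6))
      (7 ≔ .get 14 (.var 6 *ₑ .var 0 +ₑ .get 16 (.var 6)) ;;
       .store 16 (.var 6) (.get 16 (.var 6) +ₑ .lit 1) ;;
       .store 17 (.var 6) (.var 7) ;;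
       .ite (.var 6 +ₑ .lit 1 =ₑ .var 2) outBlock
         (filterCand ;; 6 ≔ .var 6 +ₑ .lit 1 ;; .store 16 (.var 6) (.lit 0)))
      (6 ≔ .var 6 -ₑ .lit 1))

/-- The candidates of the first level are the later neighbours of the vertex in the scalar `5`. -/
def copyOut : Cmd :=
  .store 15 (.lit 1) (.lit 0) ;; 8 ≔ .lit 0 ;; 9 ≔ .get 12 (.var 5) ;;
  forUp 8 9 (push 14 15 (.var 0) (.lit 1) (.get 11 (.var 5 *ₑ .var 0 +ₑ .var 8)))

/-- Array `2` becomes the list of all cliques, with their number in the scalar `3`. -/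
def listCliques : Cmd :=
  3 ≔ .lit 0 ;; 4 ≔ .lit 0 ;; 5 ≔ .lit 0 ;;
  forUp 5 0 (
    .store 17 (.lit 0) (.var 5) ;; copyOut ;; .store 16 (.lit 1) (.lit 0) ;; 6 ≔ .lit 1 ;; dfsLoop)

theorem outBlock_spec {K k N : ℕ} {s : Store} (h2 : s.var 2 = k) (h3 : s.var 3 = N)
    (h4 : s.var 4 = k * N) (hK : k * (N + 1) < K) (hNK : N + 1 < K) (hkK : k < K) {r : ℤ}
    (hr : 17 * (k : ℤ) + 10 ≤ r) :
    WP K outBlock s r fun s' r' => r - (17 * (k : ℤ) + 10) ≤ r' ∧ s'.var 3 = N + 1 ∧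
      s'.var 4 = k * (N + 1) ∧ blocks (s'.arr 2) k (N + 1) = blocks (s.arr 2) k N ++
        [chosen (s.arr 17) k] := by
  simp only [outBlock, WP, Expr.Small, Expr.eval, Expr.cost, true_and, Op.apply]
  refine WP.forUp_sum k 0 (fun i s' => s'.var 4 = k * N + i ∧ (∀ p < k * N, s'.arr 2 p = s.arr 2 p) ∧
      ∀ j < i, s'.arr 2 (k * N + j) = s.arr 17 j)
      (fun i => 9) hkK (Nat.zero_le _) (by simp [Store.var_setVar])
      (by simp [Store.var_setVar, h2]) (by decide) (by decide) (by decide) ?_ ?_ ?_ ?_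
  · simp [Store.var_setVar, Store.arr_setVar, h4]
  · simp; omega
  · rintro i s' r' _ hi hx hS ⟨h41, ho, hn⟩ hr'
    have e17 : s'.arr 17 = s.arr 17 := hS.2 17 (by decide)
    simp only [WP, Expr.Small, Expr.eval, Expr.cost, Op.apply, true_and, Store.var_setVar,
      Store.arr_setVar, Store.var_setArr, Store.arr_setArr, Nat.reduceEqDiff, if_true, if_false,
      h41, hx, e17]
    have : k * (N + 1) = k * N + k := by ring
    refine ⟨by omega, by push_cast; omega, by omega, fun p hp => ?_, fun j hj => ?_⟩
    · rw [Function.update_of_ne (by omega), ho p hp]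
    · rcases Nat.lt_succ_iff_lt_or_eq.1 hj with hj | rfl
      · rw [Function.update_of_ne (by omega), hn j hj]
      · rw [Function.update_self]
  · rintro s' r' hrr _ hS ⟨h41, ho, hn⟩
    simp only [Finset.sum_const, Nat.card_Ico, nsmul_eq_mul] at hrr
    have v3 : s'.var 3 = N := (hS.1 3 (by decide)).trans (by simp [Store.var_setVar, h3])
    simp only [v3, Store.var_setVar, Nat.reduceEqDiff, if_true, if_false, Store.arr_setVar]
    refine ⟨hNK, by push_cast at hrr ⊢; omega, trivial, by rw [h41]; ring, ?_⟩
    rw [blocks_succ, blocks_congr ho, chosen]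
    congr 2
    exact List.map_congr_left fun i hi => hn i (List.mem_range.1 hi)

theorem filterCand_spec {K n l w : ℕ} (hnK : n + 1 < K) {s : Store} (h0 : s.var 0 = n)
    (h6 : s.var 6 = l) (h7 : s.var 7 = w) (h15 : s.arr 15 l ≤ n) {r : ℤ}
    (hr : 50 * (s.arr 15 l : ℤ) + 20 ≤ r) :
    WP K filterCand s r fun s' r' => r - (50 * (s.arr 15 l : ℤ) + 20) ≤ r' ∧
      rd (s'.arr 14) (s'.arr 15) n (l + 1) = (rd (s.arr 14) (s.arr 15) n l).filter
        (fun x => s.arr 13 (w * n + x) ≠ 0) ∧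
      ∀ j ≤ l, s'.arr 15 j = s.arr 15 j ∧ (s.arr 15 j ≤ n →
        rd (s'.arr 14) (s'.arr 15) n j = rd (s.arr 14) (s.arr 15) n j) := by
  simp only [filterCand, WP, Expr.Small, Expr.eval, Expr.cost, true_and, Op.apply, h6]
  set C := rd (s.arr 14) (s.arr 15) n l with hC
  have hCl : C.length = s.arr 15 l := by simp [C]
  refine WP.forUp_sum (s.arr 15 l) 0 (fun i s' =>
      rd (s'.arr 14) (s'.arr 15) n (l + 1) = (C.take i).filter
        (fun x => s.arr 13 (w * n + x) ≠ 0) ∧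
      ∀ j ≤ l, s'.arr 15 j = s.arr 15 j ∧ (s.arr 15 j ≤ n →
        rd (s'.arr 14) (s'.arr 15) n j = rd (s.arr 14) (s.arr 15) n j))
      (fun i => 38) (by omega) (Nat.zero_le _) (by simp [Store.var_setVar])
      ?_ (by decide) (by decide) (by decide) ?_ ?_ ?_ ?_
  · simp [Store.var_setVar, Store.arr_setArr, Store.var_setArr, Store.arr_setVar, h6]
  · refine ⟨by simp [Store.arr_setArr, Store.arr_setVar, rd], fun j hj => ?_⟩
    have : j ≠ l + 1 := by omega
    simp [Store.arr_setArr, Store.arr_setVar, this, rd]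
  · simp; omega
  · rintro i s' r' _ hi hx hS ⟨ho, hn⟩ hr'
    have e13 : s'.arr 13 = s.arr 13 :=
      (hS.2 13 (by decide)).trans (by simp [Store.arr_setVar, Store.arr_setArr])
    have v0 : s'.var 0 = n :=
      (hS.1 0 (by decide)).trans (by simp [Store.var_setVar, Store.var_setArr, h0])
    have v6 : s'.var 6 = l :=
      (hS.1 6 (by decide)).trans (by simp [Store.var_setVar, Store.var_setArr, h6])
    have v7 : s'.var 7 = w :=
      (hS.1 7 (by decide)).trans (by simp [Store.var_setVar, Store.var_setArr, h7])
    have hi' : i < C.length := by omega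
    have hxv : s'.arr 14 (l * n + i) = C[i] := by
      have h1 := (hn l le_rfl).2 h15
      have h2 : i < (rd (s'.arr 14) (s'.arr 15) n l).length := by rw [h1]; exact hi'
      have h3 := getElem_rd h2
      rw [← h3]
      simp only [h1, hC]
    have hlen : s'.arr 15 (l + 1) ≤ i := by
      have h1 := congrArg List.length ho
      rw [length_rd] at h1
      rw [h1]
      exact (List.length_filter_le _ _).trans (by simp)
    have htake : C.take (i + 1) = C.take i ++ [C[i]] := List.take_succ_eq_append_getElem hi'
    simp only [push, WP, Expr.Small, Expr.eval, Expr.cost, Op.apply, true_and, Store.var_setVar,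
      Store.arr_setVar, Store.var_setArr, Store.arr_setArr, Nat.reduceEqDiff, if_true, if_false,
      hx, e13, v0, v6, v7, hxv]
    constructor
    · intro hne
      refine ⟨by omega, by push_cast; omega, ?_, fun j hj => ⟨?_, fun hjn => ?_⟩⟩
      · rw [rd_push (i' := l + 1) (by omega) (by omega), if_pos rfl, ho, htake, List.filter_append]
        simp [hne]
      · rw [Function.update_of_ne (by omega), (hn j hj).1]
      · rw [rd_push (by omega) (by rw [(hn j hj).1]; exact hjn), if_neg (by omega), (hn j hj).2 hjn]
    · intro he
      refine ⟨by push_cast; omega, ?_, hn⟩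
      rw [ho, htake, List.filter_append]
      simp [he]
  · rintro s' r' hrr _ hS ⟨ho, hn⟩
    simp only [Finset.sum_const, Nat.card_Ico, nsmul_eq_mul] at hrr
    refine ⟨by push_cast at hrr ⊢; omega, ?_, hn⟩
    rw [ho, List.take_of_length_le (by omega)]

theorem copyOut_spec {K n v : ℕ} (hnK : n + 1 < K) {s : Store} (h0 : s.var 0 = n)
    (h5 : s.var 5 = v) (h12 : s.arr 12 v ≤ n) {r : ℤ}
    (hr : 40 * (s.arr 12 v : ℤ) + 20 ≤ r) :
    WP K copyOut s r fun s' r' => r - (40 * (s.arr 12 v : ℤ) + 20) ≤ r' ∧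
      rd (s'.arr 14) (s'.arr 15) n 1 = rd (s.arr 11) (s.arr 12) n v := by
  simp only [copyOut, WP, Expr.Small, Expr.eval, Expr.cost, true_and]
  refine WP.forUp_sum (s.arr 12 v) 0 (fun i s' =>
      rd (s'.arr 14) (s'.arr 15) n 1 = (rd (s.arr 11) (s.arr 12) n v).take i)
      (fun i => 32) (by omega) (Nat.zero_le _) (by simp [Store.var_setVar])
      ?_ (by decide) (by decide) (by decide) ?_ ?_ ?_ ?_
  · simp [Store.var_setVar, Store.arr_setArr, Store.var_setArr, Store.arr_setVar, h5]
  · simp [Store.arr_setArr, Store.arr_setVar, rd]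
  · simp; omega
  · rintro i s' r' _ hi hx hS ho hr'
    have e11 : s'.arr 11 = s.arr 11 :=
      (hS.2 11 (by decide)).trans (by simp [Store.arr_setVar, Store.arr_setArr])
    have v0 : s'.var 0 = n :=
      (hS.1 0 (by decide)).trans (by simp [Store.var_setVar, Store.var_setArr, h0])
    have v5 : s'.var 5 = v :=
      (hS.1 5 (by decide)).trans (by simp [Store.var_setVar, Store.var_setArr, h5])
    have hi' : i < (rd (s.arr 11) (s.arr 12) n v).length := by simpa using hi
    have hlen : s'.arr 15 1 = i := by
      have h1 := congrArg List.length ho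
      simp only [length_rd, List.length_take] at h1
      omega
    simp only [push, WP, Expr.Small, Expr.eval, Expr.cost, Op.apply, true_and, Store.arr_setVar,
      Store.arr_setArr, Nat.reduceEqDiff, if_true, if_false, hx, e11, v0, v5]
    refine ⟨by omega, by push_cast; omega, ?_⟩
    rw [rd_push (by omega) (by omega), if_pos rfl, ho, List.take_succ_eq_append_getElem hi',
      getElem_rd]
  · rintro s' r' hrr _ hS ho
    simp only [Finset.sum_const, Nat.card_Ico, nsmul_eq_mul] at hrr
    refine ⟨by push_cast at hrr ⊢; omega, ?_⟩
    rw [ho, List.take_of_length_le (by simp)]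

/-- The loop invariant: the blocks written so far, followed by the cliques that the state of the
search still has to produce, are the list `out`. -/
theorem dfsLoop_spec {K n k N l₀ : ℕ} {T : ℕ → ℕ → Bool} {out : List (List ℕ)} (hnK : n + 1 < K)
    (hkK : k < K) {s : Store} (h0 : s.var 0 = n) (h2 : s.var 2 = k) (h3 : s.var 3 = N)
    (h4 : s.var 4 = k * N) (h6 : s.var 6 = l₀) (hlk : l₀ < k)
    (hT : ∀ w < n, ∀ x < n, T w x = (s.arr 13 (w * n + x) ≠ 0))
    (h15 : ∀ j, 1 ≤ j → j ≤ l₀ → s.arr 15 j ≤ n) (hCn : ∀ j, 1 ≤ j → j ≤ l₀ → ∀ x ∈ rd (s.arr 14) (s.arr 15) n j, x < n)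
    (hout : blocks (s.arr 2) k N ++
      rest T k (rd (s.arr 14) (s.arr 15) n) (s.arr 16) (s.arr 17) l₀ = out)
    (hoK : k * out.length < K) (hoK' : out.length < K) {r : ℤ}
    (hr : (restCost T k (rd (s.arr 14) (s.arr 15) n) (s.arr 16) l₀ : ℤ) + 2 ≤ r) :
    WP K dfsLoop s r fun s' r' =>
      r - ((restCost T k (rd (s.arr 14) (s.arr 15) n) (s.arr 16) l₀ : ℤ) + 2) ≤ r' ∧
      s'.var 3 = out.length ∧ s'.var 4 = k * out.length ∧ blocks (s'.arr 2) k out.length = out := by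
  refine WP.loop (fun s' r' => ∃ l N, s'.var 3 = N ∧ s'.var 4 = k * N ∧ s'.var 6 = l ∧ l < k ∧
    (∀ j, 1 ≤ j → j ≤ l → s'.arr 15 j ≤ n) ∧ (∀ j, 1 ≤ j → j ≤ l → ∀ x ∈ rd (s'.arr 14) (s'.arr 15) n j, x < n) ∧
    blocks (s'.arr 2) k N ++
      rest T k (rd (s'.arr 14) (s'.arr 15) n) (s'.arr 16) (s'.arr 17) l = out ∧
    r - (restCost T k (rd (s.arr 14) (s.arr 15) n) (s.arr 16) l₀ : ℤ) +
      restCost T k (rd (s'.arr 14) (s'.arr 15) n) (s'.arr 16) l ≤ r')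
    ⟨l₀, N, h3, h4, h6, hlk, h15, hCn, hout, by omega⟩ ?_
  rintro s' r' hS ⟨l', N', w3, w4, w6, hlk', w15, wCn, wout, hr'⟩
  have w0 : s'.var 0 = n := (hS.1 0 (by decide)).trans h0
  have w2 : s'.var 2 = k := (hS.1 2 (by decide)).trans h2
  have e13 : s'.arr 13 = s.arr 13 := hS.2 13 (by decide)
  refine ⟨by omega, ?_, ?_⟩
  · intro he
    simp only [Expr.eval, w6] at he
    subst he
    simp only [rest, restCost, List.append_nil] at wout hr'
    have hN : out.length = N' := by rw [← wout]; simp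
    rw [hN]
    exact ⟨by simp only [Expr.cost]; push_cast at hr' ⊢; omega, w3, w4, wout⟩
  intro he
  simp only [Expr.eval, w6] at he
  obtain ⟨q, rfl⟩ : ∃ q, l' = q + 1 := ⟨l' - 1, by omega⟩
  set C := rd (s'.arr 14) (s'.arr 15) n with hC
  have hlenC : ∀ j, (C j).length = s'.arr 15 j := fun j => by simp [C]
  have hNle : N' + (rest T k C (s'.arr 16) (s'.arr 17) (q + 1)).length = out.length := by
    rw [← wout]; simp
  have hidx : s'.arr 16 (q + 1) < s'.arr 15 (q + 1) → s'.arr 16 (q + 1) + 1 < K := fun h => by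
    have := w15 (q + 1) (by omega) le_rfl
    omega
  simp only [WP, Expr.Small, Expr.eval, Expr.cost, Op.apply, true_and, Store.var_setVar,
    Store.arr_setVar, Store.var_setArr, Store.arr_setArr, Nat.reduceEqDiff, if_true, if_false,
    w0, w2, w6, ite_one_zero_ne, ite_one_zero_eq]
  constructor
  · intro hlt
    have hlt' : s'.arr 16 (q + 1) < (C (q + 1)).length := by rw [hlenC]; exact hlt
    have hwv : s'.arr 14 ((q + 1) * n + s'.arr 16 (q + 1)) = (C (q + 1))[s'.arr 16 (q + 1)] :=
      (getElem_rd hlt').symm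
    rw [hwv]
    set w := (C (q + 1))[s'.arr 16 (q + 1)] with hw
    have hwn : w < n := wCn _ (by omega) le_rfl _ (List.getElem_mem hlt')
    have hnext := rest_next (T := T) (k := k) (cho := s'.arr 17) hlt' hw.symm
    have hcnext := restCost_next (T := T) (k := k) hlt' hw.symm
    refine ⟨hidx hlt, ?_, ?_⟩
    · intro hk
      rw [show k - 1 - (q + 1) = 0 by omega] at hnext hcnext
      simp only [ext, extCost, if_true] at hnext hcnext
      have hN1 : N' + 1 ≤ out.length := by
        rw [hnext] at hNle; simp at hNle; omega
      have hkN1 : k * (N' + 1) < K := (Nat.mul_le_mul_left k hN1).trans_lt hoK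
      refine (outBlock_spec (N := N') (k := k) (by simp [Store.var_setVar, Store.var_setArr, w2])
        (by simp [Store.var_setVar, Store.var_setArr, w3])
        (by simp [Store.var_setVar, Store.var_setArr, w4]) hkN1 (by omega) hkK
        (by push_cast; omega)).conseq ?_
      rintro s2 r2 ⟨g1, g2, g3, g4⟩ hS2
      have f14 := hS2.2 14 (by decide)
      have f15 := hS2.2 15 (by decide)
      have f16 := hS2.2 16 (by decide)
      have f17 := hS2.2 17 (by decide)
      have f6 := hS2.1 6 (by decide)
      simp only [Store.arr_setArr, Store.arr_setVar, Store.var_setVar, Store.var_setArr,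
        Nat.reduceEqDiff, if_true, if_false, w6] at f14 f15 f16 f17 f6 g4
      refine ⟨q + 1, N' + 1, g2, g3, f6, hlk', by rwa [f15], by rwa [f14, f15], ?_, ?_⟩
      · rw [g4, f14, f15, f16, f17, ← hC, ← wout, hnext, ← hk, chosen_succ, Function.update_self,
          chosen_congr (fun i hi => Function.update_of_ne (by omega) ..), List.append_assoc,
          rest_congr (C := C) (fun _ _ _ => rfl) (fun _ _ => rfl)
            (fun i hi => Function.update_of_ne (by omega) ..)]
      · rw [f14, f15, f16, ← hC]
        push_cast at g1 hr' hcnext ⊢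
        omega
    · intro hk
      rw [if_neg (by omega)] at hcnext
      refine (filterCand_spec (l := q + 1) (w := w) hnK
        (by simp [Store.var_setVar, Store.var_setArr, w0])
        (by simp [Store.var_setVar, Store.var_setArr, w6])
        (by simp [Store.var_setVar, Store.var_setArr])
        (by simpa [Store.arr_setArr, Store.arr_setVar] using w15 _ (by omega) le_rfl) ?_).conseq ?_
      · simp only [Store.arr_setArr, Store.arr_setVar, Nat.reduceEqDiff, if_false, ← hlenC]
        push_cast; omega
      rintro s2 r2 ⟨g1, g2, g3⟩ hS2
      have f2 := hS2.2 2 (by decide)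
      have f16 := hS2.2 16 (by decide)
      have f17 := hS2.2 17 (by decide)
      have f6 := hS2.1 6 (by decide)
      have f3 := hS2.1 3 (by decide)
      have f4 := hS2.1 4 (by decide)
      simp only [Store.arr_setArr, Store.arr_setVar, Store.var_setVar, Store.var_setArr,
        Nat.reduceEqDiff, if_true, if_false, w6, w3, w4, ← hlenC, ← hC] at f2 f16 f17 f6 f3 f4 g1 g2 g3
      have hfil : rd (s2.arr 14) (s2.arr 15) n (q + 1 + 1) = (C (q + 1)).filter (T w) := by
        rw [g2, e13]
        refine List.filter_congr fun x hx => ?_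
        have := hT w hwn x (wCn _ (by omega) le_rfl x hx)
        rw [Bool.eq_iff_iff, decide_eq_true_iff, this]
      have hold : ∀ j, 1 ≤ j → j ≤ q + 1 → rd (s2.arr 14) (s2.arr 15) n j = C j := fun j hj0 hj =>
        (g3 j hj).2 (by rw [hlenC]; exact w15 j hj0 hj)
      simp only [f6]
      have hupd : ∀ j ≤ q + 1, Function.update (s2.arr 16) (q + 1 + 1) 0 j =
          Function.update (s'.arr 16) (q + 1) (s'.arr 16 (q + 1) + 1) j := fun j hj => by
        rw [Function.update_of_ne (by omega), f16]
      refine ⟨by omega, q + 1 + 1, N', f3, f4, rfl, by omega, fun j hj0 hj => ?_, fun j hj0 hj x hx => ?_, ?_, ?_⟩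
      · rcases Nat.le_succ_iff.1 hj with hj | rfl
        · rw [(g3 j hj).1, hlenC]; exact w15 j hj0 hj
        · have h1 := congrArg List.length hfil
          rw [length_rd] at h1
          rw [h1]
          exact (List.length_filter_le _ _).trans ((hlenC _).trans_le (w15 _ (by omega) le_rfl))
      · rcases Nat.le_succ_iff.1 hj with hj | rfl
        · rw [hold j hj0 hj] at hx
          exact wCn j hj0 hj x hx
        · rw [hfil] at hx
          exact wCn _ (by omega) le_rfl x (List.mem_of_mem_filter hx)
      · rw [f2, rest_open (w := w) (by omega) (by rw [f17, Function.update_self])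
          (Function.update_self ..), hfil, ← wout, hnext, f17,
          chosen_congr (fun i hi => Function.update_of_ne (by omega) ..),
          rest_congr (C := C) (idx := Function.update (s'.arr 16) (q + 1) (s'.arr 16 (q + 1) + 1))
            (cho := s'.arr 17) hold hupd
            (fun i hi => Function.update_of_ne (by omega) ..)]
      · have hc2 : restCost T k (rd (s2.arr 14) (s2.arr 15) n)
            (Function.update (s2.arr 16) (q + 1 + 1) 0) (q + 1 + 1) =
            extCost T k (k - 1 - (q + 1)) ((C (q + 1)).filter (T w)) +
            restCost T k C (Function.update (s'.arr 16) (q + 1) (s'.arr 16 (q + 1) + 1)) (q + 1) := by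
          obtain ⟨f, hf⟩ : ∃ f, k - 1 - (q + 1) = f + 1 := ⟨k - 1 - (q + 1) - 1, by omega⟩
          rw [restCost, hf, extCost, hfil, Function.update_self, List.drop_zero,
            show k - 1 - (q + 1 + 1) = f by omega,
            restCost_congr (C := C) hold hupd]
        rw [hc2]
        push_cast at g1 hr' hcnext ⊢
        omega
  · intro hge
    have hge' : (C (q + 1)).length ≤ s'.arr 16 (q + 1) := by rw [hlenC]; omega
    rw [rest_pop hge'] at wout
    rw [restCost_pop hge'] at hr'
    refine ⟨by omega, q, N', w3, w4, by simp, by omega, fun j h0 hj => w15 j h0 (by omega),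
      fun j h0 hj => wCn j h0 (by omega), wout, ?_⟩
    rw [← hC]
    push_cast at hr' ⊢
    omega

/-- All cliques that the depth-first search lists, when the later neighbours are `out`. -/
def allCliques (T : ℕ → ℕ → Bool) (k : ℕ) (out : ℕ → List ℕ) (n : ℕ) : List (List ℕ) :=
  (List.range n).flatMap fun v => ext T (k - 1) [v] (out v)

theorem allCliques_succ {T : ℕ → ℕ → Bool} {k : ℕ} {out : ℕ → List ℕ} {n : ℕ} :
    allCliques T k out (n + 1) = allCliques T k out n ++ ext T (k - 1) [n] (out n) := by
  simp [allCliques, List.range_succ]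

theorem length_allCliques_mono {T : ℕ → ℕ → Bool} {k : ℕ} {out : ℕ → List ℕ} {n m : ℕ}
    (h : n ≤ m) : (allCliques T k out n).length ≤ (allCliques T k out m).length := by
  induction m, h using Nat.le_induction with
  | base => rfl
  | succ m _ ih => rw [allCliques_succ, List.length_append]; omega

theorem listCliques_spec {K n k : ℕ} {T : ℕ → ℕ → Bool} {out : ℕ → List ℕ} (hnK : n + 1 < K)
    (hkK : k < K) (hk : 2 ≤ k) {s : Store} (h0 : s.var 0 = n) (h2 : s.var 2 = k)
    (hT : ∀ w < n, ∀ x < n, T w x = (s.arr 13 (w * n + x) ≠ 0))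
    (hout : ∀ v < n, rd (s.arr 11) (s.arr 12) n v = out v)
    (hlen : ∀ v < n, (out v).length ≤ n) (hlt : ∀ v < n, ∀ x ∈ out v, x < n)
    (hoK : k * (allCliques T k out n).length < K) (hoK' : (allCliques T k out n).length < K) {r : ℤ}
    (hr : ((∑ v ∈ Finset.range n, (extCost T k (k - 1) (out v) + 40 * (out v).length + 50) + 10 : ℕ)
      : ℤ) ≤ r) :
    WP K listCliques s r fun s' r' =>
      r - ((∑ v ∈ Finset.range n, (extCost T k (k - 1) (out v) + 40 * (out v).length + 50) + 10 : ℕ)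
        : ℤ) ≤ r' ∧
      s'.var 3 = (allCliques T k out n).length ∧
      blocks (s'.arr 2) k (allCliques T k out n).length = allCliques T k out n := by
  have hsum : ((∑ v ∈ Finset.range n, (extCost T k (k - 1) (out v) + 40 * (out v).length + 50) : ℕ)
      : ℤ) = ∑ i ∈ Finset.Ico 0 n,
        (((extCost T k (k - 1) (out i) + 40 * (out i).length + 42 : ℕ) : ℤ) + 8) := by
    rw [Nat.Ico_zero_eq_range]
    push_cast
    exact Finset.sum_congr rfl fun _ _ => by ring
  push_cast [-Nat.cast_sum] at hr ⊢
  rw [hsum] at hr ⊢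
  simp only [listCliques, WP, Expr.Small, Expr.eval, Expr.cost, true_and]
  refine WP.forUp_sum n 0 (fun i s' => s'.var 3 = (allCliques T k out i).length ∧
      s'.var 4 = k * (allCliques T k out i).length ∧
      blocks (s'.arr 2) k (allCliques T k out i).length = allCliques T k out i)
      (fun i => extCost T k (k - 1) (out i) + 40 * (out i).length + 42) (by omega) (Nat.zero_le _)
      (by simp [Store.var_setVar]) (by simp [Store.var_setVar, h0]) (by decide) (by decide)
      (by decide) ?_ ?_ ?_ ?_
  · simp [Store.var_setVar, allCliques, blocks]
  · push_cast at hr ⊢; omega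
  · rintro i s' r' _ hi hx hS ⟨w3, w4, wb⟩ hr'
    have w0 : s'.var 0 = n := (hS.1 0 (by decide)).trans (by simp [Store.var_setVar, h0])
    have w2 : s'.var 2 = k := (hS.1 2 (by decide)).trans (by simp [Store.var_setVar, h2])
    have e11 : s'.arr 11 = s.arr 11 := hS.2 11 (by decide)
    have e12 : s'.arr 12 = s.arr 12 := hS.2 12 (by decide)
    have e13 : s'.arr 13 = s.arr 13 := hS.2 13 (by decide)
    have hlen12 : s.arr 12 i = (out i).length := by rw [← hout i hi, length_rd]
    have hmono := length_allCliques_mono (T := T) (k := k) (out := out) (show i + 1 ≤ n from hi)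
    simp only [WP, Expr.Small, Expr.eval, Expr.cost, true_and, hx]
    refine (copyOut_spec (v := i) hnK (by simp [Store.var_setArr, w0])
      (by simp [Store.var_setArr, hx])
      (by simpa [Store.arr_setArr, e12, hlen12] using hlen i hi) ?_).conseq ?_
    · simp [Store.arr_setArr, e12, hlen12]
      push_cast at hr'; omega
    rintro s2 r2 ⟨g1, g2⟩ hS2
    have f2 := hS2.2 2 (by decide)
    have f13 := hS2.2 13 (by decide)
    have f16 := hS2.2 16 (by decide)
    have f17 := hS2.2 17 (by decide)
    have y0 := hS2.1 0 (by decide)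
    have y2 := hS2.1 2 (by decide)
    have y3 := hS2.1 3 (by decide)
    have y4 := hS2.1 4 (by decide)
    simp only [Store.arr_setArr, Store.var_setArr, Nat.reduceEqDiff, if_true, if_false, w0, w2, w3,
      w4, e11, e12, e13, hout i hi, hlen12] at f2 f13 f16 f17 y0 y2 y3 y4 g1 g2
    obtain ⟨f, hf⟩ : ∃ f, k - 1 = f + 1 := ⟨k - 2, by omega⟩
    have hrest : ∀ cho : ℕ → ℕ, cho 0 = i →
        rest T k (rd (s2.arr 14) (s2.arr 15) n) (Function.update (s2.arr 16) 1 0) cho 1 =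
        ext T (k - 1) [i] (out i) := by
      intro cho hcho
      rw [rest, rest, Function.update_self, g2, hf]
      simp [ext, chosen, hcho]
    have hrestC : restCost T k (rd (s2.arr 14) (s2.arr 15) n) (Function.update (s2.arr 16) 1 0) 1 =
        extCost T k (k - 1) (out i) := by
      rw [restCost, restCost, Function.update_self, g2, hf]
      simp [extCost]
    have h15' : s2.arr 15 1 = (out i).length := by rw [← g2, length_rd]
    refine (dfsLoop_spec (n := n) (k := k) (N := (allCliques T k out i).length) (T := T) (l₀ := 1)
      (out := allCliques T k out (i + 1)) hnK hkK (by simp [Store.var_setVar, Store.var_setArr, y0])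
      (by simp [Store.var_setVar, Store.var_setArr, y2])
      (by simp [Store.var_setVar, Store.var_setArr, y3])
      (by simp [Store.var_setVar, Store.var_setArr, y4]) (by simp [Store.var_setVar]) (by omega)
      (by simpa [Store.arr_setVar, Store.arr_setArr, f13] using hT) ?_ ?_ ?_
      ((Nat.mul_le_mul_left k hmono).trans_lt hoK) (by omega) ?_).mono ?_
    · intro j hj0 hj
      simp only [Store.arr_setVar, Store.arr_setArr, Nat.reduceEqDiff, if_false]
      obtain rfl : j = 1 := by omega
      rw [h15']; exact hlen i hi
    · intro j hj0 hj
      simp only [Store.arr_setVar, Store.arr_setArr, Nat.reduceEqDiff, if_false]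
      obtain rfl : j = 1 := by omega
      rw [g2]; exact hlt i hi
    · simp only [Store.arr_setVar, Store.arr_setArr, Nat.reduceEqDiff, if_true, if_false, f2]
      rw [hrest _ (by rw [f17, Function.update_self]), wb, allCliques_succ]
    · simp only [Store.arr_setVar, Store.arr_setArr, Nat.reduceEqDiff, if_true, if_false, hrestC]
      push_cast at hr' g1 ⊢; omega
    · simp only [Store.arr_setVar, Store.arr_setArr, Nat.reduceEqDiff, if_true, if_false, hrestC]
      rintro s3 r3 ⟨k1, k2, k3, k4⟩
      refine ⟨by push_cast at hr' g1 k1 ⊢; omega, by simpa [Store.var_setVar] using k2,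
        by simpa [Store.var_setVar] using k3, k4⟩
  · rintro s' r' hrr _ _ ⟨ho, _, hm⟩
    exact ⟨by push_cast at hrr ⊢; omega, ho, hm⟩


/-! ### The cliques found by the search, and the time for finding them -/

section

variable {T : ℕ → ℕ → Bool} {pos : ℕ → ℕ}

theorem filter_length_cons {C : List ℕ} {a : ℕ} (hT : ∀ w x, T w x → pos w < pos x)
    (h : ∀ x ∈ C, pos a < pos x) {w : ℕ} (hw : w ∈ C) :
    (a :: C).filter (T w) = C.filter (T w) := by
  rw [List.filter_cons_of_neg]
  intro h'
  have := hT w a h'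
  have := h w hw
  omega

/-- In a list sorted by `pos`, the later neighbours of the elements have at most `d choose (j + 1)`
sublists of length `j`: each of them, together with the element, is a sublist of length `j + 1`. -/
theorem sum_choose_le (hT : ∀ w x, T w x → pos w < pos x) (j : ℕ) (C : List ℕ)
    (hC : C.Pairwise fun x y => pos x < pos y) :
    (C.map fun w => (C.filter (T w)).length.choose j).sum ≤ C.length.choose (j + 1) := by
  induction C with
  | nil => simp
  | cons a C ih =>
    rw [List.pairwise_cons] at hC
    have h1 : (C.map fun w => ((a :: C).filter (T w)).length.choose j) =
        C.map fun w => (C.filter (T w)).length.choose j :=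
      List.map_congr_left fun w hw => by rw [filter_length_cons hT hC.1 hw]
    have h2 : ((a :: C).filter (T a)).length ≤ C.length := by
      rw [List.filter_cons_of_neg (by intro h; exact lt_irrefl _ (hT a a h))]
      exact List.length_filter_le _ _
    rw [List.map_cons, List.sum_cons, h1, List.length_cons, Nat.choose_succ_succ]
    exact add_le_add (Nat.choose_le_choose j h2) (ih hC.2)

/-- A list of `d` elements has at most `d choose (j + 1)` sublists of length `j + 1` that the search
reaches, each at a cost of at most `50 D + 100` for filtering its candidates; only those of length `f`
are written. -/
theorem extCost_le (hT : ∀ w x, T w x → pos w < pos x) {k D : ℕ} (f : ℕ) (C : List ℕ)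
    (hC : C.Pairwise fun x y => pos x < pos y) (hD : C.length ≤ D) :
    extCost T k f C ≤ ∑ j ∈ Finset.range (f - 1), C.length.choose (j + 1) * (50 * D + 100) +
      C.length.choose f * (30 * k + 70) + 20 := by
  induction f generalizing C with
  | zero => simp [extCost]
  | succ f ih =>
    rw [extCost]
    have hle : ∀ w, (C.filter (T w)).length ≤ D := fun w => (List.length_filter_le _ _).trans hD
    rcases Nat.eq_zero_or_pos f with rfl | hf
    · simp [extCost]
    · have h1 : (C.map fun w => (if f = 0 then 0 else 50 * C.length + 80) +
          extCost T k f (C.filter (T w))).sum ≤ (C.map fun w => (50 * D + 100) +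
          (∑ j ∈ Finset.range (f - 1), (C.filter (T w)).length.choose (j + 1) * (50 * D + 100) +
          (C.filter (T w)).length.choose f * (30 * k + 70))).sum := by
        refine List.sum_le_sum fun w _ => ?_
        have := ih (C.filter (T w)) (hC.filter _) (hle w)
        rw [if_neg hf.ne']
        omega
      have h2 : ∀ (L : List ℕ) (a : ℕ) (F : ℕ → ℕ → ℕ) (g : ℕ → ℕ) (S : Finset ℕ) (X Y : ℕ),
          (L.map fun w => a + (∑ j ∈ S, F w j * X + g w * Y)).sum =
          L.length * a + (∑ j ∈ S, (L.map fun w => F w j).sum * X + (L.map g).sum * Y) := by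
        intro L a F g S X Y
        induction L with
        | nil => simp
        | cons b L ih =>
          simp only [List.map_cons, List.sum_cons, ih, List.length_cons, add_mul,
            Finset.sum_add_distrib]
          ring
      rw [h2 C (50 * D + 100) (fun w j => (C.filter (T w)).length.choose (j + 1))
        (fun w => (C.filter (T w)).length.choose f)] at h1
      have h3 : ∑ j ∈ Finset.range (f - 1),
          (C.map fun w => (C.filter (T w)).length.choose (j + 1)).sum * (50 * D + 100) ≤
          ∑ j ∈ Finset.range (f - 1), C.length.choose (j + 1 + 1) * (50 * D + 100) :=
        Finset.sum_le_sum fun j _ => Nat.mul_le_mul_right _ (sum_choose_le hT _ C hC)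
      have h4 := Nat.mul_le_mul_right (30 * k + 70) (sum_choose_le hT f C hC)
      have h5 : ∑ j ∈ Finset.range f, C.length.choose (j + 1) * (50 * D + 100) =
          ∑ j ∈ Finset.range (f - 1), C.length.choose (j + 1 + 1) * (50 * D + 100) +
          C.length * (50 * D + 100) := by
        obtain ⟨g, rfl⟩ : ∃ g, f = g + 1 := ⟨f - 1, by omega⟩
        rw [Finset.sum_range_succ']
        simp
      rw [Nat.add_sub_cancel, h5]
      omega

/-- The search takes time at least proportional to its output; this bounds the number of cliques by
the time for listing them. -/
theorem mul_length_ext_le (k f : ℕ) (pre C : List ℕ) :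
    30 * k * (ext T f pre C).length ≤ extCost T k f C := by
  induction f generalizing pre C with
  | zero => simp [ext, extCost]
  | succ f ih =>
    rw [ext, extCost, List.length_flatMap, ← List.sum_map_mul_left]
    refine le_trans (List.sum_le_sum fun w _ => (ih (pre ++ [w]) _).trans (Nat.le_add_left _ _))
      (Nat.le_add_right _ _)

theorem mem_ext {f : ℕ} {pre C l : List ℕ} : l ∈ ext T f pre C ↔
    ∃ t, l = pre ++ t ∧ t.length = f ∧ (∀ x ∈ t, x ∈ C) ∧ t.Pairwise fun w x => T w x := by
  induction f generalizing pre C with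
  | zero =>
    simp only [ext, List.mem_singleton]
    constructor
    · rintro rfl; exact ⟨[], by simp⟩
    · rintro ⟨t, rfl, ht, _⟩
      simp [List.length_eq_zero_iff.1 ht]
  | succ f ih =>
    simp only [ext, List.mem_flatMap, ih, List.mem_filter]
    constructor
    · rintro ⟨w, hw, t, rfl, ht, hC, hp⟩
      refine ⟨w :: t, by simp, by simp [ht], ?_, ?_⟩
      · simpa [hw] using fun x hx => (hC x hx).1
      · exact List.pairwise_cons.2 ⟨fun x hx => (hC x hx).2, hp⟩
    · rintro ⟨_ | ⟨w, t⟩, rfl, ht, hC, hp⟩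
      · simp at ht
      · rw [List.pairwise_cons] at hp
        refine ⟨w, hC w (by simp), t, by simp, by simpa using ht, fun x hx => ⟨hC x (by simp [hx]),
          hp.1 x hx⟩, hp.2⟩

theorem nodup_ext {f : ℕ} {pre C : List ℕ} (hC : C.Nodup) : (ext T f pre C).Nodup := by
  induction f generalizing pre C with
  | zero => simp [ext]
  | succ f ih =>
    rw [ext, List.nodup_flatMap]
    refine ⟨fun w _ => ih (hC.filter _), hC.imp fun {w w'} hne => ?_⟩
    intro l h1 h2
    obtain ⟨t, h1, -⟩ := mem_ext.1 h1
    obtain ⟨t', h2, -⟩ := mem_ext.1 h2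
    rw [h1] at h2
    simp only [List.append_assoc, List.append_cancel_left_eq, List.cons_append, List.nil_append,
      List.cons.injEq] at h2
    exact hne h2.1

theorem mem_allCliques {k n : ℕ} {out : ℕ → List ℕ} (hk : 2 ≤ k)
    (hout : ∀ v < n, ∀ x, x ∈ out v ↔ x < n ∧ T v x) {l : List ℕ} :
    l ∈ allCliques T k out n ↔ l.length = k ∧ (∀ x ∈ l, x < n) ∧ l.Pairwise fun w x => T w x := by
  simp only [allCliques, List.mem_flatMap, List.mem_range, mem_ext]
  constructor
  · rintro ⟨v, hv, t, rfl, ht, hC, hp⟩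
    refine ⟨by simp; omega, ?_, ?_⟩
    · simpa [hv] using fun x hx => ((hout v hv x).1 (hC x hx)).1
    · exact List.pairwise_cons.2 ⟨fun x hx => ((hout v hv x).1 (hC x hx)).2, hp⟩
  · rintro ⟨hl, hn, hp⟩
    obtain _ | ⟨v, t⟩ := l
    · simp at hl; omega
    · rw [List.pairwise_cons] at hp
      have hv := hn v (by simp)
      exact ⟨v, hv, t, by simp, by simp at hl; omega,
        fun x hx => (hout v hv x).2 ⟨hn x (by simp [hx]), hp.1 x hx⟩, hp.2⟩

theorem nodup_allCliques {k n : ℕ} {out : ℕ → List ℕ} (hout : ∀ v < n, (out v).Nodup) :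
    (allCliques T k out n).Nodup := by
  rw [allCliques, List.nodup_flatMap]
  refine ⟨fun v hv => nodup_ext (hout v (List.mem_range.1 hv)), List.nodup_range.imp fun {w w'} hne => ?_⟩
  intro l h1 h2
  obtain ⟨t, h1, -⟩ := mem_ext.1 h1
  obtain ⟨t', h2, -⟩ := mem_ext.1 h2
  rw [h1] at h2
  simp at h2
  exact hne h2.1

/-- A list sorted by `pos` is determined by its set of elements. -/
theorem eq_of_toFinset_eq {l l' : List ℕ} (h : l.Pairwise fun x y => pos x < pos y)
    (h' : l'.Pairwise fun x y => pos x < pos y) (heq : l.toFinset = l'.toFinset) : l = l' := by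
  have hn : l.Nodup := h.imp fun {x y} hxy => by rintro rfl; exact lt_irrefl _ hxy
  have hn' : l'.Nodup := h'.imp fun {x y} hxy => by rintro rfl; exact lt_irrefl _ hxy
  have hp : l.Perm l' := List.perm_of_nodup_nodup_toFinset_eq hn hn' heq
  exact hp.eq_of_pairwise (fun a b _ _ hab hba => absurd hab (by omega)) h h'

end

/-- `w` is an earlier neighbour of `x`. -/
def later (A : ℕ → List ℕ) (pos : ℕ → ℕ) (w x : ℕ) : Bool := decide (w ∈ A x ∧ pos w < pos x)

section

variable {n D k : ℕ} {A : ℕ → List ℕ} {ord pos : ℕ → ℕ}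

theorem later_pos (w x : ℕ) (h : later A pos w x) : pos w < pos x := by
  simp only [later, decide_eq_true_eq] at h; exact h.2

theorem PartialOrd.pairwise_ord (hO : PartialOrd n A D ord pos n) :
    ((List.range n).map ord).Pairwise fun x y => pos x < pos y := by
  rw [List.pairwise_map]
  refine List.pairwise_lt_range.imp_of_mem fun {a b} ha hb hab => ?_
  rw [(hO.pos_ord a (List.mem_range.1 ha)).2, (hO.pos_ord b (List.mem_range.1 hb)).2]
  omega

theorem PartialOrd.mem_ord (hO : PartialOrd n A D ord pos n) {x : ℕ} :
    x ∈ (List.range n).map ord ↔ x < n := by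
  rw [List.mem_map]
  constructor
  · rintro ⟨i, hi, rfl⟩; exact (hO.pos_ord i (List.mem_range.1 hi)).1
  · intro hx
    obtain ⟨h1, h2⟩ := hO.ord_pos x hx (hO.pos_ne_zero hx)
    have := hO.pos_ne_zero hx
    exact ⟨pos x - 1, by simp; omega, h2⟩

theorem outL_sorted (hO : PartialOrd n A D ord pos n) (u : ℕ) :
    (outL A ord pos n u).Pairwise fun x y => pos x < pos y := hO.pairwise_ord.filter _

theorem outL_nodup (hO : PartialOrd n A D ord pos n) (u : ℕ) : (outL A ord pos n u).Nodup :=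
  (outL_sorted hO u).imp fun {x y} hxy => by rintro rfl; exact lt_irrefl _ hxy

theorem mem_outL (hO : PartialOrd n A D ord pos n) {u x : ℕ} :
    x ∈ outL A ord pos n u ↔ x < n ∧ later A pos u x := by
  rw [outL, List.mem_filter, hO.mem_ord, later]

theorem outL_length_le (hA : AdjLists n A) (hO : PartialOrd n A D ord pos n) {u : ℕ} (hu : u < n) :
    (outL A ord pos n u).length ≤ D ∧ (outL A ord pos n u).length ≤ (A u).length := by
  have h1 : (outL A ord pos n u).length ≤
      ((A u).filter (fun w => pos w = 0 ∨ pos u < pos w)).length := by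
    rw [← List.toFinset_card_of_nodup (outL_nodup hO u),
      ← List.toFinset_card_of_nodup ((hA.nodup u hu).filter _)]
    refine Finset.card_le_card fun x hx => ?_
    rw [List.mem_toFinset, mem_outL hO] at hx
    obtain ⟨hx, hl⟩ := hx
    simp only [later, decide_eq_true_eq] at hl
    rw [List.mem_toFinset, List.mem_filter]
    exact ⟨(hA.mem_comm hu hx).1 hl.1, by simp [hl.2]⟩
  refine ⟨h1.trans ?_, h1.trans (List.length_filter_le _ _)⟩
  rw [← List.countP_eq_length_filter]
  exact hO.deg u hu (hO.pos_ne_zero hu)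

/-- The source of the factor `(1 / 2) ^ (k - 2)` in the running time: `2 ^ j ≤ (j + 1)!`. -/
theorem two_pow_mul_choose_le {d D j : ℕ} (h : d ≤ D) : 2 ^ j * d.choose (j + 1) ≤ d * D ^ j := by
  have h1 : 2 ^ j ≤ (j + 1).factorial := by
    simpa [add_comm] using @Nat.factorial_mul_pow_le_factorial 1 j
  calc 2 ^ j * d.choose (j + 1) ≤ (j + 1).factorial * d.choose (j + 1) := Nat.mul_le_mul_right _ h1
    _ = d.descFactorial (j + 1) := (Nat.descFactorial_eq_factorial_mul_choose _ _).symm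
    _ ≤ d ^ (j + 1) := Nat.descFactorial_le_pow _ _
    _ = d * d ^ j := by ring
    _ ≤ d * D ^ j := Nat.mul_le_mul_left _ (Nat.pow_le_pow_left h _)

theorem choose_le_real {d D j : ℕ} (h : d ≤ D) : (d.choose (j + 1) : ℝ) ≤ d * (D / 2 : ℝ) ^ j := by
  have h1 : ((2 ^ j * d.choose (j + 1) : ℕ) : ℝ) ≤ (d * D ^ j : ℕ) := by
    exact_mod_cast two_pow_mul_choose_le h
  push_cast at h1
  rw [div_pow, ← mul_div_assoc, le_div_iff₀ (by positivity)]
  linarith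

/-- The bound for a vertex with the later neighbours `C`.  For `k = 2` no bound for `D` is needed, as
the power of `D / 2` has the exponent `0`. -/
theorem extCost_le_real {T : ℕ → ℕ → Bool} (hT : ∀ w x, T w x → pos w < pos x) {C : List ℕ}
    (hC : C.Pairwise fun x y => pos x < pos y) (hD : C.length ≤ D) (hk : 2 ≤ k) {ρ : ℝ}
    (hρ : 1 ≤ ρ) (hDρ : k = 2 ∨ (D : ℝ) / 2 ≤ ρ) :
    (extCost T k (k - 1) C : ℝ) ≤ C.length * (270 * k * ρ ^ (k - 2)) + 20 := by
  have h1 : (extCost T k (k - 1) C : ℝ) ≤ ∑ j ∈ Finset.range (k - 2),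
      (C.length.choose (j + 1) : ℝ) * (50 * D + 100) +
      C.length.choose (k - 1) * (30 * k + 70) + 20 := by
    exact_mod_cast extCost_le hT (k - 1) C hC hD
  obtain ⟨q, rfl⟩ : ∃ q, k = q + 2 := ⟨k - 2, by omega⟩
  simp only [Nat.add_sub_cancel, show q + 2 - 1 = q + 1 by omega] at h1 ⊢
  have hρ0 : (0 : ℝ) ≤ ρ := by linarith
  have hd : (0 : ℝ) ≤ C.length := by positivity
  have h2 : ((C.length.choose (q + 1) : ℕ) : ℝ) ≤ C.length * ρ ^ q := by
    refine (choose_le_real hD).trans (mul_le_mul_of_nonneg_left ?_ hd)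
    rcases hDρ with h | h
    · obtain rfl : q = 0 := by omega
      simp
    · exact pow_le_pow_left₀ (by positivity) h q
  have h3 : ∑ j ∈ Finset.range q, (C.length.choose (j + 1) : ℝ) * (50 * D + 100) ≤
      ∑ j ∈ Finset.range q, C.length * (200 * ρ ^ q) := by
    refine Finset.sum_le_sum fun j hj => ?_
    rw [Finset.mem_range] at hj
    have h : (D : ℝ) / 2 ≤ ρ := hDρ.resolve_left (by omega)
    have h4 : ρ ^ j * (50 * D + 100) ≤ 200 * ρ ^ q := by
      calc ρ ^ j * (50 * D + 100) ≤ ρ ^ j * (200 * ρ) :=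
            mul_le_mul_of_nonneg_left (by linarith) (by positivity)
        _ = 200 * ρ ^ (j + 1) := by ring
        _ ≤ 200 * ρ ^ q := by
            have := pow_le_pow_right₀ hρ (show j + 1 ≤ q from hj)
            linarith
    calc (C.length.choose (j + 1) : ℝ) * (50 * D + 100)
        ≤ (C.length * ρ ^ j) * (50 * D + 100) := by
          refine mul_le_mul_of_nonneg_right ((choose_le_real hD).trans ?_) (by positivity)
          exact mul_le_mul_of_nonneg_left (pow_le_pow_left₀ (by positivity) h j) hd
      _ = C.length * (ρ ^ j * (50 * D + 100)) := by ring
      _ ≤ C.length * (200 * ρ ^ q) := mul_le_mul_of_nonneg_left h4 hd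
  rw [Finset.sum_const, Finset.card_range, nsmul_eq_mul] at h3
  have h5 : (0 : ℝ) ≤ C.length * ρ ^ q := by positivity
  have h6 : ((C.length.choose (q + 1) : ℕ) : ℝ) * (30 * (q + 2 : ℕ) + 70) ≤
      C.length * ρ ^ q * (30 * (q + 2 : ℕ) + 70) := mul_le_mul_of_nonneg_right h2 (by positivity)
  push_cast at h1 h6 ⊢
  nlinarith [mul_nonneg h5 (Nat.cast_nonneg (α := ℝ) q)]

end


/-! ### Incidence lists -/

/-- The `j`-th block of length `k` of an array. -/
def block (a : ℕ → ℕ) (k j : ℕ) : List ℕ := (List.range k).map fun i => a (k * j + i)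

/-- The numbers below `N` of the blocks that contain `v`. -/
def incL (B : ℕ → List ℕ) (N v : ℕ) : List ℕ := (List.range N).filter fun j => v ∈ B j

theorem incL_succ {B : ℕ → List ℕ} {N v : ℕ} :
    incL B (N + 1) v = incL B N v ++ if v ∈ B N then [N] else [] := by
  simp [incL, List.range_succ, List.filter_append, List.filter_cons]

theorem length_incL_le {B : ℕ → List ℕ} {N v : ℕ} : (incL B N v).length ≤ N :=
  (List.length_filter_le _ _).trans (by simp)

/-- Append the number in the scalar `4` to the lists of the elements of the block of this number,
which starts at the scalar `5`. -/
def addInc : Cmd :=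
  forUp 6 2 (7 ≔ .get 2 (.var 5) ;; push 18 3 (.var 3) (.var 7) (.var 4) ;; 5 ≔ .var 5 +ₑ .lit 1)

/-- Array `18`, with heights in array `3` and the number of blocks as stride, becomes the lists of
the blocks that contain a vertex.  Array `22` is constant `k`. -/
def buildInc : Cmd :=
  4 ≔ .lit 0 ;; 5 ≔ .lit 0 ;;
  forUp 4 3 (.store 22 (.var 4) (.var 2) ;; 6 ≔ .lit 0 ;; addInc)

theorem addInc_spec {K k N j : ℕ} {B : ℕ → List ℕ} (hj : j < N) (hkK : k < K) (hNK : N < K)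
    (hkN : k * N < K) {s : Store} (hB : B j = block (s.arr 2) k j) (hnd : (B j).Nodup)
    (h2 : s.var 2 = k) (h3 : s.var 3 = N) (h4 : s.var 4 = j) (h5 : s.var 5 = k * j)
    (h6 : s.var 6 = 0) (hinc : ∀ v, rd (s.arr 18) (s.arr 3) N v = incL B j v) {r : ℤ}
    (hr : 40 * (k : ℤ) + 4 ≤ r) :
    WP K addInc s r fun s' r' => r - (40 * (k : ℤ) + 4) ≤ r' ∧ s'.var 5 = k * (j + 1) ∧
      ∀ v, rd (s'.arr 18) (s'.arr 3) N v = incL B (j + 1) v := by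
  have hlB : (B j).length = k := by rw [hB]; simp [block]
  refine WP.forUp_sum k 0 (fun i s' => s'.var 5 = k * j + i ∧
      ∀ v, rd (s'.arr 18) (s'.arr 3) N v = incL B j v ++ if v ∈ (B j).take i then [j] else [])
      (fun _ => 32) hkK (Nat.zero_le _) h6 h2 (by decide) (by decide) (by decide) ?_ ?_ ?_ ?_
  · simpa using ⟨h5, hinc⟩
  · simp; omega
  · rintro i s' r' _ hi hx ⟨hS1, hS2⟩ ⟨w5, ho⟩ hr'
    have e2 : s'.arr 2 = s.arr 2 := hS2 2 (by decide)
    have v3 : s'.var 3 = N := (hS1 3 (by decide)).trans h3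
    have v4 : s'.var 4 = j := (hS1 4 (by decide)).trans h4
    have hi' : i < (B j).length := by omega
    have hx : s.arr 2 (k * j + i) = (B j)[i] := by simp [hB, block]
    set x := (B j)[i] with hxdef
    have htake : (B j).take (i + 1) = (B j).take i ++ [x] := List.take_succ_eq_append_getElem hi'
    have hxn : x ∉ (B j).take i := by
      have := hnd.sublist (List.take_sublist (i + 1) (B j))
      rw [htake, List.nodup_append] at this
      intro h
      exact this.2.2 x h x (by simp) rfl
    have hlen : ∀ v, s'.arr 3 v ≤ N := fun v => by
      have h1 := congrArg List.length (ho v)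
      have h2 := @length_incL_le B j v
      simp only [length_rd, List.length_append] at h1
      split at h1 <;> simp at h1 <;> omega
    have hlenx : s'.arr 3 x < N := by
      have h1 := congrArg List.length (ho x)
      have h2 := @length_incL_le B j x
      simp [hxn] at h1
      omega
    have hkj : k * j + k ≤ k * N := by
      have := Nat.mul_le_mul_left k (show j + 1 ≤ N from hj)
      rwa [mul_add, mul_one] at this
    simp only [push, WP, Expr.Small, Expr.eval, Expr.cost, Op.apply, true_and, Store.var_setVar,
      Store.arr_setVar, Store.var_setArr, Store.arr_setArr, Nat.reduceEqDiff, if_true, if_false,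
      e2, v3, v4, w5, hx]
    refine ⟨by omega, by omega, by push_cast; omega, by omega, fun v => ?_⟩
    rw [rd_push hlenx (hlen v), htake]
    by_cases hvx : v = x
    · subst hvx
      rw [if_pos rfl, ho, if_neg hxn]; simp
    · rw [if_neg hvx, ho v]
      simp [hvx]
  · rintro s' r' hrr _ _ ⟨w5, ho⟩
    simp only [Finset.sum_const, Nat.card_Ico, nsmul_eq_mul] at hrr
    refine ⟨by push_cast at hrr; omega, by rw [w5]; ring, fun v => ?_⟩
    rw [ho, incL_succ, List.take_of_length_le (by omega)]

theorem buildInc_spec {K k N : ℕ} {B : ℕ → List ℕ} (hkK : k < K) (hNK : N < K)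
    (hkN : k * N < K) {s : Store} (hB : ∀ j < N, B j = block (s.arr 2) k j)
    (hnd : ∀ j < N, (B j).Nodup)
    (h2 : s.var 2 = k) (h3 : s.var 3 = N) (hz : ∀ v, s.arr 3 v = 0) {r : ℤ}
    (hr : (N : ℤ) * (40 * k + 30) + 10 ≤ r) :
    WP K buildInc s r fun s' r' => r - ((N : ℤ) * (40 * k + 30) + 10) ≤ r' ∧
      (∀ v, rd (s'.arr 18) (s'.arr 3) N v = incL B N v) ∧ ∀ j < N, s'.arr 22 j = k := by
  simp only [buildInc, WP, Expr.Small, Expr.eval, Expr.cost, true_and]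
  refine WP.forUp_sum N 0 (fun j s' => s'.var 5 = k * j ∧
      (∀ v, rd (s'.arr 18) (s'.arr 3) N v = incL B j v) ∧ ∀ i < j, s'.arr 22 i = k)
      (fun _ => 40 * k + 20) hNK (Nat.zero_le _) (by simp [Store.var_setVar])
      (by simp [Store.var_setVar, h3]) (by decide) (by decide) (by decide) ?_ ?_ ?_ ?_
  · simp [Store.var_setVar, Store.arr_setVar, rd, hz, incL]
  · simp; nlinarith
  · rintro j s' r' _ hj hx hS ⟨w5, ho, hk⟩ hr'
    have e2 : s'.arr 2 = s.arr 2 := (hS.2 2 (by decide)).trans (by simp [Store.arr_setVar])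
    have v2 : s'.var 2 = k := (hS.1 2 (by decide)).trans (by simp [Store.var_setVar, h2])
    have v3 : s'.var 3 = N := (hS.1 3 (by decide)).trans (by simp [Store.var_setVar, h3])
    simp only [WP, Expr.Small, Expr.eval, Expr.cost, true_and, hx, v2]
    refine (addInc_spec (B := B) hj hkK hNK hkN
      (by simpa [Store.arr_setVar, Store.arr_setArr, e2] using hB j hj) (hnd j hj)
      (by simp [Store.var_setVar, Store.var_setArr, v2])
      (by simp [Store.var_setVar, Store.var_setArr, v3])
      (by simp [Store.var_setVar, Store.var_setArr, hx])
      (by simp [Store.var_setVar, Store.var_setArr, w5]) (by simp [Store.var_setVar])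
      (by simpa [Store.arr_setVar, Store.arr_setArr] using ho)
      (by push_cast at hr' ⊢; omega)).conseq ?_
    rintro s2 r2 ⟨g1, g2, g3⟩ hS2
    have f22 := hS2.2 22 (by decide)
    simp only [Store.arr_setVar, Store.arr_setArr, if_true] at f22
    refine ⟨by push_cast at g1 ⊢; omega, by simpa [Store.var_setVar] using g2, g3, fun i hi => ?_⟩
    rw [Store.arr_setVar, f22]
    rcases Nat.lt_succ_iff_lt_or_eq.1 hi with hi | rfl
    · rw [Function.update_of_ne (by omega), hk i hi]
    · rw [Function.update_self]
  · rintro s' r' hrr _ _ ⟨_, ho, hk⟩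
    simp only [Finset.sum_const, Nat.card_Ico, nsmul_eq_mul] at hrr
    rw [Nat.sub_zero] at hrr
    refine ⟨by push_cast at hrr; nlinarith, ho, hk⟩


/-! ### Sets of small numbers as machine words -/

/-- The machine word whose set bits are the elements of `S`. -/
def word (S : Finset ℕ) : ℕ := ∑ i ∈ S, 2 ^ i

theorem word_insert {S : Finset ℕ} {i : ℕ} (h : i ∉ S) : word (insert i S) = word S + 2 ^ i := by
  rw [word, Finset.sum_insert h, add_comm]; rfl

theorem word_erase {S : Finset ℕ} {i : ℕ} (h : i ∈ S) : word (S.erase i) = word S - 2 ^ i := by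
  have := Finset.sum_erase_add S (fun i => 2 ^ i) h
  simp only [word] at *
  omega

theorem word_lt {S : Finset ℕ} {L : ℕ} (h : ∀ s ∈ S, s < L) : word S < 2 ^ L := by
  have h1 : word S ≤ ∑ i ∈ Finset.range L, 2 ^ i :=
    Finset.sum_le_sum_of_subset fun s hs => Finset.mem_range.2 (h s hs)
  have h2 : ∑ i ∈ Finset.range L, 2 ^ i < 2 ^ L := Nat.geomSum_lt le_rfl (by simp)
  omega

theorem two_pow_le_word {S : Finset ℕ} {s : ℕ} (h : s ∈ S) : 2 ^ s ≤ word S :=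
  Finset.single_le_sum (f := fun i => 2 ^ i) (fun _ _ => Nat.zero_le _) h

/-- The bits of `word S` below and from position `i` on. -/
theorem word_split (S : Finset ℕ) (i : ℕ) : word S =
    2 ^ i * word ((S.filter (i ≤ ·)).image (· - i)) + word (S.filter (· < i)) := by
  have h1 : word ((S.filter (i ≤ ·)).image (· - i)) = ∑ s ∈ S.filter (i ≤ ·), 2 ^ (s - i) := by
    rw [word, Finset.sum_image]
    intro x hx y hy hxy
    simp only [Finset.coe_filter, Set.mem_ofPred_eq] at hx hy
    simp only at hxy
    omega
  rw [h1, Finset.mul_sum, word, word, ← Finset.sum_filter_add_sum_filter_not S (i ≤ ·)]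
  congr 1
  · refine Finset.sum_congr rfl fun s hs => ?_
    rw [← pow_add, Nat.add_sub_cancel' (Finset.mem_filter.1 hs).2]
  · simp only [not_le]

theorem word_mod (S : Finset ℕ) (i : ℕ) : word S % 2 ^ i = word (S.filter (· < i)) := by
  conv_lhs => rw [word_split S i]
  rw [Nat.mul_add_mod, Nat.mod_eq_of_lt (word_lt fun s hs => (Finset.mem_filter.1 hs).2)]

theorem word_div (S : Finset ℕ) (i : ℕ) :
    word S / 2 ^ i = word ((S.filter (i ≤ ·)).image (· - i)) := by
  conv_lhs => rw [word_split S i]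
  rw [Nat.mul_add_div (by positivity),
    Nat.div_eq_of_lt (word_lt fun s hs => (Finset.mem_filter.1 hs).2), add_zero]

theorem log_word {S : Finset ℕ} {s : ℕ} (hs : s ∈ S) (h : ∀ t ∈ S, t ≤ s) :
    Nat.log 2 (word S) = s :=
  Nat.log_eq_of_pow_le_of_lt_pow (two_pow_le_word hs) (word_lt fun t ht => by have := h t ht; omega)

theorem padicValNat_word {S : Finset ℕ} {s : ℕ} (hs : s ∈ S) (h : ∀ t ∈ S, s ≤ t) :
    padicValNat 2 (word S) = s := by
  have h1 : S.filter (· < s) = ∅ := Finset.filter_eq_empty_iff.2 fun t ht => by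
    have := h t ht; omega
  have h2 : S.filter (s ≤ ·) = S := Finset.filter_true_of_mem h
  have h3 := word_split S s
  rw [h1, h2] at h3
  set T := S.image (· - s)
  have hT : 0 ∈ T := Finset.mem_image.2 ⟨s, hs, by simp⟩
  have h4 : word T = word (T.erase 0) + 1 := by
    have := word_erase hT
    have := two_pow_le_word hT
    simp at *; omega
  have h5 : 2 ∣ word (T.erase 0) := Finset.dvd_sum fun i hi => dvd_pow_self 2 (by
    simp at hi; exact hi.1)
  have h6 : ¬ 2 ∣ word T := by omega
  have h7 : word ∅ = 0 := rfl
  rw [h3, h7, add_zero, padicValNat.mul (by positivity) (by omega), padicValNat.prime_pow,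
    padicValNat.eq_zero_of_not_dvd h6, add_zero]

/-- Tables of the powers of two up to `2 ^ (L + 1)` and, for arguments below this power, of the
positions of the highest and of the lowest bit; the power `2 ^ L` is only slightly larger than
`N`. -/
structure Tables (N L : ℕ) (p2 hi lo : ℕ → ℕ) : Prop where
  le : N + 2 ≤ 2 ^ L
  ge : 2 ^ L ≤ 2 * (N + 2)
  pow : ∀ i ≤ L + 1, p2 i = 2 ^ i
  high : ∀ x, 1 ≤ x → x < 2 ^ (L + 1) → hi x = Nat.log 2 x
  low : ∀ x, 1 ≤ x → x < 2 ^ (L + 1) → lo x = padicValNat 2 x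

namespace Tables

variable {N L : ℕ} {p2 hi lo : ℕ → ℕ} (hT : Tables N L p2 hi lo) {S : Finset ℕ}
include hT

/-- The lowest element of `S` from `i` on can be looked up. -/
theorem succ_spec (hS : ∀ s ∈ S, s ≤ L) (hL : L ∈ S) {i : ℕ} (hi : i ≤ L) :
    i + lo (word S / p2 i) ∈ S ∧ i ≤ i + lo (word S / p2 i) ∧
      ∀ t ∈ S, i ≤ t → i + lo (word S / p2 i) ≤ t := by
  have hne : (S.filter (i ≤ ·)).Nonempty := ⟨L, Finset.mem_filter.2 ⟨hL, hi⟩⟩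
  obtain ⟨s, hs, hmin⟩ := Finset.exists_min_image _ id hne
  have hmin' : ∀ t ∈ S, i ≤ t → s ≤ t := fun t ht hit => hmin t (Finset.mem_filter.2 ⟨ht, hit⟩)
  obtain ⟨hs1, hs2⟩ := Finset.mem_filter.1 hs
  have h1 : s - i ∈ (S.filter (i ≤ ·)).image (· - i) := Finset.mem_image.2 ⟨s, hs, rfl⟩
  have h2 : lo (word S / p2 i) = s - i := by
    rw [hT.pow i (by omega), word_div, hT.low]
    · refine padicValNat_word h1 fun t ht => ?_
      obtain ⟨t', ht', rfl⟩ := Finset.mem_image.1 ht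
      obtain ⟨h3, h4⟩ := Finset.mem_filter.1 ht'
      have := hmin' t' h3 h4
      omega
    · exact (Nat.one_le_two_pow).trans (two_pow_le_word h1)
    · refine word_lt fun t ht => ?_
      obtain ⟨t', ht', rfl⟩ := Finset.mem_image.1 ht
      have := hS t' (Finset.mem_filter.1 ht').1
      omega
  have h3 : i + (s - i) = s := by omega
  rw [h2, h3]
  exact ⟨hs1, hs2, hmin'⟩

theorem low_spec (hS : ∀ s ∈ S, s ≤ L) (hL : L ∈ S) :
    lo (word S) ∈ S ∧ ∀ t ∈ S, lo (word S) ≤ t := by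
  have := hT.succ_spec hS hL (Nat.zero_le L)
  rw [hT.pow 0 (by omega)] at this
  simp at this
  exact this

/-- The highest element of `S` below `i` can be looked up. -/
theorem pred_spec (hS : ∀ s ∈ S, s ≤ L) {i : ℕ} (hi' : i ≤ L) (h : word S % p2 i ≠ 0) :
    hi (word S % p2 i) ∈ S ∧ hi (word S % p2 i) < i ∧
      ∀ t ∈ S, t < i → t ≤ hi (word S % p2 i) := by
  rw [hT.pow i (by omega), word_mod] at *
  have hne : (S.filter (· < i)).Nonempty := by
    by_contra h'
    rw [Finset.not_nonempty_iff_eq_empty.1 h'] at h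
    exact h rfl
  obtain ⟨s, hs, hmax⟩ := Finset.exists_max_image _ id hne
  have hmax' : ∀ t ∈ S.filter (· < i), t ≤ s := hmax
  obtain ⟨hs1, hs2⟩ := Finset.mem_filter.1 hs
  rw [hT.high _ (Nat.one_le_two_pow.trans (two_pow_le_word hs)) (word_lt fun t ht => by
    have := hS t (Finset.mem_filter.1 ht).1; omega), log_word hs hmax']
  exact ⟨hs1, hs2, fun t ht hti => hmax' t (Finset.mem_filter.2 ⟨ht, hti⟩)⟩

theorem no_pred {i : ℕ} (hi' : i ≤ L) (h : word S % p2 i = 0) : ∀ t ∈ S, i ≤ t := by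
  rw [hT.pow i (by omega), word_mod] at h
  intro t ht
  by_contra hti
  have := two_pow_le_word (S := S.filter (· < i)) (Finset.mem_filter.2 ⟨ht, by omega⟩)
  have := Nat.one_le_two_pow (n := t)
  simp only [h] at *
  omega

end Tables

/-- Fill the tables in the arrays `27`, `28`, `29`; their size goes to the scalar `20`. -/
def buildPow : Cmd :=
  .loop (.get 27 (.var 20) <ₑ .var 3 +ₑ .lit 2) (
    .store 27 (.var 20 +ₑ .lit 1) (.lit 2 *ₑ .get 27 (.var 20)) ;; 20 ≔ .var 20 +ₑ .lit 1)

/-- The table entries for the argument in the scalar `4`. -/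
def tableEntry : Cmd :=
  6 ≔ .var 4 /ₑ .lit 2 ;;
  .ite (.lit 1 <ₑ .var 4) (.store 28 (.var 4) (.get 28 (.var 6) +ₑ .lit 1))
    (.store 28 (.var 4) (.lit 0)) ;;
  .ite (.var 4 %ₑ .lit 2) (.store 29 (.var 4) (.lit 0))
    (.store 29 (.var 4) (.get 29 (.var 6) +ₑ .lit 1))

/-- Fill the tables in the arrays `27`, `28`, `29`; their size goes to the scalar `20`. -/
def buildTables : Cmd :=
  .store 27 (.lit 0) (.lit 1) ;; 20 ≔ .lit 0 ;; buildPow ;;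
  .store 27 (.var 20 +ₑ .lit 1) (.lit 2 *ₑ .get 27 (.var 20)) ;;
  5 ≔ .get 27 (.var 20 +ₑ .lit 1) ;; 4 ≔ .lit 1 ;;
  forUp 4 5 tableEntry

theorem buildPow_spec {K N : ℕ} (hK : 4 * (N + 2) < K) {s : Store} (h3 : s.var 3 = N)
    (h20 : s.var 20 = 0) (h27 : s.arr 27 0 = 1) {r : ℤ} (hr : 30 * (N : ℤ) + 90 ≤ r) :
    WP K buildPow s r fun s' r' => r - (30 * (N : ℤ) + 90) ≤ r' ∧ N + 2 ≤ 2 ^ s'.var 20 ∧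
      2 ^ s'.var 20 ≤ 2 * (N + 2) ∧ ∀ i ≤ s'.var 20, s'.arr 27 i = 2 ^ i := by
  refine WP.loop (fun s' r' => r - 30 * s'.var 20 ≤ r' ∧ 2 ^ s'.var 20 ≤ 2 * (N + 2) ∧
    ∀ i ≤ s'.var 20, s'.arr 27 i = 2 ^ i) ⟨by simp [h20], by simp [h20]; omega, ?_⟩ ?_
  · intro i hi
    rw [h20] at hi
    obtain rfl : i = 0 := by omega
    simp [h27]
  rintro s' r' hS ⟨g1, g2, g3⟩
  have v3 : s'.var 3 = N := (hS.1 3 (by decide)).trans h3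
  have hlt : s'.var 20 < 2 ^ s'.var 20 := Nat.lt_two_pow_self
  have hlt' : s'.var 20 < 2 * (N + 2) := by omega
  have hlog : s'.var 20 ≤ N + 2 := by
    rcases Nat.eq_zero_or_pos (s'.var 20) with h | h
    · omega
    · obtain ⟨l, hl⟩ : ∃ l, s'.var 20 = l + 1 := ⟨s'.var 20 - 1, by omega⟩
      have : l < 2 ^ l := Nat.lt_two_pow_self
      rw [hl, pow_succ] at g2
      omega
  refine ⟨by omega, ?_, ?_⟩
  · intro he
    simp only [Expr.eval, Op.apply, ite_one_zero_eq, v3, g3 _ le_rfl, not_lt] at he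
    exact ⟨by simp only [Expr.cost]; push_cast; omega, he, g2, g3⟩
  · intro he
    simp only [Expr.eval, Op.apply, ite_one_zero_ne, v3, g3 _ le_rfl] at he
    simp only [WP, Expr.Small, Expr.eval, Expr.cost, Op.apply, Store.var_setVar,
      Store.arr_setVar, Store.var_setArr, Store.arr_setArr, if_true, g3 _ le_rfl]
    refine ⟨by omega, by omega, by push_cast; omega, by rw [pow_succ]; omega, fun i hi => ?_⟩
    rcases Nat.le_succ_iff.1 hi with hi | rfl
    · rw [Function.update_of_ne (by omega), g3 i hi]
    · rw [Function.update_self, Nat.succ_eq_add_one, pow_succ, mul_comm]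

theorem buildTables_spec {K N : ℕ} (hK : 4 * (N + 2) < K) {s : Store} (h3 : s.var 3 = N) {r : ℤ}
    (hr : 300 * (N : ℤ) + 600 ≤ r) :
    WP K buildTables s r fun s' r' => r - (300 * (N : ℤ) + 600) ≤ r' ∧
      Tables N (s'.var 20) (s'.arr 27) (s'.arr 28) (s'.arr 29) := by
  simp only [buildTables, WP, Expr.Small, Expr.eval, Expr.cost, true_and]
  refine (buildPow_spec hK (by simp [Store.var_setVar, Store.var_setArr, h3])
    (by simp [Store.var_setVar]) (by simp [Store.arr_setVar, Store.arr_setArr])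
    (by push_cast; omega)).conseq ?_
  rintro s1 r1 ⟨g1, g2, g3, g4⟩ hS1
  generalize hLd : s1.var 20 = L at g2 g3 g4
  simp only [Op.apply, g4 L le_rfl]
  refine ⟨by omega, ?_⟩
  have hpL : 2 * 2 ^ L = 2 ^ (L + 1) := by rw [pow_succ, mul_comm]
  have hp1 := Nat.one_le_two_pow (n := L + 1)
  refine WP.forUp_sum (2 ^ (L + 1)) 1 (fun x s' => ∀ y, 1 ≤ y → y < x →
    s'.arr 28 y = Nat.log 2 y ∧ s'.arr 29 y = padicValNat 2 y) (fun _ => 30) (by omega) hp1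
    (by simp [Store.var_setVar]) (by simp [Store.var_setVar, Store.var_setArr, Store.arr_setArr,
      hLd, hpL]) (by decide) (by decide) (by decide)
    (fun y h1 h2 => by omega) ?_ ?_ ?_
  · simp only [Finset.sum_const, Nat.card_Ico, nsmul_eq_mul]
    push_cast [hp1] at g1 ⊢
    have : (2 : ℤ) ^ (L + 1) ≤ 4 * (N + 2) := by exact_mod_cast (show 2 ^ (L + 1) ≤ 4 * (N + 2) by omega)
    nlinarith
  · rintro x s' r' hx1 hx hx4 hS hI hr'
    have hlogx : Nat.log 2 x < x := Nat.log_lt_self 2 (by omega)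
    have hval : padicValNat 2 x ≤ Nat.log 2 x := padicValNat_le_nat_log _
    have q1 : x ≤ 1 → Nat.log 2 x = 0 := fun h => by
      obtain rfl : x = 1 := by omega
      simp
    have q2 : 1 < x → Nat.log 2 (x / 2) + 1 = Nat.log 2 x := fun h =>
      (Nat.log_of_one_lt_of_le (by norm_num) h).symm
    have q3 : x % 2 ≠ 0 → padicValNat 2 x = 0 := fun h =>
      padicValNat.eq_zero_of_not_dvd (by omega)
    have q4 : x % 2 = 0 → padicValNat 2 (x / 2) + 1 = padicValNat 2 x := fun h => by
      conv_rhs => rw [show x = 2 * (x / 2) by omega]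
      rw [padicValNat.mul (by norm_num) (by omega), padicValNat.self (by norm_num), add_comm]
    have hI' : x ≠ 1 → s'.arr 28 (x / 2) = Nat.log 2 (x / 2) ∧
        s'.arr 29 (x / 2) = padicValNat 2 (x / 2) := fun h => hI _ (by omega) (by omega)
    have fin : ∀ a b : ℕ, a = Nat.log 2 x → b = padicValNat 2 x → ∀ y, 1 ≤ y → y < x + 1 →
        Function.update (s'.arr 28) x a y = Nat.log 2 y ∧
        Function.update (s'.arr 29) x b y = padicValNat 2 y := by
      intro a b ha' hb' y hy1 hy
      rcases Nat.lt_succ_iff_lt_or_eq.1 hy with hy | rfl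
      · rw [Function.update_of_ne (by omega), Function.update_of_ne (by omega)]
        exact hI y hy1 hy
      · simp [ha', hb']
    simp only [tableEntry, WP, Expr.Small, Expr.eval, Expr.cost, Op.apply, true_and,
      Store.var_setVar, Store.arr_setVar, Store.var_setArr, Store.arr_setArr, Nat.reduceEqDiff,
      if_true, if_false, ite_one_zero_ne, ite_one_zero_eq, hx4]
    refine ⟨by omega, fun h1 => ⟨?_, fun h2 => ⟨by push_cast at *; omega,
        fin (s'.arr 28 (x / 2) + 1) 0 (by rw [(hI' (by omega)).1, q2 h1]) (q3 h2).symm⟩,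
      fun h2 => ⟨?_, by push_cast at *; omega, fin (s'.arr 28 (x / 2) + 1)
        (s'.arr 29 (x / 2) + 1) (by rw [(hI' (by omega)).1, q2 h1]) (by rw [(hI' (by omega)).2, q4 h2])⟩⟩,
      fun h1 => ⟨fun h2 => ⟨by push_cast at *; omega, fin _ _ (q1 (by omega)).symm
        (q3 h2).symm⟩, fun h2 => by omega⟩⟩
    · rw [(hI' (by omega)).1, q2 h1]; omega
    · rw [(hI' (by omega)).2, q4 h2]; omega
  · rintro s' r' hrr hx4 hS hI
    have e20 : s'.var 20 = L := (hS.1 20 (by decide)).trans (by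
      simp [Store.var_setVar, Store.var_setArr, hLd])
    rw [e20]
    refine ⟨?_, g2, g3, ?_, fun x h1 h2 => (hI x h1 h2).1, fun x h1 h2 => (hI x h1 h2).2⟩
    · simp only [Finset.sum_const, Nat.card_Ico, nsmul_eq_mul] at hrr
      push_cast [hp1] at g1 hrr
      have : (2 : ℤ) ^ (L + 1) ≤ 4 * (N + 2) := by exact_mod_cast (show 2 ^ (L + 1) ≤ 4 * (N + 2) by omega)
      nlinarith
    · intro i hi
      rw [hS.2 27 (by decide)]
      simp only [Store.arr_setVar, Store.arr_setArr, Store.var_setArr, if_true, hLd]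
      rcases Nat.le_succ_iff.1 hi with hi | rfl
      · rw [Function.update_of_ne (by omega), g4 i hi]
      · rw [Function.update_self, hpL]

/-! ### Staircases -/

/-- `S` is the staircase of `K` on `{i₀, …, L}`: it contains `L`, and each element `s` maximizes `K`
on the elements above the predecessor of `s` in `S`.  In particular the lowest element of `S`
maximizes `K`. -/
structure Stair (i₀ L : ℕ) (S : Finset ℕ) (K : ℕ → ℚ) : Prop where
  top : L ∈ S
  le : ∀ s ∈ S, s ≤ L
  ge : ∀ s ∈ S, i₀ ≤ s
  max : ∀ s ∈ S, ∀ j, i₀ ≤ j → j ≤ L → (∀ p ∈ S, p < s → p < j) → K j ≤ K s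

namespace Stair

variable {i₀ L : ℕ} {S : Finset ℕ} {K K' : ℕ → ℚ}

theorem max_low (h : Stair i₀ L S K) {s : ℕ} (hs : s ∈ S) (hmin : ∀ t ∈ S, s ≤ t) {j : ℕ}
    (hj : i₀ ≤ j) (hjL : j ≤ L) : K j ≤ K s :=
  h.max s hs j hj hjL fun p hp hps => absurd (hmin p hp) (by omega)

theorem congr (h : Stair i₀ L S K) (hK : ∀ j ≤ L, K' j = K j) : Stair i₀ L S K' where
  top := h.top
  le := h.le
  ge := h.ge
  max s hs j hj hjL hp := by rw [hK j hjL, hK s (h.le s hs)]; exact h.max s hs j hj hjL hp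

/-- Removing the lowest element leaves the staircase of the part above it. -/
theorem erase_low (h : Stair i₀ L S K) {s : ℕ} (hs : s ∈ S) (hmin : ∀ t ∈ S, s ≤ t) (hsL : s < L)
    (hK : ∀ j, s < j → j ≤ L → K' j = K j) : Stair (s + 1) L (S.erase s) K' where
  top := Finset.mem_erase.2 ⟨by omega, h.top⟩
  le t ht := h.le t (Finset.mem_of_mem_erase ht)
  ge t ht := by
    have := hmin t (Finset.mem_of_mem_erase ht)
    have := Finset.ne_of_mem_erase ht
    omega
  max t ht j hj hjL hp := by
    have h1 := hmin t (Finset.mem_of_mem_erase ht)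
    have h2 := Finset.ne_of_mem_erase ht
    rw [hK j (by omega) hjL, hK t (by omega) (h.le t (Finset.mem_of_mem_erase ht))]
    have h3 := h.ge s hs
    refine h.max t (Finset.mem_of_mem_erase ht) j (by omega) hjL fun p hpS hpt => ?_
    rcases eq_or_ne p s with rfl | hps
    · omega
    · exact hp p (Finset.mem_erase.2 ⟨hps, hpS⟩) hpt

/-- Extending a staircase downwards by a new maximum. -/
theorem cons (h : Stair (i₀ + 1) L S K) {s : ℕ} (hs : s ∈ S) (hmin : ∀ t ∈ S, s ≤ t)
    (hK : K s < K i₀) (hi : i₀ ≤ L) : Stair i₀ L (insert i₀ S) K where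
  top := Finset.mem_insert_of_mem h.top
  le t ht := by
    rcases Finset.mem_insert.1 ht with rfl | ht
    · exact hi
    · exact h.le t ht
  ge t ht := by
    rcases Finset.mem_insert.1 ht with rfl | ht
    · exact le_rfl
    · have := h.ge t ht; omega
  max t ht j hj hjL hp := by
    rcases Finset.mem_insert.1 ht with rfl | ht
    · rcases hj.eq_or_lt with rfl | hj
      · exact le_rfl
      · exact (h.max_low hs hmin hj hjL).trans hK.le
    · have h1 := h.ge t ht
      have h2 := hp i₀ (Finset.mem_insert_self _ _) (by omega)
      exact h.max t ht j (by omega) hjL fun p hpS => hp p (Finset.mem_insert_of_mem hpS)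

/-- Extending a staircase downwards by something that is not a new maximum. -/
theorem skip (h : Stair (i₀ + 1) L S K) {s : ℕ} (hs : s ∈ S) (hmin : ∀ t ∈ S, s ≤ t)
    (hK : K i₀ ≤ K s) : Stair i₀ L S K where
  top := h.top
  le := h.le
  ge t ht := by have := h.ge t ht; omega
  max t ht j hj hjL hp := by
    rcases hj.eq_or_lt with rfl | hj
    · rcases (hmin t ht).eq_or_lt with rfl | hst
      · exact hK
      · have := hp s hs hst
        have := h.ge s hs
        omega
    · exact h.max t ht j hj hjL hp

/-- The staircase survives an increase at `i` that does not exceed the next step. -/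
theorem raise_below (h : Stair i₀ L S K) {i s : ℕ} (hK : ∀ j, j ≠ i → K' j = K j)
    (hs : s ∈ S) (his : i < s) (hmin : ∀ t ∈ S, i ≤ t → s ≤ t) (hi : K' i ≤ K' s) :
    Stair i₀ L S K' where
  top := h.top
  le := h.le
  ge := h.ge
  max t ht j hj hjL hp := by
    have hiS : i ∉ S := fun hiS => by have := hmin i hiS le_rfl; omega
    have ht' : t ≠ i := fun h => hiS (h ▸ ht)
    rw [hK t ht']
    rcases eq_or_ne j i with rfl | hji
    · refine hi.trans ?_
      rw [hK s (by omega)]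
      refine h.max t ht s (by have := h.ge s hs; omega) (h.le s hs) fun p hpS hpt => ?_
      have := hp p hpS hpt
      omega
    · rw [hK j hji]
      exact h.max t ht j hj hjL hp

end Stair

/-- The state of a staircase while the steps below `i` that do not exceed the increased value at `i`
are being removed: only the comparison of lower steps with `i` may fail. -/
structure StairExcept (i L : ℕ) (S : Finset ℕ) (K : ℕ → ℚ) : Prop where
  top : L ∈ S
  le : ∀ s ∈ S, s ≤ L
  mem : i ∈ S
  max : ∀ s ∈ S, ∀ j ≤ L, (j = i → i ≤ s) → (∀ p ∈ S, p < s → p < j) → K j ≤ K s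

namespace StairExcept

variable {i L : ℕ} {S : Finset ℕ} {K K' : ℕ → ℚ}

/-- After an increase at `i` beyond the next step, `i` becomes a step. -/
theorem of_raise (h : Stair 0 L S K) (hi : i ≤ L) {s : ℕ} (hK : ∀ j, j ≠ i → K' j = K j)
    (hKi : K i ≤ K' i)
    (hs : s ∈ S) (his : i ≤ s) (hmin : ∀ t ∈ S, i ≤ t → s ≤ t) (hsi : s = i ∨ K' s < K' i) :
    StairExcept i L (insert i S) K' where
  top := Finset.mem_insert_of_mem h.top
  le t ht := by
    rcases Finset.mem_insert.1 ht with rfl | ht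
    · exact hi
    · exact h.le t ht
  mem := Finset.mem_insert_self _ _
  max t ht j hjL hji hp := by
    have hKs : K s ≤ K' i := by
      rcases hsi with rfl | h'
      · exact hKi
      · rcases eq_or_ne s i with rfl | hne
        · exact hKi
        · rw [← hK s hne]; exact h'.le
    rcases eq_or_ne t i with rfl | hti
    · rcases eq_or_ne j t with rfl | hjt
      · exact le_rfl
      rw [hK j hjt]
      refine le_trans (h.max s hs j (Nat.zero_le _) hjL fun p hpS hps => ?_) hKs
      refine hp p (Finset.mem_insert_of_mem hpS) ?_
      by_contra hpt
      have := hmin p hpS (by omega)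
      omega
    · have htS : t ∈ S := Finset.mem_of_mem_insert_of_ne ht hti
      rw [hK t hti]
      rcases eq_or_ne j i with rfl | hne
      · have h1 := hji rfl
        exact absurd (hp j (Finset.mem_insert_self _ _) (by omega)) (by omega)
      · rw [hK j hne]
        exact h.max t htS j (Nat.zero_le _) hjL fun p hpS => hp p (Finset.mem_insert_of_mem hpS)

/-- A step below `i` that does not exceed the value at `i` can be removed. -/
theorem pop (h : StairExcept i L S K) {p : ℕ} (hpi : p < i)
    (hmax : ∀ t ∈ S, t < i → t ≤ p) (hK : K p ≤ K i) (hpS : p ∈ S) (hiL : i ≤ L) :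
    StairExcept i L (S.erase p) K where
  top := Finset.mem_erase.2 ⟨by omega, h.top⟩
  le t ht := h.le t (Finset.mem_of_mem_erase ht)
  mem := Finset.mem_erase.2 ⟨by omega, h.mem⟩
  max t ht j hjL hji hp := by
    have htS := Finset.mem_of_mem_erase ht
    rcases lt_or_ge p j with hpj | hpj
    · refine h.max t htS j hjL hji fun q hq hqt => ?_
      rcases eq_or_ne q p with rfl | hqp
      · exact hpj
      · exact hp q (Finset.mem_erase.2 ⟨hqp, hq⟩) hqt
    · rcases lt_trichotomy t i with hti | rfl | hti
      · have h1 := hmax t htS hti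
        have h2 := Finset.ne_of_mem_erase ht
        exact h.max t htS j hjL hji fun q hq hqt => hp q (Finset.mem_erase.2 ⟨by omega, hq⟩) hqt
      · refine le_trans (h.max p hpS j hjL (fun hj => by omega) fun q hq hqp => ?_) hK
        exact hp q (Finset.mem_erase.2 ⟨by omega, hq⟩) (by omega)
      · have := hp i (Finset.mem_erase.2 ⟨by omega, h.mem⟩) hti
        omega

/-- When all lower steps exceed the value at `i`, the staircase is restored. -/
theorem stair (h : StairExcept i L S K)
    (hp : (∀ t ∈ S, i ≤ t) ∨ ∃ p ∈ S, p < i ∧ (∀ t ∈ S, t < i → t ≤ p) ∧ K i ≤ K p)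
    (hiL : i ≤ L) : Stair 0 L S K where
  top := h.top
  le := h.le
  ge _ _ := Nat.zero_le _
  max t ht j _ hjL hpj := by
    rcases eq_or_ne j i with rfl | hne
    · rcases le_or_gt j t with hjt | hjt
      · exact h.max t ht j hjL (fun _ => hjt) hpj
      · rcases hp with hp | ⟨p, hpS, hp1, hp2, hp3⟩
        · have := hp t ht; omega
        · refine hp3.trans (h.max t ht p (h.le p hpS) (fun h => by omega) fun q hq hqt => ?_)
          have := hp2 t ht hjt
          omega
    · exact h.max t ht j hjL (fun h => absurd h hne) hpj

end StairExcept


/-! ### Groups of vertices with equal denominators -/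

/-- The stacks of a priority queue whose keys are the fractions `cur u / den u`.  Stack `b * R + a`
receives `u` when `den u = b` and `cur u` becomes `a`; entries become stale when `cur u` is raised or
`u` dies.  A vertex is alive if `cur u` is positive and `dead u` is zero.  The maximal `cur u` among
the vertices alive with `den u = b` is `q b`, and it is witnessed by the top of its stack. -/
structure Buckets (n B R : ℕ) (den cur dead : ℕ → ℕ) (st : ℕ → List ℕ) (q : ℕ → ℕ) : Prop where
  bd : ∀ u < n, 0 < cur u → 1 ≤ den u ∧ den u ≤ B ∧ den u ≤ cur u ∧ cur u ≤ 3 * den u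
  mem : ∀ i, ∀ u ∈ st i, u < n ∧ den u * R < i ∧ i ≤ den u * R + cur u
  nodup : ∀ i, (st i).Nodup
  live : ∀ u < n, 0 < cur u → dead u = 0 → u ∈ st (den u * R + cur u) ∧ cur u ≤ q (den u)
  top : ∀ b, 0 < q b → ∃ u, (st (b * R + q b)).getLast? = some u ∧ u < n ∧ dead u = 0 ∧
    den u = b ∧ cur u = q b

/-- The state while the new maximum of the group `b` is searched for at `a` and below. -/
structure BucketsScan (n B R : ℕ) (den cur dead : ℕ → ℕ) (st : ℕ → List ℕ) (q : ℕ → ℕ)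
    (b a : ℕ) : Prop where
  bd : ∀ u < n, 0 < cur u → 1 ≤ den u ∧ den u ≤ B ∧ den u ≤ cur u ∧ cur u ≤ 3 * den u
  mem : ∀ i, ∀ u ∈ st i, u < n ∧ den u * R < i ∧ i ≤ den u * R + cur u
  nodup : ∀ i, (st i).Nodup
  live : ∀ u < n, 0 < cur u → dead u = 0 → u ∈ st (den u * R + cur u) ∧
    (den u = b → cur u ≤ a) ∧ (den u ≠ b → cur u ≤ q (den u))
  top : ∀ b', b' ≠ b → 0 < q b' → ∃ u, (st (b' * R + q b')).getLast? = some u ∧ u < n ∧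
    dead u = 0 ∧ den u = b' ∧ cur u = q b'

theorem sid_inj {R b b' a a' : ℕ} (ha : a < R) (ha' : a' < R) (h : b * R + a = b' * R + a') :
    b = b' ∧ a = a' := by
  have h1 : (b * R + a) / R = (b' * R + a') / R := by rw [h]
  rw [mul_comm b, mul_comm b', Nat.mul_add_div (by omega), Nat.mul_add_div (by omega),
    Nat.div_eq_of_lt ha, Nat.div_eq_of_lt ha'] at h1
  have h2 : b = b' := by omega
  subst h2
  exact ⟨rfl, by omega⟩

section Buckets

variable {n B R : ℕ} {den cur dead q : ℕ → ℕ} {st : ℕ → List ℕ}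

theorem Buckets.scan (h : Buckets n B R den cur dead st q) {b u : ℕ} (hden : den u = b) :
    BucketsScan n B R den cur (Function.update dead u 1) st q b (q b) where
  bd := h.bd
  mem := h.mem
  nodup := h.nodup
  live x hx hx0 hxd := by
    have hxu : x ≠ u := by rintro rfl; simp at hxd
    rw [Function.update_of_ne hxu] at hxd
    obtain ⟨h1, h2⟩ := h.live x hx hx0 hxd
    exact ⟨h1, fun hb => hb ▸ h2, fun _ => h2⟩
  top b' hb' hq := by
    obtain ⟨x, h1, h2, h3, h4, h5⟩ := h.top b' hq
    exact ⟨x, h1, h2, by rw [Function.update_of_ne (by rintro rfl; omega)]; exact h3, h4, h5⟩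

/-- The stack number determines the denominator of its entries, since numerators are below `R`. -/
theorem bucket_mem (hR : R = 3 * B + 1)
    (hbd : ∀ u < n, 0 < cur u → 1 ≤ den u ∧ den u ≤ B ∧ den u ≤ cur u ∧ cur u ≤ 3 * den u)
    (hmem : ∀ i, ∀ u ∈ st i, u < n ∧ den u * R < i ∧ i ≤ den u * R + cur u) {b a u : ℕ} (ha : a < R)
    (hu : u ∈ st (b * R + a)) : u < n ∧ den u = b ∧ 0 < a ∧ a ≤ cur u := by
  obtain ⟨h1, h2, h3⟩ := hmem _ _ hu
  obtain ⟨h4, h5, h6, h7⟩ := hbd u h1 (by omega)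
  have h8 := sid_inj (b := b) (b' := den u) (a := a) (a' := b * R + a - den u * R) ha (by omega)
    (by omega)
  refine ⟨h1, h8.1.symm, ?_, ?_⟩
  · rw [h8.1] at h2; omega
  · rw [h8.1] at h3; omega

/-- A stale entry on top of a stack can be removed. -/
theorem BucketsScan.pop (hR : R = 3 * B + 1) {b a u : ℕ}
    (h : BucketsScan n B R den cur dead st q b a) (ha : a < R)
    (hu : (st (b * R + a)).getLast? = some u) (hs : dead u ≠ 0 ∨ a < cur u) :
    BucketsScan n B R den cur dead
      (fun i => if i = b * R + a then (st (b * R + a)).dropLast else st i) q b a where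
  bd := h.bd
  mem i x hx := by
    split at hx
    · rename_i hi
      exact hi ▸ h.mem _ x (List.mem_of_mem_dropLast hx)
    · exact h.mem i x hx
  nodup i := by
    split
    · exact (h.nodup _).sublist (List.dropLast_sublist _)
    · exact h.nodup i
  live x hx hx0 hxd := by
    obtain ⟨h1, h2⟩ := h.live x hx hx0 hxd
    refine ⟨?_, h2⟩
    split
    · rename_i hi
      obtain ⟨_, h4, _, h5⟩ := h.bd x hx hx0
      obtain ⟨h6, h7⟩ := sid_inj (by omega) ha hi
      rw [hi] at h1
      have hne : st (b * R + a) ≠ [] := List.ne_nil_of_mem h1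
      rw [← List.dropLast_append_getLast hne, List.mem_append, List.mem_singleton] at h1
      rcases h1 with h1 | h1
      · exact h1
      · rw [List.getLast?_eq_some_getLast hne] at hu
        have : x = u := h1.trans (Option.some.inj hu)
        subst this
        omega
    · exact h1
  top b' hb' hq := by
    obtain ⟨x, h1, h2, h3, h4, h5⟩ := h.top b' hb' hq
    refine ⟨x, ?_, h2, h3, h4, h5⟩
    obtain ⟨_, h6, _, h7⟩ := h.bd x h2 (by omega)
    rw [if_neg]
    · exact h1
    · intro hi
      exact hb' (sid_inj (by omega) ha hi).1

theorem BucketsScan.down {b a : ℕ} (h : BucketsScan n B R den cur dead st q b a)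
    (he : st (b * R + a) = []) : BucketsScan n B R den cur dead st q b (a - 1) where
  bd := h.bd
  mem := h.mem
  nodup := h.nodup
  live x hx hx0 hxd := by
    obtain ⟨h1, h2, h3⟩ := h.live x hx hx0 hxd
    refine ⟨h1, fun hb => ?_, h3⟩
    rcases (h2 hb).eq_or_lt with h4 | h4
    · rw [hb, h4, he] at h1; simp at h1
    · omega
  top := h.top

theorem BucketsScan.finish {b a u : ℕ} (h : BucketsScan n B R den cur dead st q b a)
    (hu : (st (b * R + a)).getLast? = some u) (hn : u < n) (hb : den u = b) (hd : dead u = 0)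
    (hc : cur u = a) :
    Buckets n B R den cur dead st (Function.update q b a) where
  bd := h.bd
  mem := h.mem
  nodup := h.nodup
  live x hx hx0 hxd := by
    obtain ⟨h1, h2, h3⟩ := h.live x hx hx0 hxd
    refine ⟨h1, ?_⟩
    rcases eq_or_ne (den x) b with h4 | h4
    · rw [h4, Function.update_self]; exact h2 h4
    · rw [Function.update_of_ne h4]; exact h3 h4
  top b' hq := by
    rcases eq_or_ne b' b with rfl | h4
    · exact ⟨u, by rw [Function.update_self]; exact ⟨hu, hn, hd, hb, hc⟩⟩
    · rw [Function.update_of_ne h4] at hq ⊢; exact h.top b' h4 hq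

theorem BucketsScan.finish_empty {b a : ℕ} (h : BucketsScan n B R den cur dead st q b a)
    (he : st (b * R + a) = []) (hab : a ≤ b) :
    Buckets n B R den cur dead st (Function.update q b 0) where
  bd := h.bd
  mem := h.mem
  nodup := h.nodup
  live x hx hx0 hxd := by
    obtain ⟨h1, h2, h3⟩ := h.live x hx hx0 hxd
    refine ⟨h1, ?_⟩
    rcases eq_or_ne (den x) b with h4 | h4
    · have h5 := h2 h4
      have h6 := h.bd x hx hx0
      rw [h4, show cur x = a by omega, he] at h1
      simp at h1
    · rw [Function.update_of_ne h4]; exact h3 h4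
  top b' hq := by
    rcases eq_or_ne b' b with rfl | h4
    · simp at hq
    · rw [Function.update_of_ne h4] at hq ⊢; exact h.top b' h4 hq

/-- Raising a numerator: the old stack entry stays behind as a stale one. -/
theorem Buckets.raise (hR : R = 3 * B + 1) (h : Buckets n B R den cur dead st q) {v a : ℕ}
    (hv : v < n) (hd : dead v = 0) (hca : cur v < a) (h1 : 1 ≤ den v) (h2 : den v ≤ B)
    (h3 : den v ≤ a) (h4 : a ≤ 3 * den v) :
    Buckets n B R den (Function.update cur v a) dead
      (fun i => if i = den v * R + a then st (den v * R + a) ++ [v] else st i)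
      (Function.update q (den v) (max (q (den v)) a)) where
  bd u hu hu0 := by
    rcases eq_or_ne u v with rfl | huv
    · simp; omega
    · rw [Function.update_of_ne huv] at *; exact h.bd u hu hu0
  mem i u hu := by
    have key : ∀ i, u ∈ st i → u < n ∧ den u * R < i ∧ i ≤ den u * R + Function.update cur v a u := by
      intro i hi
      obtain ⟨g1, g2, g3⟩ := h.mem i u hi
      refine ⟨g1, g2, ?_⟩
      rcases eq_or_ne u v with rfl | huv
      · simp; omega
      · rwa [Function.update_of_ne huv]
    split at hu
    · rename_i hi
      rcases List.mem_append.1 hu with hu | hu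
      · exact hi ▸ key _ hu
      · rw [List.mem_singleton] at hu
        subst hu
        simp; omega
    · exact key i hu
  nodup i := by
    split
    · refine List.nodup_append.2 ⟨h.nodup _, by simp, ?_⟩
      rintro x hx y hy rfl
      rw [List.mem_singleton] at hy
      subst hy
      have := h.mem _ _ hx
      omega
    · exact h.nodup i
  live u hu hu0 hud := by
    rcases eq_or_ne u v with rfl | huv
    · simp
    · rw [Function.update_of_ne huv] at *
      obtain ⟨g1, g2⟩ := h.live u hu hu0 hud
      refine ⟨?_, ?_⟩
      · split
        · rename_i hi
          rw [← hi]; simp [g1]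
        · exact g1
      · rcases eq_or_ne (den u) (den v) with he | he
        · rw [he, Function.update_self, ← he]; exact g2.trans (le_max_left _ _)
        · rwa [Function.update_of_ne he]
  top b hq := by
    have hsid : ∀ b' a', a' < R → b' * R + a' = den v * R + a → b' = den v ∧ a' = a :=
      fun b' a' ha' he => sid_inj ha' (by omega) he
    rcases eq_or_ne b (den v) with rfl | hb
    · rw [Function.update_self]
      rcases le_or_gt (q (den v)) a with hqa | hqa
      · rw [max_eq_right hqa]
        exact ⟨v, by simp, hv, hd, rfl, by simp⟩
      · rw [max_eq_left hqa.le]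
        obtain ⟨u, g1, g2, g3, g4, g5⟩ := h.top (den v) (by omega)
        obtain ⟨_, g6, _, g7⟩ := h.bd u g2 (by omega)
        have huv : u ≠ v := by rintro rfl; omega
        refine ⟨u, ?_, g2, g3, g4, by rwa [Function.update_of_ne huv]⟩
        rw [if_neg (fun he => by have := (hsid _ _ (by omega) he).2; omega)]
        exact g1
    · rw [Function.update_of_ne hb] at hq ⊢
      obtain ⟨u, g1, g2, g3, g4, g5⟩ := h.top b hq
      obtain ⟨_, g6, _, g7⟩ := h.bd u g2 (by omega)
      have huv : u ≠ v := by rintro rfl; omega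
      refine ⟨u, ?_, g2, g3, g4, by rwa [Function.update_of_ne huv]⟩
      rw [if_neg (fun he => hb (hsid _ _ (by omega) he).1)]
      exact g1

theorem Buckets.q_lt (hR : R = 3 * B + 1) (h : Buckets n B R den cur dead st q) (b : ℕ) :
    q b < R ∧ q b ≤ 3 * b ∧ (0 < q b → 1 ≤ b ∧ b ≤ B ∧ b ≤ q b) := by
  rcases Nat.eq_zero_or_pos (q b) with hq | hq
  · omega
  · obtain ⟨u, _, h2, _, h4, h5⟩ := h.top b hq
    have := h.bd u h2 (by omega)
    omega

end Buckets

/-! ### Classes of groups -/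

/-- The maximal key of the group `b`. -/
def key (q : ℕ → ℕ) (b : ℕ) : ℚ := (q b : ℚ) / b

theorem key_lt_key {q : ℕ → ℕ} {b b' : ℕ} (hb : 0 < b) (hb' : 0 < b') :
    key q b < key q b' ↔ q b * b' < q b' * b := by
  rw [key, key, div_lt_div_iff₀ (by exact_mod_cast hb) (by exact_mod_cast hb')]
  norm_cast

theorem key_le_key {q : ℕ → ℕ} {b b' : ℕ} (hb : 0 < b) (hb' : 0 < b') :
    key q b ≤ key q b' ↔ q b * b' ≤ q b' * b := by
  rw [← not_lt, key_lt_key hb' hb, not_lt]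

theorem key_congr {q q' : ℕ → ℕ} {b : ℕ} (h : q' b = q b) : key q' b = key q b := by
  rw [key, key, h]

/-- The champion `ch i` of the class `i` has a maximal key among the groups `b` with
`2 ^ i ≤ b < 2 ^ (i + 1)`. -/
def Champion (q ch : ℕ → ℕ) (i : ℕ) : Prop :=
  2 ^ i ≤ ch i ∧ ch i < 2 ^ (i + 1) ∧
    ∀ b, 2 ^ i ≤ b → b < 2 ^ (i + 1) → key q b ≤ key q (ch i)

theorem Champion.pos {q ch : ℕ → ℕ} {i : ℕ} (h : Champion q ch i) : 0 < ch i :=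
  lt_of_lt_of_le (Nat.pos_of_ne_zero (by simp)) h.1

theorem log_eq_of_class {b i : ℕ} (h1 : 2 ^ i ≤ b) (h2 : b < 2 ^ (i + 1)) : Nat.log 2 b = i :=
  Nat.log_eq_of_pow_le_of_lt_pow h1 h2

theorem class_log {b : ℕ} (hb : 1 ≤ b) : 2 ^ Nat.log 2 b ≤ b ∧ b < 2 ^ (Nat.log 2 b + 1) :=
  ⟨Nat.pow_log_le_self 2 (by omega), Nat.lt_pow_succ_log_self (by norm_num) b⟩

/-- The state of the priority queue in the arrays `19` (denominators), `20` (numerators), `21` (flags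
of the dead vertices), `23` and `24` (stacks), `25` (maxima of the groups) and `26` (champions of the
classes).  The scalar `22` holds the staircase of the keys of the champions. -/
structure Queue (n N L : ℕ) (S : Finset ℕ) (s : Store) : Prop where
  v0 : s.var 0 = n
  v20 : s.var 20 = L
  v21 : s.var 21 = 3 * (N + 1) + 1
  tables : Tables N L (s.arr 27) (s.arr 28) (s.arr 29)
  buckets : Buckets n (N + 1) (3 * (N + 1) + 1) (s.arr 19) (s.arr 20) (s.arr 21)
    (rd (s.arr 23) (s.arr 24) n) (s.arr 25)
  champ : ∀ i ≤ L, Champion (s.arr 25) (s.arr 26) i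
  v22 : s.var 22 = word S
  stair : Stair 0 L S fun i => key (s.arr 25) (s.arr 26 i)

/-- The potential of the priority queue: the number of stack entries and of steps of the
staircase. -/
def pot (N : ℕ) (S : Finset ℕ) (s : Store) : ℕ :=
  ∑ i ∈ Finset.range ((N + 2) * (3 * (N + 1) + 1)), s.arr 24 i + S.card

theorem sum_update_succ {H : ℕ → ℕ} {i M : ℕ} (hi : i < M) :
    ∑ j ∈ Finset.range M, Function.update H i (H i + 1) j = ∑ j ∈ Finset.range M, H j + 1 := by
  rw [← Finset.add_sum_erase _ _ (Finset.mem_range.2 hi),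
    ← Finset.add_sum_erase (Finset.range M) H (Finset.mem_range.2 hi), Function.update_self,
    Finset.sum_congr rfl fun j hj => Function.update_of_ne (Finset.ne_of_mem_erase hj) _ H]
  ring

theorem sum_update_pred {H : ℕ → ℕ} {i M : ℕ} (hi : i < M) (h : 0 < H i) :
    ∑ j ∈ Finset.range M, Function.update H i (H i - 1) j + 1 = ∑ j ∈ Finset.range M, H j := by
  rw [← Finset.add_sum_erase _ _ (Finset.mem_range.2 hi),
    ← Finset.add_sum_erase (Finset.range M) H (Finset.mem_range.2 hi), Function.update_self,
    Finset.sum_congr rfl fun j hj => Function.update_of_ne (Finset.ne_of_mem_erase hj) _ H]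
  rw [add_right_comm, Nat.sub_add_cancel h]

theorem sid_lt {N b a : ℕ} (hb : b ≤ N + 1) (ha : a < 3 * (N + 1) + 1) :
    b * (3 * (N + 1) + 1) + a < (N + 2) * (3 * (N + 1) + 1) := by
  have := Nat.mul_le_mul_right (3 * (N + 1) + 1) hb
  have h2 : (N + 2) * (3 * (N + 1) + 1) = (N + 1) * (3 * (N + 1) + 1) + (3 * (N + 1) + 1) := by ring
  omega

/-- Set the numerator of the vertex in the scalar `30` to the scalar `32` and push the vertex. -/
def raiseBucket : Cmd :=
  31 ≔ .get 19 (.var 30) ;; .store 20 (.var 30) (.var 32) ;;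
  33 ≔ .var 31 *ₑ .var 21 +ₑ .var 32 ;; push 23 24 (.var 0) (.var 33) (.var 30) ;;
  .ite (.get 25 (.var 31) <ₑ .var 32) (.store 25 (.var 31) (.var 32)) .skip

/-- Adjust the champion of the class of the group in the scalar `31`. -/
def raiseClass : Cmd :=
  33 ≔ .get 28 (.var 31) ;; 34 ≔ .get 26 (.var 33) ;;
  .ite (.get 25 (.var 34) *ₑ .var 31 <ₑ .get 25 (.var 31) *ₑ .var 34)
    (.store 26 (.var 33) (.var 31)) .skip

/-- Remove the steps below the class in the scalar `33` that do not exceed the key of the group in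
the scalar `34`. -/
def popSteps : Cmd :=
  .loop (.var 37) (
    38 ≔ .var 22 %ₑ .get 27 (.var 33) ;;
    .ite (.var 38) (
      38 ≔ .get 28 (.var 38) ;; 36 ≔ .get 26 (.var 38) ;;
      .ite (.get 25 (.var 34) *ₑ .var 36 <ₑ .get 25 (.var 36) *ₑ .var 34) (37 ≔ .lit 0)
        (22 ≔ .var 22 -ₑ .get 27 (.var 38)))
    (37 ≔ .lit 0))

/-- Adjust the staircase after an increase in the class in the scalar `33`. -/
def raiseStair : Cmd :=
  35 ≔ .var 33 +ₑ .get 29 (.var 22 /ₑ .get 27 (.var 33)) ;;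
  34 ≔ .get 26 (.var 33) ;; 36 ≔ .get 26 (.var 35) ;; 37 ≔ .var 35 =ₑ .var 33 ;;
  .ite (.var 37 +ₑ (.get 25 (.var 36) *ₑ .var 34 <ₑ .get 25 (.var 34) *ₑ .var 36)) (
      .ite (.var 37) .skip (22 ≔ .var 22 +ₑ .get 27 (.var 33)) ;; 37 ≔ .lit 1 ;; popSteps)
    .skip

/-- Raise the numerator of the vertex in the scalar `30` to the scalar `32`. -/
def touch : Cmd := raiseBucket ;; raiseClass ;; raiseStair

theorem raiseBucket_spec {K n N v a : ℕ} (hK : (N + 2) * (3 * (N + 1) + 1) < K) (hnK : n < K)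
    {s : Store} (h0 : s.var 0 = n) (h21 : s.var 21 = 3 * (N + 1) + 1)
    (hB : Buckets n (N + 1) (3 * (N + 1) + 1) (s.arr 19) (s.arr 20) (s.arr 21)
      (rd (s.arr 23) (s.arr 24) n) (s.arr 25)) (h30 : s.var 30 = v) (h32 : s.var 32 = a)
    (hv : v < n) (hd : s.arr 21 v = 0) (hca : s.arr 20 v < a) (h1 : 1 ≤ s.arr 19 v)
    (h2 : s.arr 19 v ≤ N + 1) (h3 : s.arr 19 v ≤ a) (h4 : a ≤ 3 * s.arr 19 v) {r : ℤ} :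
    WP K raiseBucket s r fun s' r' => r - 60 ≤ r' ∧ s'.arr 20 = Function.update (s.arr 20) v a ∧
      s'.var 31 = s.arr 19 v ∧
      Buckets n (N + 1) (3 * (N + 1) + 1) (s'.arr 19) (s'.arr 20) (s'.arr 21)
        (rd (s'.arr 23) (s'.arr 24) n) (s'.arr 25) ∧
      s'.arr 25 = Function.update (s.arr 25) (s.arr 19 v) (max (s.arr 25 (s.arr 19 v)) a) ∧
      ∑ i ∈ Finset.range ((N + 2) * (3 * (N + 1) + 1)), s'.arr 24 i =
        ∑ i ∈ Finset.range ((N + 2) * (3 * (N + 1) + 1)), s.arr 24 i + 1 := by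
  have hR : 3 * (N + 1) + 1 = 3 * (N + 1) + 1 := rfl
  have hsid := sid_lt h2 (show a < 3 * (N + 1) + 1 by omega)
  have hB' := hB.raise hR hv hd hca h1 h2 h3 h4
  have hlen : ∀ i, s.arr 24 i ≤ n := fun i => by
    have := length_le_of_nodup_lt (hB.nodup i) (fun x hx => (hB.mem i x hx).1)
    simpa using this
  have hlt : s.arr 24 (s.arr 19 v * (3 * (N + 1) + 1) + a) < n := by
    have := length_le_of_nodup_lt (hB'.nodup (s.arr 19 v * (3 * (N + 1) + 1) + a))
      (fun x hx => (hB'.mem _ x hx).1)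
    simp at this
    omega
  have hrd : (rd (Function.update (s.arr 23) ((s.arr 19 v * (3 * (N + 1) + 1) + a) * n +
      s.arr 24 (s.arr 19 v * (3 * (N + 1) + 1) + a)) v)
      (Function.update (s.arr 24) (s.arr 19 v * (3 * (N + 1) + 1) + a)
        (s.arr 24 (s.arr 19 v * (3 * (N + 1) + 1) + a) + 1)) n) =
      fun i => if i = s.arr 19 v * (3 * (N + 1) + 1) + a then
        rd (s.arr 23) (s.arr 24) n (s.arr 19 v * (3 * (N + 1) + 1) + a) ++ [v] else
        rd (s.arr 23) (s.arr 24) n i := by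
    funext i
    exact rd_push hlt (hlen i)
  have hle := hlen (s.arr 19 v * (3 * (N + 1) + 1) + a)
  rw [← hrd] at hB'
  simp only [raiseBucket, push, WP, Expr.Small, Expr.eval, Expr.cost, Op.apply, true_and,
    Store.var_setVar, Store.arr_setVar, Store.var_setArr, Store.arr_setArr, Nat.reduceEqDiff,
    if_true, if_false, ite_one_zero_ne, ite_one_zero_eq, h0, h21, h30, h32]
  refine ⟨by omega, by omega, fun h => ⟨by push_cast; omega, ?_, ?_, sum_update_succ hsid⟩,
    fun h => ⟨by push_cast; omega, ?_, ?_, sum_update_succ hsid⟩⟩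
  · rwa [max_eq_right (by omega)] at hB'
  · rw [max_eq_right (by omega)]
  · rwa [max_eq_left (by omega), Function.update_eq_self] at hB'
  · rw [max_eq_left (by omega), Function.update_eq_self]

/-- A champion can only be overtaken by the group that has just increased. -/
theorem raiseClass_spec {K N L b a : ℕ} {s : Store} {q : ℕ → ℕ}
    (hT : Tables N L (s.arr 27) (s.arr 28) (s.arr 29)) (hb : 1 ≤ b) (hbN : b ≤ N + 1)
    (hq : s.arr 25 = Function.update q b (max (q b) a)) (hC : ∀ i ≤ L, Champion q (s.arr 26) i)
    (h31 : s.var 31 = b) {r : ℤ} :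
    WP K raiseClass s r fun s' r' => r - 30 ≤ r' ∧ s'.var 33 = Nat.log 2 b ∧ Nat.log 2 b < L ∧
      (∀ i ≤ L, Champion (s'.arr 25) (s'.arr 26) i) ∧
      (∀ j ≤ L, j ≠ Nat.log 2 b → key (s'.arr 25) (s'.arr 26 j) = key q (s.arr 26 j)) ∧
      key q (s.arr 26 (Nat.log 2 b)) ≤ key (s'.arr 25) (s'.arr 26 (Nat.log 2 b)) := by
  obtain ⟨hl1, hl2⟩ := class_log hb
  set i := Nat.log 2 b with hi
  have hle := hT.le
  have hiL : i < L := by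
    by_contra h
    have := Nat.pow_le_pow_right (n := 2) (by norm_num) (not_lt.1 h)
    omega
  have h28 : s.arr 28 b = i := hT.high b hb (by rw [pow_succ]; omega)
  have hqne : ∀ b' ≠ b, key (s.arr 25) b' = key q b' := fun b' h => key_congr (by
    rw [hq, Function.update_of_ne h])
  have hqle : ∀ b', key q b' ≤ key (s.arr 25) b' := fun b' => by
    rcases eq_or_ne b' b with rfl | h
    · rw [key, key, hq, Function.update_self]
      gcongr
      exact le_max_left _ _
    · rw [hqne b' h]
  have hjb : ∀ j ≤ L, j ≠ i → ∀ b', 2 ^ j ≤ b' → b' < 2 ^ (j + 1) → b' ≠ b := by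
    rintro j _ hji b' h1 h2 rfl
    exact hji (log_eq_of_class h1 h2).symm
  obtain ⟨c1, c2, c3⟩ := hC i hiL.le
  have hcpos : 0 < s.arr 26 i := (hC i hiL.le).pos
  have hother : ∀ j ≤ L, j ≠ i → ∀ ch : ℕ → ℕ, ch j = s.arr 26 j → Champion (s.arr 25) ch j ∧
      key (s.arr 25) (ch j) = key q (s.arr 26 j) := by
    intro j hj hji ch hch
    obtain ⟨d1, d2, d3⟩ := hC j hj
    rw [Champion, hch, hqne _ (hjb j hj hji _ d1 d2)]
    refine ⟨⟨d1, d2, fun b' e1 e2 => ?_⟩, rfl⟩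
    rw [hqne _ (hjb j hj hji _ e1 e2)]
    exact d3 b' e1 e2
  simp only [raiseClass, WP, Expr.Small, Expr.eval, Expr.cost, Op.apply, true_and,
    Store.var_setVar, Store.arr_setVar, Store.var_setArr, Store.arr_setArr, Nat.reduceEqDiff,
    if_true, if_false, ite_one_zero_ne, ite_one_zero_eq, h31, h28, ← key_lt_key hcpos hb]
  refine ⟨fun h => ⟨by push_cast; omega, hiL, fun j hj => ?_, fun j hj hji => ?_, ?_⟩,
    fun h => ⟨by push_cast; omega, hiL, fun j hj => ?_, fun j hj hji => ?_, hqle _⟩⟩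
  · rcases eq_or_ne j i with rfl | hji
    · rw [Champion, Function.update_self]
      refine ⟨hl1, hl2, fun b' e1 e2 => ?_⟩
      rcases eq_or_ne b' b with rfl | hbb
      · exact le_rfl
      · rw [hqne _ hbb]
        exact (c3 b' e1 e2).trans ((hqle _).trans h.le)
    · exact (hother j hj hji _ (Function.update_of_ne hji _ _)).1
  · exact (hother j hj hji _ (Function.update_of_ne hji _ _)).2
  · rw [Function.update_self]; exact (hqle _).trans h.le
  · rcases eq_or_ne j i with rfl | hji
    · refine ⟨c1, c2, fun b' e1 e2 => ?_⟩
      rcases eq_or_ne b' b with rfl | hbb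
      · exact not_lt.1 h
      · rw [hqne _ hbb]
        exact (c3 b' e1 e2).trans (hqle _)
    · exact (hother j hj hji _ rfl).1
  · exact (hother j hj hji _ rfl).2

/-- Each removed step of the staircase pays for its removal. -/
theorem popSteps_spec {K N L i : ℕ} {S : Finset ℕ} {s : Store} (hK : 4 * (N + 2) < K)
    (hT : Tables N L (s.arr 27) (s.arr 28) (s.arr 29))
    (hC : ∀ i ≤ L, Champion (s.arr 25) (s.arr 26) i)
    (h33 : s.var 33 = i) (hi : i ≤ L) (h34 : s.var 34 = s.arr 26 i) (h37 : s.var 37 = 1)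
    (h22 : s.var 22 = word S) (hS : StairExcept i L S fun j => key (s.arr 25) (s.arr 26 j))
    {r : ℤ} (hr : 60 * (S.card : ℤ) + 60 ≤ r) :
    WP K popSteps s r fun s' r' => ∃ S' : Finset ℕ,
      r - 60 - 60 * S.card + 60 * S'.card ≤ r' ∧ s'.var 22 = word S' ∧
      Stair 0 L S' fun j => key (s.arr 25) (s.arr 26 j) := by
  refine WP.loop (fun s' r' => ∃ S' : Finset ℕ, s'.var 22 = word S' ∧
    r - 60 * S.card + 60 * S'.card - (if s'.var 37 = 0 then 50 else 0) ≤ r' ∧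
    ((s'.var 37 = 0 ∧ Stair 0 L S' fun j => key (s.arr 25) (s.arr 26 j)) ∨
     (s'.var 37 = 1 ∧ StairExcept i L S' fun j => key (s.arr 25) (s.arr 26 j))))
    ⟨S, h22, by simp [h37], .inr ⟨h37, hS⟩⟩ ?_
  rintro s' r' hSm ⟨S', w22, hrr, hor⟩
  have e25 : s'.arr 25 = s.arr 25 := hSm.2 25 (by decide)
  have e26 : s'.arr 26 = s.arr 26 := hSm.2 26 (by decide)
  have e27 : s'.arr 27 = s.arr 27 := hSm.2 27 (by decide)
  have e28 : s'.arr 28 = s.arr 28 := hSm.2 28 (by decide)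
  have v33 : s'.var 33 = i := (hSm.1 33 (by decide)).trans h33
  have v34 : s'.var 34 = s.arr 26 i := (hSm.1 34 (by decide)).trans h34
  refine ⟨by split at hrr <;> omega, ?_, ?_⟩
  · intro he
    simp only [Expr.eval] at he
    rw [if_pos he] at hrr
    rcases hor with ⟨_, hst⟩ | ⟨h1, _⟩
    · exact ⟨S', by simp only [Expr.cost]; push_cast; omega, w22, hst⟩
    · omega
  · intro he
    simp only [Expr.eval] at he
    rw [if_neg he] at hrr
    rcases hor with ⟨h1, _⟩ | ⟨h1, hst⟩
    · omega
    have hwlt : word S' < 2 ^ (L + 1) := word_lt fun t ht => by have := hst.le t ht; omega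
    have hge := hT.ge
    rw [pow_succ] at hwlt
    have hmod := Nat.mod_le (word S') (s.arr 27 i)
    simp only [WP, Expr.Small, Expr.eval, Expr.cost, Op.apply, true_and,
      Store.var_setVar, Store.arr_setVar, Nat.reduceEqDiff,
      if_true, if_false, ite_one_zero_ne, ite_one_zero_eq, e25, e26, e27, e28, v33, v34, w22]
    refine ⟨by omega, fun h0 => ?_, fun h0 => ?_⟩
    · obtain ⟨p1, p2, p3⟩ := hT.pred_spec hst.le hi h0
      set p := s.arr 28 (word S' % s.arr 27 i)
      have hpL := hst.le p p1
      simp only [← key_lt_key (hC i hi).pos (hC p hpL).pos]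
      refine ⟨fun hk => ⟨S', rfl, by push_cast; omega,
        .inl (hst.stair (.inr ⟨p, p1, p2, p3, hk.le⟩) hi)⟩, fun hk => ⟨by omega, S'.erase p,
        by rw [word_erase p1, hT.pow p (by omega)], ?_,
        .inr ⟨h1, hst.pop p2 p3 (not_lt.1 hk) p1 hi⟩⟩⟩
      have := Finset.card_erase_add_one p1
      rw [h1]
      push_cast
      omega
    · exact ⟨S', rfl, by push_cast; omega, .inl (hst.stair (.inl (hT.no_pred hi h0)) hi)⟩

/-- The class `i` belongs to the staircase after its increase iff it did before or now exceeds the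
next step above it. -/
theorem raiseStair_spec {K N L i : ℕ} {S : Finset ℕ} {s : Store} {k₀ : ℕ → ℚ}
    (hK : 4 * (N + 2) < K)
    (hT : Tables N L (s.arr 27) (s.arr 28) (s.arr 29))
    (hC : ∀ i ≤ L, Champion (s.arr 25) (s.arr 26) i)
    (h33 : s.var 33 = i) (hi : i < L) (h22 : s.var 22 = word S) (hS : Stair 0 L S k₀)
    (hk : ∀ j ≤ L, j ≠ i → key (s.arr 25) (s.arr 26 j) = k₀ j)
    (hki : k₀ i ≤ key (s.arr 25) (s.arr 26 i)) {r : ℤ} (hr : 60 * (S.card : ℤ) + 200 ≤ r) :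
    WP K raiseStair s r fun s' r' => ∃ S' : Finset ℕ,
      r - 200 - 60 * S.card + 60 * S'.card ≤ r' ∧ s'.var 22 = word S' ∧
      Stair 0 L S' fun j => key (s.arr 25) (s.arr 26 j) := by
  set k₁ : ℕ → ℚ := fun j => key (s.arr 25) (s.arr 26 j) with hk₁
  have hS₁ : Stair 0 L S (fun j => if j = i then k₀ i else k₁ j) := hS.congr fun j hj => by
    split
    · rename_i h; rw [h]
    · rename_i h; exact hk j hj h
  have hne : ∀ j, j ≠ i → k₁ j = if j = i then k₀ i else k₁ j := fun j hj => by rw [if_neg hj]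
  obtain ⟨p1, p2, p3⟩ := hT.succ_spec hS.le hS.top hi.le
  have hge := hT.ge
  have hpi := hT.pow i (by omega)
  have hLlt : L < 2 ^ L := Nat.lt_two_pow_self
  have hwlt : word S < 2 ^ (L + 1) := word_lt fun t ht => by have := hS.le t ht; omega
  have hwlt' : i ∉ S → word S + 2 ^ i < 2 ^ (L + 1) := fun h => by
    rw [← word_insert h]
    refine word_lt fun t ht => ?_
    rcases Finset.mem_insert.1 ht with rfl | ht
    · omega
    · have := hS.le t ht; omega
  rw [pow_succ] at hwlt hwlt'
  simp only [raiseStair, WP, Expr.Small, Expr.eval, Expr.cost, Op.apply, true_and,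
    Store.var_setVar, Store.arr_setVar, Nat.reduceEqDiff,
    if_true, if_false, ite_one_zero_ne, ite_one_zero_eq, h33, h22]
  set j := i + s.arr 29 (word S / s.arr 27 i) with hj
  have hjL := hS.le j p1
  have hcj := (hC j hjL).pos
  have hci := (hC i hi.le).pos
  simp only [← key_lt_key hcj hci]
  refine ⟨by omega, fun h => ⟨fun hji => ?_, fun hji => ?_⟩, fun h => ?_⟩
  · refine (popSteps_spec (i := i) (S := S) hK (by simpa [Store.arr_setVar] using hT)
      (by simpa [Store.arr_setVar] using hC) (by simp [Store.var_setVar, h33]) hi.le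
      (by simp [Store.var_setVar, Store.arr_setVar]) (by simp [Store.var_setVar])
      (by simp [Store.var_setVar, h22]) ?_ (by push_cast; omega)).mono ?_
    · have := StairExcept.of_raise (K' := k₁) hS₁ hi.le hne (by simpa using hki) p1 p2 p3 (.inl hji)
      rw [Finset.insert_eq_of_mem (hji ▸ p1)] at this
      exact this
    · rintro s' r' ⟨S', g1, g2, g3⟩
      exact ⟨S', by push_cast at g1; omega, g2, g3⟩
  · have hiS : i ∉ S := fun hiS => by have := p3 i hiS le_rfl; omega
    have hkk : k₁ j < k₁ i := by
      by_contra hc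
      rw [if_neg hji, if_neg hc] at h
      exact h rfl
    rw [hpi]
    refine ⟨by have := hwlt' hiS; omega, ?_⟩
    have hse := StairExcept.of_raise (K' := k₁) hS₁ hi.le hne (by simpa using hki) p1 p2 p3
      (.inr hkk)
    refine (popSteps_spec (i := i) (S := insert i S) hK
      (by simpa [Store.arr_setVar] using hT)
      (by simpa [Store.arr_setVar] using hC) (by simp [Store.var_setVar, h33]) hi.le
      (by simp [Store.var_setVar, Store.arr_setVar]) (by simp [Store.var_setVar])
      (by simp [Store.var_setVar, word_insert hiS])
      (by exact hse) (by rw [Finset.card_insert_of_notMem hiS]; push_cast; omega)).mono ?_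
    rintro s' r' ⟨S', g1, g2, g3⟩
    rw [Finset.card_insert_of_notMem hiS] at g1
    exact ⟨S', by push_cast at g1; omega, g2, g3⟩
  · have hji : j ≠ i := fun hji => by simp [hji] at h
    have hkk : k₁ i ≤ k₁ j := by
      by_contra hc
      rw [if_neg hji, if_pos (not_le.1 hc)] at h
      omega
    exact ⟨S, by push_cast; omega, rfl,
      hS₁.raise_below hne p1 (by omega) p3 hkk⟩

/-- Raising a numerator takes constant amortized time. -/
theorem touch_spec {K n N L v a : ℕ} {S : Finset ℕ} (hK : (N + 2) * (3 * (N + 1) + 1) < K)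
    (hnK : n < K) {s : Store} (hQ : Queue n N L S s) (h30 : s.var 30 = v) (h32 : s.var 32 = a)
    (hv : v < n) (hd : s.arr 21 v = 0) (hca : s.arr 20 v < a) (h1 : 1 ≤ s.arr 19 v)
    (h2 : s.arr 19 v ≤ N + 1) (h3 : s.arr 19 v ≤ a) (h4 : a ≤ 3 * s.arr 19 v) {r : ℤ}
    (hr : 400 + 60 * (pot N S s : ℤ) ≤ r) :
    WP K touch s r fun s' r' => ∃ S' : Finset ℕ, Queue n N L S' s' ∧
      r - 400 - 60 * pot N S s + 60 * pot N S' s' ≤ r' ∧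
      s'.arr 20 = Function.update (s.arr 20) v a := by
  have hK' : 4 * (N + 2) < K := by nlinarith
  simp only [pot] at *
  simp only [touch, WP]
  refine (raiseBucket_spec hK hnK hQ.v0 hQ.v21 hQ.buckets h30 h32 hv hd hca h1 h2 h3 h4).conseq ?_
  rintro s1 r1 ⟨g1, g2, g3, g4, g5, g6⟩ hS1
  have e26 := hS1.2 26 (by decide)
  have t1 : Tables N L (s1.arr 27) (s1.arr 28) (s1.arr 29) := by
    rw [hS1.2 27 (by decide), hS1.2 28 (by decide), hS1.2 29 (by decide)]; exact hQ.tables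
  refine (raiseClass_spec t1 h1 h2 g5 (by rw [e26]; exact hQ.champ) g3).conseq ?_
  rintro s2 r2 ⟨f1, f2, f3, f4, f5, f6⟩ hS2
  have t2 : Tables N L (s2.arr 27) (s2.arr 28) (s2.arr 29) := by
    rw [hS2.2 27 (by decide), hS2.2 28 (by decide), hS2.2 29 (by decide)]; exact t1
  have w22 : s2.var 22 = word S := by
    rw [hS2.1 22 (by decide), hS1.1 22 (by decide), hQ.v22]
  rw [e26] at f5 f6
  refine (raiseStair_spec hK' t2 f4 f2 f3 w22 hQ.stair f5 f6 (by rw [Nat.cast_add] at hr; omega)).conseq ?_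
  rintro s3 r3 ⟨S', d1, d2, d3⟩ hS3
  have e25 : s3.arr 25 = s2.arr 25 := hS3.2 25 (by decide)
  have e26 : s3.arr 26 = s2.arr 26 := hS3.2 26 (by decide)
  have ea : ∀ i, i ∉ [25, 26] → s3.arr i = s1.arr i := fun i hi => by
    rw [hS3.2 i (by simp [raiseStair, popSteps, Cmd.wa]), hS2.2 i (by
      simp [raiseClass, Cmd.wa]; simp at hi; exact hi.2)]
  have e25' : s2.arr 25 = s1.arr 25 := hS2.2 25 (by decide)
  have ev : ∀ i, i < 22 → s3.var i = s.var i := fun i hi => by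
    rw [hS3.1 i (by simp [raiseStair, popSteps, Cmd.wv]; omega), hS2.1 i (by
      simp [raiseClass, Cmd.wv]; omega), hS1.1 i (by simp [raiseBucket, push, Cmd.wv]; omega)]
  refine ⟨S', ⟨(ev 0 (by omega)).trans hQ.v0, (ev 20 (by omega)).trans hQ.v20,
    (ev 21 (by omega)).trans hQ.v21, ?_, ?_, ?_, d2, ?_⟩, ?_, ?_⟩
  · rw [ea 27 (by decide), ea 28 (by decide), ea 29 (by decide)]; exact t1
  · rw [ea 19 (by decide), ea 20 (by decide), ea 21 (by decide), ea 23 (by decide),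
      ea 24 (by decide), e25, e25']
    exact g4
  · rw [e25, e26]; exact f4
  · rw [e25, e26]; exact d3
  · rw [ea 24 (by decide), g6]
    simp only [Nat.cast_add, Nat.cast_one]
    omega
  · rw [ea 20 (by decide), g2]


/-! ### Extracting the maximum -/

theorem Champion.congr {q q' ch ch' : ℕ → ℕ} {i : ℕ} (h : Champion q ch i) (hch : ch' i = ch i)
    (hq : ∀ b, 2 ^ i ≤ b → b < 2 ^ (i + 1) → q' b = q b) : Champion q' ch' i := by
  obtain ⟨h1, h2, h3⟩ := h
  rw [Champion, hch, key_congr (hq _ h1 h2)]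
  refine ⟨h1, h2, fun b hb hb' => ?_⟩
  rw [key_congr (hq b hb hb')]
  exact h3 b hb hb'

/-- Find the vertex with the maximal key, in the scalar `45`, and mark it as dead.  Its class, group
and numerator are left in the scalars `41`, `42`, `43`. -/
def findMax : Cmd :=
  41 ≔ .get 29 (.var 22) ;; 42 ≔ .get 26 (.var 41) ;; 43 ≔ .get 25 (.var 42) ;;
  44 ≔ .var 42 *ₑ .var 21 +ₑ .var 43 ;;
  45 ≔ .get 23 (.var 44 *ₑ .var 0 +ₑ (.get 24 (.var 44) -ₑ .lit 1)) ;;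
  .store 21 (.var 45) (.lit 1)

/-- While the scalar `46` is set, search for the new maximum of the group in the scalar `42`,
downwards from the scalar `43`. -/
def scanGroup : Cmd :=
  .loop (.var 46) (
    44 ≔ .var 42 *ₑ .var 21 +ₑ .var 43 ;;
    .ite (.get 24 (.var 44)) (
      47 ≔ .get 23 (.var 44 *ₑ .var 0 +ₑ (.get 24 (.var 44) -ₑ .lit 1)) ;;
      .ite (.get 21 (.var 47) +ₑ (.var 43 <ₑ .get 20 (.var 47)))
        (.store 24 (.var 44) (.get 24 (.var 44) -ₑ .lit 1))
        (.store 25 (.var 42) (.var 43) ;; 46 ≔ .lit 0))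
    (.ite (.var 42 <ₑ .var 43) (43 ≔ .var 43 -ₑ .lit 1)
      (.store 25 (.var 42) (.lit 0) ;; 46 ≔ .lit 0)))

/-- Find the new maximum of the group in the scalar `42`, which is at most the scalar `43`. -/
def fixGroup : Cmd := 46 ≔ .lit 1 ;; scanGroup

/-- Compare the group in the scalar `33` with the champion in the scalar `34`. -/
def compareGroup : Cmd :=
  .ite (.get 25 (.var 34) *ₑ .var 33 <ₑ .get 25 (.var 33) *ₑ .var 34) (34 ≔ .var 33) .skip

/-- Find the new champion of the class in the scalar `41`. -/
def fixClass : Cmd :=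
  34 ≔ .get 27 (.var 41) ;; 36 ≔ .get 27 (.var 41 +ₑ .lit 1) ;; 33 ≔ .var 34 ;;
  forUp 33 36 compareGroup ;;
  .store 26 (.var 41) (.var 34)

/-- Extend the staircase downwards to `0`, where the scalar `48` holds its lower end. -/
def extendStair : Cmd :=
  .loop (.var 48) (
    48 ≔ .var 48 -ₑ .lit 1 ;; 35 ≔ .get 29 (.var 22) ;;
    34 ≔ .get 26 (.var 48) ;; 36 ≔ .get 26 (.var 35) ;;
    .ite (.get 25 (.var 36) *ₑ .var 34 <ₑ .get 25 (.var 34) *ₑ .var 36)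
      (22 ≔ .var 22 +ₑ .get 27 (.var 48)) .skip)

/-- Rebuild the staircase after the class in the scalar `41`, its lowest step, has changed. -/
def fixStair : Cmd :=
  22 ≔ .var 22 -ₑ .get 27 (.var 41) ;; 48 ≔ .var 41 +ₑ .lit 1 ;; extendStair

/-- Remove a vertex with the maximal key; it is left in the scalar `45`. -/
def extractMax : Cmd := findMax ;; fixGroup ;; fixClass ;; fixStair

/-- The search for the new maximum of a group descends at most from `3 b` to `b`; the removal of stale
entries is paid for by the potential. -/
theorem fixGroup_spec {K n N b a : ℕ} (hK : (N + 2) * (3 * (N + 1) + 1) < K) (hnK : n < K)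
    {s : Store} (h0 : s.var 0 = n) (h21 : s.var 21 = 3 * (N + 1) + 1)
    (hB : BucketsScan n (N + 1) (3 * (N + 1) + 1) (s.arr 19) (s.arr 20) (s.arr 21)
      (rd (s.arr 23) (s.arr 24) n) (s.arr 25) b a) (h42 : s.var 42 = b) (h43 : s.var 43 = a)
    (hb : b ≤ N + 1) (ha : a ≤ 3 * b) {r : ℤ}
    (hr : 60 * (∑ i ∈ Finset.range ((N + 2) * (3 * (N + 1) + 1)), s.arr 24 i : ℕ) +
      180 * (b : ℤ) + 100 ≤ r) :
    WP K fixGroup s r fun s' r' =>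
      r - 180 * b - 100 -
        60 * (∑ i ∈ Finset.range ((N + 2) * (3 * (N + 1) + 1)), s.arr 24 i : ℕ) +
        60 * (∑ i ∈ Finset.range ((N + 2) * (3 * (N + 1) + 1)), s'.arr 24 i : ℕ) ≤ r' ∧
      Buckets n (N + 1) (3 * (N + 1) + 1) (s'.arr 19) (s'.arr 20) (s'.arr 21)
        (rd (s'.arr 23) (s'.arr 24) n) (s'.arr 25) ∧
      ∃ x, s'.arr 25 = Function.update (s.arr 25) b x := by
  have hR : 3 * (N + 1) + 1 = 3 * (N + 1) + 1 := rfl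
  set M := (N + 2) * (3 * (N + 1) + 1) with hM
  simp only [fixGroup, WP, Expr.Small, Expr.eval, Expr.cost, true_and]
  refine WP.loop (fun s' r' => ∃ a' ≤ a, s'.var 43 = a' ∧
    r - 2 - 60 * (a - a') - 60 * (∑ i ∈ Finset.range M, s.arr 24 i : ℕ) +
      60 * (∑ i ∈ Finset.range M, s'.arr 24 i : ℕ) - (if s'.var 46 = 0 then 55 else 0) ≤ r' ∧
    ((s'.var 46 = 0 ∧ Buckets n (N + 1) (3 * (N + 1) + 1) (s'.arr 19) (s'.arr 20) (s'.arr 21)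
        (rd (s'.arr 23) (s'.arr 24) n) (s'.arr 25) ∧
      ∃ x, s'.arr 25 = Function.update (s.arr 25) b x) ∨
    (s'.var 46 = 1 ∧ BucketsScan n (N + 1) (3 * (N + 1) + 1) (s'.arr 19) (s'.arr 20) (s'.arr 21)
      (rd (s'.arr 23) (s'.arr 24) n) (s'.arr 25) b a' ∧ s'.arr 25 = s.arr 25)))
    ⟨a, le_rfl, by simp [Store.var_setVar, h43], by simp [Store.var_setVar, Store.arr_setVar],
      .inr ⟨by simp [Store.var_setVar], hB, rfl⟩⟩ ?_
  rintro s' r' hSm ⟨a', ha', w43, hrr, hor⟩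
  have v0 : s'.var 0 = n := (hSm.1 0 (by decide)).trans (by simp [Store.var_setVar, h0])
  have v21 : s'.var 21 = 3 * (N + 1) + 1 :=
    (hSm.1 21 (by decide)).trans (by simp [Store.var_setVar, h21])
  have v42 : s'.var 42 = b := (hSm.1 42 (by decide)).trans (by simp [Store.var_setVar, h42])
  have hpos : 0 ≤ ((∑ i ∈ Finset.range M, s'.arr 24 i : ℕ) : ℤ) := Int.natCast_nonneg _
  refine ⟨by split at hrr <;> omega, ?_, ?_⟩
  · intro he
    simp only [Expr.eval] at he
    rw [if_pos he] at hrr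
    rcases hor with ⟨_, h1, h2⟩ | ⟨h1, _⟩
    · exact ⟨by simp only [Expr.cost, Nat.cast_add, Nat.cast_one] at hrr ⊢; omega, h1, h2⟩
    · omega
  · intro he
    simp only [Expr.eval] at he
    rw [if_neg he] at hrr
    rcases hor with ⟨h1, _⟩ | ⟨h1, hsc, h25⟩
    · omega
    have haR : a' < 3 * (N + 1) + 1 := by omega
    have hsid : b * (3 * (N + 1) + 1) + a' < M := sid_lt hb haR
    simp only [WP, Expr.Small, Expr.eval, Expr.cost, Op.apply, true_and,
      Store.var_setVar, Store.arr_setVar, Store.var_setArr, Store.arr_setArr, Nat.reduceEqDiff,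
      if_true, if_false, ite_one_zero_ne, ite_one_zero_eq, v0, v21, v42, w43]
    set i := b * (3 * (N + 1) + 1) + a' with hi
    set u := s'.arr 23 (i * n + (s'.arr 24 i - 1)) with hu
    refine ⟨by omega, fun hne => ?_, fun he0 => ⟨fun hlt => ?_, fun hge => ?_⟩⟩
    · have htop : (rd (s'.arr 23) (s'.arr 24) n i).getLast? = some u := rd_top (by omega)
      have humem : u ∈ rd (s'.arr 23) (s'.arr 24) n i := List.mem_of_getLast? htop
      obtain ⟨u1, u2, u3, u4⟩ := bucket_mem hR hsc.bd hsc.mem haR humem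
      have hHn : s'.arr 24 i ≤ n := by
        have := length_le_of_nodup_lt (hsc.nodup i) (fun x hx => (hsc.mem i x hx).1)
        simpa using this
      refine ⟨fun hst => ⟨by omega, a', ha', rfl, ?_, .inr ⟨h1, ?_, h25⟩⟩,
        fun hst => ⟨a', ha', rfl, ?_, .inl ⟨?_, a', by rw [h25]⟩⟩⟩
      · have := sum_update_pred (H := s'.arr 24) hsid (by omega)
        rw [h1, if_neg one_ne_zero]
        rw [← this] at hrr
        simp only [Nat.cast_add, Nat.cast_one] at hrr ⊢
        omega
      · have h2 := hsc.pop hR haR htop (by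
          by_contra hc
          rw [not_or, not_not] at hc
          simp [hc] at hst)
        convert h2 using 1
        funext j
        exact rd_pop
      · simp only [Nat.cast_add, Nat.cast_one] at hrr ⊢
        omega
      · have : s'.arr 21 u = 0 ∧ s'.arr 20 u ≤ a' := by
          constructor
          · omega
          · by_contra hc
            rw [if_pos (by omega)] at hst
            omega
        exact hsc.finish htop u1 u2 this.1 (by omega)
    · have hnil : rd (s'.arr 23) (s'.arr 24) n i = [] := List.length_eq_zero_iff.1 (by simpa using he0)
      refine ⟨by omega, a' - 1, by omega, rfl, ?_, .inr ⟨h1, hsc.down hnil, h25⟩⟩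
      rw [h1, if_neg one_ne_zero]
      simp only [Nat.cast_add, Nat.cast_one] at hrr ⊢
      omega
    · have hnil : rd (s'.arr 23) (s'.arr 24) n i = [] := List.length_eq_zero_iff.1 (by simpa using he0)
      refine ⟨a', ha', rfl, ?_, .inl ⟨hsc.finish_empty hnil (by omega), 0, by rw [h25]⟩⟩
      simp only [Nat.cast_add, Nat.cast_one] at hrr ⊢
      omega

theorem fixClass_spec {K N L g : ℕ} {s : Store} (hK : 4 * (N + 2) < K)
    (hT : Tables N L (s.arr 27) (s.arr 28) (s.arr 29)) (hg : g < L) (h41 : s.var 41 = g) {r : ℤ}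
    (hr : 40 * (2 : ℤ) ^ g + 50 ≤ r) :
    WP K fixClass s r fun s' r' => r - 40 * (2 : ℤ) ^ g - 50 ≤ r' ∧
      Champion (s'.arr 25) (s'.arr 26) g ∧ ∃ c, s'.arr 26 = Function.update (s.arr 26) g c := by
  have hge := hT.ge
  have h27 := hT.pow g (by omega)
  have h27' := hT.pow (g + 1) (by omega)
  have hpow : 2 ^ (g + 1) ≤ 2 ^ L := Nat.pow_le_pow_right (by norm_num) hg
  have hcard : 2 ^ (g + 1) - 2 ^ g = 2 ^ g := by rw [pow_succ]; omega
  have hle : 2 ^ g ≤ 2 ^ (g + 1) := by rw [pow_succ]; omega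
  simp only [fixClass, WP, Expr.Small, Expr.eval, Expr.cost, Op.apply, true_and,
    Store.var_setVar, Store.arr_setVar, Nat.reduceEqDiff, if_true, if_false, h41, h27, h27']
  refine WP.forUp_sum (2 ^ (g + 1)) (2 ^ g) (fun x s' => 2 ^ g ≤ s'.var 34 ∧
    s'.var 34 < 2 ^ (g + 1) ∧
    ∀ b, 2 ^ g ≤ b → b < x → key (s'.arr 25) b ≤ key (s'.arr 25) (s'.var 34)) (fun _ => 30)
    (by omega) hle
    (by simp [Store.var_setVar]) (by simp [Store.var_setVar]) (by decide) (by decide) (by decide)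
    ?_ ?_ ?_ ?_
  · simp only [Store.var_setVar, Store.arr_setVar, Nat.reduceEqDiff, if_true, if_false]
    refine ⟨le_rfl, ?_, fun b h1 h2 => by omega⟩
    rw [pow_succ]
    have := Nat.one_le_two_pow (n := g)
    omega
  · simp only [Finset.sum_const, Nat.card_Ico, nsmul_eq_mul, hcard]
    push_cast at hr ⊢
    linarith
  · rintro x s' r' hx hx' w33 hS ⟨h1, h2, h3⟩ hr'
    have hpos := Nat.one_le_two_pow (n := g)
    simp only [compareGroup, WP, Expr.Small, Expr.eval, Expr.cost, Op.apply, true_and,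
      Store.var_setVar, Store.arr_setVar, Nat.reduceEqDiff,
      if_true, if_false, ite_one_zero_ne, ite_one_zero_eq, w33,
      ← key_lt_key (q := s'.arr 25) (show 0 < s'.var 34 by omega) (show 0 < x by omega)]
    refine ⟨fun h => ⟨by push_cast at *; omega, hx, hx', fun b hb hbx => ?_⟩,
      fun h => ⟨by push_cast at *; omega, h1, h2, fun b hb hbx => ?_⟩⟩
    · rcases Nat.lt_succ_iff_lt_or_eq.1 hbx with hbx | rfl
      · exact (h3 b hb hbx).trans h.le
      · exact le_rfl
    · rcases Nat.lt_succ_iff_lt_or_eq.1 hbx with hbx | rfl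
      · exact h3 b hb hbx
      · exact not_lt.1 h
  · rintro s' r' hrr _ hS ⟨h1, h2, h3⟩
    have v41 : s'.var 41 = g := (hS.1 41 (by decide)).trans (by simp [Store.var_setVar, h41])
    have e26 : s'.arr 26 = s.arr 26 := hS.2 26 (by decide)
    simp only [Store.arr_setArr, Nat.reduceEqDiff,
      if_true, if_false, v41, e26]
    simp only [Finset.sum_const, Nat.card_Ico, nsmul_eq_mul, hcard] at hrr
    push_cast at hrr
    refine ⟨by push_cast; linarith, ?_, _, rfl⟩
    rw [Champion, Function.update_self]
    exact ⟨h1, h2, h3⟩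

/-- The staircase is extended downwards class by class; a class becomes a step iff it exceeds the
present lowest step. -/
theorem extendStair_spec {K N L i₀ : ℕ} {S : Finset ℕ} {s : Store} (hK : 4 * (N + 2) < K)
    (hT : Tables N L (s.arr 27) (s.arr 28) (s.arr 29))
    (hC : ∀ i ≤ L, Champion (s.arr 25) (s.arr 26) i)
    (h48 : s.var 48 = i₀) (h22 : s.var 22 = word S) (hi : i₀ ≤ L)
    (hS : Stair i₀ L S fun j => key (s.arr 25) (s.arr 26 j)) {r : ℤ}
    (hr : 60 * (S.card : ℤ) + 120 * i₀ + 10 ≤ r) :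
    WP K extendStair s r fun s' r' => ∃ S' : Finset ℕ,
      r - 120 * i₀ - 10 - 60 * S.card + 60 * S'.card ≤ r' ∧ s'.var 22 = word S' ∧
      Stair 0 L S' fun j => key (s.arr 25) (s.arr 26 j) := by
  refine WP.loop (fun s' r' => ∃ (S' : Finset ℕ) (i : ℕ), i ≤ i₀ ∧ s'.var 48 = i ∧
    s'.var 22 = word S' ∧ r - 120 * (i₀ - i) - 60 * S.card + 60 * S'.card ≤ r' ∧
    Stair i L S' fun j => key (s.arr 25) (s.arr 26 j))
    ⟨S, i₀, le_rfl, h48, h22, by simp, hS⟩ ?_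
  rintro s' r' hSm ⟨S', i, hii, w48, w22, hrr, hst⟩
  have e25 : s'.arr 25 = s.arr 25 := hSm.2 25 (by decide)
  have e26 : s'.arr 26 = s.arr 26 := hSm.2 26 (by decide)
  have e27 : s'.arr 27 = s.arr 27 := hSm.2 27 (by decide)
  have e29 : s'.arr 29 = s.arr 29 := hSm.2 29 (by decide)
  refine ⟨by omega, ?_, ?_⟩
  · intro he
    simp only [Expr.eval, w48] at he
    subst he
    exact ⟨S', by simp only [Expr.cost]; push_cast; omega, w22, hst⟩
  · intro he
    simp only [Expr.eval, w48] at he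
    obtain ⟨j, rfl⟩ : ∃ j, i = j + 1 := ⟨i - 1, by omega⟩
    obtain ⟨p1, p2⟩ := hT.low_spec hst.le hst.top
    have hge := hT.ge
    have hjS : j ∉ S' := fun h => by have := hst.ge j h; omega
    have hwlt : word S' + 2 ^ j < 2 ^ (L + 1) := by
      rw [← word_insert hjS]
      refine word_lt fun t ht => ?_
      rcases Finset.mem_insert.1 ht with rfl | ht
      · omega
      · have := hst.le t ht; omega
    rw [pow_succ] at hwlt
    have hLlt : L < 2 ^ L := Nat.lt_two_pow_self
    simp only [WP, Expr.Small, Expr.eval, Expr.cost, Op.apply, true_and,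
      Store.var_setVar, Store.arr_setVar, Nat.reduceEqDiff, if_true, if_false, ite_one_zero_ne,
      ite_one_zero_eq, w48, w22, e25, e26, e27, e29, Nat.add_sub_cancel, hT.pow j (by omega),
      ← key_lt_key (hC _ (hst.le _ p1)).pos (hC j (by omega)).pos]
    refine ⟨by omega, fun h => ⟨by omega, insert j S', j, by omega, rfl, (word_insert hjS).symm, ?_,
      hst.cons p1 p2 h (by omega)⟩, fun h => ⟨S', j, by omega, rfl, rfl, ?_,
      hst.skip p1 p2 (not_lt.1 h)⟩⟩
    · rw [Finset.card_insert_of_notMem hjS]; push_cast at *; omega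
    · push_cast at *; omega

/-- Extracting the maximum takes amortized time linear in the denominator of its key. -/
theorem extractMax_spec {K n N L v : ℕ} {S : Finset ℕ} (hK : (N + 2) * (3 * (N + 1) + 1) < K)
    (hnK : n < K) {s : Store} (hQ : Queue n N L S s) (hv : v < n) (hd : s.arr 21 v = 0)
    (hc : 0 < s.arr 20 v) {r : ℤ}
    (hr : ∀ u < n, s.arr 21 u = 0 → 0 < s.arr 20 u →
      60 * (pot N S s : ℤ) + 500 * s.arr 19 u + 500 ≤ r) :
    WP K extractMax s r fun s' r' => ∃ (S' : Finset ℕ) (u : ℕ), Queue n N L S' s' ∧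
      s'.var 45 = u ∧ u < n ∧ s.arr 21 u = 0 ∧ 0 < s.arr 20 u ∧
      (∀ x < n, s.arr 21 x = 0 → 0 < s.arr 20 x →
        s.arr 20 x * s.arr 19 u ≤ s.arr 20 u * s.arr 19 x) ∧
      s'.arr 21 = Function.update (s.arr 21) u 1 ∧
      r - 500 * s.arr 19 u - 500 - 60 * pot N S s + 60 * pot N S' s' ≤ r' := by
  have hK' : 4 * (N + 2) < K := by nlinarith
  have hR : 3 * (N + 1) + 1 = 3 * (N + 1) + 1 := rfl
  have hT := hQ.tables
  have hB := hQ.buckets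
  obtain ⟨p1, p2⟩ := hT.low_spec hQ.stair.le hQ.stair.top
  set g := s.arr 29 (word S) with hg
  set b := s.arr 26 g with hb
  have hgL := hQ.stair.le g p1
  obtain ⟨c1, c2, c3⟩ := hQ.champ g hgL
  have hbpos : 0 < b := (hQ.champ g hgL).pos
  have hTle := hT.le
  have hmax : ∀ x < n, s.arr 21 x = 0 → 0 < s.arr 20 x → 1 ≤ s.arr 19 x ∧
      s.arr 20 x ≤ s.arr 25 (s.arr 19 x) ∧
      s.arr 25 (s.arr 19 x) * b ≤ s.arr 25 b * s.arr 19 x := by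
    intro x hx hxd hx0
    obtain ⟨d1, d2, d3, d4⟩ := hB.bd x hx hx0
    refine ⟨d1, (hB.live x hx hx0 hxd).2, ?_⟩
    rw [← key_le_key d1 hbpos]
    obtain ⟨l1, l2⟩ := class_log d1
    have hl : Nat.log 2 (s.arr 19 x) ≤ L := by
      by_contra h
      have := Nat.pow_le_pow_right (n := 2) (by norm_num) (le_of_lt (not_le.1 h))
      omega
    exact ((hQ.champ _ hl).2.2 _ l1 l2).trans (hQ.stair.max_low p1 p2 (Nat.zero_le _) hl)
  have hq : 0 < s.arr 25 b := by
    obtain ⟨h1, h2, h3⟩ := hmax v hv hd hc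
    by_contra h0
    rw [Nat.eq_zero_of_not_pos h0, zero_mul] at h3
    have := Nat.mul_pos (show 0 < s.arr 25 (s.arr 19 v) by omega) hbpos
    omega
  obtain ⟨u, u1, u2, u3, u4, u5⟩ := hB.top b hq
  obtain ⟨d1, d2, d3, d4⟩ := hB.bd u u2 (by omega)
  replace hr := hr u u2 u3 (by omega)
  rw [u4] at hr
  obtain ⟨q1, q2, q3⟩ := hB.q_lt hR b
  have hsid := sid_lt (N := N) (b := b) (by omega) q1
  have hgL' : g < L := by
    by_contra h
    have := Nat.pow_le_pow_right (n := 2) (by norm_num) (not_lt.1 h)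
    omega
  set i := b * (3 * (N + 1) + 1) + s.arr 25 b with hi
  have hHpos : 0 < s.arr 24 i := by
    have : rd (s.arr 23) (s.arr 24) n i ≠ [] := by rintro h; rw [h] at u1; simp at u1
    have := List.length_pos_of_ne_nil this
    simpa using this
  have hu : s.arr 23 (i * n + (s.arr 24 i - 1)) = u := by
    rw [rd_top hHpos] at u1
    exact Option.some.inj u1
  have hp2g : (2 : ℤ) ^ g ≤ b := by exact_mod_cast c1
  have hgb : g + 1 ≤ b := by have : g < 2 ^ g := Nat.lt_two_pow_self; omega
  simp only [pot, Nat.cast_add] at *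
  simp only [extractMax, WP, findMax, Expr.Small, Expr.eval, Expr.cost, Op.apply, true_and,
    Store.var_setVar, Store.arr_setVar, Nat.reduceEqDiff,
    if_true, if_false, hQ.v0, hQ.v21, hQ.v22, ← hg, ← hb, ← hi, hu]
  refine ⟨by omega, ?_⟩
  refine (fixGroup_spec (b := b) (a := s.arr 25 b) hK hnK (by simp [Store.var_setVar, Store.var_setArr, hQ.v0])
    (by simp [Store.var_setVar, Store.var_setArr, hQ.v21])
    (by simpa [Store.arr_setVar, Store.arr_setArr] using hB.scan u4)
    (by simp [Store.var_setVar, Store.var_setArr])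
    (by simp [Store.var_setVar, Store.var_setArr]) (by omega) q2
    (by simp only [Store.arr_setVar, Store.arr_setArr, Nat.reduceEqDiff, if_false]
        push_cast at hr ⊢; omega)).conseq ?_
  rintro s1 r1 ⟨f1, f2, x, f3⟩ hS1
  simp only [Store.arr_setVar, Store.arr_setArr, Nat.reduceEqDiff, if_false] at f1 f3
  have ha1 : ∀ j, j ∉ [21, 24, 25] → s1.arr j = s.arr j := fun j hj => by
    rw [hS1.2 j (by simp [fixGroup, scanGroup, Cmd.wa] at hj ⊢; tauto)]
    simp at hj
    simp [Store.arr_setVar, Store.arr_setArr, hj.1]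
  have hv1 : ∀ j, j ∉ [41, 42, 43, 44, 45, 46, 47] → s1.var j = s.var j := fun j hj => by
    rw [hS1.1 j (by simp [fixGroup, scanGroup, Cmd.wv] at hj ⊢; tauto)]
    simp at hj
    simp [Store.var_setVar, Store.var_setArr, hj]
  have h21 : s1.arr 21 = Function.update (s.arr 21) u 1 := by
    rw [hS1.2 21 (by decide)]; simp [Store.arr_setVar, Store.arr_setArr]
  have v41 : s1.var 41 = g := by
    rw [hS1.1 41 (by decide)]; simp [Store.var_setVar, Store.var_setArr]
  have v45 : s1.var 45 = u := by
    rw [hS1.1 45 (by decide)]; simp [Store.var_setVar, Store.var_setArr]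
  have t1 : Tables N L (s1.arr 27) (s1.arr 28) (s1.arr 29) := by
    rw [ha1 27 (by decide), ha1 28 (by decide), ha1 29 (by decide)]; exact hT
  have hpos1 : 0 ≤ ((∑ i ∈ Finset.range ((N + 2) * (3 * (N + 1) + 1)), s1.arr 24 i : ℕ) : ℤ) :=
    Int.natCast_nonneg _
  have hSc : 0 ≤ (S.card : ℤ) := Int.natCast_nonneg _
  refine (fixClass_spec hK' t1 hgL' v41 (by push_cast at *; omega)).conseq ?_
  rintro s2 r2 ⟨e1, e2, c, e3⟩ hS2
  rw [ha1 26 (by decide)] at e3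
  have e25 : s2.arr 25 = s1.arr 25 := hS2.2 25 (by decide)
  have hCh : ∀ j ≤ L, Champion (s2.arr 25) (s2.arr 26) j := by
    intro j hj
    rcases eq_or_ne j g with rfl | hjg
    · exact e2
    · refine (hQ.champ j hj).congr (by rw [e3, Function.update_of_ne hjg]) fun b' h1 h2 => ?_
      rw [e25, f3, Function.update_of_ne]
      rintro rfl
      exact hjg ((log_eq_of_class h1 h2).symm.trans (log_eq_of_class c1 c2))
  have hkey : ∀ j ≤ L, j ≠ g → key (s2.arr 25) (s2.arr 26 j) = key (s.arr 25) (s.arr 26 j) := by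
    intro j hj hjg
    rw [e3, Function.update_of_ne hjg]
    refine key_congr ?_
    rw [e25, f3, Function.update_of_ne]
    intro h
    obtain ⟨h1, h2, _⟩ := hQ.champ j hj
    rw [h] at h1 h2
    exact hjg ((log_eq_of_class h1 h2).symm.trans (log_eq_of_class c1 c2))
  have t2 : Tables N L (s2.arr 27) (s2.arr 28) (s2.arr 29) := by
    rw [hS2.2 27 (by decide), hS2.2 28 (by decide), hS2.2 29 (by decide)]; exact t1
  have w41 : s2.var 41 = g := (hS2.1 41 (by decide)).trans v41
  have w22 : s2.var 22 = word S :=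
    (hS2.1 22 (by decide)).trans ((hv1 22 (by decide)).trans hQ.v22)
  have hst : Stair (g + 1) L (S.erase g) fun j => key (s2.arr 25) (s2.arr 26 j) :=
    hQ.stair.erase_low p1 p2 hgL' fun j hgj hj => hkey j hj (by omega)
  have hwlt : word S < 2 ^ (L + 1) := word_lt fun t ht => by have := hQ.stair.le t ht; omega
  have hge := hT.ge
  rw [pow_succ] at hwlt
  have hcard := Finset.card_erase_add_one p1
  have hLlt : L < 2 ^ L := Nat.lt_two_pow_self
  simp only [fixStair, WP, Expr.Small, Expr.eval, Expr.cost, Op.apply,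
    Store.var_setVar, Nat.reduceEqDiff,
    if_false, w41, w22, t2.pow g (by omega)]
  refine ⟨by omega, by omega, ?_⟩
  refine (extendStair_spec (i₀ := g + 1) (S := S.erase g) hK' (by exact t2) (by exact hCh)
    (by simp [Store.var_setVar])
    (by simp [Store.var_setVar, word_erase p1]) (by omega) (by exact hst)
    (by push_cast at *; omega)).conseq ?_
  rintro s3 r3 ⟨S', d1, d2, d3⟩ hS3
  have ha3 : ∀ j, s3.arr j = s2.arr j := fun j => hS3.2 j (by simp [extendStair, Cmd.wa])
  have ha2 : ∀ j, j ≠ 26 → s2.arr j = s1.arr j := fun j hj =>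
    hS2.2 j (by simpa [fixClass, forUp, compareGroup, Cmd.wa] using hj)
  have hv3 : ∀ j, j ∉ [22, 48, 33, 34, 35, 36] → s3.var j = s1.var j := fun j hj => by
    rw [hS3.1 j (by simp [extendStair, Cmd.wv] at hj ⊢; tauto)]
    simp at hj
    simp only [Store.var_setVar, hj, if_false]
    exact hS2.1 j (by simp [fixClass, forUp, compareGroup, Cmd.wv]; tauto)
  refine ⟨S', u, ⟨?_, ?_, ?_, ?_, ?_, ?_, d2, ?_⟩, (hv3 45 (by decide)).trans v45, u2, u3, by omega,
    fun x hx hxd hx0 => ?_, ?_, ?_⟩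
  · exact (hv3 0 (by decide)).trans ((hv1 0 (by decide)).trans hQ.v0)
  · exact (hv3 20 (by decide)).trans ((hv1 20 (by decide)).trans hQ.v20)
  · exact (hv3 21 (by decide)).trans ((hv1 21 (by decide)).trans hQ.v21)
  · rw [ha3, ha3, ha3]; exact t2
  · simp only [ha3, ha2 19 (by decide), ha2 20 (by decide), ha2 21 (by decide), ha2 23 (by decide),
      ha2 24 (by decide), ha2 25 (by decide)]
    exact f2
  · simp only [ha3]; exact hCh
  · simp only [ha3]; exact d3
  · obtain ⟨h1, h2, h3⟩ := hmax x hx hxd hx0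
    rw [u4, u5]
    exact (Nat.mul_le_mul_right b h2).trans h3
  · rw [ha3, ha2 21 (by decide), h21]
  · rw [ha3, ha2 24 (by decide), u4]
    push_cast at *
    omega


/-! ### Motif residents under deletions -/

/-- The contribution to the numerator of a vertex of an instance of which `r` of the `k` vertices
remain.  The numerator is `3` times the denominator minus the numerator of the motif resident, so
that the next vertex to be deleted is one with the largest key. -/
def contrib (k r : ℕ) : ℕ := 1 + (if r = k then 0 else 1) + (if r = 1 then 1 else 0)

/-- The change of the contribution when `r` drops to `r - 1` and still is positive. -/
def delta (k r : ℕ) : ℕ := (if r = k then 1 else 0) + (if r = 2 then 1 else 0)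

/-- A bound for the number of future changes of the contribution. -/
def changes (k r : ℕ) : ℕ := (if r = k then 1 else 0) + (if 2 ≤ r then 1 else 0)

/-- Whether the instance is cut. -/
def isCut (k r : ℕ) : ℕ := if 0 < r ∧ r < k then 1 else 0

/-- The numbers below `N` of the blocks that contain `x`. -/
def incS (B : ℕ → List ℕ) (N x : ℕ) : Finset ℕ := (Finset.range N).filter fun j => x ∈ B j

/-- The numerator of the key of `x`, when `rem j` vertices remain in the `j`-th instance.  Vertices
without instances receive the largest possible key `3 / 1`. -/
def num (B : ℕ → List ℕ) (N k : ℕ) (rem : ℕ → ℕ) (x : ℕ) : ℕ :=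
  if incS B N x = ∅ then 3 else ∑ j ∈ incS B N x, contrib k (rem j)

theorem contrib_bounds (k r : ℕ) : 1 ≤ contrib k r ∧ contrib k r ≤ 3 := by
  unfold contrib; split <;> split <;> omega

theorem contrib_pred {k r : ℕ} (hk : 2 ≤ k) (hr : 2 ≤ r) :
    contrib k (r - 1) = contrib k r + delta k r ∨ k < r := by
  by_cases h : k < r
  · exact .inr h
  · left
    unfold contrib delta
    split_ifs <;> omega

theorem changes_pred {k r : ℕ} (hk : 2 ≤ k) (hr : 1 ≤ r) (hrk : r ≤ k) :
    changes k (r - 1) ≤ changes k r ∧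
      (delta k r ≠ 0 → changes k (r - 1) + 1 ≤ changes k r) := by
  unfold changes delta
  constructor
  · split_ifs <;> omega
  · intro h
    split_ifs at * <;> omega

theorem incL_eq {B : ℕ → List ℕ} {N x : ℕ} : (incL B N x).length = (incS B N x).card := by
  have h : (incL B N x).toFinset = incS B N x := by
    ext j; simp [incL, incS]
  rw [← h, List.toFinset_card_of_nodup (l := incL B N x) (List.nodup_range.filter _)]

theorem sum_update {f : ℕ → ℕ} {rem : ℕ → ℕ} {j v : ℕ} {s : Finset ℕ} (hj : j ∈ s) :
    ∑ i ∈ s, f (Function.update rem j v i) + f (rem j) = ∑ i ∈ s, f (rem i) + f v := by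
  rw [← Finset.add_sum_erase _ _ hj, ← Finset.add_sum_erase s (fun i => f (rem i)) hj,
    Function.update_self, Finset.sum_congr rfl fun i hi => by
      rw [Function.update_of_ne (Finset.ne_of_mem_erase hi)]]
  ring

theorem num_bounds {B : ℕ → List ℕ} {N k : ℕ} {rem : ℕ → ℕ} {x : ℕ} :
    max (incS B N x).card 1 ≤ num B N k rem x ∧ num B N k rem x ≤ 3 * max (incS B N x).card 1 := by
  unfold num
  split
  · rename_i h; simp [h]
  · rename_i h
    have hc : 1 ≤ (incS B N x).card := Finset.card_pos.2 (Finset.nonempty_iff_ne_empty.2 h)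
    have h1 := Finset.card_nsmul_le_sum (incS B N x) (fun j => contrib k (rem j)) 1
      fun j _ => (contrib_bounds k _).1
    have h2 := Finset.sum_le_card_nsmul (incS B N x) (fun j => contrib k (rem j)) 3
      fun j _ => (contrib_bounds k _).2
    simp only [smul_eq_mul] at h1 h2
    omega

theorem num_update_of_mem {B : ℕ → List ℕ} {N k : ℕ} {rem : ℕ → ℕ} {x j : ℕ} (hj : j < N)
    (hx : x ∈ B j) (hk : 2 ≤ k) (hr : 2 ≤ rem j) (hrk : rem j ≤ k) :
    num B N k (Function.update rem j (rem j - 1)) x = num B N k rem x + delta k (rem j) := by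
  have hjm : j ∈ incS B N x := by simp [incS, hj, hx]
  have hne : incS B N x ≠ ∅ := Finset.ne_empty_of_mem hjm
  have := sum_update (f := contrib k) (rem := rem) (v := rem j - 1) hjm
  have h2 := contrib_pred hk hr
  rw [num, num, if_neg hne, if_neg hne]
  omega

theorem num_update_of_notMem {B : ℕ → List ℕ} {N k : ℕ} {rem : ℕ → ℕ} {x j v : ℕ}
    (hx : x ∉ B j) : num B N k (Function.update rem j v) x = num B N k rem x := by
  unfold num
  congr 1
  refine Finset.sum_congr rfl fun i hi => ?_
  rw [Function.update_of_ne]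
  rintro rfl
  simp [incS, hx] at hi

theorem num_congr {B : ℕ → List ℕ} {N k : ℕ} {rem rem' : ℕ → ℕ} {x : ℕ}
    (h : ∀ j < N, rem' j = rem j) : num B N k rem' x = num B N k rem x := by
  unfold num
  congr 1
  refine Finset.sum_congr rfl fun i hi => ?_
  rw [h i (by simp [incS] at hi; exact hi.1)]

theorem Queue.congr {n N L : ℕ} {S : Finset ℕ} {s s' : Store} (h : Queue n N L S s)
    (hv : ∀ x ∈ [0, 20, 21, 22], s'.var x = s.var x)
    (ha : ∀ a ∈ [19, 20, 21, 23, 24, 25, 26, 27, 28, 29], s'.arr a = s.arr a) :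
    Queue n N L S s' where
  v0 := (hv 0 (by simp)).trans h.v0
  v20 := (hv 20 (by simp)).trans h.v20
  v21 := (hv 21 (by simp)).trans h.v21
  tables := by rw [ha 27 (by simp), ha 28 (by simp), ha 29 (by simp)]; exact h.tables
  buckets := by
    rw [ha 19 (by simp), ha 20 (by simp), ha 21 (by simp), ha 23 (by simp), ha 24 (by simp),
      ha 25 (by simp)]
    exact h.buckets
  champ := by rw [ha 25 (by simp), ha 26 (by simp)]; exact h.champ
  v22 := (hv 22 (by simp)).trans h.v22
  stair := by rw [ha 25 (by simp), ha 26 (by simp)]; exact h.stair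

theorem pot_congr {N : ℕ} {S : Finset ℕ} {s s' : Store} (h : s'.arr 24 = s.arr 24) :
    pot N S s' = pot N S s := by rw [pot, pot, h]

/-- Raise by the scalar `64` the numerators of the vertices alive in the block that starts at the
scalar `65`. -/
def bumpBlock : Cmd :=
  forUp 66 2 (
    30 ≔ .get 2 (.var 65) ;;
    .ite (.get 21 (.var 30)) .skip (32 ≔ .get 20 (.var 30) +ₑ .var 64 ;; touch) ;;
    65 ≔ .var 65 +ₑ .lit 1)

/-- Delete the vertex in the scalar `45` from the instance at the position of the scalar `60` in its
incidence list. -/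
def dropInstance : Cmd :=
  62 ≔ .get 18 (.var 45 *ₑ .var 3 +ₑ .var 60) ;; 63 ≔ .get 22 (.var 62) ;;
  .store 22 (.var 62) (.var 63 -ₑ .lit 1) ;;
  52 ≔ .var 52 +ₑ (.var 63 =ₑ .var 2) -ₑ (.var 63 =ₑ .lit 1) ;;
  64 ≔ (.var 63 =ₑ .var 2) +ₑ (.var 63 =ₑ .lit 2) ;;
  .ite (.var 64) (65 ≔ .var 2 *ₑ .var 62 ;; 66 ≔ .lit 0 ;; bumpBlock) .skip

/-- Delete the vertex in the scalar `45` from all its instances. -/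
def dropVertex : Cmd :=
  60 ≔ .lit 0 ;; 61 ≔ .get 3 (.var 45) ;; forUp 60 61 dropInstance

theorem bumpBlock_spec {K n N L k j d : ℕ} {S : Finset ℕ} {B : ℕ → List ℕ}
    (hK : (N + 2) * (3 * (N + 1) + 1) < K)
    (hnK : n < K) (hkK : k < K) (hkN : k * N + 1 < K) (hj : j < N) {s : Store} (hQ : Queue n N L S s)
    (h2 : s.var 2 = k) (hB : B j = block (s.arr 2) k j) (hnd : (B j).Nodup) (hlt : ∀ x ∈ B j, x < n)
    (h64 : s.var 64 = d) (hd : 1 ≤ d) (h65 : s.var 65 = k * j) (h66 : s.var 66 = 0)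
    (hx : ∀ x ∈ B j, s.arr 21 x = 0 → 0 < s.arr 20 x ∧ s.arr 20 x + d ≤ 3 * s.arr 19 x) {r : ℤ}
    (hr : 60 * (pot N S s : ℤ) + 500 * k + 10 ≤ r) :
    WP K bumpBlock s r fun s' r' => ∃ S' : Finset ℕ, Queue n N L S' s' ∧
      r - (60 * (pot N S s : ℤ) + 500 * k + 10) + 60 * pot N S' s' ≤ r' ∧
      ∀ x, s'.arr 20 x = s.arr 20 x + if x ∈ B j ∧ s.arr 21 x = 0 then d else 0 := by
  have hlB : (B j).length = k := by rw [hB]; simp [block]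
  refine WP.forUp k 0 (fun i s' r' => ∃ S' : Finset ℕ, Queue n N L S' s' ∧
      s'.var 65 = k * j + i ∧
      r - 60 * (pot N S s : ℤ) - 500 * i + 60 * pot N S' s' ≤ r' ∧
      ∀ x, s'.arr 20 x = s.arr 20 x + if x ∈ (B j).take i ∧ s.arr 21 x = 0 then d else 0)
      hkK (Nat.zero_le _) h66 h2 (by decide) (by decide) (by decide)
      ⟨S, hQ, h65, by push_cast; omega, by simp⟩ ?_ ?_ ?_
  · rintro i s' r' hi ⟨S', _, _, h, _⟩
    have h1 : 0 ≤ (pot N S' s' : ℤ) := Int.natCast_nonneg _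
    have h2 : (i : ℤ) ≤ k := by exact_mod_cast hi
    omega
  · rintro i s' r' _ hi hxi hS ⟨S', hQ', w65, hrr, hcur⟩
    have e2 : s'.arr 2 = s.arr 2 := hS.2 2 (by decide)
    have e19 : s'.arr 19 = s.arr 19 := hS.2 19 (by decide)
    have e21 : s'.arr 21 = s.arr 21 := hS.2 21 (by decide)
    have v64 : s'.var 64 = d := (hS.1 64 (by decide)).trans h64
    have hi' : i < (B j).length := by omega
    have hxv : s.arr 2 (k * j + i) = (B j)[i] := by simp [hB, block]
    have hxB : (B j)[i] ∈ B j := List.getElem_mem hi'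
    generalize hxdef : (B j)[i] = x at hxv hxB
    have htake : (B j).take (i + 1) = (B j).take i ++ [x] := by
      rw [List.take_succ_eq_append_getElem hi', hxdef]
    have hxn : x ∉ (B j).take i := by
      have := hnd.sublist (List.take_sublist (i + 1) (B j))
      rw [htake, List.nodup_append] at this
      intro h
      exact this.2.2 x h x (by simp) rfl
    have hkj : k * j + k ≤ k * N := by
      have := Nat.mul_le_mul_left k (show j + 1 ≤ N from hj)
      rwa [mul_add, mul_one] at this
    have hpot : 0 ≤ (pot N S' s' : ℤ) := Int.natCast_nonneg _
    simp only [WP, Expr.Small, Expr.eval, Expr.cost, Op.apply, true_and, Store.var_setVar,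
      Store.arr_setVar, Nat.reduceEqDiff, if_true, if_false, e2, w65, hxv, e21, v64]
    have hcurx : s'.arr 20 x = s.arr 20 x := by rw [hcur]; simp [hxn]
    have hik : (i : ℤ) + 1 ≤ k := by exact_mod_cast hi
    refine ⟨fun hdead => ⟨by omega, S', hQ'.congr ?_ fun a _ => by simp [Store.arr_setVar], by ring,
      ?_, fun y => ?_⟩, fun hlive => ?_⟩
    · intro y hy
      fin_cases hy <;> simp [Store.var_setVar]
    · have hp : pot N S' (((s'.setVar 30 x).setVar 65 (k * j + i + 1)).setVar 66 (i + 1)) =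
          pot N S' s' :=
        pot_congr rfl
      rw [hp]
      push_cast; omega
    · rw [hcur, htake]
      congr 2
      simp only [List.mem_append, List.mem_singleton, eq_iff_iff]
      constructor
      · tauto
      · rintro ⟨h1 | rfl, h2⟩
        · exact ⟨h1, h2⟩
        · omega
    · obtain ⟨hx1, hx2⟩ := hx x hxB hlive
      obtain ⟨hb1, hb2, hb3, hb4⟩ := hQ'.buckets.bd x (hlt x hxB) (by omega)
      rw [e19] at hb1 hb2 hb3 hb4
      rw [hcurx] at hb3 hb4
      rw [hcurx]
      have hp : pot N S' ((s'.setVar 30 x).setVar 32 (s.arr 20 x + d)) = pot N S' s' := pot_congr rfl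
      have hK3 : 3 * (N + 1) < K := by nlinarith
      refine ⟨by omega, ?_⟩
      have hQ2 : Queue n N L S' ((s'.setVar 30 x).setVar 32 (s.arr 20 x + d)) :=
        hQ'.congr (fun y hy => by fin_cases hy <;> simp [Store.var_setVar])
          fun a _ => by simp [Store.arr_setVar]
      refine (touch_spec (v := x) (a := s.arr 20 x + d) hK hnK hQ2 (by simp [Store.var_setVar])
        (by simp [Store.var_setVar]) (hlt x hxB) (by simpa [Store.arr_setVar, e21] using hlive)
        (by simp only [Store.arr_setVar, hcurx]; omega) (by simpa [Store.arr_setVar, e19] using hb1)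
        (by simpa [Store.arr_setVar, e19] using hb2)
        (by simp only [Store.arr_setVar, e19]; omega)
        (by simpa only [Store.arr_setVar, e19] using hx2) ?_).conseq ?_
      · rw [hp]
        push_cast; omega
      · rintro s2 r2 ⟨S2, g1, g2, g3⟩ hS2
        rw [hp] at g2
        have hp2 : pot N S2 ((s2.setVar 65 (k * j + i + 1)).setVar 66 (i + 1)) = pot N S2 s2 :=
          pot_congr rfl
        have w65' : s2.var 65 = k * j + i := by
          rw [hS2.1 65 (by decide)]; simp [Store.var_setVar, w65]
        simp only [w65', Store.arr_setVar] at g3 ⊢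
        refine ⟨by omega, S2, g1.congr (fun y hy => by fin_cases hy <;> simp [Store.var_setVar])
          fun a _ => by simp [Store.arr_setVar], by ring, ?_, fun y => ?_⟩
        · rw [hp2]
          push_cast at *; omega
        · rw [g3, htake]
          rcases eq_or_ne y x with rfl | hyx
          · simp [hlive]
          · rw [Function.update_of_ne hyx, hcur]
            simp [hyx]
  · rintro s' r' _ _ ⟨S', hQ', _, hrr, hcur⟩
    refine ⟨S', hQ', by omega, fun x => ?_⟩
    rw [hcur, List.take_of_length_le (by omega)]

/-- The contributions of the instance to its remaining vertices are adjusted only if they change; this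
costs `O(k)` and is paid for by `changes`. -/
theorem dropInstance_spec {K n N L k u i j : ℕ} {S : Finset ℕ} {B : ℕ → List ℕ}
    (hK : (N + 2) * (3 * (N + 1) + 1) < K) (hk : 2 ≤ k)
    (hnK : n < K) (hkK : k < K) (hkN : k * N + 1 < K) (hj : j < N) {s : Store} (hQ : Queue n N L S s)
    (h2 : s.var 2 = k) (h3 : s.var 3 = N) (h45 : s.var 45 = u) (h60 : s.var 60 = i)
    (h18 : s.arr 18 (u * N + i) = j)
    (hB : B j = block (s.arr 2) k j) (hnd : (B j).Nodup) (hlt : ∀ x ∈ B j, x < n)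
    (hr1 : 1 ≤ s.arr 22 j) (hrk : s.arr 22 j ≤ k)
    (hlive : ∀ x ∈ B j, s.arr 21 x = 0 → 2 ≤ s.arr 22 j)
    (hden : ∀ x < n, s.arr 19 x = max (incS B N x).card 1)
    (hnum : ∀ x < n, s.arr 21 x = 0 → s.arr 20 x = num B N k (s.arr 22) x)
    (hcut : s.var 52 = ∑ i ∈ Finset.range N, isCut k (s.arr 22 i)) {r : ℤ}
    (hr : 60 * (pot N S s : ℤ) + 600 * k * (∑ i ∈ Finset.range N, changes k (s.arr 22 i) : ℕ) + 100 ≤ r) :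
    WP K dropInstance s r fun s' r' => ∃ S' : Finset ℕ, Queue n N L S' s' ∧
      s'.arr 22 = Function.update (s.arr 22) j (s.arr 22 j - 1) ∧
      (∀ x < n, s'.arr 21 x = 0 → s'.arr 20 x = num B N k (s'.arr 22) x) ∧
      s'.var 52 = ∑ i ∈ Finset.range N, isCut k (s'.arr 22 i) ∧
      r - (60 * (pot N S s : ℤ) + 600 * k * (∑ i ∈ Finset.range N, changes k (s.arr 22 i) : ℕ) + 100) +
      (60 * (pot N S' s' : ℤ) + 600 * k * (∑ i ∈ Finset.range N, changes k (s'.arr 22 i) : ℕ)) ≤ r' := by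
  have hjr : j ∈ Finset.range N := Finset.mem_range.2 hj
  have hcut' := sum_update (f := isCut k) (rem := s.arr 22) (v := s.arr 22 j - 1) hjr
  have hch' := sum_update (f := changes k) (rem := s.arr 22) (v := s.arr 22 j - 1) hjr
  obtain ⟨hc1, hc2⟩ := changes_pred hk hr1 hrk
  have hcutN : ∑ i ∈ Finset.range N, isCut k (s.arr 22 i) ≤ N := by
    have := Finset.sum_le_card_nsmul (Finset.range N) (fun i => isCut k (s.arr 22 i)) 1
      fun i _ => by unfold isCut; split <;> omega
    simpa using this
  have hK3 : 3 * N + 3 < K := by nlinarith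
  -- An instance becomes cut by its first deletion and ceases to be cut by its last one.
  have hcutv : s.var 52 + (if s.arr 22 j = k then 1 else 0) - (if s.arr 22 j = 1 then 1 else 0) =
      ∑ i ∈ Finset.range N, isCut k (Function.update (s.arr 22) j (s.arr 22 j - 1) i) := by
    have : isCut k (s.arr 22 j) + (if s.arr 22 j = k then 1 else 0) =
        isCut k (s.arr 22 j - 1) + (if s.arr 22 j = 1 then 1 else 0) := by
      unfold isCut; split_ifs <;> omega
    omega
  have hkj : k * j ≤ k * N := Nat.mul_le_mul_left k hj.le
  have hkch : (k : ℤ) * (∑ i ∈ Finset.range N, changes k (Function.update (s.arr 22) j (s.arr 22 j - 1) i) : ℕ) +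
      k * (changes k (s.arr 22 j) - changes k (s.arr 22 j - 1) : ℕ) =
      k * (∑ i ∈ Finset.range N, changes k (s.arr 22 i) : ℕ) := by
    have : (∑ i ∈ Finset.range N, changes k (Function.update (s.arr 22) j (s.arr 22 j - 1) i)) +
      (changes k (s.arr 22 j) - changes k (s.arr 22 j - 1)) =
      ∑ i ∈ Finset.range N, changes k (s.arr 22 i) := by omega
    rw [← this, Nat.cast_add]; ring
  have hknn : (0 : ℤ) ≤ k * (changes k (s.arr 22 j) - changes k (s.arr 22 j - 1) : ℕ) := by positivity
  have hknn' : (0 : ℤ) ≤ k * (∑ i ∈ Finset.range N,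
    changes k (Function.update (s.arr 22) j (s.arr 22 j - 1) i) : ℕ) := by positivity
  have hnum' : ∀ x < n, x ∉ B j → s.arr 21 x = 0 →
      s.arr 20 x = num B N k (Function.update (s.arr 22) j (s.arr 22 j - 1)) x := by
    intro x hx hxB hx0
    rw [num_update_of_notMem hxB, hnum x hx hx0]
  have hnum2 : ∀ x ∈ B j, s.arr 21 x = 0 →
      num B N k (Function.update (s.arr 22) j (s.arr 22 j - 1)) x =
        s.arr 20 x + delta k (s.arr 22 j) := by
    intro x hxB hx0
    rw [num_update_of_mem hj hxB hk (hlive x hxB hx0) hrk, hnum x (hlt x hxB) hx0]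
  have hdelta : delta k (s.arr 22 j) ≤ 2 := by unfold delta; split_ifs <;> omega
  simp only [mul_assoc] at *
  simp only [dropInstance, WP, Expr.Small, Expr.eval, Expr.cost, Op.apply, true_and, Store.var_setVar,
    Store.arr_setVar, Store.var_setArr, Store.arr_setArr, Nat.reduceEqDiff, if_true, if_false,
    h2, h3, h45, h60, h18, hcutv]
  rw [show ((if s.arr 22 j = k then 1 else 0) + if s.arr 22 j = 2 then 1 else 0 : ℕ) =
    delta k (s.arr 22 j) from rfl]
  refine ⟨by omega, ?_, by omega, fun hne => ⟨by omega, ?_⟩, fun h0 => ⟨S, hQ.congr ?_ ?_, ?_, ?_⟩⟩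
  · have : ∑ i ∈ Finset.range N, isCut k (Function.update (s.arr 22) j (s.arr 22 j - 1) i) ≤ N := by
      have := Finset.sum_le_card_nsmul (Finset.range N) (fun i => isCut k
        (Function.update (s.arr 22) j (s.arr 22 j - 1) i)) 1
        fun i _ => by unfold isCut; split <;> omega
      simpa using this
    omega
  · have hkk : (k : ℤ) ≤ k * (changes k (s.arr 22 j) - changes k (s.arr 22 j - 1) : ℕ) := by
      have h1 := hc2 hne
      have h2 : (1 : ℤ) ≤ (changes k (s.arr 22 j) - changes k (s.arr 22 j - 1) : ℕ) := by
        exact_mod_cast (show 1 ≤ changes k (s.arr 22 j) - changes k (s.arr 22 j - 1) by omega)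
      nlinarith
    have hk2 : (2 : ℤ) ≤ k := by exact_mod_cast hk
    refine (bumpBlock_spec (j := j) (d := delta k (s.arr 22 j)) (B := B) (S := S) (L := L) (k := k) hK hnK hkK hkN hj
      (hQ.congr ?_ ?_) (by simp [Store.var_setVar, Store.var_setArr, h2])
      (by simpa [Store.arr_setVar, Store.arr_setArr] using hB) hnd hlt
      (by simp [Store.var_setVar]) (by omega)
      (by simp [Store.var_setVar]) (by simp [Store.var_setVar]) ?_ ?_).conseq ?_
    · intro y hy; fin_cases hy <;> simp [Store.var_setVar, Store.var_setArr]
    · intro y hy; fin_cases hy <;> simp [Store.arr_setVar, Store.arr_setArr]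
    · simp only [Store.arr_setVar, Store.arr_setArr, Nat.reduceEqDiff, if_false]
      intro x hxB hx0
      have h1 := (num_bounds (B := B) (N := N) (k := k) (rem := s.arr 22) (x := x)).1
      have h3 := (num_bounds (B := B) (N := N) (k := k)
        (rem := Function.update (s.arr 22) j (s.arr 22 j - 1)) (x := x)).2
      rw [hnum2 x hxB hx0] at h3
      rw [hden x (hlt x hxB)]
      rw [← hnum x (hlt x hxB) hx0] at h1
      omega
    · rw [pot_congr (s := s) (by simp [Store.arr_setVar, Store.arr_setArr])]
      simp only [Nat.cast_add, Nat.cast_one]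
      omega
    · rintro s' r' ⟨S', g1, g2, g3⟩ hS
      rw [pot_congr (s := s) (by simp [Store.arr_setVar, Store.arr_setArr])] at g2
      simp only [Nat.cast_add, Nat.cast_one] at g2
      have e22 : s'.arr 22 = Function.update (s.arr 22) j (s.arr 22 j - 1) := by
        rw [hS.2 22 (by decide)]; simp [Store.arr_setVar, Store.arr_setArr]
      have e21 : s'.arr 21 = s.arr 21 := by
        rw [hS.2 21 (by decide)]; simp [Store.arr_setVar, Store.arr_setArr]
      simp only [Store.arr_setVar, Store.arr_setArr, Nat.reduceEqDiff, if_false] at g3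
      rw [e21, e22]
      refine ⟨S', g1, rfl, fun x hx hx0 => ?_, ?_, ?_⟩
      · rw [g3]
        by_cases hxB : x ∈ B j
        · rw [hnum2 x hxB hx0, if_pos ⟨hxB, hx0⟩]
        · rw [if_neg (fun h => hxB h.1), add_zero]
          exact hnum' x hx hxB hx0
      · rw [hS.1 52 (by decide)]; simp [Store.var_setVar]
      · omega
  · intro y hy; fin_cases hy <;> simp [Store.var_setVar, Store.var_setArr]
  · intro y hy; fin_cases hy <;> simp [Store.arr_setVar, Store.arr_setArr]
  · intro x hx hx0
    by_cases hxB : x ∈ B j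
    · rw [hnum2 x hxB hx0, h0, add_zero]
    · exact hnum' x hx hxB hx0
  · rw [pot_congr (s := s) (S := S) (N := N) (s' := Store.setVar _ _ _)
      (by simp [Store.arr_setVar, Store.arr_setArr])]
    simp only [Nat.cast_add, Nat.cast_one]
    omega


/-- The number of vertices of the `j`-th block that are not in the list `del`. -/
def remC (B : ℕ → List ℕ) (del : List ℕ) (j : ℕ) : ℕ := (B j).countP fun x => x ∉ del

theorem remC_append {B : ℕ → List ℕ} {del : List ℕ} {j u : ℕ} (hnd : (B j).Nodup) (hu : u ∉ del) :
    remC B (del ++ [u]) j + (if u ∈ B j then 1 else 0) = remC B del j := by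
  unfold remC
  generalize B j = l at *
  induction l with
  | nil => simp
  | cons a l ih =>
    rw [List.nodup_cons] at hnd
    have hl := ih hnd.2
    simp only [List.countP_cons, List.mem_append, List.mem_cons, List.not_mem_nil, or_false,
      decide_eq_true_eq] at hl ⊢
    by_cases hau : a = u
    · subst hau
      simp [hnd.1, hu] at hl ⊢
      omega
    · have hua : u ≠ a := fun h => hau h.symm
      by_cases had : a ∈ del <;> simp [had, hau, hua] at hl ⊢ <;> omega

/-- Deleting a vertex from all its instances. -/
theorem dropVertex_spec {K n N L k u : ℕ} {S : Finset ℕ} {B : ℕ → List ℕ} {del : List ℕ}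
    (hK : (N + 2) * (3 * (N + 1) + 1) < K) (hk : 2 ≤ k)
    (hnK : n < K) (hkK : k < K) (hkN : k * N + 1 < K) {s : Store} (hQ : Queue n N L S s)
    (h2 : s.var 2 = k) (h3 : s.var 3 = N) (h45 : s.var 45 = u)
    (hinc : rd (s.arr 18) (s.arr 3) N u = incL B N u)
    (hB : ∀ j < N, B j = block (s.arr 2) k j) (hnd : ∀ j < N, (B j).Nodup)
    (hlt : ∀ j < N, ∀ x ∈ B j, x < n) (hu : u ∉ del)
    (hdead : ∀ x < n, s.arr 21 x = 0 ↔ x ∉ del ++ [u])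
    (hrem : ∀ j < N, s.arr 22 j = remC B del j)
    (hden : ∀ x < n, s.arr 19 x = max (incS B N x).card 1)
    (hnum : ∀ x < n, s.arr 21 x = 0 → s.arr 20 x = num B N k (s.arr 22) x)
    (hcut : s.var 52 = ∑ i ∈ Finset.range N, isCut k (s.arr 22 i)) {r : ℤ}
    (hr : 60 * (pot N S s : ℤ) + 600 * k * (∑ i ∈ Finset.range N, changes k (s.arr 22 i) : ℕ) +
      120 * s.arr 3 u + 150 ≤ r) :
    WP K dropVertex s r fun s' r' => ∃ S' : Finset ℕ, Queue n N L S' s' ∧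
      (∀ j < N, s'.arr 22 j = remC B (del ++ [u]) j) ∧
      (∀ x < n, s'.arr 21 x = 0 → s'.arr 20 x = num B N k (s'.arr 22) x) ∧
      s'.var 52 = ∑ i ∈ Finset.range N, isCut k (s'.arr 22 i) ∧
      r - (60 * (pot N S s : ℤ) + 600 * k * (∑ i ∈ Finset.range N, changes k (s.arr 22 i) : ℕ) +
        120 * s.arr 3 u + 150) +
      (60 * (pot N S' s' : ℤ) +
        600 * k * (∑ i ∈ Finset.range N, changes k (s'.arr 22 i) : ℕ)) ≤ r' := by
  have hlen : s.arr 3 u = (incL B N u).length := by rw [← hinc]; simp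
  have hndL : (incL B N u).Nodup := List.nodup_range.filter _
  have hmemL : ∀ j, j ∈ incL B N u ↔ j < N ∧ u ∈ B j := fun j => by simp [incL]
  have hlenN : s.arr 3 u ≤ N := hlen ▸ length_incL_le
  have hK3 : 3 * N + 3 < K := by nlinarith
  simp only [dropVertex, WP, Expr.Small, Expr.eval, Expr.cost, true_and, Store.var_setVar,
    Store.arr_setVar, Nat.reduceEqDiff, if_false, h45]
  refine WP.forUp (s.arr 3 u) 0 (fun i s' r' => ∃ S' : Finset ℕ, Queue n N L S' s' ∧
      (∀ j < N, s'.arr 22 j = remC B (del ++ [u]) j + if j ∈ (incL B N u).drop i then 1 else 0) ∧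
      (∀ x < n, s'.arr 21 x = 0 → s'.arr 20 x = num B N k (s'.arr 22) x) ∧
      s'.var 52 = ∑ i ∈ Finset.range N, isCut k (s'.arr 22 i) ∧
      r - (60 * (pot N S s : ℤ) + 600 * k * (∑ i ∈ Finset.range N, changes k (s.arr 22 i) : ℕ) +
        120 * i + 5) +
      (60 * (pot N S' s' : ℤ) +
        600 * k * (∑ i ∈ Finset.range N, changes k (s'.arr 22 i) : ℕ)) ≤ r')
    (by omega) (Nat.zero_le _) (by simp [Store.var_setVar]) (by simp [Store.var_setVar])
    (by decide) (by decide) (by decide) ?_ ?_ ?_ ?_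
  · refine ⟨S, hQ.congr (fun y hy => by fin_cases hy <;> simp [Store.var_setVar])
      (fun y _ => by simp [Store.arr_setVar]), ?_, by simpa [Store.arr_setVar] using hnum,
      by simpa [Store.arr_setVar, Store.var_setVar] using hcut, ?_⟩
    · intro j hj
      have h := remC_append (B := B) (j := j) (hnd j hj) hu
      simp only [Store.arr_setVar, List.drop_zero, hmemL, hj, true_and, hrem j hj]
      exact h.symm
    · rw [pot_congr (s := s) (S := S) (N := N) (s' := Store.setVar _ _ _) (by simp [Store.arr_setVar])]
      simp only [Store.arr_setVar]
      push_cast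
      omega
  · rintro i s' r' hi ⟨S', _, _, _, _, h⟩
    have h1 : 0 ≤ (pot N S' s' : ℤ) := Int.natCast_nonneg _
    have h2 : 0 ≤ 600 * (k : ℤ) * (∑ i ∈ Finset.range N, changes k (s'.arr 22 i) : ℕ) := by positivity
    have h2 : (i : ℤ) ≤ s.arr 3 u := by exact_mod_cast hi
    omega
  · rintro i s' r' _ hi hx hS ⟨S', hQ', hrem', hnum', hcut', hrr⟩
    have ha : ∀ a ∈ [2, 3, 18, 19, 21], s'.arr a = s.arr a := fun a ha => by
      rw [hS.2 a (by fin_cases ha <;> decide)]; simp [Store.arr_setVar]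
    have hv : ∀ a ∈ [2, 3, 45], s'.var a = s.var a := fun a ha => by
      rw [hS.1 a (by fin_cases ha <;> decide)]; fin_cases ha <;> simp [Store.var_setVar]
    have hi' : i < (incL B N u).length := hlen ▸ hi
    have hdrop : (incL B N u).drop i = (incL B N u)[i] :: (incL B N u).drop (i + 1) :=
      List.drop_eq_getElem_cons hi'
    have h18 : s.arr 18 (u * N + i) = (incL B N u)[i] := by
      rw [List.getElem_of_eq hinc.symm, getElem_rd]
    have hjm : (incL B N u)[i] ∈ incL B N u := List.getElem_mem hi'
    generalize hjd : (incL B N u)[i] = j at hdrop h18 hjm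
    obtain ⟨hj, huj⟩ := (hmemL j).1 hjm
    have hjn : j ∉ (incL B N u).drop (i + 1) := by
      have := hndL.sublist (List.drop_sublist i (incL B N u))
      rw [hdrop] at this
      exact (List.nodup_cons.1 this).1
    have hremj := hrem' j hj
    rw [hdrop, if_pos (by simp)] at hremj
    have hle : remC B (del ++ [u]) j + 1 ≤ k := by
      have h := remC_append (B := B) (j := j) (hnd j hj) hu
      rw [if_pos huj] at h
      rw [h, ← show (B j).length = k by rw [hB j hj]; simp [block]]
      exact List.countP_le_length
    have h1 : 0 ≤ (pot N S' s' : ℤ) := Int.natCast_nonneg _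
    have hk1 : 0 ≤ 600 * (k : ℤ) * (∑ i ∈ Finset.range N, changes k (s'.arr 22 i) : ℕ) := by positivity
    have h2i : (i : ℤ) + 1 ≤ s.arr 3 u := by exact_mod_cast hi
    refine (dropInstance_spec (j := j) (u := u) (i := i) (B := B) hK hk hnK hkK hkN hj hQ'
      ((hv 2 (by simp)).trans h2)
      ((hv 3 (by simp)).trans h3) ((hv 45 (by simp)).trans h45) hx
      (by rw [ha 18 (by simp)]; exact h18) (by rw [ha 2 (by simp)]; exact hB j hj) (hnd j hj)
      (hlt j hj) (by omega) (by omega) ?_ (by rw [ha 19 (by simp)]; exact hden) hnum' hcut'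
      (by omega)).mono ?_
    · intro x hxB hx0
      rw [ha 21 (by simp), hdead x (hlt j hj x hxB)] at hx0
      have : 0 < remC B (del ++ [u]) j := List.countP_pos_iff.2 ⟨x, hxB, by simpa using hx0⟩
      omega
    · rintro s2 r2 ⟨S2, g1, g2, g3, g4, g5⟩
      refine ⟨S2, g1.congr (fun y hy => by fin_cases hy <;> simp [Store.var_setVar])
        (fun y _ => by simp [Store.arr_setVar]), ?_, by simpa [Store.arr_setVar] using g3,
        by simpa [Store.arr_setVar, Store.var_setVar] using g4, ?_⟩
      · intro y hy
        rw [Store.arr_setVar, g2]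
        rcases eq_or_ne y j with rfl | hyj
        · rw [Function.update_self, hremj, if_neg hjn]; simp
        · rw [Function.update_of_ne hyj, hrem' y hy, hdrop]
          simp [hyj]
      · rw [pot_congr (s := s2) (S := S2) (N := N) (s' := Store.setVar _ _ _)
          (by simp [Store.arr_setVar])]
        simp only [Store.arr_setVar]
        push_cast at *
        omega
  · rintro s' r' _ _ ⟨S', hQ', hrem', hnum', hcut', hrr⟩
    refine ⟨S', hQ', fun j hj => ?_, hnum', hcut', by omega⟩
    rw [hrem' j hj, hlen, List.drop_length]
    simp

/-! ### Filling the priority queue -/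

/-- The denominators of the keys. -/
def initDen : Cmd :=
  4 ≔ .lit 0 ;;
  forUp 4 0 (.ite (.get 3 (.var 4)) (.store 19 (.var 4) (.get 3 (.var 4)))
    (.store 19 (.var 4) (.lit 1)))

/-- An empty priority queue. -/
def initQueue : Cmd :=
  21 ≔ .lit 3 *ₑ (.var 3 +ₑ .lit 1) +ₑ .lit 1 ;; 22 ≔ .get 27 (.var 20) ;;
  4 ≔ .lit 0 ;; 5 ≔ .var 20 +ₑ .lit 1 ;;
  forUp 4 5 (.store 26 (.var 4) (.get 27 (.var 4)))

/-- Insert all vertices into the priority queue. -/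
def initCur : Cmd :=
  50 ≔ .lit 0 ;;
  forUp 50 0 (
    30 ≔ .var 50 ;; .ite (.get 3 (.var 30)) (32 ≔ .get 3 (.var 30)) (32 ≔ .lit 3) ;; touch)

theorem initDen_spec {K n : ℕ} (hnK : n < K) {s : Store} (h0 : s.var 0 = n) {r : ℤ}
    (hr : 20 * (n : ℤ) + 10 ≤ r) :
    WP K initDen s r fun s' r' => r - (20 * (n : ℤ) + 10) ≤ r' ∧
      ∀ x < n, s'.arr 19 x = max (s.arr 3 x) 1 := by
  simp only [initDen, WP, Expr.Small, Expr.eval, Expr.cost, true_and]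
  refine WP.forUp_sum n 0 (fun i s' => ∀ x < i, s'.arr 19 x = max (s.arr 3 x) 1) (fun _ => 10) hnK
    (Nat.zero_le _) (by simp [Store.var_setVar]) (by simp [Store.var_setVar, h0]) (by decide)
    (by decide) (by decide) (by simp) ?_ ?_ ?_
  · simp; omega
  · rintro i s' r' _ hi hx hS hI hr'
    have e3 : s'.arr 3 = s.arr 3 := (hS.2 3 (by decide)).trans (by simp [Store.arr_setVar])
    simp only [WP, Expr.Small, Expr.eval, Expr.cost, true_and, Store.arr_setVar, Store.arr_setArr,
      if_true, hx, e3]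
    refine ⟨fun h => ⟨by push_cast at *; omega, fun x hx => ?_⟩,
      fun h => ⟨by push_cast at *; omega, fun x hx => ?_⟩⟩
    all_goals
      rcases Nat.lt_succ_iff_lt_or_eq.1 hx with hx | rfl
      · rw [Function.update_of_ne (by omega), hI x hx]
      · rw [Function.update_self]; omega
  · rintro s' r' hrr _ _ hI
    simp only [Finset.sum_const, Nat.card_Ico, nsmul_eq_mul] at hrr
    exact ⟨by push_cast at hrr; omega, hI⟩

theorem initQueue_spec {K n N L : ℕ} (hK : (N + 2) * (3 * (N + 1) + 1) < K) {s : Store}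
    (h0 : s.var 0 = n) (h3 : s.var 3 = N) (h20 : s.var 20 = L)
    (hT : Tables N L (s.arr 27) (s.arr 28) (s.arr 29)) (hcur : ∀ x, s.arr 20 x = 0)
    (hH : ∀ x, s.arr 24 x = 0) (hq : ∀ x, s.arr 25 x = 0) {r : ℤ} (hr : 40 * (N : ℤ) + 140 ≤ r) :
    WP K initQueue s r fun s' r' => r - (40 * (N : ℤ) + 140) ≤ r' ∧ Queue n N L {L} s' ∧
      pot N {L} s' = 1 := by
  have hLlt : L < 2 ^ L := Nat.lt_two_pow_self
  have hge := hT.ge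
  have hK' : 4 * (N + 2) < K := by nlinarith
  simp only [initQueue, WP, Expr.Small, Expr.eval, Expr.cost, Op.apply, true_and, Store.var_setVar,
    Store.arr_setVar, Nat.reduceEqDiff, if_false, h3, h20]
  refine ⟨by omega, by omega, ?_⟩
  refine WP.forUp_sum (L + 1) 0 (fun i s' => ∀ x < i, s'.arr 26 x = 2 ^ x) (fun _ => 5) (by omega)
    (Nat.zero_le _) (by simp [Store.var_setVar]) (by simp [Store.var_setVar]) (by decide)
    (by decide) (by decide) (by simp) ?_ ?_ ?_
  · simp; omega
  · rintro i s' r' _ hi hx hS hI hr'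
    have e27 : s'.arr 27 = s.arr 27 := (hS.2 27 (by decide)).trans (by simp [Store.arr_setVar])
    simp only [WP, Expr.Small, Expr.eval, Expr.cost, true_and, Store.arr_setVar, Store.arr_setArr,
      if_true, hx, e27]
    refine ⟨by push_cast at *; omega, fun x hx => ?_⟩
    rcases Nat.lt_succ_iff_lt_or_eq.1 hx with hx | rfl
    · rw [Function.update_of_ne (by omega), hI x hx]
    · rw [Function.update_self, hT.pow x (by omega)]
  · rintro s' r' hrr _ hS hI
    have ha : ∀ a, a ≠ 26 → s'.arr a = s.arr a := fun a ha => by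
      rw [hS.2 a (by simpa [Cmd.wa] using ha)]; simp [Store.arr_setVar]
    simp only [Finset.sum_const, Nat.card_Ico, nsmul_eq_mul] at hrr
    have hkey : ∀ b, key (s'.arr 25) b = 0 := fun b => by
      rw [key, ha 25 (by decide), hq]; simp
    have hrd : ∀ i, rd (s'.arr 23) (s'.arr 24) n i = [] := fun i => by
      rw [ha 24 (by decide)]; simp [rd, hH]
    refine ⟨by push_cast at hrr; omega, ⟨?_, ?_, ?_, ?_, ?_, ?_, ?_, ?_⟩, ?_⟩
    · rw [hS.1 0 (by decide)]; simp [Store.var_setVar, h0]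
    · rw [hS.1 20 (by decide)]; simp [Store.var_setVar, h20]
    · rw [hS.1 21 (by decide)]; simp [Store.var_setVar]
    · rw [ha 27 (by decide), ha 28 (by decide), ha 29 (by decide)]; exact hT
    · rw [ha 20 (by decide), ha 25 (by decide)]
      refine ⟨fun u _ h => ?_, fun i u hu => ?_, fun i => ?_, fun u _ h => ?_, fun b h => ?_⟩
      · rw [hcur] at h; omega
      · rw [hrd] at hu; simp at hu
      · rw [hrd]; simp
      · rw [hcur] at h; omega
      · rw [hq] at h; omega
    · intro i hi
      rw [Champion, hI i (by omega)]
      refine ⟨le_rfl, Nat.pow_lt_pow_right (by norm_num) (by omega), fun b _ _ => ?_⟩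
      rw [hkey, hkey]
    · rw [hS.1 22 (by decide)]; simp [Store.var_setVar, word, hT.pow L (by omega)]
    · refine ⟨by simp, by simp, fun _ _ => Nat.zero_le _, fun t _ j _ _ _ => ?_⟩
      simp only [hkey, le_rfl]
    · simp [pot, ha 24 (by decide), hH]

theorem initCur_spec {K n N L : ℕ} {S : Finset ℕ} (hK : (N + 2) * (3 * (N + 1) + 1) < K)
    (hnK : n < K) {s : Store} (hQ : Queue n N L S s) (hcur : ∀ x, s.arr 20 x = 0)
    (hd : ∀ x, s.arr 21 x = 0) (hM : ∀ x < n, s.arr 3 x ≤ N)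
    (hden : ∀ x < n, s.arr 19 x = max (s.arr 3 x) 1) {r : ℤ}
    (hr : 60 * (pot N S s : ℤ) + 500 * n + 10 ≤ r) :
    WP K initCur s r fun s' r' => ∃ S' : Finset ℕ, Queue n N L S' s' ∧
      r - (60 * (pot N S s : ℤ) + 500 * n + 10) + 60 * pot N S' s' ≤ r' ∧
      ∀ x < n, s'.arr 20 x = if s.arr 3 x = 0 then 3 else s.arr 3 x := by
  simp only [initCur, WP, Expr.Small, Expr.eval, Expr.cost, true_and]
  refine WP.forUp n 0 (fun i s' r' => ∃ S' : Finset ℕ, Queue n N L S' s' ∧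
      r - (60 * (pot N S s : ℤ) + 500 * i + 2) + 60 * pot N S' s' ≤ r' ∧
      ∀ x, s'.arr 20 x = if x < i then if s.arr 3 x = 0 then 3 else s.arr 3 x else 0)
      hnK (Nat.zero_le _) (by simp [Store.var_setVar]) (by simp [Store.var_setVar, hQ.v0])
      (by decide) (by decide) (by decide) ?_ ?_ ?_ ?_
  · refine ⟨S, hQ.congr (fun y hy => by fin_cases hy <;> simp [Store.var_setVar])
      (fun y _ => by simp [Store.arr_setVar]), ?_, by simp [Store.arr_setVar, hcur]⟩
    rw [pot_congr (s := s) (S := S) (N := N) (s' := Store.setVar _ _ _) (by simp [Store.arr_setVar])]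
    push_cast; omega
  · rintro i s' r' hi ⟨S', _, h, _⟩
    have h1 : 0 ≤ (pot N S' s' : ℤ) := Int.natCast_nonneg _
    have h2 : (i : ℤ) ≤ n := by exact_mod_cast hi
    omega
  · rintro i s' r' _ hi hx hS ⟨S', hQ', hrr, hc⟩
    have ha : ∀ a ∈ [3, 19, 21], s'.arr a = s.arr a := fun a ha => by
      rw [hS.2 a (by fin_cases ha <;> decide)]; simp [Store.arr_setVar]
    have e3 := ha 3 (by simp)
    have hMi := hM i hi
    have hdi := hden i hi
    have h2i : (i : ℤ) + 1 ≤ n := by exact_mod_cast hi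
    have h1 : 0 ≤ (pot N S' s' : ℤ) := Int.natCast_nonneg _
    have key : ∀ a : ℕ, (a = if s.arr 3 i = 0 then 3 else s.arr 3 i) → ∀ r0 : ℤ, r' - 30 ≤ r0 →
        WP K touch ((s'.setVar 30 i).setVar 32 a) r0 fun s'' r'' => ∃ S' : Finset ℕ,
          Queue n N L S' (s''.setVar 50 (i + 1)) ∧
          r - (60 * (pot N S s : ℤ) + 500 * (i + 1 : ℕ) + 2) +
            60 * pot N S' (s''.setVar 50 (i + 1)) ≤ r'' - 4 ∧
          ∀ x, (s''.setVar 50 (i + 1)).arr 20 x =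
            if x < i + 1 then if s.arr 3 x = 0 then 3 else s.arr 3 x else 0 := by
      intro a haa r0 hr0
      have hp : pot N S' ((s'.setVar 30 i).setVar 32 a) = pot N S' s' := pot_congr rfl
      refine (touch_spec (v := i) (a := a) hK hnK (hQ'.congr
        (fun y hy => by fin_cases hy <;> simp [Store.var_setVar])
        (fun y _ => by simp [Store.arr_setVar])) (by simp [Store.var_setVar])
        (by simp [Store.var_setVar]) hi (by simp [Store.arr_setVar, ha 21 (by simp), hd])
        ?_ ?_ ?_ ?_ ?_ (by rw [hp]; omega)).mono ?_
      · simp only [Store.arr_setVar, hc, lt_irrefl, if_false]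
        split_ifs at haa <;> omega
      · simp only [Store.arr_setVar, ha 19 (by simp), hdi]; omega
      · simp only [Store.arr_setVar, ha 19 (by simp), hdi]; omega
      · simp only [Store.arr_setVar, ha 19 (by simp), hdi]; split_ifs at haa <;> omega
      · simp only [Store.arr_setVar, ha 19 (by simp), hdi]; split_ifs at haa <;> omega
      · rintro s2 r2 ⟨S2, g1, g2, g3⟩
        rw [hp] at g2
        refine ⟨S2, g1.congr (fun y hy => by fin_cases hy <;> simp [Store.var_setVar])
          (fun y _ => by simp [Store.arr_setVar]), ?_, fun x => ?_⟩
        · rw [pot_congr (s := s2) (S := S2) (N := N) (s' := Store.setVar _ _ _)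
            (by simp [Store.arr_setVar])]
          push_cast at *; omega
        · simp only [Store.arr_setVar] at g3 ⊢
          rw [g3]
          rcases eq_or_ne x i with rfl | hxi
          · simp [haa]
          · rw [Function.update_of_ne hxi, hc]
            simp only [show x < i + 1 ↔ x < i by omega]
    simp only [WP, Expr.Small, Expr.eval, Expr.cost, true_and, Store.var_setVar, Store.arr_setVar,
      if_true, hx, e3]
    exact ⟨fun h => key _ (by rw [if_neg h]) _ (by push_cast; omega),
      fun h => key _ (by rw [if_pos h]) _ (by push_cast; omega)⟩
  · rintro s' r' _ _ ⟨S', hQ', hrr, hc⟩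
    exact ⟨S', hQ', by omega, fun x hx => by rw [hc, if_pos hx]⟩


/-! ### The greedy deletion -/

/-- The sum of `f` over the numbers below `n` that are not in the list `del`. -/
def volC (f : ℕ → ℕ) (n : ℕ) (del : List ℕ) : ℕ := ∑ x ∈ Finset.range n, if x ∈ del then 0 else f x

theorem volC_append {f : ℕ → ℕ} {n u : ℕ} {del : List ℕ} (hu : u < n) (hud : u ∉ del) :
    volC f n (del ++ [u]) + f u = volC f n del := by
  unfold volC
  rw [← Finset.add_sum_erase _ _ (Finset.mem_range.2 hu),
    ← Finset.add_sum_erase (Finset.range n) (fun x => if x ∈ del then 0 else f x)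
      (Finset.mem_range.2 hu), if_pos (by simp), if_neg hud,
    Finset.sum_congr rfl fun x hx => by
      rw [show (if x ∈ del ++ [u] then 0 else f x) = if x ∈ del then 0 else f x by
        simp [Finset.ne_of_mem_erase hx]]]
  ring

/-- Among the first `t` sets of the run, given by their volumes and cuts, the set number `bi` is one
of minimal conductance among those that contain at most half of the total volume `tot`; its cut is
`bc`, and `bv` is its volume, or `1` if the volume is `0`.  As long as there is no such set, the
conductance `bc / bv` is infinite. -/
def Best (tot : ℕ) (vol cut : ℕ → ℕ) (t bi bc bv : ℕ) : Prop :=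
  (bv = 0 ∧ bc = 1 ∧ ∀ i < t, tot - vol i < vol i) ∨
  (bi < t ∧ vol bi ≤ tot - vol bi ∧ bc = cut bi ∧ bv = max (vol bi) 1 ∧
    ∀ i < t, vol i ≤ tot - vol i → bc * max (vol i) 1 ≤ cut i * bv)

section Best

variable {tot t bi bc bv : ℕ} {vol cut : ℕ → ℕ}

theorem Best.skip (h : Best tot vol cut t bi bc bv) (ht : tot - vol t < vol t) :
    Best tot vol cut (t + 1) bi bc bv := by
  rcases h with ⟨h1, h2, h3⟩ | ⟨h1, h2, h3, h4, h5⟩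
  · refine .inl ⟨h1, h2, fun i hi => ?_⟩
    rcases Nat.lt_succ_iff_lt_or_eq.1 hi with hi | rfl
    · exact h3 i hi
    · exact ht
  · refine .inr ⟨by omega, h2, h3, h4, fun i hi hv => ?_⟩
    rcases Nat.lt_succ_iff_lt_or_eq.1 hi with hi | rfl
    · exact h5 i hi hv
    · omega

theorem Best.keep (h : Best tot vol cut t bi bc bv) (hc : ¬ cut t * bv < bc * max (vol t) 1) :
    Best tot vol cut (t + 1) bi bc bv := by
  rcases h with ⟨h1, h2, h3⟩ | ⟨h1, h2, h3, h4, h5⟩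
  · rw [h1, h2, mul_zero, one_mul] at hc; omega
  · refine .inr ⟨by omega, h2, h3, h4, fun i hi hv => ?_⟩
    rcases Nat.lt_succ_iff_lt_or_eq.1 hi with hi | rfl
    · exact h5 i hi hv
    · omega

theorem Best.update (h : Best tot vol cut t bi bc bv) (ht : vol t ≤ tot - vol t)
    (hc : cut t * bv < bc * max (vol t) 1) :
    Best tot vol cut (t + 1) t (cut t) (max (vol t) 1) := by
  refine .inr ⟨by omega, ht, rfl, rfl, fun i hi hv => ?_⟩
  rcases Nat.lt_succ_iff_lt_or_eq.1 hi with hi | rfl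
  · rcases h with ⟨h1, h2, h3⟩ | ⟨h1, h2, h3, h4, h5⟩
    · have := h3 i hi; omega
    · have h6 := h5 i hi hv
      have h7 : 0 < bv := by omega
      refine Nat.le_of_mul_le_mul_left ?_ h7
      have h8 := Nat.mul_le_mul_right (max (vol i) 1) hc.le
      have h9 := Nat.mul_le_mul_right (max (vol t) 1) h6
      nlinarith
  · exact le_rfl

theorem Best.congr {vol' cut' : ℕ → ℕ} (h : Best tot vol cut t bi bc bv)
    (hv : ∀ i < t, vol' i = vol i) (hc : ∀ i < t, cut' i = cut i) :
    Best tot vol' cut' t bi bc bv := by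
  rcases h with ⟨h1, h2, h3⟩ | ⟨h1, h2, h3, h4, h5⟩
  · exact .inl ⟨h1, h2, fun i hi => by rw [hv i hi]; exact h3 i hi⟩
  · refine .inr ⟨h1, by rwa [hv bi h1], by rwa [hc bi h1], by rwa [hv bi h1], fun i hi => ?_⟩
    rw [hv i hi, hc i hi]
    exact h5 i hi

end Best

/-- Compare the current set with the best one so far. -/
def checkBest : Cmd :=
  .ite (.var 57 -ₑ .var 51 <ₑ .var 51) .skip (
    58 ≔ .var 51 ;; .ite (.var 58) .skip (58 ≔ .lit 1) ;;
    .ite (.var 52 *ₑ .var 55 <ₑ .var 54 *ₑ .var 58)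
      (53 ≔ .var 50 ;; 54 ≔ .var 52 ;; 55 ≔ .var 58) .skip)

/-- One round of the deletion. -/
def deleteRound : Cmd :=
  checkBest ;; extractMax ;;
  .store 4 (.var 50) (.var 45) ;; 51 ≔ .var 51 -ₑ .get 3 (.var 45) ;; dropVertex

/-- The deletion of all vertices. -/
def deleteAll : Cmd :=
  50 ≔ .lit 0 ;; 57 ≔ .var 2 *ₑ .var 3 ;; 51 ≔ .var 57 ;; 52 ≔ .lit 0 ;; 53 ≔ .lit 0 ;;
  54 ≔ .lit 1 ;; 55 ≔ .lit 0 ;; forUp 50 0 deleteRound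

/-- Mark the vertices that are deleted in round number `53` or later. -/
def markCluster : Cmd := forUp 53 0 (.store 5 (.get 4 (.var 53)) (.lit 1))

theorem checkBest_spec {K tot t : ℕ} {vol cut : ℕ → ℕ} {s : Store}
    (h57 : s.var 57 = tot) (h51 : s.var 51 = vol t) (h52 : s.var 52 = cut t) (h50 : s.var 50 = t)
    (hb : Best tot vol cut t (s.var 53) (s.var 54) (s.var 55)) {r : ℤ} :
    WP K checkBest s r fun s' r' => r - 40 ≤ r' ∧
      Best tot vol cut (t + 1) (s'.var 53) (s'.var 54) (s'.var 55) := by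
  simp only [checkBest, WP, Expr.Small, Expr.eval, Expr.cost, Op.apply, true_and,
    Store.var_setVar, Nat.reduceEqDiff, if_true, if_false, ite_one_zero_ne, ite_one_zero_eq,
    h50, h51, h52, h57]
  refine ⟨fun h => ⟨by push_cast; omega, hb.skip h⟩, fun h =>
    ⟨fun h0 => ⟨fun hc => ⟨by push_cast; omega, ?_⟩, fun hc => ⟨by push_cast; omega, hb.keep ?_⟩⟩,
     fun h0 => ⟨fun hc => ⟨by push_cast; omega, ?_⟩, fun hc => ⟨by push_cast; omega, hb.keep ?_⟩⟩⟩⟩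
  · have := hb.update (not_lt.1 h) (by rwa [max_eq_left (by omega)])
    rwa [max_eq_left (by omega)] at this
  · rwa [max_eq_left (by omega)]
  · have := hb.update (not_lt.1 h) (by rwa [max_eq_right (by omega)])
    rwa [max_eq_right (by omega)] at this
  · rwa [max_eq_right (by omega)]

/-- What the first `t` rounds of the deletion have achieved, when the `i`-th deleted vertex is
`a i`. -/
structure Deleted (n N k t : ℕ) (B : ℕ → List ℕ) (M a : ℕ → ℕ) (bi bc bv : ℕ) : Prop where
  nodup : (chosen a t).Nodup
  lt : ∀ i < t, a i < n
  greedy : ∀ i < t, ∀ x < n, x ∉ chosen a i →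
    num B N k (remC B (chosen a i)) x * max (M (a i)) 1 ≤
      num B N k (remC B (chosen a i)) (a i) * max (M x) 1
  best : Best (k * N) (fun i => volC M n (chosen a i))
    (fun i => ∑ j ∈ Finset.range N, isCut k (remC B (chosen a i) j)) t bi bc bv

theorem Deleted.snoc {n N k t u : ℕ} {B : ℕ → List ℕ} {M a : ℕ → ℕ} {bi bc bv bi' bc' bv' : ℕ}
    (h : Deleted n N k t B M a bi bc bv) (hu : u < n) (hud : u ∉ chosen a t)
    (hg : ∀ x < n, x ∉ chosen a t → num B N k (remC B (chosen a t)) x * max (M u) 1 ≤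
      num B N k (remC B (chosen a t)) u * max (M x) 1)
    (hb : Best (k * N) (fun i => volC M n (chosen a i))
      (fun i => ∑ j ∈ Finset.range N, isCut k (remC B (chosen a i) j)) (t + 1) bi' bc' bv') :
    Deleted n N k (t + 1) B M (Function.update a t u) bi' bc' bv' := by
  have hc : ∀ i ≤ t, chosen (Function.update a t u) i = chosen a i := fun i hi =>
    chosen_congr fun j hj => Function.update_of_ne (by omega) _ _
  refine ⟨?_, fun i hi => ?_, fun i hi => ?_, ?_⟩
  · rw [chosen_succ, hc t le_rfl, Function.update_self]
    exact List.nodup_append.2 ⟨h.nodup, by simp, fun x hx y hy => by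
      rw [List.mem_singleton] at hy
      rintro rfl
      exact hud (hy ▸ hx)⟩
  · rcases Nat.lt_succ_iff_lt_or_eq.1 hi with hi | rfl
    · rw [Function.update_of_ne (by omega)]; exact h.lt i hi
    · rwa [Function.update_self]
  · rw [hc i (by omega)]
    rcases Nat.lt_succ_iff_lt_or_eq.1 hi with hi | rfl
    · rw [Function.update_of_ne (by omega)]; exact h.greedy i hi
    · rwa [Function.update_self]
  · exact hb.congr (fun i hi => by simp only [hc i (by omega)])
      fun i hi => by simp only [hc i (by omega)]

/-- The credits for the greedy deletion: the potential of the queue, `600 k` for each future change of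
the contributions of an instance, and `1500 * max (M x) 1` for each vertex `x`, which pays for its
extraction and for walking through its instances. -/
theorem deleteAll_spec {K n N L k : ℕ} {S : Finset ℕ} {B : ℕ → List ℕ}
    (hK : (N + 2) * (3 * (N + 1) + 1) < K) (hk : 2 ≤ k)
    (hnK : n < K) (hkK : k < K) (hkN : k * N + 1 < K) {s : Store} (hQ : Queue n N L S s)
    (h2 : s.var 2 = k) (h3 : s.var 3 = N)
    (hinc : ∀ u < n, rd (s.arr 18) (s.arr 3) N u = incL B N u)
    (hB : ∀ j < N, B j = block (s.arr 2) k j) (hnd : ∀ j < N, (B j).Nodup)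
    (hlt : ∀ j < N, ∀ x ∈ B j, x < n)
    (hdead : ∀ x, s.arr 21 x = 0)
    (hrem : ∀ j < N, s.arr 22 j = k)
    (hden : ∀ x < n, s.arr 19 x = max (s.arr 3 x) 1)
    (hnum : ∀ x < n, s.arr 20 x = if s.arr 3 x = 0 then 3 else s.arr 3 x)
    (hvol : ∑ x ∈ Finset.range n, s.arr 3 x = k * N) {r : ℤ}
    (hr : 60 * (pot N S s : ℤ) + 1200 * k * N + 1500 * (k * N + n) + 100 ≤ r) :
    WP K deleteAll s r fun s' r' =>
      r - (60 * (pot N S s : ℤ) + 1200 * k * N + 1500 * (k * N + n) + 100) ≤ r' ∧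
      Deleted n N k n B (s.arr 3) (s'.arr 4) (s'.var 53) (s'.var 54) (s'.var 55) := by
  set M := s.arr 3 with hMdef
  have hMc : ∀ x < n, M x = (incS B N x).card := fun x hx => by
    rw [← incL_eq, ← hinc x hx]; simp [hMdef]
  have hMN : ∀ x < n, M x ≤ N := fun x hx => by
    rw [hMc x hx, ← incL_eq]; exact length_incL_le
  have hK3 : 3 * N + 3 < K := by nlinarith
  have hlB : ∀ j < N, (B j).length = k := fun j hj => by rw [hB j hj]; simp [block]
  set D : ℕ → ℕ := fun x => 1500 * max (M x) 1 with hD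
  have hD0 : volC D n [] ≤ 1500 * (k * N + n) := by
    have h1 : volC D n [] ≤ ∑ x ∈ Finset.range n, (1500 * (M x) + 1500) := by
      refine Finset.sum_le_sum fun x _ => ?_
      simp only [List.not_mem_nil, if_false, hD]
      omega
    rw [Finset.sum_add_distrib, ← Finset.mul_sum, hvol] at h1
    simp at h1
    omega
  have hch0 : (∑ i ∈ Finset.range N, changes k (s.arr 22 i)) = 2 * N := by
    rw [Finset.sum_congr rfl fun i hi => by
      rw [hrem i (Finset.mem_range.1 hi), show changes k k = 2 by simp [changes, hk]]]
    simp [mul_comm]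
  have hcut0 : (∑ i ∈ Finset.range N, isCut k (s.arr 22 i)) = 0 :=
    Finset.sum_eq_zero fun i hi => by rw [hrem i (Finset.mem_range.1 hi)]; simp [isCut]
  set Φ : ℤ := 60 * (pot N S s : ℤ) + 1200 * k * N + 1500 * (k * N + n) + 50 with hΦ
  simp only [deleteAll, WP, Expr.Small, Expr.eval, Expr.cost, Op.apply, true_and, Store.var_setVar,
    Nat.reduceEqDiff, if_true, if_false, h2, h3]
  refine ⟨by omega, ?_⟩
  -- The last conjunct of the invariant is the amortized analysis: the bracket is the potential.
  refine WP.forUp n 0 (fun t s' r' => ∃ S' : Finset ℕ, Queue n N L S' s' ∧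
      (∀ x < n, s'.arr 21 x = 0 ↔ x ∉ chosen (s'.arr 4) t) ∧
      (∀ j < N, s'.arr 22 j = remC B (chosen (s'.arr 4) t) j) ∧
      (∀ x < n, s'.arr 21 x = 0 → s'.arr 20 x = num B N k (s'.arr 22) x) ∧
      s'.var 51 = volC M n (chosen (s'.arr 4) t) ∧
      s'.var 52 = ∑ i ∈ Finset.range N, isCut k (s'.arr 22 i) ∧
      Deleted n N k t B M (s'.arr 4) (s'.var 53) (s'.var 54) (s'.var 55) ∧
      r - Φ + (60 * (pot N S' s' : ℤ) +
        600 * k * (∑ i ∈ Finset.range N, changes k (s'.arr 22 i) : ℕ) +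
        (volC D n (chosen (s'.arr 4) t) : ℕ)) ≤ r')
    hnK (Nat.zero_le _) (by simp [Store.var_setVar]) (by simp [Store.var_setVar, hQ.v0])
    (by decide) (by decide) (by decide) ?_ ?_ ?_ ?_
  · refine ⟨S, hQ.congr (fun y hy => by fin_cases hy <;> simp [Store.var_setVar])
      (fun y _ => by simp [Store.arr_setVar]), ?_, ?_, ?_, ?_, ?_, ⟨?_, ?_, ?_, ?_⟩, ?_⟩
    · simp [Store.arr_setVar, hdead, chosen]
    · intro j hj
      simp only [Store.arr_setVar]
      rw [hrem j hj, ← hlB j hj]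
      simp [remC, chosen]
    · intro x hx _
      simp only [Store.arr_setVar]
      rw [hnum x hx, num, hMc x hx]
      simp only [Finset.card_eq_zero]
      congr 1
      rw [Finset.sum_congr rfl fun j hj => by
        rw [hrem j (by simp [incS] at hj; exact hj.1), show contrib k k = 1 by
          unfold contrib; rw [if_pos rfl, if_neg (by omega)]]]
      simp
    · simp [Store.var_setVar, volC, chosen, ← hvol]
    · simp only [Store.var_setVar, Store.arr_setVar, Nat.reduceEqDiff, if_true, if_false]
      exact hcut0.symm
    · simp [chosen]
    · intro i hi; omega
    · intro i hi; omega
    · exact .inl ⟨by simp [Store.var_setVar], by simp [Store.var_setVar], fun i hi => by omega⟩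
    · rw [pot_congr (s := s) (S := S) (N := N) (s' := Store.setVar _ _ _) (by simp [Store.arr_setVar])]
      simp only [Store.arr_setVar, hch0]
      rw [show chosen (s.arr 4) 0 = [] from rfl]
      have : ((volC D n [] : ℕ) : ℤ) ≤ 1500 * (k * N + n) := by exact_mod_cast hD0
      push_cast
      nlinarith
  · rintro t s' r' _ ⟨S', _, _, _, _, _, _, _, h⟩
    have h1 : 0 ≤ 60 * (pot N S' s' : ℤ) + 600 * k * (∑ i ∈ Finset.range N, changes k (s'.arr 22 i) : ℕ) +
        (volC D n (chosen (s'.arr 4) t) : ℕ) := by positivity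
    omega
  · rintro t s' r' _ ht hxt hS ⟨S', hQ', hdead', hrem', hnum', hvol', hcut', hdel, hrr⟩
    have ha : ∀ a ∈ [2, 3, 18, 19], s'.arr a = s.arr a := fun a ha => by
      rw [hS.2 a (by fin_cases ha <;> decide)]; simp [Store.arr_setVar]
    have hv : ∀ a ∈ [2, 3], s'.var a = s.var a := fun a ha => by
      rw [hS.1 a (by fin_cases ha <;> decide)]; fin_cases ha <;> simp [Store.var_setVar]
    have v57 : s'.var 57 = k * N := (hS.1 57 (by decide)).trans (by simp [Store.var_setVar])
    set del := chosen (s'.arr 4) t with hdeldef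
    have hlen : del.length = t := by simp [hdeldef, chosen]
    have hcutC : ∑ i ∈ Finset.range N, isCut k (s'.arr 22 i) =
        ∑ j ∈ Finset.range N, isCut k (remC B del j) :=
      Finset.sum_congr rfl fun j hj => by rw [hrem' j (Finset.mem_range.1 hj)]
    -- The extraction needs a witness that some vertex is left.
    obtain ⟨v, hvn, hvd⟩ : ∃ v < n, v ∉ del := by
      by_contra hc
      push Not at hc
      have h1 : Finset.range n ⊆ del.toFinset := fun x hx => by
        simpa using hc x (Finset.mem_range.1 hx)
      have h2 := Finset.card_le_card h1
      have h3 := del.toFinset_card_le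
      simp only [Finset.card_range] at h2
      omega
    have hnumD : ∀ x < n, x ∉ del → s'.arr 20 x = num B N k (remC B del) x ∧ 0 < s'.arr 20 x := by
      intro x hx hxd
      rw [hnum' x hx ((hdead' x hx).2 hxd), num_congr hrem']
      have := (num_bounds (B := B) (N := N) (k := k) (rem := remC B del) (x := x)).1
      exact ⟨rfl, by omega⟩
    have hnn : 0 ≤ 600 * (k : ℤ) * (∑ i ∈ Finset.range N, changes k (s'.arr 22 i) : ℕ) := by positivity
    have hnn' : 0 ≤ 60 * (pot N S' s' : ℤ) := by positivity
    simp only [deleteRound, WP]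
    refine (checkBest_spec (tot := k * N) (t := t) (vol := fun i => volC M n (chosen (s'.arr 4) i))
      (cut := fun i => ∑ j ∈ Finset.range N, isCut k (remC B (chosen (s'.arr 4) i) j)) v57 hvol'
      (hcut'.trans hcutC) hxt hdel.best).conseq ?_
    rintro s1 r1 ⟨g1, g2⟩ hS1
    have ha1 : ∀ a, s1.arr a = s'.arr a := fun a => hS1.2 a (by simp [checkBest, Cmd.wa])
    have hv1 : ∀ a, a ∉ [53, 54, 55, 58] → s1.var a = s'.var a := fun a ha =>
      hS1.1 a (by simp [checkBest, Cmd.wv] at ha ⊢; tauto)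
    have hQ1 : Queue n N L S' s1 := hQ'.congr
      (fun y hy => hv1 y (by fin_cases hy <;> decide)) (fun y _ => ha1 y)
    have hDu : ∀ u < n, u ∉ del → (D u : ℤ) ≤ volC D n del ∧ (D u : ℤ) = 1500 * s'.arr 19 u ∧
        (1 : ℤ) ≤ s'.arr 19 u ∧ (M u : ℤ) ≤ s'.arr 19 u := by
      intro u hu hud
      have h1 := volC_append (f := D) hu hud
      rw [ha 19 (by simp), hden u hu]
      simp only [hD]
      refine ⟨by exact_mod_cast (show D u ≤ volC D n del by omega), by push_cast; ring, ?_, ?_⟩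
      · exact_mod_cast (show 1 ≤ max (M u) 1 by omega)
      · exact_mod_cast (show M u ≤ max (M u) 1 by omega)
    refine (extractMax_spec (v := v) hK hnK hQ1 hvn (by rw [ha1, hdead' v hvn]; exact hvd)
      (by rw [ha1]; exact (hnumD v hvn hvd).2) ?_).conseq ?_
    · intro u hu hu0 _
      rw [ha1, hdead' u hu] at hu0
      obtain ⟨d1, d2, d3, d4⟩ := hDu u hu hu0
      rw [pot_congr (ha1 24), ha1]
      omega
    rintro s2 r2 ⟨S2, u, hQ2, w45, hu, hu0, _, hgr, h21, f1⟩ hS2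
    rw [ha1, hdead' u hu] at hu0
    obtain ⟨d1, d2, d3, d4⟩ := hDu u hu hu0
    rw [pot_congr (ha1 24), ha1] at f1
    have ha2 : ∀ a, a ∉ [21, 24, 25, 26] → s2.arr a = s'.arr a := fun a ha => by
      rw [hS2.2 a (by
        simp [extractMax, findMax, fixGroup, scanGroup, fixClass, forUp, compareGroup, fixStair,
          extendStair, Cmd.wa] at ha ⊢; tauto), ha1]
    have hv2 : ∀ a, a ∈ [2, 3, 50, 51, 52] → s2.var a = s'.var a := fun a ha => by
      rw [hS2.1 a (by fin_cases ha <;> decide), hv1 a (by fin_cases ha <;> decide)]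
    have hv3 : ∀ a, a ∈ [53, 54, 55] → s2.var a = s1.var a := fun a ha =>
      hS2.1 a (by fin_cases ha <;> decide)
    have e3 : s2.arr 3 = M := (ha2 3 (by decide)).trans (ha 3 (by simp))
    have hvapp := volC_append (f := M) hu hu0
    have hDapp := volC_append (f := D) hu hu0
    have hvolle : volC M n del ≤ k * N := by
      rw [← hvol]
      exact Finset.sum_le_sum fun x _ => by split <;> omega
    have hdel2 : chosen (Function.update (s'.arr 4) t u) (t + 1) = del ++ [u] := by
      rw [chosen_succ, Function.update_self, hdeldef]
      congr 1
      exact chosen_congr fun j hj => Function.update_of_ne (by omega) _ _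
    have e4 : s2.arr 4 = s'.arr 4 := ha2 4 (by decide)
    simp only [Expr.Small, Expr.eval, Expr.cost, true_and, Store.var_setVar, Op.apply,
      Store.arr_setVar, Store.var_setArr, Store.arr_setArr, Nat.reduceEqDiff, if_false,
      w45, hv2 50 (by simp), hv2 51 (by simp), hxt, e3, hvol', e4]
    rw [show volC M n del - M u = volC M n (del ++ [u]) by omega]
    refine ⟨by omega, ?_⟩
    have hp2 : ∀ x y, pot N S2 ((s2.setArr 4 t u).setVar x y) = pot N S2 s2 := fun x y =>
      pot_congr (by simp [Store.arr_setVar, Store.arr_setArr])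
    refine (dropVertex_spec (u := u) (del := del) (B := B) (S := S2) hK hk hnK hkK hkN
      (hQ2.congr (fun y hy => by fin_cases hy <;> simp [Store.var_setVar, Store.var_setArr])
        (fun y hy => by fin_cases hy <;> simp [Store.arr_setVar, Store.arr_setArr]))
      (by simp [Store.var_setVar, Store.var_setArr, hv2, hv, h2])
      (by simp [Store.var_setVar, Store.var_setArr, hv2, hv, h3])
      (by simp [Store.var_setVar, Store.var_setArr, w45]) ?_ ?_ hnd hlt hu0 ?_ ?_ ?_ ?_ ?_ ?_).conseq ?_
    · simp only [Store.arr_setVar, Store.arr_setArr, Nat.reduceEqDiff, if_false, e3,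
        ha2 18 (by decide), ha 18 (by simp)]
      exact hinc u hu
    · simp only [Store.arr_setVar, Store.arr_setArr, Nat.reduceEqDiff, if_false,
        ha2 2 (by decide), ha 2 (by simp)]
      exact hB
    · intro x hx
      simp only [Store.arr_setVar, Store.arr_setArr, Nat.reduceEqDiff, if_false, h21, ha1]
      rcases eq_or_ne x u with rfl | hxu
      · simp
      · rw [Function.update_of_ne hxu, hdead' x hx]; simp [hxu]
    · simp only [Store.arr_setVar, Store.arr_setArr, Nat.reduceEqDiff, if_false,
        ha2 22 (by decide)]
      exact hrem'
    · simp only [Store.arr_setVar, Store.arr_setArr, Nat.reduceEqDiff, if_false,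
        ha2 19 (by decide), ha 19 (by simp)]
      intro x hx
      rw [hden x hx, hMc x hx]
    · simp only [Store.arr_setVar, Store.arr_setArr, Nat.reduceEqDiff, if_false, h21, ha1,
        ha2 22 (by decide), ha2 20 (by decide)]
      intro x hx hx0
      refine hnum' x hx ?_
      rcases eq_or_ne x u with rfl | hxu
      · simp at hx0
      · rwa [Function.update_of_ne hxu] at hx0
    · simp only [Store.var_setVar, Store.var_setArr, Store.arr_setVar, Store.arr_setArr,
        Nat.reduceEqDiff, if_false, ha2 22 (by decide), hv2 52 (by simp)]
      exact hcut'
    · simp only [hp2, Store.arr_setVar, Store.arr_setArr, Nat.reduceEqDiff, if_false, e3,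
        ha2 22 (by decide)]
      simp only [Nat.cast_add, Nat.cast_one]
      omega
    · rintro s3 r3 ⟨S3, hQ3, c1, c2, c3, c4⟩ hS3
      simp only [hp2, Store.arr_setVar, Store.arr_setArr, Nat.reduceEqDiff, if_false, e3,
        ha2 22 (by decide)] at c4
      have e4' : s3.arr 4 = Function.update (s'.arr 4) t u := by
        rw [hS3.2 4 (by decide)]; simp [Store.arr_setVar, Store.arr_setArr, e4]
      have e21' : s3.arr 21 = Function.update (s'.arr 21) u 1 := by
        rw [hS3.2 21 (by decide)]; simp [Store.arr_setVar, Store.arr_setArr, h21, ha1]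
      have hp3 : pot N S3 (s3.setVar 50 (t + 1)) = pot N S3 s3 := pot_congr rfl
      refine ⟨S3, hQ3.congr (fun y hy => by fin_cases hy <;> simp [Store.var_setVar])
        (fun y _ => by simp [Store.arr_setVar]), ?_, ?_, ?_, ?_, ?_, ?_, ?_⟩
      · intro x hx
        simp only [e4', hdel2, e21']
        rcases eq_or_ne x u with rfl | hxu
        · simp
        · rw [Function.update_of_ne hxu, hdead' x hx]; simp [hxu]
      · simp only [e4', hdel2]; exact c1
      · simpa only [Store.arr_setVar] using c2
      · simp only [e4', hdel2]
        rw [hS3.1 51 (by decide)]; simp [Store.var_setVar]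
      · simpa only [Store.arr_setVar, Store.var_setVar, Nat.reduceEqDiff, if_false] using c3
      · simp only [e4']
        have h535 : ∀ a ∈ [53, 54, 55], s3.var a = s1.var a := fun a ha => by
          rw [hS3.1 a (by fin_cases ha <;> decide)]
          simp only [Store.var_setVar, Store.var_setArr]
          rw [if_neg (by fin_cases ha <;> decide)]
          exact hv3 a ha
        rw [h535 53 (by simp), h535 54 (by simp), h535 55 (by simp)]
        refine hdel.snoc hu hu0 (fun x hx hxd => ?_) g2
        have h1 := hgr x hx (by rw [ha1, hdead' x hx]; exact hxd)
          (by rw [ha1]; exact (hnumD x hx hxd).2)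
        simp only [ha1] at h1
        rw [(hnumD x hx hxd).1, (hnumD u hu hu0).1, ha 19 (by simp), hden u hu, hden x hx] at h1
        exact h1
      · rw [hp3]
        simp only [e4', hdel2]
        have hDapp' : (volC D n (del ++ [u]) : ℤ) + D u = volC D n del := by exact_mod_cast hDapp
        simp only [Nat.cast_add, Nat.cast_one] at *
        omega
  · rintro s' r' _ _ ⟨S', _, _, _, _, _, _, h, hrr⟩
    refine ⟨?_, h⟩
    have h1 : 0 ≤ 60 * (pot N S' s' : ℤ) + 600 * k * (∑ i ∈ Finset.range N, changes k (s'.arr 22 i) : ℕ) +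
        (volC D n (chosen (s'.arr 4) n) : ℕ) := by positivity
    simp only [hΦ] at hrr
    omega

/-- The best set consists of the vertices deleted in round `b` or later. -/
theorem markCluster_spec {K n b : ℕ} (hnK : n < K) {s : Store} (h0 : s.var 0 = n)
    (h53 : s.var 53 = b) (hb : b ≤ n) (h5 : ∀ x, s.arr 5 x = 0) {r : ℤ}
    (hr : 20 * (n : ℤ) + 10 ≤ r) :
    WP K markCluster s r fun s' r' => r - (20 * (n : ℤ) + 10) ≤ r' ∧
      ∀ x, s'.arr 5 x = if ∃ i < n, b ≤ i ∧ s.arr 4 i = x then 1 else 0 := by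
  have hnb : ((n - b : ℕ) : ℤ) ≤ n := by exact_mod_cast Nat.sub_le n b
  refine WP.forUp_sum n b (fun t s' => ∀ x, s'.arr 5 x =
    if ∃ i < t, b ≤ i ∧ s.arr 4 i = x then 1 else 0) (fun _ => 10) hnK hb h53 h0 (by decide)
    (by decide) (by decide) ?_ ?_ ?_ ?_
  · intro x
    rw [h5, if_neg]
    rintro ⟨i, h1, h2, _⟩
    omega
  · simp only [Finset.sum_const, Nat.card_Ico, nsmul_eq_mul]
    push_cast [hb]
    omega
  · rintro t s' r' hbt ht hx hS hI hr'
    have e4 : s'.arr 4 = s.arr 4 := hS.2 4 (by decide)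
    simp only [WP, Expr.Small, Expr.eval, Expr.cost, true_and, Store.arr_setVar, Store.arr_setArr,
      if_true, hx, e4]
    refine ⟨by push_cast at *; omega, fun x => ?_⟩
    rcases eq_or_ne x (s.arr 4 t) with rfl | hxt
    · rw [Function.update_self, if_pos ⟨t, by omega, hbt, rfl⟩]
    · rw [Function.update_of_ne hxt, hI]
      congr 1
      rw [eq_iff_iff]
      constructor
      · rintro ⟨i, h1, h2, h3⟩; exact ⟨i, by omega, h2, h3⟩
      · rintro ⟨i, h1, h2, h3⟩
        rcases Nat.lt_succ_iff_lt_or_eq.1 h1 with h1 | rfl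
        · exact ⟨i, h1, h2, h3⟩
        · exact absurd h3.symm hxt
  · rintro s' r' hrr _ _ hI
    simp only [Finset.sum_const, Nat.card_Ico, nsmul_eq_mul] at hrr
    exact ⟨by push_cast [hb] at hrr; omega, hI⟩


/-! ### The whole program -/

/-- The program PSMC: adjacency lists, degeneracy order, lists of later neighbours, list of all
cliques, incidence lists, priority queue, deletion of all vertices, indicator of the best set. -/
def psmc : Cmd :=
  buildAdj ;; buildOrd ;; buildOut ;; listCliques ;; buildInc ;; buildTables ;; initDen ;;
  initQueue ;; initCur ;; deleteAll ;; markCluster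

theorem psmc_ok : psmc.ok = true := by decide

/-- Double counting of the pairs of a block and one of its elements. -/
theorem sum_length_incL (B : ℕ → List ℕ) (n N k : ℕ) (hlen : ∀ j < N, (B j).length = k)
    (hnd : ∀ j < N, (B j).Nodup) (hlt : ∀ j < N, ∀ x ∈ B j, x < n) :
    ∑ x ∈ Finset.range n, (incL B N x).length = k * N := by
  simp only [incL_eq, incS, Finset.card_filter]
  rw [Finset.sum_comm]
  have : ∀ j ∈ Finset.range N, ∑ x ∈ Finset.range n, (if x ∈ B j then 1 else 0) = k := by
    intro j hj
    have hj := Finset.mem_range.1 hj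
    rw [← Finset.card_filter, ← hlen j hj, ← List.toFinset_card_of_nodup (hnd j hj)]
    congr 1
    ext x
    simp only [Finset.mem_filter, Finset.mem_range, List.mem_toFinset]
    exact ⟨fun h => h.2, fun h => ⟨hlt j hj x h, h⟩⟩
  rw [Finset.sum_congr rfl this]
  simp [mul_comm]

/-- When a single vertex remains, the remaining volume is at most half of the total volume, so that
the last round always offers a candidate. -/
theorem Deleted.lt_of_vol {n N k : ℕ} {B : ℕ → List ℕ} {M a : ℕ → ℕ} {bi bc bv : ℕ} (hn : 0 < n)
    (hk : 2 ≤ k) (hM : ∀ x < n, M x ≤ N) (h : Deleted n N k n B M a bi bc bv) :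
    bi < n ∧ volC M n (chosen a bi) ≤ k * N - volC M n (chosen a bi) ∧
      ∀ i < n, volC M n (chosen a i) ≤ k * N - volC M n (chosen a i) →
        (∑ j ∈ Finset.range N, isCut k (remC B (chosen a bi) j)) * max (volC M n (chosen a i)) 1 ≤
        (∑ j ∈ Finset.range N, isCut k (remC B (chosen a i) j)) *
          max (volC M n (chosen a bi)) 1 := by
  obtain ⟨q, rfl⟩ : ∃ q, n = q + 1 := ⟨n - 1, by omega⟩
  -- Let `a q` be the last vertex.  The remaining volume in its round is `M (a q) ≤ N`, which is at
  -- most half of `k * N`.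
  have hq := h.nodup
  rw [chosen_succ, List.nodup_append] at hq
  have hqn : a q ∉ chosen a q := fun hm => hq.2.2 _ hm _ (by simp) rfl
  have hlast := volC_append (f := M) (h.lt q (by omega)) hqn
  have hall : volC M (q + 1) (chosen a q ++ [a q]) = 0 := by
    refine Finset.sum_eq_zero fun x hx => ?_
    rw [if_pos]
    have h1 : (chosen a (q + 1)).toFinset ⊆ Finset.range (q + 1) := by
      intro y hy
      simp only [chosen, List.mem_toFinset, List.mem_map, List.mem_range] at hy
      obtain ⟨i, hi, rfl⟩ := hy
      exact Finset.mem_range.2 (h.lt i hi)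
    have h2 : (chosen a (q + 1)).toFinset = Finset.range (q + 1) := by
      refine Finset.eq_of_subset_of_card_le h1 ?_
      rw [List.toFinset_card_of_nodup h.nodup]; simp [chosen]
    rw [← chosen_succ, ← List.mem_toFinset, h2]; exact hx
  rw [hall] at hlast
  have hMq := hM (a q) (h.lt q (by omega))
  have h2N : 2 * N ≤ k * N := Nat.mul_le_mul_right _ hk
  rcases h.best with ⟨_, _, hno⟩ | ⟨h1, h2, rfl, rfl, h3⟩
  · have : k * N - volC M (q + 1) (chosen a q) < volC M (q + 1) (chosen a q) := hno q (by omega)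
    omega
  · exact ⟨h1, h2, h3⟩

/-- What the program has recorded in its final memory. -/
structure Recorded (n N k D : ℕ) (A : ℕ → List ℕ) (s : Store) : Prop where
  cliques : ∃ ord pos, PartialOrd n A D ord pos n ∧
    blocks (s.arr 2) k N = allCliques (later A pos) k (outL A ord pos n) n
  count : s.var 3 = N
  degrees : ∀ v, s.arr 3 v = (incL (block (s.arr 2) k) N v).length
  deleted : ∃ b c d, Deleted n N k n (block (s.arr 2) k) (s.arr 3) (s.arr 4) b c d ∧
    ∀ x, s.arr 5 x = if ∃ i < n, b ≤ i ∧ s.arr 4 i = x then 1 else 0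

/-- The hypotheses `hN` and `hc` ask for the number `N` of cliques and for a bound `c` of the time for
listing them for every vertex order that the program might compute. -/
theorem psmc_spec {K n m k D N c : ℕ} {E : List (ℕ × ℕ)} (hm : E.length = m) (hmK : m < K)
    (hnK : n + 1 < K) (hn : 0 < n) (hk : 2 ≤ k) (hkK : k < K) (hkN : k * N + 1 < K)
    (hNK : (N + 2) * (3 * (N + 1) + 1) < K)
    (hE : ∀ p ∈ E, p.1 < n ∧ p.2 < n ∧ p.1 ≠ p.2) (hA : AdjLists n (adjOf E))
    (hD0 : (if k < 3 then n else 0) ≤ D) (hDn : D ≤ n)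
    (hdeg : ∀ d, (if k < 3 then n else 0) ≤ d → ∀ U ⊆ Finset.range n, U.Nonempty →
      (∀ v ∈ U, d < (adjOf E v).countP (fun w => w ∈ U)) → d < D)
    (hN : ∀ ord pos, PartialOrd n (adjOf E) D ord pos n →
      (allCliques (later (adjOf E) pos) k (outL (adjOf E) ord pos n) n).length = N)
    (hc : ∀ ord pos, PartialOrd n (adjOf E) D ord pos n →
      ∑ v ∈ Finset.range n, (extCost (later (adjOf E) pos) k (k - 1) (outL (adjOf E) ord pos n v) +
        40 * (outL (adjOf E) ord pos n v).length + 50) ≤ c)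
    {s : Store} (h0 : s.var 0 = n) (h1 : s.var 1 = m) (h2 : s.var 2 = k)
    (ha0 : ∀ e (he : e < E.length), s.arr 0 e = E[e].1)
    (ha1 : ∀ e (he : e < E.length), s.arr 1 e = E[e].2)
    (hz : ∀ a, 2 ≤ a → ∀ i, s.arr a i = 0) {r : ℤ}
    (hr : ((68 * m + (D - (if k < 3 then n else 0) + 1) * (38 * n + 40) +
      130 * ∑ v ∈ Finset.range n, (adjOf E v).length + c + 4000 * (k * N) + 3000 * n + 1500 : ℕ)
      : ℤ) ≤ r) :
    WP K psmc s r fun s' r' => 0 ≤ r' ∧ Recorded n N k D (adjOf E) s' := by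
  have hNk : 2 * N ≤ k * N := Nat.mul_le_mul_right _ hk
  have hNK' : 4 * (N + 2) < K := lt_of_le_of_lt (by nlinarith) hNK
  have hs1 : ∑ v ∈ Finset.range n, (70 * (adjOf E v).length + 50) =
      70 * ∑ v ∈ Finset.range n, (adjOf E v).length + 50 * n := by
    rw [Finset.sum_add_distrib, Finset.mul_sum]; simp [mul_comm]
  have hs2 : ∑ v ∈ Finset.range n, (60 * (adjOf E v).length + 30) =
      60 * ∑ v ∈ Finset.range n, (adjOf E v).length + 30 * n := by
    rw [Finset.sum_add_distrib, Finset.mul_sum]; simp [mul_comm]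
  generalize hsA : ∑ v ∈ Finset.range n, (adjOf E v).length = sA at *
  generalize hcO : (D - (if k < 3 then n else 0) + 1) * (38 * n + 40) = cO at *
  refine (buildAdj_spec hm hmK (by omega) hE (fun u hu => hA.length_le hu) h0 h1 ha0 ha1
    (hz 7 (by omega)) (hz 8 (by omega)) (by omega)).conseq ?_
  rintro s1 r1 ⟨hr1, hadj⟩ hS1
  refine (buildOrd_spec (K := K) hA hnK hD0 hDn hdeg ((hS1.1 0 (by decide)).trans h0)
    ((hS1.1 2 (by decide)).trans h2) (fun u hu => (hadj u hu).1) (fun u hu => ?_)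
    (fun v => by rw [hS1.2 9 (by decide)]; exact hz 9 (by omega) v)
    (r := r1) (by rw [hcO, hs1]; omega)).conseq ?_
  · rw [(hadj u hu).2, ← (hadj u hu).1]; simp [rd]
  rintro s2 r2 ⟨hr2, hO⟩ hS2
  rw [hcO, hs1] at hr2
  have z2 : ∀ a, 2 ≤ a → a ∉ buildAdj.wa → a ∉ buildOrd.wa → ∀ i, s2.arr a i = 0 :=
    fun a h h' h'' i => by rw [hS2.2 a h'', hS1.2 a h']; exact hz a h i
  refine (buildOut_spec (K := K) hA hnK hO rfl rfl (s := s2)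
    ((hS2.1 0 (by decide)).trans ((hS1.1 0 (by decide)).trans h0))
    (fun u hu => by rw [hS2.2 6 (by decide), hS2.2 7 (by decide)]; exact (hadj u hu).1)
    (z2 12 (by omega) (by decide) (by decide)) (z2 13 (by omega) (by decide) (by decide))
    (r := r2) (by rw [hs2]; omega)).conseq ?_
  rintro s3 r3 ⟨hr3, hout, hmat⟩ hS3
  rw [hs2] at hr3
  have hN' := hN _ _ hO
  have hc' := hc _ _ hO
  have hlist : ∀ l, l ∈ allCliques (later (adjOf E) (s2.arr 9)) k
      (outL (adjOf E) (s2.arr 10) (s2.arr 9) n) n ↔ _ :=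
    fun l => mem_allCliques hk (fun v _ x => mem_outL hO)
  generalize hpos : s2.arr 9 = pos at *
  generalize hord : s2.arr 10 = ord at *
  have h03 : s3.var 0 = n := (hS3.1 0 (by decide)).trans
    ((hS2.1 0 (by decide)).trans ((hS1.1 0 (by decide)).trans h0))
  have h23 : s3.var 2 = k := (hS3.1 2 (by decide)).trans
    ((hS2.1 2 (by decide)).trans ((hS1.1 2 (by decide)).trans h2))
  have z3 : ∀ a, 2 ≤ a → a ∉ buildAdj.wa → a ∉ buildOrd.wa → a ∉ buildOut.wa →
      ∀ i, s3.arr a i = 0 :=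
    fun a h h' h'' h3 i => by rw [hS3.2 a h3]; exact z2 a h h' h'' i
  refine (listCliques_spec (K := K) (n := n) (k := k) (T := later (adjOf E) pos)
    (out := outL (adjOf E) ord pos n) hnK hkK hk h03 h23
    (fun w hw x hx => by simp only [hmat w hw x hx, later, decide_eq_true_eq]) hout
    (fun v hv => (outL_length_le hA hO hv).1.trans hDn)
    (fun v hv x hx => ((mem_outL hO).1 hx).1) (by rw [hN']; omega) (by rw [hN']; omega)
    (r := r3) (by omega)).conseq ?_
  rintro s4 r4 ⟨hr4, h34, hbl⟩ hS4
  rw [hN'] at h34 hbl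
  have hbmem : ∀ j < N, block (s4.arr 2) k j ∈ allCliques (later (adjOf E) pos) k
      (outL (adjOf E) ord pos n) n := fun j hj => by
    rw [← hbl]; exact List.mem_map.2 ⟨j, List.mem_range.2 hj, rfl⟩
  have hnd : ∀ j < N, (block (s4.arr 2) k j).Nodup := fun j hj =>
    (((hlist _).1 (hbmem j hj)).2.2).imp fun {x y} h => by
      rintro rfl
      exact lt_irrefl _ (later_pos _ _ h)
  have hlt : ∀ j < N, ∀ x ∈ block (s4.arr 2) k j, x < n := fun j hj =>
    ((hlist _).1 (hbmem j hj)).2.1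
  have h04 : s4.var 0 = n := (hS4.1 0 (by decide)).trans h03
  have h24 : s4.var 2 = k := (hS4.1 2 (by decide)).trans h23
  have z4 : ∀ a, 2 ≤ a → a ∉ buildAdj.wa → a ∉ buildOrd.wa → a ∉ buildOut.wa →
      a ∉ listCliques.wa → ∀ i, s4.arr a i = 0 :=
    fun a h h' h'' h3 h4 i => by rw [hS4.2 a h4]; exact z3 a h h' h'' h3 i
  have hvol := sum_length_incL (block (s4.arr 2) k) n N k (fun j _ => by simp [block]) hnd hlt
  generalize hB : block (s4.arr 2) k = B at *
  have hB' : ∀ j, B j = block (s4.arr 2) k j := fun j => by rw [hB]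
  generalize hKN : k * N = kN at *
  have e1 : (N : ℤ) * (40 * k + 30) = 40 * kN + 30 * N := by
    rw [← hKN]; push_cast; ring
  refine (buildInc_spec (K := K) (B := B) hkK (by omega) (by omega) (fun j _ => hB' j) hnd h24 h34
    (z4 3 (by omega) (by decide) (by decide) (by decide) (by decide))
    (r := r4) (by omega)).conseq ?_
  rintro s5 r5 ⟨hr5, hinc, hrem⟩ hS5
  have hM5 : ∀ v, s5.arr 3 v = (incL B N v).length := fun v => by
    rw [← hinc v]; simp [rd]
  refine (buildTables_spec (K := K) hNK' ((hS5.1 3 (by decide)).trans h34)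
    (r := r5) (by omega)).conseq ?_
  rintro s6 r6 ⟨hr6, hT⟩ hS6
  have h06 : s6.var 0 = n := (hS6.1 0 (by decide)).trans ((hS5.1 0 (by decide)).trans h04)
  refine (initDen_spec (K := K) (by omega) h06 (r := r6) (by omega)).conseq ?_
  rintro s7 r7 ⟨hr7, hden⟩ hS7
  have z7 : ∀ a, 2 ≤ a → a ∉ (buildAdj ;; buildOrd ;; buildOut ;; listCliques ;; buildInc ;;
      buildTables ;; initDen).wa → ∀ i, s7.arr a i = 0 := fun a h h' i => by
    simp only [Cmd.wa, List.mem_append, not_or] at h'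
    obtain ⟨g1, g2, g3, g4, g5, g6, g7⟩ := h'
    rw [hS7.2 a g7, hS6.2 a g6, hS5.2 a g5]
    exact z4 a h g1 g2 g3 g4 i
  refine (initQueue_spec (K := K) (L := s6.var 20) hNK ((hS7.1 0 (by decide)).trans h06)
    ((hS7.1 3 (by decide)).trans ((hS6.1 3 (by decide)).trans ((hS5.1 3 (by decide)).trans h34)))
    (hS7.1 20 (by decide))
    (by rw [hS7.2 27 (by decide), hS7.2 28 (by decide), hS7.2 29 (by decide)]; exact hT)
    (z7 20 (by omega) (by decide)) (z7 24 (by omega) (by decide)) (z7 25 (by omega) (by decide))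
    (r := r7) (by omega)).conseq ?_
  rintro s8 r8 ⟨hr8, hQ8, hp8⟩ hS8
  have e38 : s8.arr 3 = s5.arr 3 := by
    rw [hS8.2 3 (by decide), hS7.2 3 (by decide), hS6.2 3 (by decide)]
  have hden8 : ∀ x < n, s8.arr 19 x = max (s8.arr 3 x) 1 := fun x hx => by
    rw [e38, hS8.2 19 (by decide), hden x hx, hS6.2 3 (by decide)]
  have hMN : ∀ x, s5.arr 3 x ≤ N := fun x => by rw [hM5]; exact length_incL_le
  refine (initCur_spec (K := K) hNK (by omega) hQ8
    (fun x => by rw [hS8.2 20 (by decide)]; exact z7 20 (by omega) (by decide) x)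
    (fun x => by rw [hS8.2 21 (by decide)]; exact z7 21 (by omega) (by decide) x)
    (fun x _ => by rw [e38]; exact hMN x) hden8
    (r := r8) (by rw [hp8]; omega)).conseq ?_
  rintro s9 r9 ⟨S', hQ9, hr9, hnum⟩ hS9
  rw [hp8] at hr9
  have e39 : s9.arr 3 = s5.arr 3 := by rw [hS9.2 3 (by decide), e38]
  have e29 : s9.arr 2 = s4.arr 2 := by
    rw [hS9.2 2 (by decide), hS8.2 2 (by decide), hS7.2 2 (by decide), hS6.2 2 (by decide),
      hS5.2 2 (by decide)]
  have h29 : s9.var 2 = k := by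
    rw [hS9.1 2 (by decide), hS8.1 2 (by decide), hS7.1 2 (by decide), hS6.1 2 (by decide),
      hS5.1 2 (by decide), h24]
  have h39 : s9.var 3 = N := by
    rw [hS9.1 3 (by decide), hS8.1 3 (by decide), hS7.1 3 (by decide), hS6.1 3 (by decide),
      hS5.1 3 (by decide), h34]
  have h09 : s9.var 0 = n := by
    rw [hS9.1 0 (by decide), hS8.1 0 (by decide), hS7.1 0 (by decide), h06]
  have e189 : s9.arr 18 = s5.arr 18 := by
    rw [hS9.2 18 (by decide), hS8.2 18 (by decide), hS7.2 18 (by decide), hS6.2 18 (by decide)]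
  have e229 : s9.arr 22 = s5.arr 22 := by
    rw [hS9.2 22 (by decide), hS8.2 22 (by decide), hS7.2 22 (by decide), hS6.2 22 (by decide)]
  have e3 : (1200 : ℤ) * k * N = 1200 * kN := by rw [← hKN]; push_cast; ring
  have e4 : (k : ℤ) * N = kN := by rw [← hKN]; push_cast; ring
  refine (deleteAll_spec (K := K) (B := B) hNK hk (by omega) hkK (by omega) hQ9 h29 h39
    (fun u _ => by rw [e189, e39]; exact hinc u) (fun j _ => by rw [e29]; exact hB' j) hnd hlt
    (fun x => by rw [hS9.2 21 (by decide), hS8.2 21 (by decide)]; exact z7 21 (by omega) (by decide) x)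
    (fun j hj => by rw [e229]; exact hrem j hj)
    (fun x hx => by rw [hS9.2 19 (by decide), hden8 x hx, e38, e39])
    (fun x hx => by rw [hnum x hx, e38, e39])
    (by rw [e39, hKN, ← hvol]; exact Finset.sum_congr rfl fun x _ => hM5 x)
    (r := r9) (by rw [e3, e4]; omega)).conseq ?_
  rintro s10 r10 ⟨hr10, hdel⟩ hS10
  rw [e3, e4] at hr10
  have hb := hdel.lt_of_vol hn hk (fun x _ => by rw [e39]; exact hMN x)
  refine (markCluster_spec (K := K) (by omega) ((hS10.1 0 (by decide)).trans h09) rfl hb.1.le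
    (fun x => by rw [hS10.2 5 (by decide), hS9.2 5 (by decide), hS8.2 5 (by decide)];
                 exact z7 5 (by omega) (by decide) x) (r := r10) (by omega)).conseq ?_
  rintro s' r' ⟨hr', hmark⟩ hS'
  refine ⟨by omega, ?_⟩
  have f2 : s'.arr 2 = s4.arr 2 := by rw [hS'.2 2 (by decide), hS10.2 2 (by decide), e29]
  have f3 : s'.arr 3 = s9.arr 3 := by rw [hS'.2 3 (by decide), hS10.2 3 (by decide)]
  have f4 : s'.arr 4 = s10.arr 4 := hS'.2 4 (by decide)
  refine ⟨⟨ord, pos, hO, by rw [f2, hbl]⟩, ?_, fun v => ?_,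
    ⟨s10.var 53, s10.var 54, s10.var 55, ?_, ?_⟩⟩
  · rw [hS'.1 3 (by decide), hS10.1 3 (by decide), h39]
  · rw [f3, e39, f2, hB]; exact hM5 v
  · rw [f2, f3, f4, hB]; exact hdel
  · rw [f4]; exact hmark


/-! ### Edge lists and adjacency lists -/

section EdgeList

variable {n k : ℕ} {G : SimpleGraph (Fin n)} {L : List (Fin n × Fin n)}

/-- The edge list with endpoints read as natural numbers. -/
def natEdges (L : List (Fin n × Fin n)) : List (ℕ × ℕ) := L.map fun p => ((p.1 : ℕ), (p.2 : ℕ))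

theorem mem_adjOf {E : List (ℕ × ℕ)} {u v : ℕ} : v ∈ adjOf E u ↔ (u, v) ∈ E ∨ (v, u) ∈ E := by
  simp only [adjOf, List.mem_flatMap, List.mem_append, Prod.exists]
  constructor
  · rintro ⟨a, b, h, h' | h'⟩
    · split at h'
      · simp at h'; subst_vars; exact Or.inl h
      · simp at h'
    · split at h'
      · simp at h'; subst_vars; exact Or.inr h
      · simp at h'
  · rintro (h | h)
    · exact ⟨_, _, h, Or.inl (by simp)⟩
    · exact ⟨_, _, h, Or.inr (by simp)⟩

theorem sum_length_adjOf {E : List (ℕ × ℕ)} (hE : ∀ p ∈ E, p.1 < n ∧ p.2 < n ∧ p.1 ≠ p.2) :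
    ∑ v ∈ Finset.range n, (adjOf E v).length = 2 * E.length := by
  induction E with
  | nil => simp [adjOf]
  | cons p E ih =>
    have h := hE p (by simp)
    have h1 : ∀ v, (adjOf (p :: E) v).length =
        ((if v = p.1 then 1 else 0) + (if v = p.2 then 1 else 0)) + (adjOf E v).length := by
      intro v
      simp only [adjOf, List.flatMap_cons, List.length_append]
      congr 2 <;> split <;> rfl
    simp only [h1, Finset.sum_add_distrib, ih fun q hq => hE q (by simp [hq])]
    simp [h.1, h.2.1]
    ring

theorem IsEdgeList.mem_natEdges (hL : IsEdgeList G L) {u v : Fin n} :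
    ((u : ℕ), (v : ℕ)) ∈ natEdges L ∨ ((v : ℕ), (u : ℕ)) ∈ natEdges L ↔ G.Adj u v := by
  rw [← SimpleGraph.mem_edgeSet, ← hL.2]
  simp only [natEdges, List.mem_map, Prod.mk.injEq, Prod.exists, Fin.val_inj, Sym2.eq_iff]
  constructor
  · rintro (⟨a, b, h, rfl, rfl⟩ | ⟨a, b, h, rfl, rfl⟩)
    · exact ⟨_, _, h, Or.inl ⟨rfl, rfl⟩⟩
    · exact ⟨_, _, h, Or.inr ⟨rfl, rfl⟩⟩
  · rintro ⟨a, b, h, ⟨rfl, rfl⟩ | ⟨rfl, rfl⟩⟩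
    · exact Or.inl ⟨_, _, h, rfl, rfl⟩
    · exact Or.inr ⟨_, _, h, rfl, rfl⟩

theorem IsEdgeList.mem_adj (hL : IsEdgeList G L) {u v : Fin n} :
    (v : ℕ) ∈ adjOf (natEdges L) u ↔ G.Adj u v := mem_adjOf.trans hL.mem_natEdges

theorem IsEdgeList.natEdges_lt (hL : IsEdgeList G L) :
    ∀ p ∈ natEdges L, p.1 < n ∧ p.2 < n ∧ p.1 ≠ p.2 := by
  intro p hp
  obtain ⟨q, hq, rfl⟩ := List.mem_map.1 hp
  have h : G.Adj q.1 q.2 := hL.mem_natEdges.1 (Or.inl hp)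
  exact ⟨q.1.2, q.2.2, fun h' => h.ne (Fin.val_injective h')⟩

theorem IsEdgeList.length_eq [DecidableRel G.Adj] (hL : IsEdgeList G L) : L.length = G.edgeFinset.card := by
  rw [← List.length_map (f := fun p : Fin n × Fin n => s(p.1, p.2)),
    ← List.toFinset_card_of_nodup hL.1]
  congr 1
  ext e
  rw [List.mem_toFinset, hL.2, SimpleGraph.mem_edgeFinset]

theorem IsEdgeList.nodup_adj (hL : IsEdgeList G L) (u : ℕ) : (adjOf (natEdges L) u).Nodup := by
  rw [adjOf, List.nodup_flatMap]
  refine ⟨fun p hp => ?_, ?_⟩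
  · have := (hL.natEdges_lt p hp).2.2
    have h : ¬ (u = p.1 ∧ u = p.2) := fun h => this (h.1.symm.trans h.2)
    by_cases h1 : u = p.1
    · rw [if_pos h1, if_neg fun h2 => h ⟨h1, h2⟩]; simp
    · rw [if_neg h1]; split <;> simp
  · rw [natEdges, List.pairwise_map]
    refine (List.pairwise_map.1 hL.1).imp fun {p q} h x hx hx' => h ?_
    simp only [List.mem_append] at hx hx'
    have key : ∀ p : Fin n × Fin n, (x ∈ (if u = (p.1 : ℕ) then [(p.2 : ℕ)] else []) ∨
        x ∈ (if u = (p.2 : ℕ) then [(p.1 : ℕ)] else [])) →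
        (u = p.1 ∧ x = p.2) ∨ (u = p.2 ∧ x = p.1) := by
      rintro p (h | h) <;> split at h <;> simp_all
    rw [Sym2.eq_iff]
    rcases key p hx with ⟨h1, h2⟩ | ⟨h1, h2⟩ <;> rcases key q hx' with ⟨h3, h4⟩ | ⟨h3, h4⟩ <;>
      simp only [Fin.ext_iff] <;> omega

theorem IsEdgeList.adjLists (hL : IsEdgeList G L) : AdjLists n (adjOf (natEdges L)) where
  nodup u _ := hL.nodup_adj u
  lt u hu v hv := by
    rcases mem_adjOf.1 hv with h | h
    · exact (hL.natEdges_lt _ h).2.1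
    · exact (hL.natEdges_lt _ h).1
  symm u hu v hv := mem_adjOf.2 (mem_adjOf.1 hv).symm

/-! ### Degeneracy -/

variable [DecidableRel G.Adj]

theorem degeneracy_spec (G : SimpleGraph (Fin n)) [DecidableRel G.Adj] :
    degeneracy G ≤ n ∧ ∀ S : Finset (Fin n), S.Nonempty →
      ∃ v ∈ S, (G.neighborFinset v ∩ S).card ≤ degeneracy G := by
  have h : n ∈ {d : ℕ | ∀ S : Finset (Fin n), S.Nonempty →
      ∃ v ∈ S, (G.neighborFinset v ∩ S).card ≤ d} := by
    rintro S ⟨v, hv⟩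
    exact ⟨v, hv, by simpa using Finset.card_le_univ (G.neighborFinset v ∩ S)⟩
  exact ⟨Nat.sInf_le h, Nat.sInf_mem ⟨n, h⟩⟩

theorem one_le_degeneracy (h : 0 < G.edgeFinset.card) : 1 ≤ degeneracy G := by
  obtain ⟨e, he⟩ := Finset.card_pos.1 h
  induction e with | _ u v =>
  rw [SimpleGraph.mem_edgeFinset, SimpleGraph.mem_edgeSet] at he
  obtain ⟨w, hw, hc⟩ := (degeneracy_spec G).2 {u, v} (by simp)
  refine le_trans (Finset.card_pos.2 ?_) hc
  simp only [Finset.mem_insert, Finset.mem_singleton] at hw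
  rcases hw with rfl | rfl
  · exact ⟨v, by simp [he]⟩
  · exact ⟨u, by simp [he.symm]⟩

/-- A threshold at which the peeling process can get stuck lies below the degeneracy. -/
theorem IsEdgeList.lt_degeneracy (hL : IsEdgeList G L) {d : ℕ} {U : Finset ℕ}
    (hU : U ⊆ Finset.range n) (hU' : U.Nonempty)
    (h : ∀ v ∈ U, d < (adjOf (natEdges L) v).countP (fun w => w ∈ U)) : d < degeneracy G := by
  obtain ⟨x, hx⟩ := hU'
  obtain ⟨v, hv, hc⟩ := (degeneracy_spec G).2 (Finset.univ.filter fun v => (v : ℕ) ∈ U)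
    ⟨⟨x, Finset.mem_range.1 (hU hx)⟩, by simpa using hx⟩
  refine (h v (by simpa using hv)).trans_le (le_trans (le_of_eq ?_) hc)
  rw [List.countP_eq_length_filter,
    ← List.toFinset_card_of_nodup ((hL.nodup_adj _).filter _),
    ← Finset.card_map Fin.valEmbedding]
  congr 1
  ext y
  simp only [List.mem_toFinset, List.mem_filter, decide_eq_true_eq, Finset.mem_map,
    Finset.mem_inter, Finset.mem_filter, Finset.mem_univ, true_and, SimpleGraph.mem_neighborFinset,
    Fin.valEmbedding_apply]
  constructor
  · rintro ⟨h1, h2⟩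
    exact ⟨⟨y, Finset.mem_range.1 (hU h2)⟩, ⟨hL.mem_adj.1 h1, h2⟩, rfl⟩
  · rintro ⟨w, ⟨h1, h2⟩, rfl⟩
    exact ⟨hL.mem_adj.2 h1, h2⟩

/-! ### The lists of the depth-first search are the cliques -/

/-- The vertices of a list of natural numbers. -/
def vset (n : ℕ) (l : List ℕ) : Finset (Fin n) := Finset.univ.filter fun v => (v : ℕ) ∈ l

theorem mem_vset {l : List ℕ} {v : Fin n} : v ∈ vset n l ↔ (v : ℕ) ∈ l := by simp [vset]

theorem vset_map {l : List ℕ} (hl : ∀ x ∈ l, x < n) :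
    (vset n l).map Fin.valEmbedding = l.toFinset := by
  ext y
  simp only [Finset.mem_map, mem_vset, List.mem_toFinset, Fin.valEmbedding_apply]
  exact ⟨fun ⟨w, h, e⟩ => e ▸ h, fun h => ⟨⟨y, hl y h⟩, h, rfl⟩⟩

theorem card_vset {l : List ℕ} (hl : ∀ x ∈ l, x < n) (hnd : l.Nodup) :
    (vset n l).card = l.length := by
  rw [← Finset.card_map Fin.valEmbedding, vset_map hl, List.toFinset_card_of_nodup hnd]

/-- A clique is found exactly once, namely as the list of its vertices in the computed order. -/
theorem IsEdgeList.bijOn_cliques (hL : IsEdgeList G L) (hk : 2 ≤ k) {D : ℕ} {ord pos : ℕ → ℕ}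
    (hO : PartialOrd n (adjOf (natEdges L)) D ord pos n) :
    Set.BijOn (vset n) {l | l ∈ allCliques (later (adjOf (natEdges L)) pos) k
      (outL (adjOf (natEdges L)) ord pos n) n} (G.cliqueFinset k) := by
  have hmem : ∀ l, l ∈ allCliques (later (adjOf (natEdges L)) pos) k
      (outL (adjOf (natEdges L)) ord pos n) n ↔ _ :=
    fun l => mem_allCliques hk (fun v _ x => mem_outL hO)
  have hpw : ∀ l : List ℕ, (l.Pairwise fun w x => (later (adjOf (natEdges L)) pos w x : Prop)) →
      l.Pairwise fun x y => pos x < pos y := fun l h => h.imp fun {x y} h => later_pos x y h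
  have hnd : ∀ l : List ℕ, (l.Pairwise fun x y => pos x < pos y) → l.Nodup :=
    fun l h => h.imp fun {x y} h => by rintro rfl; exact lt_irrefl _ h
  refine ⟨fun l hl => ?_, fun l hl l' hl' heq => ?_, fun S hS => ?_⟩
  · obtain ⟨h1, h2, h3⟩ := (hmem l).1 hl
    rw [Finset.mem_coe, SimpleGraph.mem_cliqueFinset_iff, SimpleGraph.isNClique_iff,
      card_vset h2 (hnd l (hpw l h3))]
    refine ⟨fun u hu v hv huv => ?_, h1⟩
    rw [Finset.mem_coe, mem_vset] at hu hv
    have h4 : l.Pairwise fun w x => (w, x) ∈ natEdges L ∨ (x, w) ∈ natEdges L :=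
      h3.imp fun {w x} h => by
        simp only [later, decide_eq_true_eq] at h
        exact (mem_adjOf.1 h.1).symm
    have hsymm : Std.Symm fun w x : ℕ => (w, x) ∈ natEdges L ∨ (x, w) ∈ natEdges L :=
      ⟨fun _ _ h => h.symm⟩
    exact hL.mem_natEdges.1 (h4.forall hu hv fun h => huv (Fin.val_injective h))
  · obtain ⟨_, h2, h3⟩ := (hmem l).1 hl
    obtain ⟨_, h2', h3'⟩ := (hmem l').1 hl'
    refine eq_of_toFinset_eq (hpw l h3) (hpw l' h3') ?_
    rw [← vset_map h2, ← vset_map h2', heq]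
  · rw [Finset.mem_coe, SimpleGraph.mem_cliqueFinset_iff, SimpleGraph.isNClique_iff] at hS
    set l := ((List.range n).map ord).filter fun x => x ∈ S.map Fin.valEmbedding with hl
    have hml : ∀ x, x ∈ l ↔ x ∈ S.map Fin.valEmbedding := fun x => by
      rw [hl, List.mem_filter, hO.mem_ord, decide_eq_true_eq, and_iff_right_iff_imp]
      intro hx
      obtain ⟨v, _, rfl⟩ := Finset.mem_map.1 hx
      exact v.2
    have hlS : vset n l = S := by
      ext v
      rw [mem_vset, hml]
      simp [Fin.val_inj]
    have hln : ∀ x ∈ l, x < n := fun x hx => hO.mem_ord.1 (List.mem_of_mem_filter hx)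
    have hlp : l.Pairwise fun x y => pos x < pos y := hO.pairwise_ord.filter _
    refine ⟨l, (hmem l).2 ⟨?_, hln, ?_⟩, hlS⟩
    · rw [← card_vset hln (hnd l hlp), hlS, hS.2]
    · refine hlp.imp_of_mem fun {x y} hx hy hxy => ?_
      obtain ⟨u, hu, rfl⟩ := Finset.mem_map.1 ((hml x).1 hx)
      obtain ⟨v, hv, rfl⟩ := Finset.mem_map.1 ((hml y).1 hy)
      simp only [later, decide_eq_true_eq, Fin.valEmbedding_apply] at hxy ⊢
      refine ⟨hL.mem_adj.2 (hS.1 hv hu ?_), hxy⟩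
      rintro rfl
      exact lt_irrefl _ hxy

theorem IsEdgeList.length_allCliques (hL : IsEdgeList G L) (hk : 2 ≤ k) {D : ℕ} {ord pos : ℕ → ℕ}
    (hO : PartialOrd n (adjOf (natEdges L)) D ord pos n) :
    (allCliques (later (adjOf (natEdges L)) pos) k
      (outL (adjOf (natEdges L)) ord pos n) n).length = (G.cliqueFinset k).card := by
  rw [← List.toFinset_card_of_nodup (nodup_allCliques fun v _ => outL_nodup hO v)]
  refine Set.BijOn.finsetCard_eq (vset n) ?_
  simpa [List.coe_toFinset] using hL.bijOn_cliques hk hO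

/-- The blocks of an array that lists all cliques enumerate them. -/
theorem IsEdgeList.bijOn_block (hL : IsEdgeList G L) (hk : 2 ≤ k) {D N : ℕ} {ord pos a : ℕ → ℕ}
    (hO : PartialOrd n (adjOf (natEdges L)) D ord pos n)
    (hb : blocks a k N = allCliques (later (adjOf (natEdges L)) pos) k
      (outL (adjOf (natEdges L)) ord pos n) n) :
    Set.BijOn (fun j => vset n (block a k j)) (Set.Iio N) (G.cliqueFinset k) ∧
      ∀ j < N, (block a k j).Nodup ∧ ∀ x ∈ block a k j, x < n := by
  have hb' : blocks a k N = (List.range N).map (block a k) := rfl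
  have hmem : ∀ j < N, block a k j ∈ allCliques (later (adjOf (natEdges L)) pos) k
      (outL (adjOf (natEdges L)) ord pos n) n := fun j hj => by
    rw [← hb, hb']; exact List.mem_map.2 ⟨j, List.mem_range.2 hj, rfl⟩
  refine ⟨(hL.bijOn_cliques hk hO).comp ⟨fun j hj => hmem j hj, ?_, fun l hl => ?_⟩, fun j hj => ?_⟩
  · have hnd := nodup_allCliques (T := later (adjOf (natEdges L)) pos) (k := k) (n := n)
      (out := outL (adjOf (natEdges L)) ord pos n) fun v _ => outL_nodup hO v
    rw [← hb, hb'] at hnd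
    exact fun i hi j hj h =>
      List.inj_on_of_nodup_map hnd (List.mem_range.2 hi) (List.mem_range.2 hj) h
  · rw [Set.mem_ofPred_eq, ← hb, hb'] at hl
    obtain ⟨j, hj, rfl⟩ := List.mem_map.1 hl
    exact ⟨j, List.mem_range.1 hj, rfl⟩
  · obtain ⟨-, h2, h3⟩ := (mem_allCliques hk (fun v _ x => mem_outL hO)).1 (hmem j hj)
    exact ⟨h3.imp fun {x y} h => by rintro rfl; exact lt_irrefl _ (later_pos _ _ h), h2⟩

end EdgeList


/-! ### The recorded numbers are the graph-theoretic quantities -/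

/-- The lists `B 0, …, B (N - 1)` enumerate the `k`-cliques of `G`. -/
structure Enumerates {n : ℕ} (G : SimpleGraph (Fin n)) [DecidableRel G.Adj] (k N : ℕ)
    (B : ℕ → List ℕ) : Prop where
  bijOn : Set.BijOn (fun j => vset n (B j)) (Set.Iio N) (G.cliqueFinset k)
  nodup : ∀ j < N, (B j).Nodup
  lt : ∀ j < N, ∀ x ∈ B j, x < n
  length : ∀ j < N, (B j).length = k

section Enumerates

variable {n k N : ℕ} {G : SimpleGraph (Fin n)} [DecidableRel G.Adj] {B : ℕ → List ℕ}

theorem Enumerates.card_filter (h : Enumerates G k N B) (p : Finset (Fin n) → Prop)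
    [DecidablePred p] : ((G.cliqueFinset k).filter p).card =
      ((Finset.range N).filter fun j => p (vset n (B j))).card := by
  symm
  refine Finset.card_bij (fun j _ => vset n (B j)) ?_ ?_ ?_
  · intro j hj
    rw [Finset.mem_filter, Finset.mem_range] at hj
    exact Finset.mem_filter.2 ⟨h.bijOn.mapsTo hj.1, hj.2⟩
  · intro i hi j hj hij
    rw [Finset.mem_filter, Finset.mem_range] at hi hj
    exact h.bijOn.injOn hi.1 hj.1 hij
  · intro S hS
    rw [Finset.mem_filter] at hS
    obtain ⟨j, hj, rfl⟩ := h.bijOn.surjOn (Finset.mem_coe.2 hS.1)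
    exact ⟨j, Finset.mem_filter.2 ⟨Finset.mem_range.2 hj, hS.2⟩, rfl⟩

theorem Enumerates.motifDegree_eq (h : Enumerates G k N B) (u : Fin n) :
    motifDegree G k u = (incS B N u).card := by
  simp only [motifDegree, h.card_filter, mem_vset, incS]

theorem Enumerates.sum_motifDegree (h : Enumerates G k N B) :
    ∑ u, motifDegree G k u = k * N := by
  rw [← sum_length_incL B n N k h.length h.nodup h.lt, Finset.sum_range]
  exact Finset.sum_congr rfl fun u _ => by rw [h.motifDegree_eq, incL_eq]

variable {C : Finset (Fin n)} {del : List ℕ}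

theorem Enumerates.card_inter (h : Enumerates G k N B) (hC : ∀ v : Fin n, v ∈ C ↔ (v : ℕ) ∉ del)
    {j : ℕ} (hj : j < N) : (C ∩ vset n (B j)).card = remC B del j := by
  rw [remC, List.countP_eq_length_filter,
    ← card_vset (fun x hx => h.lt j hj x (List.mem_of_mem_filter hx)) ((h.nodup j hj).filter _)]
  congr 1
  ext v
  simp [mem_vset, hC, and_comm]

theorem Enumerates.motifDegreeIn_eq (h : Enumerates G k N B)
    (hC : ∀ v : Fin n, v ∈ C ↔ (v : ℕ) ∉ del) (i : ℕ) (u : Fin n) :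
    motifDegreeIn G k C i u = ((incS B N u).filter fun j => remC B del j = i).card := by
  rw [motifDegreeIn, h.card_filter, incS, Finset.filter_filter]
  congr 1
  refine Finset.filter_congr fun j hj => ?_
  rw [mem_vset, h.card_inter hC (Finset.mem_range.1 hj)]

/-- The motif resident is `3` minus the quotient that the priority queue maximizes. -/
theorem Enumerates.motifResident_eq (h : Enumerates G k N B)
    (hC : ∀ v : Fin n, v ∈ C ↔ (v : ℕ) ∉ del) (u : Fin n) :
    motifResident G k C u =
      3 - (num B N k (remC B del) u : ℚ) / (max (motifDegree G k u) 1 : ℕ) := by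
  rw [motifResident, h.motifDegreeIn_eq hC, h.motifDegreeIn_eq hC, h.motifDegree_eq, num]
  -- A vertex without instances: both sides are `0`, the left one as a quotient by `0`.
  by_cases he : incS B N u = ∅
  · simp [he]
  · have hc : 0 < (incS B N u).card := Finset.card_pos.2 (Finset.nonempty_iff_ne_empty.2 he)
    have h1 := Finset.card_filter_add_card_filter_not (s := incS B N u) (fun j => remC B del j = k)
    rw [if_neg he, max_eq_left hc]
    simp only [contrib, Finset.sum_add_distrib, Finset.sum_ite,
      Finset.sum_const_zero, Finset.sum_const, smul_eq_mul, mul_one, zero_add, add_zero]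
    have hq : ((incS B N u).card : ℚ) ≠ 0 := by positivity
    have h1' : ((((incS B N u).filter fun j => remC B del j = k).card : ℚ) +
      ((incS B N u).filter fun j => ¬ remC B del j = k).card) = (incS B N u).card := by
      exact_mod_cast h1
    rw [eq_sub_iff_add_eq, ← add_div, div_eq_iff hq]
    push_cast
    linarith

theorem Enumerates.motifVol_eq (hC : ∀ v : Fin n, v ∈ C ↔ (v : ℕ) ∉ del) {M : ℕ → ℕ}
    (hM : ∀ v : Fin n, M v = motifDegree G k v) : motifVol G k C = volC M n del := by
  rw [motifVol, volC, Finset.sum_range, ← Finset.sum_filter_add_sum_filter_not Finset.univ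
    (fun v => v ∈ C) (f := fun v : Fin n => if (v : ℕ) ∈ del then 0 else M v)]
  rw [Finset.sum_eq_zero (s := Finset.univ.filter fun v => v ∉ C), add_zero]
  · rw [Finset.filter_mem_eq_inter, Finset.univ_inter]
    exact Finset.sum_congr rfl fun v hv => by rw [if_neg ((hC v).1 hv), hM]
  · intro v hv
    rw [Finset.mem_filter, hC, not_not] at hv
    rw [if_pos hv.2]

theorem Enumerates.motifVol_compl (h : Enumerates G k N B) (C : Finset (Fin n)) :
    motifVol G k Cᶜ = k * N - motifVol G k C := by
  rw [← h.sum_motifDegree, motifVol, motifVol, ← Finset.sum_add_sum_compl C]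
  omega

theorem Enumerates.motifCut_eq (h : Enumerates G k N B)
    (hC : ∀ v : Fin n, v ∈ C ↔ (v : ℕ) ∉ del) :
    motifCut G k C = ∑ j ∈ Finset.range N, isCut k (remC B del j) := by
  rw [motifCut, h.card_filter, Finset.card_filter]
  refine Finset.sum_congr rfl fun j hj => ?_
  have hj := Finset.mem_range.1 hj
  rw [isCut, ← h.card_inter hC hj, Finset.inter_comm]
  congr 1
  have h1 := Finset.card_inter_add_card_sdiff (vset n (B j)) C
  rw [card_vset (h.lt j hj) (h.nodup j hj), h.length j hj] at h1
  rw [← Finset.sdiff_eq_inter_compl, ← Finset.card_pos, ← Finset.card_pos, Finset.inter_comm C]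
  rw [eq_iff_iff]
  constructor
  · rintro ⟨h2, h3⟩
    exact ⟨h2, by omega⟩
  · rintro ⟨h2, h3⟩
    exact ⟨h2, by omega⟩

/-- An instance that meets `C` gives positive volume. -/
theorem motifCut_eq_zero (h : motifVol G k C = 0) : motifCut G k C = 0 := by
  rw [motifCut, Finset.card_eq_zero, Finset.filter_eq_empty_iff]
  rintro S hS ⟨⟨v, hv⟩, -⟩
  rw [Finset.mem_inter] at hv
  have h1 := (Finset.sum_eq_zero_iff.1 h) v hv.2
  rw [motifDegree, Finset.card_eq_zero, Finset.filter_eq_empty_iff] at h1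
  exact h1 hS hv.1

/-- Comparison of conductances without division.  If the volume on the right vanishes, then so does
the cut, and the hypothesis forces the cut on the left to vanish. -/
theorem motifConductance_le {C C' : Finset (Fin n)} (hC : motifVol G k C ≤ motifVol G k Cᶜ)
    (hC' : motifVol G k C' ≤ motifVol G k C'ᶜ)
    (h : motifCut G k C * max (motifVol G k C') 1 ≤ motifCut G k C' * max (motifVol G k C) 1) :
    motifConductance G k C ≤ motifConductance G k C' := by
  rw [motifConductance, motifConductance, min_eq_left hC, min_eq_left hC']
  rcases Nat.eq_zero_or_pos (motifVol G k C) with h0 | h0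
  · simp only [h0, Nat.cast_zero, div_zero]; positivity
  rcases Nat.eq_zero_or_pos (motifVol G k C') with h1 | h1
  · rw [h1, motifCut_eq_zero h1] at h
    have : motifCut G k C = 0 := by simpa using h
    simp only [this, Nat.cast_zero, zero_div]; positivity
  rw [max_eq_left (Nat.succ_le_of_lt h0), max_eq_left (Nat.succ_le_of_lt h1)] at h
  rw [div_le_div_iff₀ (by exact_mod_cast h0) (by exact_mod_cast h1)]
  exact_mod_cast h

/-- A deletion sequence as recorded by the program is a run of PSMC. -/
theorem Enumerates.isRun (h : Enumerates G k N B) {M a : ℕ → ℕ} {b c d : ℕ}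
    (hM : ∀ v : Fin n, M v = motifDegree G k v) (hn : 0 < n) (hk : 2 ≤ k)
    (hd : Deleted n N k n B M a b c d) :
    ∃ (σ : Equiv.Perm (Fin n)) (i : Fin n), (i : ℕ) = b ∧ IsRun G k σ (remaining σ i) ∧
      ∀ i : Fin n, a i = σ i := by
  have hinj : ∀ i < n, ∀ j < n, a i = a j → i = j := fun i hi j hj hij =>
    List.inj_on_of_nodup_map hd.nodup (List.mem_range.2 hi) (List.mem_range.2 hj) hij
  have hbij : Function.Bijective fun i : Fin n => (⟨a i, hd.lt i i.2⟩ : Fin n) :=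
    Finite.injective_iff_bijective.1 fun i j hij =>
      Fin.ext (hinj i i.2 j j.2 (Fin.mk.inj hij))
  set σ : Equiv.Perm (Fin n) := Equiv.ofBijective _ hbij with hσ
  have haσ : ∀ i : Fin n, a i = σ i := fun i => rfl
  -- The set of round `i` is the complement of the first `i` deleted vertices.
  have hC : ∀ (i v : Fin n), v ∈ remaining σ i ↔ (v : ℕ) ∉ chosen a i := by
    intro i v
    obtain ⟨j, rfl⟩ := σ.surjective v
    simp only [remaining, Finset.mem_filter, Finset.mem_univ, true_and, Equiv.symm_apply_apply,
      chosen, List.mem_map, List.mem_range, not_exists, not_and, ← haσ]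
    constructor
    · intro hij m hm hmj
      have := hinj m (hm.trans i.2) j j.2 hmj
      have := Fin.le_def.1 hij
      omega
    · intro hm
      by_contra hij
      exact hm j (Fin.lt_def.1 (not_le.1 hij)) rfl
  have hvol : ∀ i : Fin n, motifVol G k (remaining σ i) = volC M n (chosen a i) := fun i =>
    Enumerates.motifVol_eq (hC i) hM
  have hle : ∀ v < n, M v ≤ N := fun v hv => by
    rw [hM ⟨v, hv⟩, h.motifDegree_eq, incS]
    exact (Finset.card_filter_le _ _).trans (by simp)
  obtain ⟨hb, hb1, hb2⟩ := hd.lt_of_vol hn hk hle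
  have hvb : motifVol G k (remaining σ ⟨b, hb⟩) ≤ motifVol G k (remaining σ ⟨b, hb⟩)ᶜ := by
    rw [h.motifVol_compl, hvol]; exact hb1
  refine ⟨σ, ⟨b, hb⟩, rfl, ⟨fun i v hv => ?_, ⟨_, rfl⟩, hvb, fun i hi => ?_⟩, haσ⟩
  · rw [h.motifResident_eq (hC i), h.motifResident_eq (hC i)]
    have hg := hd.greedy i i.2 v v.2 ((hC i v).1 hv)
    rw [hM v, haσ i, hM (σ i)] at hg
    refine sub_le_sub_left ?_ 3
    rw [div_le_div_iff₀ (by positivity) (by positivity)]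
    exact_mod_cast hg
  · refine motifConductance_le hvb hi ?_
    rw [h.motifCut_eq (hC _), h.motifCut_eq (hC i), hvol, hvol]
    refine hb2 i i.2 ?_
    rw [h.motifVol_compl, hvol] at hi
    exact hi

theorem Recorded.recordsRun {D : ℕ} {L : List (Fin n × Fin n)} {s : Store} (hL : IsEdgeList G L)
    (hn : 0 < n) (hk : 2 ≤ k) (h : Recorded n N k D (adjOf (natEdges L)) s) :
    RecordsRun G k s := by
  obtain ⟨ord, pos, hO, hb⟩ := h.cliques
  obtain ⟨hbij, hnd⟩ := hL.bijOn_block hk hO hb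
  have hE : Enumerates G k N (block (s.arr 2) k) :=
    ⟨hbij, fun j hj => (hnd j hj).1, fun j hj => (hnd j hj).2, fun j _ => by simp [block]⟩
  have hM : ∀ v : Fin n, s.arr 3 v = motifDegree G k v := fun v => by
    rw [h.degrees, hE.motifDegree_eq, incL_eq]
  refine ⟨?_, hM, ?_⟩
  · rw [h.count]
    have himg : ∀ j < N, (Finset.range k).image (fun i => s.arr 2 (k * j + i)) =
        (vset n (block (s.arr 2) k j)).map Fin.valEmbedding := fun j hj => by
      rw [vset_map (hnd j hj).2]
      ext x
      simp [block]
    refine ⟨fun j hj => ?_, fun i hi j hj hij => ?_, ?_⟩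
    · exact ⟨_, hbij.mapsTo hj, himg j hj⟩
    · simp only [himg i hi, himg j hj] at hij
      exact hbij.injOn hi hj (Finset.map_injective _ hij)
    · rintro _ ⟨S, hS, rfl⟩
      obtain ⟨j, hj, rfl⟩ := hbij.surjOn (Finset.mem_coe.2 hS)
      exact ⟨j, hj, himg j hj⟩
  · obtain ⟨b, c, d, hd, h5⟩ := h.deleted
    obtain ⟨σ, i, rfl, hrun, haσ⟩ := hE.isRun hM hn hk hd
    refine ⟨σ, _, hrun, haσ, fun v => ?_⟩
    rw [h5]
    congr 1
    rw [eq_iff_iff]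
    obtain ⟨j, rfl⟩ := σ.surjective v
    simp only [remaining, Finset.mem_filter, Finset.mem_univ, true_and, Equiv.symm_apply_apply]
    constructor
    · rintro ⟨m, hm, him, hmj⟩
      rw [haσ ⟨m, hm⟩] at hmj
      rw [← σ.injective (Fin.val_injective hmj)]
      exact him
    · intro hij
      exact ⟨j, j.2, hij, haσ j⟩

end Enumerates


/-! ### Running time -/

section Time

variable {n k D : ℕ} {G : SimpleGraph (Fin n)} [DecidableRel G.Adj] {L : List (Fin n × Fin n)}
  {ord pos : ℕ → ℕ}

theorem mul_length_allCliques_le {T : ℕ → ℕ → Bool} {out : ℕ → List ℕ} :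
    30 * (k * (allCliques T k out n).length) ≤
      ∑ v ∈ Finset.range n, (extCost T k (k - 1) (out v) + 40 * (out v).length + 50) := by
  induction n with
  | zero => simp [allCliques]
  | succ n ih =>
    have := mul_length_ext_le (T := T) k (k - 1) [n] (out n)
    rw [allCliques_succ, Finset.sum_range_succ, List.length_append]
    linarith

/-- The total time for listing the cliques: the sum over the vertices of the bounds for their later
neighbours, of which there are at most as many as neighbours. -/
theorem IsEdgeList.listing_cost_le (hL : IsEdgeList G L) (hk : 2 ≤ k)
    (hn : n ≤ 2 * G.edgeFinset.card)
    (hO : PartialOrd n (adjOf (natEdges L)) D ord pos n) {ρ : ℝ} (hρ : 1 ≤ ρ)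
    (hDρ : k = 2 ∨ (D : ℝ) / 2 ≤ ρ) :
    ((∑ v ∈ Finset.range n, (extCost (later (adjOf (natEdges L)) pos) k (k - 1)
      (outL (adjOf (natEdges L)) ord pos n v) +
        40 * (outL (adjOf (natEdges L)) ord pos n v).length + 50) : ℕ) : ℝ) ≤
      650 * (k * ρ ^ (k - 2) * G.edgeFinset.card) := by
  have hA := hL.adjLists
  have hlen := sum_length_adjOf hL.natEdges_lt
  rw [natEdges, List.length_map, hL.length_eq, ← natEdges] at hlen
  have hQ : 1 ≤ ρ ^ (k - 2) := one_le_pow₀ hρ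
  have hk' : (2 : ℝ) ≤ k := by exact_mod_cast hk
  have hn' : (n : ℝ) ≤ 2 * (G.edgeFinset.card : ℕ) := by exact_mod_cast hn
  set m : ℝ := ((G.edgeFinset.card : ℕ) : ℝ) with hm
  have hm0 : 0 ≤ m := by positivity
  have hkQ : 2 ≤ k * ρ ^ (k - 2) := by nlinarith
  have hsum : ∑ v ∈ Finset.range n, ((adjOf (natEdges L) v).length : ℝ) = 2 * m := by
    rw [hm]; exact_mod_cast hlen
  push_cast
  calc ∑ v ∈ Finset.range n, ((extCost (later (adjOf (natEdges L)) pos) k (k - 1)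
        (outL (adjOf (natEdges L)) ord pos n v) : ℝ) +
          40 * ((outL (adjOf (natEdges L)) ord pos n v).length : ℝ) + 50)
      ≤ ∑ v ∈ Finset.range n,
          (((adjOf (natEdges L) v).length : ℝ) * (270 * (k * ρ ^ (k - 2)) + 40) + 70) := by
        refine Finset.sum_le_sum fun v hv => ?_
        have h1 := extCost_le_real (k := k) (D := D) (later_pos (A := adjOf (natEdges L))
          (pos := pos)) (outL_sorted hO v) (outL_length_le hA hO (Finset.mem_range.1 hv)).1 hk
          hρ hDρ
        have h2 : ((outL (adjOf (natEdges L)) ord pos n v).length : ℝ) ≤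
            (adjOf (natEdges L) v).length := by
          exact_mod_cast (outL_length_le hA hO (Finset.mem_range.1 hv)).2
        nlinarith
    _ = 2 * m * (270 * (k * ρ ^ (k - 2)) + 40) + 70 * n := by
        rw [Finset.sum_add_distrib, ← Finset.sum_mul, hsum]; simp [mul_comm]
    _ ≤ 650 * (k * ρ ^ (k - 2) * m) := by nlinarith

/-- For `k = 2` there is a single phase of removals, so that the product does not contribute a factor
`δ`; for `k ≥ 3` the factor `δ + 1` is absorbed by `ρ ^ (k - 2)`. -/
theorem peeling_cost_le {δ : ℕ} (hk : 2 ≤ k) {m : ℕ} (hm : 0 < m) (hn : n ≤ 2 * m) {ρ : ℝ}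
    (hρ : 1 ≤ ρ) (hδ : (δ : ℝ) / 2 ≤ ρ) :
    ((((if k < 3 then n else δ) - (if k < 3 then n else 0) + 1) * (38 * n + 40) : ℕ) : ℝ) ≤
      174 * (k * ρ ^ (k - 2) * m) := by
  have hk' : (2 : ℝ) ≤ k := by exact_mod_cast hk
  have hn' : (n : ℝ) ≤ 2 * m := by exact_mod_cast hn
  have hm1 : (1 : ℝ) ≤ m := by exact_mod_cast hm
  have hQ : 1 ≤ ρ ^ (k - 2) := one_le_pow₀ hρ
  have hQm : (m : ℝ) ≤ ρ ^ (k - 2) * m := by nlinarith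
  have hkQ : 2 * (ρ ^ (k - 2) * m) ≤ k * ρ ^ (k - 2) * m := by nlinarith
  split
  · simp only [Nat.sub_self, zero_add, one_mul]
    push_cast
    linarith
  · have hρQ : ρ ≤ ρ ^ (k - 2) := le_self_pow₀ hρ (by omega)
    have hρm : ρ * m ≤ ρ ^ (k - 2) * m := by nlinarith
    push_cast [Nat.sub_zero]
    calc ((δ : ℝ) + 1) * (38 * n + 40) ≤ (3 * ρ) * (116 * m) := by
          refine mul_le_mul (by linarith) (by linarith) (by positivity) (by linarith)
      _ ≤ 174 * (k * ρ ^ (k - 2) * m) := by linarith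

theorem total_cost_le {m c cO N t : ℕ} {ρ : ℝ} (hk : 2 ≤ k) (hm : 0 < m) (hn : n ≤ 2 * m)
    (hρ : 1 ≤ ρ) (hN : 30 * (k * N) ≤ c) (hc : (c : ℝ) ≤ 650 * (k * ρ ^ (k - 2) * m))
    (hO : (cO : ℝ) ≤ 174 * (k * ρ ^ (k - 2) * m))
    (ht : t ≤ 68 * m + cO + 130 * (2 * m) + c + 4000 * (k * N) + 3000 * n + 1500) :
    (t : ℝ) ≤ 100000 * (k * ρ ^ (k - 2) * m) := by
  have hk' : (2 : ℝ) ≤ k := by exact_mod_cast hk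
  have hm1 : (1 : ℝ) ≤ m := by exact_mod_cast hm
  have hn' : (n : ℝ) ≤ 2 * m := by exact_mod_cast hn
  have hN' : (30 : ℝ) * (k * N : ℕ) ≤ c := by exact_mod_cast hN
  have hQ : 1 ≤ ρ ^ (k - 2) := one_le_pow₀ hρ
  have hkQ : 2 ≤ k * ρ ^ (k - 2) := by nlinarith
  have hkQm : 2 * m ≤ k * ρ ^ (k - 2) * m := by nlinarith
  have ht' : (t : ℝ) ≤ 68 * m + cO + 130 * (2 * m) + c + 4000 * (k * N : ℕ) + 3000 * n + 1500 := by
    exact_mod_cast ht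
  linarith

/-- The program runs in time `O(k ρ ^ (k - 2) m)` for `ρ = max 1 (δ / 2)`. -/
theorem IsEdgeList.exec_psmc (hL : IsEdgeList G L) (hk : 2 ≤ k) (hn0 : 0 < n)
    (hn : n ≤ 2 * G.edgeFinset.card) {ρ : ℝ} (hρ : 1 ≤ ρ) (hδ : (degeneracy G : ℝ) / 2 ≤ ρ) :
    ∃ (t : ℕ) (s : Store),
      Exec ((n + k + (G.cliqueFinset k).card) ^ 96) psmc (input k L) t s ∧ RecordsRun G k s ∧
      (t : ℝ) ≤ 100000 * (k * ρ ^ (k - 2) * G.edgeFinset.card) := by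
  obtain ⟨m, hm⟩ : ∃ m, m = G.edgeFinset.card := ⟨_, rfl⟩
  obtain ⟨N, hN⟩ : ∃ N, N = (G.cliqueFinset k).card := ⟨_, rfl⟩
  obtain ⟨X, hX⟩ : ∃ X, X = n + k + N := ⟨_, rfl⟩
  have hm0 : 0 < G.edgeFinset.card := by omega
  have hmc : m ≤ n.choose 2 := by
    rw [hm]; simpa using G.card_edgeFinset_le_card_choose_two
  have hn2 : 2 ≤ n := by
    by_contra h
    have : n = 1 := by omega
    subst this
    simp at hmc
    omega
  -- `X` exceeds each of `n`, `k`, `N`, so that all stored numbers are below `X ^ 6`, and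
  -- intermediate values are below `(X ^ 6) ^ 16 = X ^ 96`.
  have hX4 : 4 ≤ X := by omega
  have hmn : m ≤ n ^ 2 := hmc.trans (Nat.choose_le_pow n 2)
  have hX2 : X ^ 2 * 16 ≤ X ^ 6 := by
    have h16 : 16 ≤ X ^ 4 := le_trans (by norm_num) (Nat.pow_le_pow_left hX4 4)
    calc X ^ 2 * 16 ≤ X ^ 2 * X ^ 4 := Nat.mul_le_mul_left _ h16
      _ = X ^ 6 := by ring
  have hXX : 4 * X ≤ X ^ 2 := by nlinarith
  have hnX : n ^ 2 ≤ X ^ 2 := Nat.pow_le_pow_left (by omega) 2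
  have hkNX : k * N ≤ X ^ 2 := by
    rw [sq]; exact Nat.mul_le_mul (by omega) (by omega)
  have hNX : (N + 2) * (3 * (N + 1) + 1) ≤ 3 * X ^ 2 := by
    calc (N + 2) * (3 * (N + 1) + 1) ≤ X * (3 * X) := Nat.mul_le_mul (by omega) (by omega)
      _ = 3 * X ^ 2 := by ring
  have hbdd : (input k L).Bdd (X ^ 6) := by
    have hget : ∀ (f : Fin n × Fin n → Fin n) (i : ℕ),
        (L.map fun p => (f p : ℕ)).getD i 0 < X ^ 6 := by
      intro f i
      rw [List.getD_eq_getElem?_getD, List.getElem?_map]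
      cases L[i]? with
      | none => simp; omega
      | some p => have := (f p).2; simp; omega
    refine ⟨fun x => ?_, fun a i => ?_⟩
    · have := hL.length_eq
      simp only [input]
      split
      · omega
      · split
        · omega
        · split <;> omega
    · simp only [input]
      split
      · exact hget Prod.fst i
      · split
        · exact hget Prod.snd i
        · omega
  have hDδ := degeneracy_spec G
  -- The real bound of the listing cost, rounded down to serve as time credits.
  set c : ℕ := ⌊650 * (k * ρ ^ (k - 2) * (G.edgeFinset.card : ℝ))⌋₊ with hc
  have hDρ : k = 2 ∨ (((if k < 3 then n else degeneracy G : ℕ) : ℝ)) / 2 ≤ ρ := by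
    by_cases h3 : k < 3
    · exact Or.inl (by omega)
    · rw [if_neg h3]; exact Or.inr hδ
  have hcost : ∀ ord pos, PartialOrd n (adjOf (natEdges L)) (if k < 3 then n else degeneracy G)
      ord pos n → ∑ v ∈ Finset.range n, (extCost (later (adjOf (natEdges L)) pos) k (k - 1)
        (outL (adjOf (natEdges L)) ord pos n v) +
          40 * (outL (adjOf (natEdges L)) ord pos n v).length + 50) ≤ c :=
    fun ord pos hO => Nat.le_floor (hL.listing_cost_le hk hn hO hρ hDρ)
  have hwp := psmc_spec (K := X ^ 6) (n := n) (m := m) (k := k)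
    (D := if k < 3 then n else degeneracy G) (N := N) (c := c) (E := natEdges L)
    (by rw [natEdges, List.length_map, hL.length_eq, hm]) (by omega) (by omega) hn0 hk (by omega)
    (by omega) (by omega) hL.natEdges_lt hL.adjLists (by split <;> omega)
    (by split; exacts [le_rfl, hDδ.1])
    (fun d hd U hU hU' h => by
      by_cases h3 : k < 3
      · rw [if_pos h3] at hd ⊢
        obtain ⟨v, hv⟩ := hU'
        have h1 := h v hv
        have h2 := hL.adjLists.length_le (Finset.mem_range.1 (hU hv))
        have h4 := List.countP_le_length (p := fun w => decide (w ∈ U)) (l := adjOf (natEdges L) v)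
        omega
      · rw [if_neg h3]
        exact hL.lt_degeneracy hU hU' h)
    (fun ord pos hO => (hL.length_allCliques hk hO).trans hN.symm) hcost
    (s := input k L) rfl (by simp [input, hL.length_eq, hm]) rfl
    (fun e he => by simp [input, natEdges] at he ⊢; simp [he])
    (fun e he => by simp [input, natEdges] at he ⊢; simp [he])
    (fun a ha i => by simp only [input]; rw [if_neg (by omega), if_neg (by omega)]) le_rfl
  obtain ⟨t, s, hexec, -, ht, hrec⟩ := WP.sound (by omega) psmc psmc_ok _ _ _ hbdd hwp
  refine ⟨t, s, ?_, hrec.recordsRun hL hn0 hk, ?_⟩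
  · rw [← hN, ← hX]
    rw [← pow_mul] at hexec
    exact hexec
  · obtain ⟨ord, pos, hO, hb⟩ := hrec.cliques
    -- The run itself provides the vertex order that bounds the number of cliques by `c`.
    have h30 := (mul_length_allCliques_le (k := k) (n := n)
      (T := later (adjOf (natEdges L)) pos)
      (out := outL (adjOf (natEdges L)) ord pos n)).trans (hcost ord pos hO)
    rw [hL.length_allCliques hk hO, ← hN] at h30
    have hsum := sum_length_adjOf hL.natEdges_lt
    rw [natEdges, List.length_map, hL.length_eq, ← natEdges, ← hm] at hsum
    rw [hsum] at ht
    have hpeel := peeling_cost_le (n := n) (δ := degeneracy G) hk (hm ▸ hm0) (hm ▸ hn) hρ hδ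
    have hcr : (c : ℝ) ≤ 650 * (k * ρ ^ (k - 2) * m) := by
      rw [hm]; exact Nat.floor_le (by positivity)
    rw [← hm]
    exact total_cost_le hk (hm ▸ hm0) (hm ▸ hn) hρ h30 hcr hpeel (by exact_mod_cast sub_nonneg.1 ht)

end Time

end PSMC

theorem theorem6 :
    ∃ (P : PSMC.Cmd) (c : ℕ) (C : ℝ) (D : ℕ → ℝ),
      ∀ (n k : ℕ) (G : SimpleGraph (Fin n)) [DecidableRel G.Adj] (L : List (Fin n × Fin n)),
        2 ≤ k → 0 < n → n ≤ 2 * G.edgeFinset.card → PSMC.IsEdgeList G L →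
        ∃ (t : ℕ) (s : PSMC.Store),
          PSMC.Exec ((n + k + (G.cliqueFinset k).card) ^ c) P (PSMC.input k L) t s ∧
          PSMC.RecordsRun G k s ∧
          (k = 2 ∨ 2 ≤ PSMC.degeneracy G →
            (t : ℝ) ≤ C * (k * ((PSMC.degeneracy G : ℝ) / 2) ^ (k - 2) * G.edgeFinset.card)) ∧
          (t : ℝ) ≤ D k * (k * ((PSMC.degeneracy G : ℝ) / 2) ^ (k - 2) * G.edgeFinset.card) := by
  refine ⟨PSMC.psmc, 96, 100000, fun k => 100000 * 2 ^ (k - 2), fun n k G _ L hk hn0 hn hL => ?_⟩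
  obtain ⟨t, s, hexec, hrec, ht⟩ := hL.exec_psmc hk hn0 hn (ρ := max 1 ((PSMC.degeneracy G : ℝ) / 2))
    (le_max_left _ _) (le_max_right _ _)
  refine ⟨t, s, hexec, hrec, fun h => ?_, ?_⟩
  · have hpow : max 1 ((PSMC.degeneracy G : ℝ) / 2) ^ (k - 2) =
        ((PSMC.degeneracy G : ℝ) / 2) ^ (k - 2) := by
      rcases h with rfl | h
      · simp
      · have h2 : (2 : ℝ) ≤ PSMC.degeneracy G := by exact_mod_cast h
        rw [max_eq_right (by linarith)]
    rwa [hpow] at ht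
  · -- As there is an edge, the degeneracy is positive, and `max 1 (δ / 2) ≤ 2 * (δ / 2)`.
    have h1 : (1 : ℝ) ≤ PSMC.degeneracy G := by
      exact_mod_cast PSMC.one_le_degeneracy (G := G) (by omega)
    have hpow : max 1 ((PSMC.degeneracy G : ℝ) / 2) ^ (k - 2) ≤
        2 ^ (k - 2) * ((PSMC.degeneracy G : ℝ) / 2) ^ (k - 2) := by
      rw [← mul_pow]
      exact pow_le_pow_left₀ (by positivity) (max_le (by linarith) (by linarith)) _
    refine ht.trans ?_
    calc 100000 * ((k : ℝ) * max 1 ((PSMC.degeneracy G : ℝ) / 2) ^ (k - 2) * G.edgeFinset.card)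
        ≤ 100000 * (k * (2 ^ (k - 2) * ((PSMC.degeneracy G : ℝ) / 2) ^ (k - 2)) *
          G.edgeFinset.card) := by gcongr
      _ = 100000 * 2 ^ (k - 2) *
          (k * ((PSMC.degeneracy G : ℝ) / 2) ^ (k - 2) * G.edgeFinset.card) := by ring
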